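/- **Setting.** Let $\Omega\subset\mathbb R^3$ be a nonempty bounded open set with $C^2$ boundary, outward unit normal $n$ and surface measure $dS$. Let $\mathscr L=\{\sum_k i^k e_k: i\in\mathbb Z^3\}$ be a lattice ($e_1,e_2,e_3$ a basis of $\mathbb R^3$) and $\Box$ a unit cell, i.e. a bounded Borel set whose translates by $\mathscr L$ tile $\mathbb R^3$. For $l\in(0,1]$ the scaled cells are $\hat x+l\Box$, $\hat x\in l\mathscr L$. A cell is *full* if it is contained in $\Omega$, and *partial* if it meets $\Omega$ and is not contained in $\Omega$. Assume that $\partial\Omega$ is *good*: the number of partial cells is at most $C|\partial\Omega|/l^2$ with $C$ independent of $l\in(0,1]$; and that the number of partial cells with $|(\hat x+l\Box)\cap\partial\Omega|=0$ is $o(l^{-2})$ as $l\to0$. **Charges.** Let $\rho_l:\mathbb R^3\to\mathbb R$, $l\in(0,1]$, be measurable net charge distributions such that * $\|\rho_l(\hat x+l\,\cdot)\|_{L^2(\Box)}\le C$ for all $l$ and all $\hat x\in l\mathscr L$, and $\rho_l|_{\Omega^c}\in L^1$; * $\rho_l$ is *1-concentrated near $\partial\Omega$*: there are $d>0$ and $g\in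 L^1(\mathbb R)$ with $|\rho_l(s+lt\,n(s))|\le g(t)$ for all $l\in(0,1]$, $s\in\partial\Omega$ and $t>d$ such that $\operatorname{dist}(s+lt\,n(s),\Omega)=lt$; * no scaled charge escapes to infinity: for every $\varepsilon>0$ there is $R$ with $\int_{\Omega^c\cap\{|x|>R\}}|\rho_l|/l\,dV\le\varepsilon$ for all $l\in(0,1]$; * full cells of total charge zero form the *bulk*; the other full cells form the *transition region* $\mathscr T_l$. Assume $|\mathscr T_l|\to0$ as $l\to0$ and that, for each $l$, the set of cells of $\mathscr T_l$ is the disjoint union of (a) charge-neutral clusters of cells of diameter at most $\kappa l$, with $\kappa$ independent of $l$ (they join the bulk), (b) charge-neutral clusters whose diameters tend to $0$ uniformly as $l\to0$ and whose total volume is $O(l)$ (they join the surface region), and (c) a remainder of volume $o(l)$. **Limit objects.** As $l\to0$, possibly along a sequence, * $\rho_0\in L^2(\Omega\times\Box)$ is the *two-scale limit* of $\rho_l$ if $\int_\Omega\rho_l(x)\psi(x,x/l)\,dV\to\int_\Omega|\Box|^{-1}\int_\Box\rho_0(x,y)\psi(x,y)\,dV_y\,dV_x$ for all smooth $\psi$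 that are $\mathscr L$-periodic in $y$ and vanish for $x$ outside some compact subset of $\Omega$; its dipole moment per unit volume is $p(x)=|\Box|^{-1}\int_\Box y\,\rho_0(x,y)\,dV_y$; * the *inner surface charge* $\sigma_i\in L^1(\partial\Omega)$ is the limit of $\sigma_{i,l}$, where for $s\in\partial\Omega\cap(\hat x+l\Box)$, $$\sigma_{i,l}(s)=\frac1{|(\hat x+l\Box)\cap\partial\Omega|}\int_{(\hat x+l\Box)\cap\Omega}\frac{\rho_l}{l}\,dV$$ (and $\sigma_{i,l}(s)=0$ if this area is $0$); * the *outer surface charge* $\sigma_o\in L^1(\partial\Omega)$ is $\lim_{h\to\infty}\sigma_{o,h}$, where $\sigma_{o,h}\in L^1(\partial\Omega)$ is the limit as $l\to0$ of $s\mapsto\int_0^h\rho_l(s+lt\,n(s))\,dt$, for every $h>0$. All limits on $\partial\Omega$ are weak, tested with continuous functions. For a potential variation $\delta\phi$, the energy variation is $\delta W_l=\int_{\mathbb R^3}\rho_l\,\delta\phi\,dV$. Admissible $\delta\phi:\mathbb R^3\to\mathbb R$ are those that are continuous, belong to $W^{1,2}(\Omega)$ and are bounded on $\Omega^c$; $\delta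 E=\nabla\delta\phi$ is the weak gradient on $\Omega$. **Theorem.** 1. Every sequence in $(0,1]$ tending to $0$ has a subsequence along which $\rho_0$, $\sigma_i$ and $\sigma_o$ all exist. 2. Suppose that $\rho_0,\sigma_i,\sigma_o$ exist as $l\to0$, along all $l$ or along some sequence (more generally, along any filter finer than that of right neighbourhoods of $0$); put $\sigma=\sigma_i+\sigma_o$. Then $p\in L^2(\Omega)$, and $p$ is the classical polarization: it is the weak $L^2(\Omega)$ limit of $p_l$, which equals $\frac{1}{|l\Box|}\int_{\hat x+l\Box}\frac{z-\hat x}{l}\rho_l(z)\,dV_z$ on each full cell $\hat x+l\Box$ and $0$ elsewhere. Moreover, for every admissible $\delta\phi$, the function $\rho_l\,\delta\phi$ is integrable on $\mathbb R^3$ for each $l\in(0,1]$, $\delta\phi\,\sigma$ is integrable on $\partial\Omega$, $\delta E\cdot p$ is integrable on $\Omega$, and, along the same $l$, $$\lim_{l\to0}\frac{\delta W_l}{l}=\int_{\partial\Omega}\delta\phi\,\sigma\,dS+\int_\Omega\delta E\cdot p\,dV .$$ -/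

import Mathlib

open MeasureTheory Set Filter Topology

noncomputable section

/-- Three-dimensional Euclidean space. -/
abbrev E3 : Type := EuclideanSpace ℝ (Fin 3)

/-- Labels of the points of a three-dimensional lattice. -/
abbrev Idx : Type := Fin 3 → ℤ

/-! ### The domain, its boundary and its normal -/

/-- `Ω` is a nonempty bounded open set with `C²` boundary, given as the sublevel set of the `C²`
function `r`, whose gradient does not vanish on `∂Ω`. -/
structure IsC2Domain (Ω : Set E3) (r : E3 → ℝ) : Prop where
  nonempty : Ω.Nonempty
  bounded : Bornology.IsBounded Ω
  contDiff : ContDiff ℝ 2 r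
  eq_sublevel : Ω = {x | r x < 0}
  gradient_ne_zero : ∀ s ∈ frontier Ω, gradient r s ≠ 0

/-- The outward unit normal of `{r < 0}` at a boundary point `s`. -/
def outwardNormal (r : E3 → ℝ) (s : E3) : E3 := ‖gradient r s‖⁻¹ • gradient r s

/-- The surface measure `dS` on `∂Ω`: the two-dimensional Hausdorff measure, normalised so that it
is the usual area. -/
def surfaceMeasure (Ω : Set E3) : Measure E3 := (μHE[2] : Measure E3).restrict (frontier Ω)

/-! ### The lattice and the unit cells -/

/-- The lattice point `∑ₖ iᵏ eₖ`. -/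
def latticePoint (e : Module.Basis (Fin 3) ℝ E3) (i : Idx) : E3 := ∑ k, (i k : ℝ) • e k

/-- `Q` is a unit cell of the lattice: bounded, Borel, and its lattice translates tile space
(they cover it and are pairwise disjoint). -/
structure IsUnitCell (e : Module.Basis (Fin 3) ℝ E3) (Q : Set E3) : Prop where
  bounded : Bornology.IsBounded Q
  measurable : MeasurableSet Q
  tiles : ∀ x : E3, ∃! i : Idx, x - latticePoint e i ∈ Q

/-- The corner of the `i`-th cell at scale `l`: the scaled lattice point. -/
def corner (e : Module.Basis (Fin 3) ℝ E3) (l : ℝ) (i : Idx) : E3 := l • latticePoint e i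

/-- The `i`-th scaled unit cell: corner plus `l Q`. -/
def cell (e : Module.Basis (Fin 3) ℝ E3) (Q : Set E3) (l : ℝ) (i : Idx) : Set E3 :=
  (fun y => corner e l i + l • y) '' Q

/-- The region of space occupied by a collection of cells. -/
def region (e : Module.Basis (Fin 3) ℝ E3) (Q : Set E3) (l : ℝ) (A : Set Idx) : Set E3 :=
  ⋃ i ∈ A, cell e Q l i

/-- The full cells: those contained in `Ω`. -/
def fullCells (e : Module.Basis (Fin 3) ℝ E3) (Q Ω : Set E3) (l : ℝ) : Set Idx :=
  {i | cell e Q l i ⊆ Ω}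

/-- The partial cells: those that meet `Ω` without being contained in it. -/
def partialCells (e : Module.Basis (Fin 3) ℝ E3) (Q Ω : Set E3) (l : ℝ) : Set Idx :=
  {i | (cell e Q l i ∩ Ω).Nonempty ∧ ¬ cell e Q l i ⊆ Ω}

/-- The area of the part of `∂Ω` that lies in the `i`-th cell. -/
def cellArea (e : Module.Basis (Fin 3) ℝ E3) (Q Ω : Set E3) (l : ℝ) (i : Idx) : ℝ :=
  (surfaceMeasure Ω).real (cell e Q l i)

/-- The boundary is "good": the number of partial cells is at most `C |∂Ω| / l²`. -/
def IsGoodBoundary (e : Module.Basis (Fin 3) ℝ E3) (Q Ω : Set E3) : Prop :=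
  ∃ C : ℝ, ∀ l ∈ Ioc (0 : ℝ) 1,
    ((partialCells e Q Ω l).ncard : ℝ) ≤ C * (surfaceMeasure Ω).real univ / l ^ 2

/-- The partial cells which contain no boundary area (so that no surface charge density can be
attached to them) are negligible in number compared with `l⁻²`. -/
def FewAreaFreePartialCells (e : Module.Basis (Fin 3) ℝ E3) (Q Ω : Set E3) : Prop :=
  Tendsto (fun l : ℝ => l ^ 2 * ({i ∈ partialCells e Q Ω l | cellArea e Q Ω l i = 0}.ncard : ℝ))
    (𝓝[>] 0) (𝓝 0)

/-! ### Assumptions on the charge distributions -/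

/-- The rescaled charges `y ↦ ρ_l (x̂ + l y)` are bounded in `L²(Q)`, uniformly in the cell and
in the scale. -/
def IsCellwiseL2Bounded (e : Module.Basis (Fin 3) ℝ E3) (Q : Set E3) (ρ : ℝ → E3 → ℝ) : Prop :=
  ∃ C : NNReal, ∀ l ∈ Ioc (0 : ℝ) 1, ∀ i : Idx,
    eLpNorm (fun y => ρ l (corner e l i + l • y)) 2 (volume.restrict Q) ≤ C

/-- The charge outside `Ω` is 1-concentrated near `∂Ω`:  `|ρ_l (s + l t n(s))| ≤ g t` for `t > d`,
with `g` integrable. A point that lies on several normals is counted only in its representation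
by a nearest boundary point. -/
def IsOneConcentrated (Ω : Set E3) (n : E3 → E3) (ρ : ℝ → E3 → ℝ) : Prop :=
  ∃ d > (0 : ℝ), ∃ g : ℝ → ℝ, Integrable g ∧
    ∀ l ∈ Ioc (0 : ℝ) 1, ∀ s ∈ frontier Ω, ∀ t > d,
      Metric.infDist (s + (l * t) • n s) Ω = l * t → |ρ l (s + (l * t) • n s)| ≤ g t

/-- The scaled outer charges `ρ_l / l` are tight: no scaled charge escapes to infinity. -/
def IsTightOutside (Ω : Set E3) (ρ : ℝ → E3 → ℝ) : Prop :=
  ∀ ε > (0 : ℝ), ∃ R : ℝ, ∀ l ∈ Ioc (0 : ℝ) 1,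
    ∫ x in Ωᶜ \ Metric.closedBall 0 R, |ρ l x| / l ≤ ε

/-- The total charge of a collection of cells. -/
def regionCharge (e : Module.Basis (Fin 3) ℝ E3) (Q : Set E3) (ρ : ℝ → E3 → ℝ) (l : ℝ)
    (A : Set Idx) : ℝ := ∫ x in region e Q l A, ρ l x

/-- The transition cells: full cells with net charge. (The other full cells, which are neutral,
form the bulk.) -/
def transitionCells (e : Module.Basis (Fin 3) ℝ E3) (Q Ω : Set E3) (ρ : ℝ → E3 → ℝ) (l : ℝ) :
    Set Idx :=
  {i ∈ fullCells e Q Ω l | ∫ x in cell e Q l i, ρ l x ≠ 0}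

/-- The assumption on the transition region. It vanishes in volume, and at each scale its cells
are distributed over
* charge-neutral clusters `N` that scale like the unit cells (they are added to the bulk);
* charge-neutral clusters `S` of vanishing diameter whose total volume is `O(l)`, i.e. is a
  surface-level quantity (they are added to the surface region);
* a remainder `R` of volume `o(l)`, i.e. negligible with respect to surface-level quantities. -/
structure IsTransitionDecomposition (e : Module.Basis (Fin 3) ℝ E3) (Q Ω : Set E3)
    (ρ : ℝ → E3 → ℝ) (N S : ℝ → Set (Set Idx)) (R : ℝ → Set Idx) : Prop where
  volume_tendsto_zero : Tendsto
    (fun l => volume.real (region e Q l (transitionCells e Q Ω ρ l))) (𝓝[>] 0) (𝓝 0)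
  union_eq : ∀ l ∈ Ioc (0 : ℝ) 1, ⋃₀ (N l ∪ S l) ∪ R l = transitionCells e Q Ω ρ l
  pairwise_disjoint : ∀ l ∈ Ioc (0 : ℝ) 1, (N l ∪ S l).PairwiseDisjoint id
  disjoint_remainder : ∀ l ∈ Ioc (0 : ℝ) 1, Disjoint (⋃₀ (N l ∪ S l)) (R l)
  neutral : ∀ l ∈ Ioc (0 : ℝ) 1, ∀ U ∈ N l ∪ S l, regionCharge e Q ρ l U = 0
  nondegenerate : ∃ κ : ℝ, ∀ l ∈ Ioc (0 : ℝ) 1, ∀ U ∈ N l,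
    Metric.diam (region e Q l U) ≤ κ * l
  surface_diam : ∀ ε > (0 : ℝ), ∀ᶠ l in 𝓝[>] (0 : ℝ), ∀ U ∈ S l,
    Metric.diam (region e Q l U) ≤ ε
  surface_volume : ∃ C : ℝ, ∀ l ∈ Ioc (0 : ℝ) 1,
    volume.real (region e Q l (⋃₀ S l)) ≤ C * l
  remainder_volume : Tendsto (fun l => volume.real (region e Q l (R l)) / l) (𝓝[>] 0) (𝓝 0)

/-! ### The variation of the potential and of the energy -/

/-- `G` is the weak gradient of `u` on the open set `Ω`. -/
def IsWeakGradient (Ω : Set E3) (u : E3 → ℝ) (G : E3 → E3) : Prop :=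
  ∀ η : E3 → ℝ, ContDiff ℝ (⊤ : ℕ∞) η → HasCompactSupport η → tsupport η ⊆ Ω →
    ∀ v : E3, ∫ x in Ω, u x * fderiv ℝ η x v = - ∫ x in Ω, η x * inner ℝ (G x) v

/-- The variation `φ` of the potential is continuous, lies in `W^{1,2}(Ω)` with weak gradient `G`
(the variation of the electric field), and is bounded outside `Ω`. -/
structure IsPotentialVariation (Ω : Set E3) (φ : E3 → ℝ) (G : E3 → E3) : Prop where
  continuous : Continuous φ
  memLp : MemLp φ 2 (volume.restrict Ω)
  memLp_gradient : MemLp G 2 (volume.restrict Ω)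
  weakGradient : IsWeakGradient Ω φ G
  bounded_outside : ∃ M : ℝ, ∀ x ∈ Ωᶜ, |φ x| ≤ M

/-- The variation of the total energy caused by the variation `φ` of the potential, for the net
charge distribution `q`. -/
def energyVariation (q φ : E3 → ℝ) : ℝ := ∫ x, q x * φ x

/-! ### Two-scale limit, polarization and surface charges -/

/-- Two-scale convergence of `ρ_l` in `Ω` to `ρ₀ ∈ L²(Ω × Q)`, as `l` tends to zero along the
filter `F`. -/
structure IsTwoScaleLimit (e : Module.Basis (Fin 3) ℝ E3) (Q Ω : Set E3) (ρ : ℝ → E3 → ℝ)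
    (F : Filter ℝ) (ρ₀ : E3 → E3 → ℝ) : Prop where
  memLp : MemLp (Function.uncurry ρ₀) 2 (volume.restrict (Ω ×ˢ Q))
  tendsto : ∀ ψ : E3 × E3 → ℝ, ContDiff ℝ (⊤ : ℕ∞) ψ →
    (∃ K ⊆ Ω, IsCompact K ∧ ∀ x ∉ K, ∀ y, ψ (x, y) = 0) →
    (∀ x y i, ψ (x, y + latticePoint e i) = ψ (x, y)) →
    Tendsto (fun l : ℝ => ∫ x in Ω, ρ l x * ψ (x, l⁻¹ • x)) F
      (𝓝 (∫ x in Ω, ⨍ y in Q, ρ₀ x y * ψ (x, y)))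

/-- The dipole moment of `ρ₀` per unit volume, `p(x) = |Q|⁻¹ ∫_Q y ρ₀(x, y) dy`. -/
def polarization (Q : Set E3) (ρ₀ : E3 → E3 → ℝ) (x : E3) : E3 := ⨍ y in Q, ρ₀ x y • y

/-- The classical polarization at scale `l`: on each full cell, the dipole moment of the cell per
unit volume. -/
def cellPolarization (e : Module.Basis (Fin 3) ℝ E3) (Q Ω : Set E3) (ρ : ℝ → E3 → ℝ) (l : ℝ)
    (x : E3) : E3 :=
  ∑ᶠ i ∈ fullCells e Q Ω l, (cell e Q l i).indicator
    (fun _ => ⨍ z in cell e Q l i, ρ l z • (l⁻¹ • (z - corner e l i))) x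

/-- The inner surface charge density at scale `l`: at a point of `∂Ω` in a given cell, the charge
`∫ ρ_l / l` of the part of that cell inside `Ω`, divided by the area of `∂Ω` in that cell. -/
def innerSurfaceCharge (e : Module.Basis (Fin 3) ℝ E3) (Q Ω : Set E3) (ρ : ℝ → E3 → ℝ) (l : ℝ)
    (s : E3) : ℝ :=
  ∑ᶠ i : Idx, (cell e Q l i).indicator
    (fun _ => (∫ x in cell e Q l i ∩ Ω, ρ l x / l) / cellArea e Q Ω l i) s

/-- The outer surface charge density at scale `l` of the layer of thickness `l h`. -/
def outerSurfaceCharge (n : E3 → E3) (ρ : ℝ → E3 → ℝ) (l h : ℝ) (s : E3) : ℝ :=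
  ∫ t in Ioc 0 h, ρ l (s + (l * t) • n s)

/-- Weak convergence, along `F`, of densities on `∂Ω` to a density `τ ∈ L¹(∂Ω)`. -/
def TendstoOnBoundary {α : Type} (Ω : Set E3) (F : Filter α) (τ' : α → E3 → ℝ) (τ : E3 → ℝ) :
    Prop :=
  Integrable τ (surfaceMeasure Ω) ∧ ∀ ψ : E3 → ℝ, Continuous ψ →
    Tendsto (fun a => ∫ s, ψ s * τ' a s ∂(surfaceMeasure Ω)) F
      (𝓝 (∫ s, ψ s * τ s ∂(surfaceMeasure Ω)))

/-- `ρ₀`, `σi` and `σo` are the two-scale limit, the inner surface charge and the outer surface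
charge of `ρ_l` as `l` tends to zero along `F`. For the outer charge, first `l → 0` for a fixed
layer `h`, and then `h → ∞`. -/
structure IsHomogenizedLimit (e : Module.Basis (Fin 3) ℝ E3) (Q Ω : Set E3) (n : E3 → E3)
    (ρ : ℝ → E3 → ℝ) (F : Filter ℝ) (ρ₀ : E3 → E3 → ℝ) (σi σo : E3 → ℝ) : Prop where
  twoScale : IsTwoScaleLimit e Q Ω ρ F ρ₀
  inner : TendstoOnBoundary Ω F (innerSurfaceCharge e Q Ω ρ) σi
  outer : ∃ σh : ℝ → E3 → ℝ,
    (∀ h > (0 : ℝ), TendstoOnBoundary Ω F (fun l => outerSurfaceCharge n ρ l h) (σh h)) ∧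
    TendstoOnBoundary Ω atTop σh σo

end

/-! The energy of the charge in `Ω` is a priori only bounded, so division by `l` looks singular.
Neutrality removes the singularity: a neutral cluster does not see constant potentials, and over a
cell the potential varies by an amount of order `l`. Space is split into full cells, partial cells
and the exterior.

Full cells. For almost every `x` the increment `φ (x + w) - φ x` is the integral of `⟪G (x + t w),
w⟫` over `t` in `[0, 1]` (`ae_translate_sub_eq`). On a neutral cell the energy is therefore the mean
of `G` paired with the first moment of the charge, which is `l` times the integral of `⟪G, p_l⟫`.
Summed over cells, the error is `l` times the `L²` norm of the charge times the `L²` modulus of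
continuity of `G` under translations of length `O(l)`, hence `o(l)`
(`enorm_integral_sub_inner_le_of_neutral`, `tendsto_deepBulkCells`). Nothing beyond `G ∈ L²` is
needed. Microscopic neutral clusters of transition cells obey the same estimate without an affine
correction, because the charge lives there on a set of vanishing volume. Mesoscopic clusters have
volume `O(l)` and the continuous potential oscillates little on them; the remainder has volume
`o(l)`. Within distance `O(l)` of the boundary, where segments may leave `Ω`, the volume is `O(l)`
and uniform continuity of `φ` suffices.

Partial cells. There are `O(l⁻²)` of them, each with charge `O(l³)`, so freezing the potential in
each cell costs `o(1)` after division by `l`. What remains is the pairing with the inner surface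
charge (`tendsto_partialCells_sub_innerSurfaceCharge`).

Exterior. In normal coordinates `s + l t n(s)` the volume is area times length up to a factor
tending to one at the boundary (`HasLipschitzNormal.layer_comparison`). A layer of thickness `l h`
yields the outer charge at height `h`. Concentration and tightness make the rest small for large
`h`, uniformly in `l` (`exists_integral_outside_le`).

Polarization. The two-scale limit is the weak `L²` limit of the unfolded charges `ρ_l (x̂ + l y)`.
Since these are bounded and the smooth periodic tests span a dense subspace, convergence holds
against all of `L²`, in particular against `⟪ψ(x), y⟫`, and this pairing is the dipole moment.

Existence of limits is weak `L²` compactness applied three times: to the unfolded charges, to the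
charges of the partial cells in normal coordinates stretched by `1 / l`, and to the exterior charges
in the same coordinates with a weight that decays exponentially in the height. The bound `g` makes
the exterior limit profile integrable, which permits `h → ∞`. -/

open scoped NNReal ENNReal Function

/-! ### Nearest points and normals of a `C²` domain -/

/-- A nearest point of a set that contains all short segments in the directions of an open half
space is reached along the normal of that half space. -/
theorem sub_eq_smul_of_forall_norm_le {V : Type*} [NormedAddCommGroup V] [InnerProductSpace ℝ V]
    {K : Set V} {a s x : V} (hs : ∀ y ∈ K, ‖x - s‖ ≤ ‖x - y‖)
    (hK : ∀ v, inner ℝ v a < 0 → ∀ᶠ τ in 𝓝[>] (0 : ℝ), s + τ • v ∈ K) (ha : a ≠ 0) :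
    x - s = ‖x - s‖ • (‖a‖⁻¹ • a) := by
  set z := x - s with hz
  have hna : 0 < ‖a‖ := norm_pos_iff.2 ha
  -- First variation: moving `s` to `s + τ v` changes the squared distance by `-2 τ ⟪z, v⟫ + τ²
  -- ‖v‖²`, which must not be negative for small `τ`.
  have key : ∀ v, inner ℝ v a < 0 → inner ℝ z v ≤ 0 := by
    intro v hv
    by_contra! hpos
    have hev : ∀ᶠ τ in 𝓝[>] (0 : ℝ), τ * ‖v‖ ^ 2 < 2 * inner ℝ z v := by
      have : Tendsto (fun τ : ℝ => τ * ‖v‖ ^ 2) (𝓝[>] 0) (𝓝 (0 * ‖v‖ ^ 2)) :=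
        (tendsto_id.mul_const _).mono_left nhdsWithin_le_nhds
      rw [zero_mul] at this
      exact this.eventually (gt_mem_nhds (by linarith))
    obtain ⟨τ, h1, h2, h3⟩ := ((hK v hv).and (hev.and self_mem_nhdsWithin)).exists
    have h3 : 0 < τ := h3
    have h4 := hs _ h1
    have h5 : x - (s + τ • v) = z - τ • v := by rw [hz]; abel
    rw [h5] at h4
    have h6 : ‖z‖ ^ 2 ≤ ‖z - τ • v‖ ^ 2 := by gcongr
    rw [norm_sub_sq_real z, inner_smul_right, norm_smul, mul_pow, Real.norm_eq_abs, sq_abs] at h6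
    nlinarith
  have hza : 0 ≤ inner ℝ z a := by
    have := key (-a) (by rw [inner_neg_left, real_inner_self_eq_norm_sq]; nlinarith)
    rw [inner_neg_right] at this
    linarith
  set w := z - (inner ℝ z a / ‖a‖ ^ 2) • a with hw
  have hwa : inner ℝ w a = 0 := by
    rw [hw, inner_sub_left, real_inner_smul_left, real_inner_self_eq_norm_sq]
    field_simp
    ring
  have hzw : inner ℝ z w = ‖w‖ ^ 2 := by
    have : z = w + (inner ℝ z a / ‖a‖ ^ 2) • a := by rw [hw]; abel
    conv_lhs => rw [this]
    rw [inner_add_left, real_inner_smul_left, real_inner_comm w a, hwa, real_inner_self_eq_norm_sq]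
    ring
  have hw0 : w = 0 := by
    -- The part `w` of `z` orthogonal to `a` is only a limit of admissible directions; tilting it by
    -- `-ε a` makes it admissible, and then `ε → 0`.
    have h1 : ∀ ε > 0, ‖w‖ ^ 2 ≤ 0 + ε * inner ℝ z a := by
      intro ε hε
      have := key (w - ε • a) (by
        rw [inner_sub_left, hwa, real_inner_smul_left, real_inner_self_eq_norm_sq]
        have : 0 < ε * ‖a‖ ^ 2 := by positivity
        linarith)
      rw [inner_sub_right, hzw, inner_smul_right] at this
      linarith
    have h2 : ‖w‖ ^ 2 ≤ 0 := by
      have ht : Tendsto (fun ε : ℝ => 0 + ε * inner ℝ z a) (𝓝[>] 0) (𝓝 (0 + 0 * inner ℝ z a)) :=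
        (tendsto_const_nhds.add (tendsto_id.mul_const _)).mono_left nhdsWithin_le_nhds
      rw [zero_mul, add_zero] at ht
      exact ge_of_tendsto ht (eventually_nhdsWithin_of_forall h1)
    simpa using le_antisymm h2 (by positivity)
  have hz2 : z = (inner ℝ z a / ‖a‖ ^ 2) • a := by
    rw [hw, sub_eq_zero] at hw0; exact hw0
  set c := inner ℝ z a / ‖a‖ ^ 2 with hc
  have hc0 : 0 ≤ c := by positivity
  have hnz : ‖z‖ = c * ‖a‖ := by
    rw [hz2, norm_smul, Real.norm_eq_abs, abs_of_nonneg hc0]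
  rw [hnz, smul_smul, mul_assoc, mul_inv_cancel₀ hna.ne', mul_one]
  exact hz2

/-- Normalisation is Lipschitz away from zero, since `(‖a‖⁻¹ - ‖b‖⁻¹) b` has norm `‖a‖⁻¹ |‖b‖ -
‖a‖|`. It turns a Lipschitz gradient into a Lipschitz normal. -/
theorem norm_normalize_sub_le {V : Type*} [NormedAddCommGroup V] [NormedSpace ℝ V]
    {a b : V} (ha : a ≠ 0) (hb : b ≠ 0) :
    ‖‖a‖⁻¹ • a - ‖b‖⁻¹ • b‖ ≤ 2 * ‖a‖⁻¹ * ‖a - b‖ := by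
  have hna : 0 < ‖a‖ := norm_pos_iff.2 ha
  have hnb : 0 < ‖b‖ := norm_pos_iff.2 hb
  have h1 : ‖a‖⁻¹ • a - ‖b‖⁻¹ • b = ‖a‖⁻¹ • (a - b) + (‖a‖⁻¹ - ‖b‖⁻¹) • b := by
    rw [smul_sub, sub_smul]; abel
  have h2 : |‖a‖⁻¹ - ‖b‖⁻¹| * ‖b‖ = ‖a‖⁻¹ * |‖b‖ - ‖a‖| := by
    rw [inv_sub_inv hna.ne' hnb.ne', abs_div, abs_of_pos (mul_pos hna hnb)]
    field_simp
  have h3 : |‖b‖ - ‖a‖| ≤ ‖a - b‖ := by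
    rw [abs_sub_comm]; exact abs_norm_sub_norm_le a b
  calc ‖‖a‖⁻¹ • a - ‖b‖⁻¹ • b‖ ≤ ‖‖a‖⁻¹ • (a - b)‖ + ‖(‖a‖⁻¹ - ‖b‖⁻¹) • b‖ := by
        rw [h1]; exact norm_add_le _ _
    _ = ‖a‖⁻¹ * ‖a - b‖ + ‖a‖⁻¹ * |‖b‖ - ‖a‖| := by
        rw [norm_smul, norm_smul, Real.norm_eq_abs, Real.norm_eq_abs, h2, abs_of_pos (by positivity)]
    _ ≤ ‖a‖⁻¹ * ‖a - b‖ + ‖a‖⁻¹ * ‖a - b‖ := by gcongr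
    _ = _ := by ring

/-- The quantitative properties of a bounded domain with `C²` boundary and outward normal `n`. -/
structure HasLipschitzNormal (Ω : Set E3) (n : E3 → E3) (L : ℝ) : Prop where
  pos : 0 < L
  isOpen : IsOpen Ω
  nonempty : Ω.Nonempty
  bounded : Bornology.IsBounded Ω
  measurable : Measurable n
  norm_eq_one : ∀ s ∈ frontier Ω, ‖n s‖ = 1
  lipschitz : ∀ s ∈ frontier Ω, ∀ s' ∈ frontier Ω, ‖n s - n s'‖ ≤ L * ‖s - s'‖
  inner_le : ∀ s ∈ frontier Ω, ∀ y ∈ closure Ω, inner ℝ (n s) (y - s) ≤ L * ‖y - s‖ ^ 2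
  abs_inner_le : ∀ s ∈ frontier Ω, ∀ s' ∈ frontier Ω, |inner ℝ (n s) (s' - s)| ≤ L * ‖s' - s‖ ^ 2
  exterior : ∀ x ∉ Ω, ∃ s ∈ frontier Ω, x = s + Metric.infDist x Ω • n s
  interior : ∀ x ∈ Ω, ∃ s ∈ frontier Ω, x = s - Metric.infDist x Ωᶜ • n s

theorem eventually_lt_of_inner_gradient_neg {r : E3 → ℝ} {s v : E3} (hr : DifferentiableAt ℝ r s)
    (hv : inner ℝ v (gradient r s) < 0) : ∀ᶠ τ in 𝓝[>] (0 : ℝ), r (s + τ • v) < r s := by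
  have h1 : HasDerivAt (fun τ : ℝ => r (s + τ • v)) (inner ℝ v (gradient r s)) 0 := by
    have h2 : HasFDerivAt r (fderiv ℝ r s) (s + (0 : ℝ) • v) := by simpa using hr.hasFDerivAt
    have h3 : HasDerivAt (fun τ : ℝ => s + τ • v) v 0 := by
      simpa using ((hasDerivAt_id (0 : ℝ)).smul_const v).const_add s
    have h4 := h2.comp_hasDerivAt 0 h3
    rw [← toDual_gradient, InnerProductSpace.toDual_apply_apply, real_inner_comm] at h4
    exact h4
  have h5 := h1.tendsto_slope_zero_right
  filter_upwards [h5.eventually (gt_mem_nhds hv), self_mem_nhdsWithin] with τ h6 h7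
  have h7 : 0 < τ := h7
  simp only [zero_add, zero_smul, add_zero, smul_eq_mul] at h6
  have h8 : r (s + τ • v) - r s = τ * (τ⁻¹ * (r (s + τ • v) - r s)) := by
    field_simp
  nlinarith

/-- The defining function is used only here. Its gradient is Lipschitz on a ball and bounded below
on the compact boundary. Taylor's formula at a boundary point, where `r = 0`, gives the quadratic
bounds because `r ≤ 0` on the closure. Nearest points give the representations along normals. -/
theorem IsC2Domain.exists_hasLipschitzNormal {Ω : Set E3} {r : E3 → ℝ} (h : IsC2Domain Ω r) :
    ∃ L, HasLipschitzNormal Ω (outwardNormal r) L := by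
  have hdiff : Differentiable ℝ r := h.contDiff.differentiable (by norm_num)
  have hopen : IsOpen Ω := by
    rw [h.eq_sublevel]; exact isOpen_lt hdiff.continuous continuous_const
  have hfr0 : ∀ s ∈ frontier Ω, r s = 0 := by
    intro s hs
    rw [h.eq_sublevel] at hs
    exact frontier_lt_subset_eq hdiff.continuous continuous_const hs
  have hcl0 : ∀ y ∈ closure Ω, r y ≤ 0 := by
    intro y hy
    rw [h.eq_sublevel] at hy
    exact closure_lt_subset_le hdiff.continuous continuous_const hy
  have hcpt : IsCompact (frontier Ω) :=
    Metric.isCompact_of_isClosed_isBounded isClosed_frontier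
      (h.bounded.closure.subset frontier_subset_closure)
  have hgradC : ContDiff ℝ 1 (gradient r) := by
    have h1 : ContDiff ℝ 1 (fderiv ℝ r) := h.contDiff.fderiv_right (by norm_num)
    exact (InnerProductSpace.toDual ℝ E3).symm.contDiff.comp h1
  obtain ⟨ρ, hρ⟩ := h.bounded.closure.subset_closedBall (0 : E3)
  have hconv : Convex ℝ (Metric.closedBall (0 : E3) ρ) := convex_closedBall _ _
  -- A convex set is needed: segments between points of the closure may leave it.
  obtain ⟨M, hM⟩ : ∃ M, LipschitzOnWith M (gradient r) (Metric.closedBall (0 : E3) ρ) :=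
    (hgradC.locallyLipschitz.locallyLipschitzOn).exists_lipschitzOnWith_of_compact
      (isCompact_closedBall _ _)
  have taylor : ∀ x ∈ closure Ω, ∀ y ∈ closure Ω,
      |r y - r x - inner ℝ (gradient r x) (y - x)| ≤ M * ‖y - x‖ ^ 2 := by
    intro x hx y hy
    have hseg : segment ℝ x y ⊆ Metric.closedBall (0 : E3) ρ := hconv.segment_subset (hρ hx) (hρ hy)
    have h1 := (convex_segment x y).norm_image_sub_le_of_norm_hasFDerivWithin_le'
      (f := r) (f' := fderiv ℝ r) (φ := fderiv ℝ r x) (C := M * ‖y - x‖)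
      (fun z _ => (hdiff z).hasFDerivAt.hasFDerivWithinAt) (fun z hz => by
        rw [← toDual_gradient, ← toDual_gradient, ← map_sub, LinearIsometryEquiv.norm_map]
        refine (hM.norm_sub_le (hseg hz) (hρ hx)).trans ?_
        gcongr
        exact norm_sub_le_of_mem_segment hz) (left_mem_segment ℝ x y) (right_mem_segment ℝ x y)
    rw [← toDual_gradient, InnerProductSpace.toDual_apply_apply, Real.norm_eq_abs] at h1
    linarith [h1]
  obtain ⟨c, hc0, hc⟩ : ∃ c > 0, ∀ s ∈ frontier Ω, c ≤ ‖gradient r s‖ := by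
    rcases (frontier Ω).eq_empty_or_nonempty with he | hne
    · exact ⟨1, one_pos, by simp [he]⟩
    · obtain ⟨s, hs, hmin⟩ := hcpt.exists_isMinOn hne hgradC.continuous.norm.continuousOn
      exact ⟨‖gradient r s‖, norm_pos_iff.2 (h.gradient_ne_zero s hs), fun s' hs' => hmin hs'⟩
  have hfc : frontier Ω ⊆ closure Ω := frontier_subset_closure
  -- `2 c⁻¹ M` controls the normalised gradient, `c⁻¹ M` suffices for the quadratic bounds, and the
  -- summand `1` makes `L` positive.
  set L : ℝ := 2 * c⁻¹ * M + 1 with hL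
  have hM0 : (0 : ℝ) ≤ M := M.2
  have hcM : c⁻¹ * M ≤ L := by
    have : 0 ≤ c⁻¹ * M := by positivity
    rw [hL]; nlinarith
  have hn : ∀ s v, inner ℝ (outwardNormal r s) v = ‖gradient r s‖⁻¹ * inner ℝ (gradient r s) v :=
    fun s v => real_inner_smul_left _ _ _
  refine ⟨L, by positivity, hopen, h.nonempty, h.bounded, ?_, ?_, ?_, ?_, ?_, ?_, ?_⟩
  · have := hgradC.continuous.measurable
    exact (this.norm.inv).smul this
  · intro s hs
    have := norm_pos_iff.2 (h.gradient_ne_zero s hs)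
    rw [outwardNormal, norm_smul, norm_inv, norm_norm, inv_mul_cancel₀ this.ne']
  · intro s hs s' hs'
    calc _ ≤ 2 * ‖gradient r s‖⁻¹ * ‖gradient r s - gradient r s'‖ :=
          norm_normalize_sub_le (h.gradient_ne_zero s hs) (h.gradient_ne_zero s' hs')
      _ ≤ 2 * c⁻¹ * (M * ‖s - s'‖) := by
          gcongr
          · exact hc s hs
          · exact hM.norm_sub_le (hρ (hfc hs)) (hρ (hfc hs'))
      _ ≤ L * ‖s - s'‖ := by
          rw [hL]; nlinarith [norm_nonneg (s - s')]
  · intro s hs y hy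
    have h1 := (abs_le.1 (taylor s (hfc hs) y hy)).1
    have h2 := hcl0 y hy
    rw [hfr0 s hs] at h1
    have h3 : inner ℝ (gradient r s) (y - s) ≤ M * ‖y - s‖ ^ 2 := by linarith
    rw [hn]
    calc _ ≤ ‖gradient r s‖⁻¹ * (M * ‖y - s‖ ^ 2) := by gcongr
      _ ≤ c⁻¹ * (M * ‖y - s‖ ^ 2) := by gcongr; exact hc s hs
      _ ≤ L * ‖y - s‖ ^ 2 := by rw [← mul_assoc]; gcongr
  · intro s hs s' hs'
    have h1 := taylor s (hfc hs) s' (hfc hs')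
    rw [hfr0 s hs, hfr0 s' hs', sub_self, zero_sub, abs_neg] at h1
    rw [hn, abs_mul, abs_of_nonneg (by positivity)]
    calc _ ≤ ‖gradient r s‖⁻¹ * (M * ‖s' - s‖ ^ 2) := by gcongr
      _ ≤ c⁻¹ * (M * ‖s' - s‖ ^ 2) := by gcongr; exact hc s hs
      _ ≤ L * ‖s' - s‖ ^ 2 := by rw [← mul_assoc]; gcongr
  · intro x hx
    obtain ⟨s, hs, hd⟩ := isClosed_closure.exists_infDist_eq_dist h.nonempty.closure x
    rw [Metric.infDist_closure] at hd
    have hmin : ∀ y ∈ Ω, ‖x - s‖ ≤ ‖x - y‖ := by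
      intro y hy
      rw [← dist_eq_norm, ← dist_eq_norm, ← hd]
      exact Metric.infDist_le_dist_of_mem hy
    -- A nearest point inside the open set could be improved by moving it towards `x`.
    have hsf : s ∈ frontier Ω := by
      rw [hopen.frontier_eq]
      refine ⟨hs, fun hsΩ => ?_⟩
      have hxs : x ≠ s := fun he => hx (he ▸ hsΩ)
      have h1 : ∀ᶠ τ in 𝓝[>] (0 : ℝ), s + τ • (x - s) ∈ Ω := by
        have : Tendsto (fun τ : ℝ => s + τ • (x - s)) (𝓝[>] 0) (𝓝 (s + (0 : ℝ) • (x - s))) :=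
          (tendsto_const_nhds.add (tendsto_id.smul_const _)).mono_left nhdsWithin_le_nhds
        rw [zero_smul, add_zero] at this
        exact this.eventually (hopen.mem_nhds hsΩ)
      have h2 : ∀ᶠ τ in 𝓝[>] (0 : ℝ), τ ∈ Ioo (0 : ℝ) 1 := Ioo_mem_nhdsGT one_pos
      obtain ⟨τ, h3, h4⟩ := (h1.and h2).exists
      have h5 := hmin _ h3
      have h6 : x - (s + τ • (x - s)) = (1 - τ) • (x - s) := by rw [sub_smul, one_smul]; abel
      rw [h6, norm_smul, Real.norm_eq_abs, abs_of_pos (by linarith [h4.2])] at h5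
      have : 0 < ‖x - s‖ := norm_pos_iff.2 (sub_ne_zero.2 hxs)
      nlinarith [h4.1]
    refine ⟨s, hsf, ?_⟩
    have h1 := sub_eq_smul_of_forall_norm_le (a := gradient r s) hmin (fun v hv => by
      filter_upwards [eventually_lt_of_inner_gradient_neg (hdiff s) hv] with τ hτ
      rw [hfr0 s hsf] at hτ
      rw [h.eq_sublevel]; exact hτ) (h.gradient_ne_zero s hsf)
    rw [hd, dist_eq_norm, ← sub_eq_iff_eq_add']
    exact h1
  · intro x hx
    have hne : Ωᶜ.Nonempty := by
      by_contra hcon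
      rw [not_nonempty_iff_eq_empty, compl_empty_iff] at hcon
      exact NormedSpace.unbounded_univ ℝ E3 (hcon ▸ h.bounded)
    obtain ⟨s, hs, hd⟩ := hopen.isClosed_compl.exists_infDist_eq_dist hne x
    have hmin : ∀ y ∈ Ωᶜ, ‖x - s‖ ≤ ‖x - y‖ := by
      intro y hy
      rw [← dist_eq_norm, ← dist_eq_norm, ← hd]
      exact Metric.infDist_le_dist_of_mem hy
    have hsf : s ∈ frontier Ω := by
      rw [hopen.frontier_eq]
      refine ⟨?_, hs⟩
      have hxs : x ≠ s := fun he => hs (he ▸ hx)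
      have hlim : Tendsto (fun τ : ℝ => s + τ • (x - s)) (𝓝[>] 0) (𝓝 s) := by
        have : Tendsto (fun τ : ℝ => s + τ • (x - s)) (𝓝[>] 0) (𝓝 (s + (0 : ℝ) • (x - s))) :=
          (tendsto_const_nhds.add (tendsto_id.smul_const _)).mono_left nhdsWithin_le_nhds
        rwa [zero_smul, add_zero] at this
      have h2 : ∀ᶠ τ in 𝓝[>] (0 : ℝ), τ ∈ Ioo (0 : ℝ) 1 := Ioo_mem_nhdsGT one_pos
      refine mem_closure_of_tendsto hlim ?_
      filter_upwards [h2] with τ h4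
      by_contra h3
      have h5 := hmin _ h3
      have h6 : x - (s + τ • (x - s)) = (1 - τ) • (x - s) := by rw [sub_smul, one_smul]; abel
      rw [h6, norm_smul, Real.norm_eq_abs, abs_of_pos (by linarith [h4.2])] at h5
      have : 0 < ‖x - s‖ := norm_pos_iff.2 (sub_ne_zero.2 hxs)
      nlinarith [h4.1]
    refine ⟨s, hsf, ?_⟩
    -- For the complement, `-r` plays the role of `r`, so `x - s` points along the inward normal.
    have hg : gradient (fun y => -r y) s = -gradient r s := by
      apply HasGradientAt.gradient
      rw [hasGradientAt_iff_hasFDerivAt, map_neg, toDual_gradient]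
      exact (hdiff s).hasFDerivAt.neg
    have h1 := sub_eq_smul_of_forall_norm_le (a := -gradient r s) hmin (fun v hv => by
      filter_upwards [eventually_lt_of_inner_gradient_neg (r := fun y => -r y) (hdiff s).neg
        (by rw [hg]; exact hv)] with τ hτ
      rw [hfr0 s hsf] at hτ
      rw [h.eq_sublevel]; simp only [mem_compl_iff, mem_ofPred_eq, not_lt]; linarith)
      (neg_ne_zero.2 (h.gradient_ne_zero s hsf))
    rw [hd, dist_eq_norm]
    rw [norm_neg, smul_neg, smul_neg] at h1
    rw [outwardNormal, sub_eq_add_neg, ← h1]; abel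

/-! ### Area and volume in normal coordinates, without Jacobians -/

/-- The comparison of distances makes `f` factor through `g` on `E` by a `K`-Lipschitz map, although
neither map need be injective. Two parametrisations can thus be compared without inverting either.
-/
theorem euclideanHausdorffMeasure_image_le {X : Type*} (d : ℕ) {f g : X → E3} {E : Set X} {K : ℝ≥0}
    (h : ∀ x ∈ E, ∀ y ∈ E, dist (f x) (f y) ≤ K * dist (g x) (g y)) :
    (μHE[d] : Measure E3) (f '' E) ≤ (K : ℝ≥0∞) ^ d * μHE[d] (g '' E) := by
  rcases E.eq_empty_or_nonempty with rfl | ⟨x₀, hx₀⟩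
  · simp
  have : Nonempty X := ⟨x₀⟩
  set k : E3 → E3 := fun y => f (Function.invFunOn g E y) with hk
  have hinv : ∀ y ∈ g '' E, Function.invFunOn g E y ∈ E ∧ g (Function.invFunOn g E y) = y :=
    fun y hy => ⟨Function.invFunOn_mem hy, Function.invFunOn_eq hy⟩
  have hlip : LipschitzOnWith K k (g '' E) := by
    refine LipschitzOnWith.of_dist_le_mul fun y hy y' hy' => ?_
    have := h _ (hinv y hy).1 _ (hinv y' hy').1
    rwa [(hinv y hy).2, (hinv y' hy').2] at this
  have himg : f '' E = k '' (g '' E) := by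
    rw [image_image]
    refine image_congr fun x hx => ?_
    have h1 := hinv (g x) (mem_image_of_mem g hx)
    have h2 := h x hx _ h1.1
    rw [h1.2, dist_self, mul_zero] at h2
    exact dist_le_zero.1 h2
  rw [himg]
  simp only [Measure.euclideanHausdorffMeasure_def, Measure.smul_apply]
  have := hlip.hausdorffMeasure_image_le (d := (d : ℝ)) (by positivity)
  rw [ENNReal.rpow_natCast] at this
  calc _ ≤ _ := smul_le_smul_of_nonneg_left this (by positivity)
    _ = _ := by simp only [ENNReal.smul_def, smul_eq_mul]; ring

theorem volume_image_le_of_dist_le {X : Type*} {f g : X → E3} {E : Set X} {K : ℝ≥0}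
    (h : ∀ x ∈ E, ∀ y ∈ E, dist (f x) (f y) ≤ K * dist (g x) (g y)) :
    volume (f '' E) ≤ (K : ℝ≥0∞) ^ 3 * volume (g '' E) := by
  rw [← EuclideanSpace.euclideanHausdorffMeasure_eq_volume 3]
  exact euclideanHausdorffMeasure_image_le 3 h

/-- Volume by integration of the areas of the cross-sections orthogonal to a unit vector. -/
theorem volume_eq_lintegral_slices {v : E3} (hv : ‖v‖ = 1) {A : Set E3} (hA : MeasurableSet A) :
    volume A = ∫⁻ t : ℝ, (μHE[2] : Measure E3) (A ∩ {z | inner ℝ v z = t}) := by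
  have hv0 : v ≠ 0 := by
    rintro rfl; simp at hv
  have h := EuclideanGeometry.euclideanHausdorffMeasure_eq_lintegral (0 : E3) hv0 hA
  rw [finrank_euclideanSpace, Fintype.card_fin, EuclideanSpace.euclideanHausdorffMeasure_eq_volume]
    at h
  rw [h]
  have h1 : ‖v‖ₑ = 1 := by rw [enorm_eq_iff_norm_eq.2 (show ‖v‖ = ‖(1 : ℝ)‖ by simpa using hv)]; simp
  rw [h1, one_mul]
  refine lintegral_congr fun t => ?_
  congr 2
  ext z
  simp only [SetLike.mem_coe, AffineSubspace.mem_mk', vadd_eq_add, add_zero, vsub_eq_sub,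
    Submodule.mem_orthogonal_singleton_iff_inner_right, mem_ofPred_eq, inner_sub_right,
    inner_smul_right, real_inner_self_eq_norm_sq, hv]
  constructor <;> intro h <;> linarith

/-- The surface coordinate is flattened to the plane orthogonal to `v`, the height is measured
along `v`. -/
noncomputable def flatten (v : E3) (z : E3 × ℝ) : E3 := z.1 - (inner ℝ v z.1 : ℝ) • v + z.2 • v

theorem continuous_flatten (v : E3) : Continuous (flatten v) := by
  unfold flatten; fun_prop

theorem inner_flatten {v : E3} (hv : ‖v‖ = 1) (z : E3 × ℝ) : inner ℝ v (flatten v z) = z.2 := by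
  simp only [flatten, inner_add_right, inner_sub_right, inner_smul_right,
    real_inner_self_eq_norm_sq, hv]
  ring

theorem norm_flatten_sub_sq {v : E3} (hv : ‖v‖ = 1) (z z' : E3 × ℝ) :
    ‖flatten v z - flatten v z'‖ ^ 2 =
      ‖z.1 - z'.1 - (inner ℝ v (z.1 - z'.1) : ℝ) • v‖ ^ 2 + (z.2 - z'.2) ^ 2 := by
  have h1 : flatten v z - flatten v z' =
      (z.1 - z'.1 - (inner ℝ v (z.1 - z'.1) : ℝ) • v) + (z.2 - z'.2) • v := by
    simp only [flatten, inner_sub_right, sub_smul]; abel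
  rw [h1, norm_add_sq_real, inner_smul_right, inner_sub_left, real_inner_smul_left,
    real_inner_self_eq_norm_sq, norm_smul, hv, real_inner_comm v]
  simp only [one_pow, mul_one, sub_self, mul_zero, add_zero, Real.norm_eq_abs, sq_abs]

/-- On `B` all chords are nearly orthogonal to `v`. -/
def IsNearlyFlat (v : E3) (η : ℝ) (B : Set E3) : Prop :=
  ∀ s ∈ B, ∀ s' ∈ B, |inner ℝ v (s - s')| ≤ η * ‖s - s'‖

/-- Projecting a chord along `v` removes at most the fraction `η` of its length, so flattening is
injective on nearly flat pieces with a quantitative inverse. -/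
theorem IsNearlyFlat.le_norm {v : E3} (hv : ‖v‖ = 1) {η : ℝ} {B : Set E3} (hB : IsNearlyFlat v η B)
    {z z' : E3 × ℝ} (hz : z.1 ∈ B) (hz' : z'.1 ∈ B) :
    (1 - η) * ‖z.1 - z'.1‖ ≤ ‖flatten v z - flatten v z'‖ := by
  set a := z.1 - z'.1 with ha
  have h1 := hB _ hz _ hz'
  rw [← ha] at h1
  have h2 : ‖a‖ ≤ ‖a - (inner ℝ v a : ℝ) • v‖ + η * ‖a‖ := by
    calc ‖a‖ = ‖(a - (inner ℝ v a : ℝ) • v) + (inner ℝ v a : ℝ) • v‖ := by rw [sub_add_cancel]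
      _ ≤ ‖a - (inner ℝ v a : ℝ) • v‖ + ‖(inner ℝ v a : ℝ) • v‖ := norm_add_le _ _
      _ ≤ _ := by rw [norm_smul, hv, mul_one, Real.norm_eq_abs]; gcongr
  have h3 : ‖a - (inner ℝ v a : ℝ) • v‖ ≤ ‖flatten v z - flatten v z'‖ := by
    refine le_of_sq_le_sq ?_ (norm_nonneg _)
    rw [norm_flatten_sub_sq hv]
    nlinarith [sq_nonneg (z.2 - z'.2)]
  linarith

theorem abs_snd_sub_le_norm_flatten {v : E3} (hv : ‖v‖ = 1) (z z' : E3 × ℝ) :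
    |z.2 - z'.2| ≤ ‖flatten v z - flatten v z'‖ := by
  refine abs_le_of_sq_le_sq ?_ (norm_nonneg _)
  rw [norm_flatten_sub_sq hv]
  nlinarith [sq_nonneg ‖z.1 - z'.1 - (inner ℝ v (z.1 - z'.1) : ℝ) • v‖]

theorem IsNearlyFlat.injOn_flatten {v : E3} (hv : ‖v‖ = 1) {η : ℝ} (hη : η < 1) {B : Set E3}
    (hB : IsNearlyFlat v η B) : InjOn (flatten v) (B ×ˢ univ) := by
  intro z hz z' hz' h
  have h1 := hB.le_norm hv hz.1 hz'.1
  have h2 := abs_snd_sub_le_norm_flatten hv z z'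
  rw [h, sub_self, norm_zero] at h1 h2
  have h3 : ‖z.1 - z'.1‖ = 0 := le_antisymm (by nlinarith [norm_nonneg (z.1 - z'.1)]) (norm_nonneg _)
  exact Prod.ext (sub_eq_zero.1 (norm_eq_zero.1 h3)) (sub_eq_zero.1 (abs_nonpos_iff.1 h2))

theorem image_flatten_inter {v : E3} (hv : ‖v‖ = 1) (E : Set (E3 × ℝ)) (t : ℝ) :
    flatten v '' E ∩ {z | inner ℝ v z = t} = (fun s => flatten v (s, t)) '' {s | (s, t) ∈ E} := by
  ext z
  constructor
  · rintro ⟨⟨w, hw, rfl⟩, hz⟩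
    rw [mem_ofPred_eq, inner_flatten hv] at hz
    subst hz
    exact ⟨w.1, hw, rfl⟩
  · rintro ⟨s, hs, rfl⟩
    exact ⟨⟨_, hs, rfl⟩, inner_flatten hv _⟩

theorem IsNearlyFlat.measurableSet_image_flatten {v : E3} (hv : ‖v‖ = 1) {η : ℝ} (hη : η < 1)
    {B : Set E3} (hB : IsNearlyFlat v η B) {E : Set (E3 × ℝ)} (hE : MeasurableSet E)
    (hEB : E ⊆ B ×ˢ univ) : MeasurableSet (flatten v '' E) :=
  hE.image_of_measurable_injOn (continuous_flatten v).measurable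
    ((hB.injOn_flatten hv hη).mono hEB)

/-- Slice by slice, flattening is an orthogonal projection and cannot increase area. -/
theorem IsNearlyFlat.volume_image_flatten_le {v : E3} (hv : ‖v‖ = 1) {η : ℝ} (hη : η < 1)
    {B : Set E3} (hB : IsNearlyFlat v η B) {E : Set (E3 × ℝ)} (hE : MeasurableSet E)
    (hEB : E ⊆ B ×ˢ univ) :
    volume (flatten v '' E) ≤ ∫⁻ t : ℝ, (μHE[2] : Measure E3) {s | (s, t) ∈ E} := by
  rw [volume_eq_lintegral_slices hv (hB.measurableSet_image_flatten hv hη hE hEB)]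
  refine lintegral_mono fun t => ?_
  simp only [image_flatten_inter hv]
  have h := euclideanHausdorffMeasure_image_le 2 (f := fun s => flatten v (s, t)) (g := id) (K := 1)
    (E := {s | (s, t) ∈ E}) (fun s _ s' _ => by
      rw [NNReal.coe_one, one_mul, dist_eq_norm, dist_eq_norm, id, id]
      refine le_of_sq_le_sq ?_ (norm_nonneg _)
      rw [norm_flatten_sub_sq hv]
      simp only [sub_self, zero_pow two_ne_zero, add_zero]
      rw [norm_sub_sq_real (s - s'), inner_smul_right, norm_smul, hv, real_inner_comm, mul_one,
        Real.norm_eq_abs, sq_abs]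
      nlinarith [sq_nonneg (inner ℝ v (s - s') : ℝ)])
  simpa using h

/-- On a slice, lengths shrink at most by the factor `1 - η`, hence areas at most by its square. -/
theorem IsNearlyFlat.lintegral_le_volume_image_flatten {v : E3} (hv : ‖v‖ = 1) {η : ℝ} (hη : η < 1)
    {B : Set E3} (hB : IsNearlyFlat v η B) {E : Set (E3 × ℝ)} (hE : MeasurableSet E)
    (hEB : E ⊆ B ×ˢ univ) :
    ∫⁻ t : ℝ, (μHE[2] : Measure E3) {s | (s, t) ∈ E} ≤
      ENNReal.ofReal ((1 - η)⁻¹ ^ 2) * volume (flatten v '' E) := by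
  have hη' : 0 < 1 - η := by linarith
  rw [volume_eq_lintegral_slices hv (hB.measurableSet_image_flatten hv hη hE hEB),
    ← lintegral_const_mul' _ _ ENNReal.ofReal_ne_top]
  refine lintegral_mono fun t => ?_
  simp only [image_flatten_inter hv]
  have h := euclideanHausdorffMeasure_image_le 2 (f := id) (g := fun s => flatten v (s, t))
    (K := ⟨(1 - η)⁻¹, by positivity⟩) (E := {s | (s, t) ∈ E}) (fun s hs s' hs' => by
      rw [dist_eq_norm, dist_eq_norm, id, id]
      have h1 := hB.le_norm hv (z := (s, t)) (z' := (s', t)) (hEB hs).1 (hEB hs').1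
      change _ ≤ (1 - η)⁻¹ * _
      rw [inv_mul_eq_div, le_div_iff₀ hη']
      linarith)
  rw [image_id] at h
  convert h using 2
  rw [ENNReal.ofReal_pow (by positivity), ENNReal.ofReal]
  congr 2
  exact Real.toNNReal_of_nonneg _

/-- The area of `B` is the measure of `B × [0, 1]`, which is controlled by the volume of its
flattening, a bounded set. -/
theorem IsNearlyFlat.measure_lt_top {v : E3} (hv : ‖v‖ = 1) {η : ℝ} (hη : η < 1)
    {B : Set E3} (hB : IsNearlyFlat v η B) (hBm : MeasurableSet B) (hBb : Bornology.IsBounded B) :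
    (μHE[2] : Measure E3) B < ∞ := by
  have h := hB.lintegral_le_volume_image_flatten hv hη (E := B ×ˢ Icc (0 : ℝ) 1)
    (hBm.prod measurableSet_Icc) (prod_mono_right (subset_univ _))
  have h1 : (μHE[2] : Measure E3) B ≤
      ∫⁻ t : ℝ, (μHE[2] : Measure E3) {s | (s, t) ∈ B ×ˢ Icc (0 : ℝ) 1} := by
    calc (μHE[2] : Measure E3) B = ∫⁻ t in Icc (0 : ℝ) 1, (μHE[2] : Measure E3) B := by simp
      _ ≤ ∫⁻ t in Icc (0 : ℝ) 1, (μHE[2] : Measure E3) {s | (s, t) ∈ B ×ˢ Icc (0 : ℝ) 1} := by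
          refine setLIntegral_mono' measurableSet_Icc fun t ht => ?_
          exact measure_mono fun s hs => ⟨hs, ht⟩
      _ ≤ _ := setLIntegral_le_lintegral _ _
  refine (h1.trans h).trans_lt (ENNReal.mul_lt_top ENNReal.ofReal_lt_top ?_)
  have hcpt : IsCompact (flatten v '' (closure B ×ˢ Icc (0 : ℝ) 1)) :=
    ((Metric.isCompact_of_isClosed_isBounded isClosed_closure hBb.closure).prod
      isCompact_Icc).image (continuous_flatten v)
  exact (measure_mono (image_mono (prod_mono_left subset_closure))).trans_lt hcpt.measure_lt_top

/-- The normal coordinate map of a surface with unit normal `n`. -/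
def normalMap (n : E3 → E3) (z : E3 × ℝ) : E3 := z.1 + z.2 • n z.1

/-- The increments of the two maps differ by three small terms: the component of the chord along
`v`, the deviation of `n` from `v` times the height difference, and the variation of `n` times one
height. The factors `2` come from bounding the chord by twice the flattened increment, as `η ≤ 1 /
2`. -/
theorem IsNearlyFlat.norm_normalMap_sub_flatten_le {n : E3 → E3} {v : E3} (hv : ‖v‖ = 1)
    {η L T : ℝ} (hη : 0 ≤ η) (hη' : η ≤ 1 / 2) (hL : 0 ≤ L) (hT : 0 ≤ T) {B : Set E3}
    (hB : IsNearlyFlat v η B) (hn : ∀ s ∈ B, ‖n s - v‖ ≤ η)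
    (hlip : ∀ s ∈ B, ∀ s' ∈ B, ‖n s - n s'‖ ≤ L * ‖s - s'‖)
    {z z' : E3 × ℝ} (hz : z.1 ∈ B) (hz' : z'.1 ∈ B) (ht' : |z'.2| ≤ T) :
    ‖(normalMap n z - normalMap n z') - (flatten v z - flatten v z')‖ ≤
      (3 * η + 2 * T * L) * ‖flatten v z - flatten v z'‖ := by
  set a := z.1 - z'.1 with ha
  set X := ‖flatten v z - flatten v z'‖ with hX
  have h1 : (normalMap n z - normalMap n z') - (flatten v z - flatten v z') =
      (inner ℝ v a : ℝ) • v + (z.2 - z'.2) • (n z.1 - v) + z'.2 • (n z.1 - n z'.1) := by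
    simp only [normalMap, flatten, ha, inner_sub_right, sub_smul, smul_sub]
    abel
  have h2 : ‖a‖ ≤ 2 * X := by
    have := hB.le_norm hv hz hz'
    nlinarith [norm_nonneg a]
  have h3 : |z.2 - z'.2| ≤ X := abs_snd_sub_le_norm_flatten hv z z'
  have hX0 : 0 ≤ X := norm_nonneg _
  rw [h1]
  calc _ ≤ ‖(inner ℝ v a : ℝ) • v‖ + ‖(z.2 - z'.2) • (n z.1 - v)‖ + ‖z'.2 • (n z.1 - n z'.1)‖ :=
        norm_add₃_le
    _ ≤ η * ‖a‖ + X * η + T * (L * ‖a‖) := by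
        simp only [norm_smul, hv, mul_one, Real.norm_eq_abs]
        gcongr
        · exact hB _ hz _ hz'
        · exact hn _ hz
        · exact hlip _ hz _ hz'
    _ ≤ η * (2 * X) + X * η + T * (L * (2 * X)) := by gcongr
    _ = _ := by ring

namespace HasLipschitzNormal

variable {Ω : Set E3} {n : E3 → E3} {L : ℝ}

theorem isCompact_frontier (h : HasLipschitzNormal Ω n L) : IsCompact (frontier Ω) :=
  Metric.isCompact_of_isClosed_isBounded isClosed_frontier
    (h.bounded.closure.subset frontier_subset_closure)

theorem frontier_nonempty (h : HasLipschitzNormal Ω n L) : (frontier Ω).Nonempty := by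
  obtain ⟨x, hx⟩ := h.nonempty
  obtain ⟨s, hs, -⟩ := h.interior x hx
  exact ⟨s, hs⟩

theorem disjoint_frontier (h : HasLipschitzNormal Ω n L) : Disjoint Ω (frontier Ω) := by
  rw [IsOpen.frontier_eq h.isOpen]; exact disjoint_sdiff_right

theorem measurable_normalMap (h : HasLipschitzNormal Ω n L) : Measurable (normalMap n) :=
  measurable_fst.add (measurable_snd.smul (h.measurable.comp measurable_fst))

/-- The chord leaves the tangent plane at its endpoint `s'` by at most `L ‖s - s'‖² ≤ 2 L δ ‖s -
s'‖`, and the normal turns by at most `L δ` between `s'` and the centre; together this is `3 L δ`.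
-/
theorem nearlyFlat_ball (h : HasLipschitzNormal Ω n L) {η δ : ℝ} (hδ : 3 * (L * δ) ≤ η)
    {s₀ : E3} (hs₀ : s₀ ∈ frontier Ω) :
    IsNearlyFlat (n s₀) η (frontier Ω ∩ Metric.ball s₀ δ) ∧
      ∀ s ∈ frontier Ω ∩ Metric.ball s₀ δ, ‖n s - n s₀‖ ≤ η := by
  have h1 : ∀ s ∈ frontier Ω ∩ Metric.ball s₀ δ, ‖n s - n s₀‖ ≤ L * δ := by
    intro s hs
    refine (h.lipschitz s hs.1 s₀ hs₀).trans ?_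
    have := hs.2
    rw [Metric.mem_ball, dist_eq_norm] at this
    have := h.pos
    gcongr
  refine ⟨fun s hs s' hs' => ?_, fun s hs => ?_⟩
  · have h2 : inner ℝ (n s₀) (s - s') = inner ℝ (n s') (s - s') - inner ℝ (n s' - n s₀) (s - s') := by
      rw [inner_sub_left]; ring
    have h3 := h.abs_inner_le s' hs'.1 s hs.1
    have h4 : ‖s - s'‖ ≤ 2 * δ := by
      rw [← dist_eq_norm]
      linarith [dist_triangle_right s s' s₀, Metric.mem_ball.1 hs.2, Metric.mem_ball.1 hs'.2]
    have h5 : |inner ℝ (n s' - n s₀) (s - s')| ≤ L * δ * ‖s - s'‖ :=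
      (abs_real_inner_le_norm _ _).trans (by gcongr; exact h1 s' hs')
    rw [h2]
    have hL := h.pos
    calc _ ≤ |inner ℝ (n s') (s - s')| + |inner ℝ (n s' - n s₀) (s - s')| := abs_sub _ _
      _ ≤ L * ‖s - s'‖ ^ 2 + L * δ * ‖s - s'‖ := add_le_add h3 h5
      _ = (L * ‖s - s'‖ + L * δ) * ‖s - s'‖ := by ring
      _ ≤ η * ‖s - s'‖ := by
        gcongr
        nlinarith
  · have := h1 s hs
    have : 0 ≤ L * δ := (norm_nonneg _).trans this
    linarith

theorem isFiniteMeasure (h : HasLipschitzNormal Ω n L) : IsFiniteMeasure (surfaceMeasure Ω) := by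
  have hL := h.pos
  refine ⟨?_⟩
  rw [surfaceMeasure, Measure.restrict_apply_univ]
  refine h.isCompact_frontier.measure_lt_top_of_nhdsWithin fun s hs => ?_
  have h1 := h.nearlyFlat_ball (η := 1 / 2) (δ := 1 / (6 * L)) (by field_simp; norm_num) hs
  exact ⟨frontier Ω ∩ Metric.ball s (1 / (6 * L)),
    inter_mem_nhdsWithin _ (Metric.ball_mem_nhds _ (by positivity)),
    h1.1.measure_lt_top (h.norm_eq_one s hs) (by norm_num)
      (isClosed_frontier.measurableSet.inter measurableSet_ball)
      (Metric.isBounded_ball.subset inter_subset_right)⟩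

/-- Small balls about a dense sequence of boundary points, made disjoint so that measures of pieces
can be summed. -/
theorem exists_nearlyFlat_partition (h : HasLipschitzNormal Ω n L) {η : ℝ} (hη : 0 < η) :
    ∃ (B : ℕ → Set E3) (v : ℕ → E3), (∀ i, MeasurableSet (B i)) ∧ Pairwise (Disjoint on B) ∧
      (⋃ i, B i) = frontier Ω ∧ (∀ i, ‖v i‖ = 1) ∧ (∀ i, IsNearlyFlat (v i) η (B i)) ∧
      ∀ i, ∀ s ∈ B i, ‖n s - v i‖ ≤ η := by
  have hL := h.pos
  have : Nonempty (frontier Ω) := h.frontier_nonempty.to_subtype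
  set p : ℕ → frontier Ω := TopologicalSpace.denseSeq (frontier Ω) with hp
  set δ := η / (3 * L) with hδ
  have hδ0 : 0 < δ := by positivity
  have hδη : 3 * (L * δ) ≤ η := by rw [hδ]; apply le_of_eq; field_simp
  set A : ℕ → Set E3 := fun i => frontier Ω ∩ Metric.ball (p i : E3) δ with hA
  have hflat := fun i => h.nearlyFlat_ball hδη (p i).2
  have hsub : ∀ i, disjointed A i ⊆ A i := fun i => disjointed_subset A i
  refine ⟨disjointed A, fun i => n (p i), fun i => ?_, disjoint_disjointed A, ?_,
    fun i => h.norm_eq_one _ (p i).2, fun i => ?_, fun i s hs => (hflat i).2 s (hsub i hs)⟩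
  · exact MeasurableSet.disjointed
      (fun i => isClosed_frontier.measurableSet.inter measurableSet_ball) i
  · rw [iUnion_disjointed]
    refine subset_antisymm (iUnion_subset fun i => inter_subset_left) fun s hs => ?_
    obtain ⟨i, hi⟩ := (TopologicalSpace.denseRange_denseSeq (frontier Ω)).exists_dist_lt
      (⟨s, hs⟩ : frontier Ω) hδ0
    exact mem_iUnion.2 ⟨i, hs, hi⟩
  · exact fun s hs s' hs' => (hflat i).1 s (hsub i hs) s' (hsub i hs')

theorem prod_apply_eq_lintegral (h : HasLipschitzNormal Ω n L) {E : Set (E3 × ℝ)}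
    (hE : MeasurableSet E) (hEΩ : E ⊆ frontier Ω ×ˢ univ) :
    ((surfaceMeasure Ω).prod volume) E = ∫⁻ t : ℝ, (μHE[2] : Measure E3) {s | (s, t) ∈ E} := by
  have := h.isFiniteMeasure
  rw [Measure.prod_apply_symm hE]
  refine lintegral_congr fun t => ?_
  rw [surfaceMeasure, Measure.restrict_eq_self]
  · rfl
  · exact fun s hs => (hEΩ hs).1

/-- Upper half of an area formula: on each flat piece the normal map is `1 + δ` Lipschitz with
respect to flattening, which does not increase the product measure. Overlaps of images do no harm in
this direction. -/
theorem volume_image_normalMap_le (h : HasLipschitzNormal Ω n L) {η T : ℝ} (hη : 0 < η)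
    (hη' : η ≤ 1 / 2) (hT : 0 ≤ T) {E : Set (E3 × ℝ)} (hE : MeasurableSet E)
    (hEΩ : E ⊆ frontier Ω ×ˢ Icc (-T) T) :
    volume (normalMap n '' E) ≤ ENNReal.ofReal ((1 + (3 * η + 2 * T * L)) ^ 3) *
      ((surfaceMeasure Ω).prod volume) E := by
  obtain ⟨B, v, hBm, hBd, hBU, hv, hflat, hn⟩ := h.exists_nearlyFlat_partition hη
  have hL := h.pos
  set δ := 3 * η + 2 * T * L with hδ
  have hδ0 : 0 ≤ δ := by positivity
  have hEU : E = ⋃ i, E ∩ (B i ×ˢ univ) := by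
    rw [← inter_iUnion, ← iUnion_prod_const, hBU, eq_comm, inter_eq_left]
    exact hEΩ.trans (prod_mono_right (subset_univ _))
  have hBΩ : ∀ i, B i ⊆ frontier Ω := fun i => hBU ▸ subset_iUnion B i
  have hm : ∀ i, MeasurableSet (E ∩ (B i ×ˢ univ)) := fun i =>
    hE.inter ((hBm i).prod MeasurableSet.univ)
  have hd : Pairwise (Disjoint on fun i => E ∩ (B i ×ˢ (univ : Set ℝ))) := fun i j hij => by
    refine Disjoint.mono inter_subset_right inter_subset_right ?_
    exact disjoint_left.2 fun z hz hz' => (disjoint_left.1 (hBd hij)) hz.1 hz'.1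
  have hpiece : ∀ i, volume (normalMap n '' (E ∩ (B i ×ˢ univ))) ≤
      ENNReal.ofReal ((1 + δ) ^ 3) * ((surfaceMeasure Ω).prod volume) (E ∩ (B i ×ˢ univ)) := by
    intro i
    have h1 := volume_image_le_of_dist_le (f := normalMap n) (g := flatten (v i))
      (E := E ∩ (B i ×ˢ univ)) (K := ⟨1 + δ, by positivity⟩) (fun z hz z' hz' => by
        have h2 := (hflat i).norm_normalMap_sub_flatten_le (hv i) hη.le hη' hL.le hT (hn i)
          (fun s hs s' hs' => h.lipschitz s (hBΩ i hs) s' (hBΩ i hs')) hz.2.1 hz'.2.1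
          (abs_le.2 (hEΩ hz'.1).2)
        rw [dist_eq_norm, dist_eq_norm]
        have h3 := norm_le_norm_add_norm_sub' (normalMap n z - normalMap n z')
          (flatten (v i) z - flatten (v i) z')
        change _ ≤ (1 + δ) * _
        rw [add_mul, one_mul]
        exact h3.trans (add_le_add le_rfl h2))
    have h4 := (hflat i).volume_image_flatten_le (hv i) (by linarith) (hm i) inter_subset_right
    rw [← h.prod_apply_eq_lintegral (hm i) (inter_subset_left.trans
      (hEΩ.trans (prod_mono_right (subset_univ _))))] at h4
    refine h1.trans ?_
    rw [ENNReal.ofReal_pow (by positivity)]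
    gcongr
    rw [ENNReal.ofReal]
    exact le_of_eq (congrArg _ (Real.toNNReal_of_nonneg _).symm)
  conv_lhs => rw [hEU, image_iUnion]
  conv_rhs => rw [hEU, measure_iUnion hd hm, ← ENNReal.tsum_mul_left]
  exact (measure_iUnion_le _).trans (ENNReal.tsum_le_tsum hpiece)

/-- Lower half: the roles of the two maps are exchanged. Injectivity is essential here, as the
volumes of the images of the pieces have to add up exactly. -/
theorem prod_le_volume_image_normalMap (h : HasLipschitzNormal Ω n L) {η T : ℝ} (hη : 0 < η)
    (hη' : η ≤ 1 / 2) (hT : 0 ≤ T) (hδ1 : 3 * η + 2 * T * L < 1) {E : Set (E3 × ℝ)}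
    (hE : MeasurableSet E) (hEΩ : E ⊆ frontier Ω ×ˢ Icc (-T) T) (hinj : InjOn (normalMap n) E) :
    ((surfaceMeasure Ω).prod volume) E ≤ ENNReal.ofReal ((1 - η)⁻¹ ^ 2 *
      (1 - (3 * η + 2 * T * L))⁻¹ ^ 3) * volume (normalMap n '' E) := by
  obtain ⟨B, v, hBm, hBd, hBU, hv, hflat, hn⟩ := h.exists_nearlyFlat_partition hη
  have hL := h.pos
  set δ := 3 * η + 2 * T * L with hδ
  have hδ0 : 0 ≤ δ := by positivity
  have hδ2 : 0 < 1 - δ := by linarith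
  have hEU : E = ⋃ i, E ∩ (B i ×ˢ univ) := by
    rw [← inter_iUnion, ← iUnion_prod_const, hBU, eq_comm, inter_eq_left]
    exact hEΩ.trans (prod_mono_right (subset_univ _))
  have hBΩ : ∀ i, B i ⊆ frontier Ω := fun i => hBU ▸ subset_iUnion B i
  have hm : ∀ i, MeasurableSet (E ∩ (B i ×ˢ univ)) := fun i =>
    hE.inter ((hBm i).prod MeasurableSet.univ)
  have hd : Pairwise (Disjoint on fun i => E ∩ (B i ×ˢ (univ : Set ℝ))) := fun i j hij => by
    refine Disjoint.mono inter_subset_right inter_subset_right ?_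
    exact disjoint_left.2 fun z hz hz' => (disjoint_left.1 (hBd hij)) hz.1 hz'.1
  have hpiece : ∀ i, ((surfaceMeasure Ω).prod volume) (E ∩ (B i ×ˢ univ)) ≤
      ENNReal.ofReal ((1 - η)⁻¹ ^ 2 * (1 - δ)⁻¹ ^ 3) *
        volume (normalMap n '' (E ∩ (B i ×ˢ univ))) := by
    intro i
    have h1 := volume_image_le_of_dist_le (f := flatten (v i)) (g := normalMap n)
      (E := E ∩ (B i ×ˢ univ)) (K := ⟨(1 - δ)⁻¹, by positivity⟩) (fun z hz z' hz' => by
        have h2 := (hflat i).norm_normalMap_sub_flatten_le (hv i) hη.le hη' hL.le hT (hn i)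
          (fun s hs s' hs' => h.lipschitz s (hBΩ i hs) s' (hBΩ i hs')) hz.2.1 hz'.2.1
          (abs_le.2 (hEΩ hz'.1).2)
        rw [dist_eq_norm, dist_eq_norm]
        have h3 := norm_le_norm_add_norm_sub (normalMap n z - normalMap n z')
          (flatten (v i) z - flatten (v i) z')
        change _ ≤ (1 - δ)⁻¹ * _
        rw [inv_mul_eq_div, le_div_iff₀ hδ2]
        linarith)
    have h4 := (hflat i).lintegral_le_volume_image_flatten (hv i) (by linarith) (hm i)
      inter_subset_right
    rw [← h.prod_apply_eq_lintegral (hm i) (inter_subset_left.trans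
      (hEΩ.trans (prod_mono_right (subset_univ _))))] at h4
    refine h4.trans ?_
    rw [ENNReal.ofReal_mul (by positivity), mul_assoc]
    gcongr
    refine h1.trans ?_
    rw [ENNReal.ofReal_pow (by positivity)]
    gcongr
    rw [ENNReal.ofReal]
    exact le_of_eq (congrArg _ (Real.toNNReal_of_nonneg _).symm)
  conv_lhs => rw [hEU, measure_iUnion hd hm]
  conv_rhs => rw [hEU, image_iUnion]
  rw [measure_iUnion (fun i j hij => ?_) (fun i => (hm i).image_of_measurable_injOn
    h.measurable_normalMap (hinj.mono inter_subset_left)), ← ENNReal.tsum_mul_left]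
  · exact ENNReal.tsum_le_tsum hpiece
  · change Disjoint (_ '' _) (_ '' _)
    rw [disjoint_iff_inter_eq_empty, ← hinj.image_inter inter_subset_left inter_subset_left,
      disjoint_iff_inter_eq_empty.1 (hd hij), image_empty]

/-- The one-sided bound `inner_le` is an exterior ball condition with radius `1 / (2 L)`: for
smaller `t`, the open ball of radius `t` about `s + t n(s)` misses `Ω`. -/
theorem infDist_normalMap (h : HasLipschitzNormal Ω n L) {s : E3} (hs : s ∈ frontier Ω) {t : ℝ}
    (ht : 0 ≤ t) (ht' : 2 * L * t ≤ 1) : Metric.infDist (s + t • n s) Ω = t := by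
  have hns := h.norm_eq_one s hs
  apply le_antisymm
  · rw [← Metric.infDist_closure]
    refine (Metric.infDist_le_dist_of_mem (frontier_subset_closure hs)).trans ?_
    rw [dist_eq_norm, add_sub_cancel_left, norm_smul, hns, mul_one, Real.norm_eq_abs,
      abs_of_nonneg ht]
  · refine (Metric.le_infDist h.nonempty).2 fun y hy => ?_
    rw [dist_eq_norm]
    refine le_of_sq_le_sq ?_ (norm_nonneg _)
    have h1 : s + t • n s - y = t • n s - (y - s) := by abel
    rw [h1, norm_sub_sq_real, real_inner_smul_left, norm_smul, hns, mul_one, Real.norm_eq_abs, sq_abs]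
    have h2 := h.inner_le s hs y (subset_closure hy)
    have h3 : t * inner ℝ (n s) (y - s) ≤ t * (L * ‖y - s‖ ^ 2) := by gcongr
    nlinarith [sq_nonneg ‖y - s‖]

/-- The height is recovered as the distance to `Ω`. Two feet under the same point then differ by
`t'` times the difference of their normals, and `t' L ≤ 1 / 2` forces them to coincide. -/
theorem injOn_normalMap (h : HasLipschitzNormal Ω n L) {τ : ℝ} (hτ : 2 * L * τ ≤ 1) :
    InjOn (normalMap n) (frontier Ω ×ˢ Ioo 0 τ) := by
  rintro ⟨s, t⟩ ⟨hs, ht⟩ ⟨s', t'⟩ ⟨hs', ht'⟩ heq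
  have hL := h.pos
  simp only [normalMap] at heq hs ht hs' ht'
  have e1 := h.infDist_normalMap hs ht.1.le (by nlinarith [ht.2])
  have e2 := h.infDist_normalMap hs' ht'.1.le (by nlinarith [ht'.2])
  rw [heq, e2] at e1
  subst e1
  have h1 : s - s' = t' • (n s' - n s) := by
    rw [smul_sub, sub_eq_sub_iff_add_eq_add, add_comm _ s', heq]
  have h2 : ‖s - s'‖ ≤ t' * (L * ‖s - s'‖) := by
    conv_lhs => rw [h1, norm_smul, Real.norm_eq_abs, abs_of_pos ht'.1]
    rw [norm_sub_rev s s']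
    exact mul_le_mul_of_nonneg_left (h.lipschitz s' hs' s hs) ht'.1.le
  have h3 : ‖s - s'‖ = 0 := by
    refine le_antisymm ?_ (norm_nonneg _)
    have : t' * L ≤ 1 / 2 := by nlinarith [ht'.2]
    nlinarith [norm_nonneg (s - s')]
  rw [sub_eq_zero.1 (norm_eq_zero.1 h3)]

end HasLipschitzNormal

/-! ### Layers and tubes about the boundary -/

/-- The points outside `Ω` whose distance from `Ω` is positive and less than `τ`. -/
def outerLayer (Ω : Set E3) (τ : ℝ) : Set E3 := {x | 0 < Metric.infDist x Ω ∧ Metric.infDist x Ω < τ}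

/-- The points whose distance from `∂Ω` is at most `a`. -/
def boundaryTube (Ω : Set E3) (a : ℝ) : Set E3 := {x | Metric.infDist x (frontier Ω) ≤ a}

theorem measurableSet_outerLayer (Ω : Set E3) (τ : ℝ) : MeasurableSet (outerLayer Ω τ) := by
  have := (Metric.continuous_infDist_pt Ω).measurable
  exact (measurableSet_lt measurable_const this).inter (measurableSet_lt this measurable_const)

namespace HasLipschitzNormal

variable {Ω : Set E3} {n : E3 → E3} {L : ℝ}

theorem infDist_pos_iff_notMem_closure (h : HasLipschitzNormal Ω n L) {x : E3} :
    0 < Metric.infDist x Ω ↔ x ∉ closure Ω := by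
  rw [Metric.mem_closure_iff_infDist_zero h.nonempty]
  exact ⟨fun h => h.ne', fun h => lt_of_le_of_ne Metric.infDist_nonneg (Ne.symm h)⟩

theorem image_normalMap_layer (h : HasLipschitzNormal Ω n L) {τ : ℝ} (hτ : 2 * L * τ ≤ 1) :
    normalMap n '' (frontier Ω ×ˢ Ioo 0 τ) = outerLayer Ω τ := by
  have hL := h.pos
  ext x
  constructor
  · rintro ⟨⟨s, t⟩, ⟨hs, ht⟩, rfl⟩
    have e1 := h.infDist_normalMap hs ht.1.le (by nlinarith [ht.2])
    simp only [outerLayer, normalMap, mem_ofPred_eq, e1]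
    exact ht
  · rintro ⟨h1, h2⟩
    obtain ⟨s, hs, hx⟩ := h.exterior x
      (fun hx => h.infDist_pos_iff_notMem_closure.1 h1 (subset_closure hx))
    exact ⟨(s, Metric.infDist x Ω), ⟨hs, h1, h2⟩, hx.symm⟩

/-- The volume bound phrased as an inequality of measures, ready for integrating arbitrary
nonnegative functions. -/
theorem restrict_le_map_normalMap (h : HasLipschitzNormal Ω n L) {T : ℝ} (hT : 0 ≤ T) {η : ℝ}
    (hη : 0 < η) (hη' : η ≤ 1 / 2)
    {D : Set (E3 × ℝ)} (hD : MeasurableSet D) (hDΩ : D ⊆ frontier Ω ×ˢ Icc (-T) T)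
    {X : Set E3} (hX : X ⊆ normalMap n '' D) :
    volume.restrict X ≤ ENNReal.ofReal ((1 + (3 * η + 2 * T * L)) ^ 3) •
      (((surfaceMeasure Ω).prod volume).restrict D).map (normalMap n) := by
  refine Measure.le_iff.2 fun A hA => ?_
  have hm := h.measurable_normalMap hA
  rw [Measure.restrict_apply hA, Measure.smul_apply, Measure.map_apply h.measurable_normalMap hA,
    Measure.restrict_apply hm, smul_eq_mul]
  refine le_trans (measure_mono ?_)
    (h.volume_image_normalMap_le hη hη' hT (hm.inter hD) (inter_subset_right.trans hDΩ))
  rintro x ⟨hxA, hxX⟩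
  obtain ⟨z, hz, rfl⟩ := hX hxX
  exact ⟨z, ⟨hxA, hz⟩, rfl⟩

/-- The Jacobian of normal coordinates tends to one at the boundary. Flatness and thickness are
taken to be the same number `η`; as it tends to zero, the constants of both volume inequalities tend
to one. -/
theorem layer_comparison (h : HasLipschitzNormal Ω n L) {ε : ℝ} (hε : 0 < ε) :
    ∃ τ₀ > 0, 2 * L * τ₀ ≤ 1 ∧ ∀ τ ≤ τ₀,
      volume.restrict (outerLayer Ω τ) ≤ ENNReal.ofReal (1 + ε) •
        (((surfaceMeasure Ω).prod volume).restrict (frontier Ω ×ˢ Ioo 0 τ)).map (normalMap n) ∧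
      (((surfaceMeasure Ω).prod volume).restrict (frontier Ω ×ˢ Ioo 0 τ)).map (normalMap n) ≤
        ENNReal.ofReal (1 + ε) • volume.restrict (outerLayer Ω τ) := by
  have hL := h.pos
  have lim1 : Tendsto (fun η : ℝ => (1 + (3 * η + 2 * η * L)) ^ 3) (𝓝[>] 0) (𝓝 1) := by
    have : Continuous fun η : ℝ => (1 + (3 * η + 2 * η * L)) ^ 3 := by fun_prop
    simpa using (this.tendsto 0).mono_left nhdsWithin_le_nhds
  have lim2 : Tendsto (fun η : ℝ => (1 - η)⁻¹ ^ 2 * (1 - (3 * η + 2 * η * L))⁻¹ ^ 3) (𝓝[>] 0)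
      (𝓝 1) := by
    have : ContinuousAt (fun η : ℝ => (1 - η)⁻¹ ^ 2 * (1 - (3 * η + 2 * η * L))⁻¹ ^ 3) 0 := by
      apply ContinuousAt.mul <;> apply ContinuousAt.pow <;> apply ContinuousAt.inv₀ <;>
        first | fun_prop | norm_num
    simpa using this.tendsto.mono_left nhdsWithin_le_nhds
  have hsmall : ∀ᶠ η in 𝓝[>] (0 : ℝ), η < min (1 / 2) (1 / (3 + 4 * L)) :=
    nhdsWithin_le_nhds (gt_mem_nhds (by positivity))
  obtain ⟨η, hη1, hη2, hη3, hη0⟩ := ((lim1.eventually (gt_mem_nhds (by linarith : 1 < 1 + ε))).and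
    ((lim2.eventually (gt_mem_nhds (by linarith : 1 < 1 + ε))).and
      (hsmall.and self_mem_nhdsWithin))).exists
  have hη0 : 0 < η := hη0
  have hη4 : η ≤ 1 / 2 := hη3.le.trans (min_le_left _ _)
  have hη5 : η * (3 + 4 * L) < 1 := by
    rw [← lt_div_iff₀ (by positivity)]
    exact hη3.trans_le (min_le_right _ _)
  refine ⟨η, hη0, by nlinarith, fun τ hτ => ?_⟩
  have hD : MeasurableSet (frontier Ω ×ˢ Ioo 0 τ) :=
    isClosed_frontier.measurableSet.prod measurableSet_Ioo
  have hDΩ : frontier Ω ×ˢ Ioo 0 τ ⊆ frontier Ω ×ˢ Icc (-η) η :=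
    prod_mono_right fun t ht => ⟨by linarith [ht.1], by linarith [ht.2]⟩
  have hτL : 2 * L * τ ≤ 1 := by nlinarith
  have himg := h.image_normalMap_layer hτL
  constructor
  · have := h.restrict_le_map_normalMap hη0.le hη0 hη4 hD hDΩ himg.ge
    refine this.trans (Measure.le_iff.2 fun A hA => ?_)
    simp only [Measure.smul_apply, smul_eq_mul]
    gcongr
  · refine Measure.le_iff.2 fun A hA => ?_
    have hm := h.measurable_normalMap hA
    rw [Measure.smul_apply, Measure.map_apply h.measurable_normalMap hA,
      Measure.restrict_apply hm, Measure.restrict_apply hA, smul_eq_mul]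
    have h1 := h.prod_le_volume_image_normalMap hη0 hη4 hη0.le (by nlinarith) (hm.inter hD)
      (inter_subset_right.trans hDΩ) ((h.injOn_normalMap hτL).mono inter_subset_right)
    rw [image_preimage_inter, himg] at h1
    refine h1.trans ?_
    gcongr

/-- Exterior points have nonnegative height and interior points nonpositive height along the normal
at a nearest boundary point. -/
theorem boundaryTube_subset (h : HasLipschitzNormal Ω n L) (a : ℝ) :
    boundaryTube Ω a ⊆ normalMap n '' (frontier Ω ×ˢ Icc (-a) a) := by
  intro x hx
  have hx : Metric.infDist x (frontier Ω) ≤ a := hx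
  by_cases hxΩ : x ∈ Ω
  · obtain ⟨s, hs, hxs⟩ := h.interior x hxΩ
    refine ⟨(s, -Metric.infDist x Ωᶜ), ⟨hs, ?_⟩, ?_⟩
    · have h1 : Metric.infDist x Ωᶜ ≤ Metric.infDist x (frontier Ω) :=
        Metric.infDist_le_infDist_of_subset
          (fun y hy hyΩ => (disjoint_left.1 h.disjoint_frontier) hyΩ hy) h.frontier_nonempty
      have h2 : 0 ≤ Metric.infDist x Ωᶜ := Metric.infDist_nonneg
      exact ⟨by simp only; linarith, by simp only; linarith⟩
    · rw [normalMap, neg_smul, ← sub_eq_add_neg]; exact hxs.symm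
  · obtain ⟨s, hs, hxs⟩ := h.exterior x hxΩ
    refine ⟨(s, Metric.infDist x Ω), ⟨hs, ?_⟩, hxs.symm⟩
    have h1 : Metric.infDist x Ω ≤ Metric.infDist x (frontier Ω) := by
      rw [← Metric.infDist_closure]
      exact Metric.infDist_le_infDist_of_subset frontier_subset_closure h.frontier_nonempty
    have h2 : 0 ≤ Metric.infDist x Ω := Metric.infDist_nonneg
    exact ⟨by simp only; linarith, by simp only; linarith⟩

/-- The constant in the estimate of the volume of sets parametrised by normal coordinates. -/
theorem tube_comparison (h : HasLipschitzNormal Ω n L) {T : ℝ} (hT : 0 ≤ T) :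
    ∃ K : ℝ≥0, ∀ {D : Set (E3 × ℝ)}, MeasurableSet D → D ⊆ frontier Ω ×ˢ Icc (-T) T →
      ∀ {X : Set E3}, X ⊆ normalMap n '' D → volume.restrict X ≤
        (K : ℝ≥0∞) • (((surfaceMeasure Ω).prod volume).restrict D).map (normalMap n) :=
  -- Only some finite constant is wanted for a thickness of arbitrary size, so the flatness `1 / 2`
  -- will do.
  ⟨_, fun hD hDΩ _ hX => h.restrict_le_map_normalMap hT one_half_pos le_rfl hD hDΩ hX⟩

end HasLipschitzNormal

/-! ### Cells, regions and unfolding -/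

theorem volume_image_add_smul (c : E3) {l : ℝ} (hl : 0 < l) (S : Set E3) :
    volume ((fun y => c + l • y) '' S) = ENNReal.ofReal (l ^ 3) * volume S := by
  have h1 : (fun y => c + l • y) '' S = (fun y => c + y) '' ((fun y => l • y) '' S) := by
    rw [image_image]
  rw [h1, image_add_left, measure_preimage_add, image_smul, Measure.addHaar_smul]
  rw [finrank_euclideanSpace, Fintype.card_fin, abs_of_pos (by positivity)]

theorem measurableEmbedding_add_smul (c : E3) {l : ℝ} (hl : 0 < l) :
    MeasurableEmbedding (fun y : E3 => c + l • y) :=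
  ((Homeomorph.smulOfNeZero l hl.ne').trans (Homeomorph.addLeft c)).measurableEmbedding

namespace IsUnitCell

variable {e : Module.Basis (Fin 3) ℝ E3} {Q : Set E3}

theorem mem_cell_iff {l : ℝ} (hl : 0 < l) {i : Idx} {x : E3} :
    x ∈ cell e Q l i ↔ l⁻¹ • x - latticePoint e i ∈ Q := by
  constructor
  · rintro ⟨y, hy, rfl⟩
    simpa [corner, smul_smul, inv_mul_cancel₀ hl.ne'] using hy
  · intro h
    refine ⟨_, h, ?_⟩
    simp [corner, smul_sub, smul_smul, mul_inv_cancel₀ hl.ne']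

/-- The label of the unit cell that contains a point. -/
noncomputable def index (hQ : IsUnitCell e Q) (x : E3) : Idx := (hQ.tiles x).choose

theorem mem_cell_iff_index (hQ : IsUnitCell e Q) {l : ℝ} (hl : 0 < l) {i : Idx} {x : E3} :
    x ∈ cell e Q l i ↔ hQ.index (l⁻¹ • x) = i := by
  rw [mem_cell_iff hl]
  have h := (hQ.tiles (l⁻¹ • x)).choose_spec
  exact ⟨fun hi => (h.2 i hi).symm, fun hi => hi ▸ h.1⟩

theorem mem_cell_index (hQ : IsUnitCell e Q) {l : ℝ} (hl : 0 < l) (x : E3) :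
    x ∈ cell e Q l (hQ.index (l⁻¹ • x)) := (hQ.mem_cell_iff_index hl).2 rfl

theorem measurableSet_cell (hQ : IsUnitCell e Q) {l : ℝ} (hl : 0 < l) (i : Idx) :
    MeasurableSet (cell e Q l i) :=
  (measurableEmbedding_add_smul _ hl).measurableSet_image.2 hQ.measurable

theorem pairwise_disjoint_cell (hQ : IsUnitCell e Q) {l : ℝ} (hl : 0 < l) :
    Pairwise (Disjoint on cell e Q l) := fun i j hij =>
  disjoint_left.2 fun x hi hj => hij (by
    rw [hQ.mem_cell_iff_index hl] at hi hj; rw [← hi, hj])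

theorem iUnion_cell (hQ : IsUnitCell e Q) {l : ℝ} (hl : 0 < l) : ⋃ i, cell e Q l i = univ :=
  eq_univ_of_forall fun x => mem_iUnion.2 ⟨_, hQ.mem_cell_index hl x⟩

theorem volume_cell {l : ℝ} (hl : 0 < l) (i : Idx) :
    volume (cell e Q l i) = ENNReal.ofReal (l ^ 3) * volume Q := volume_image_add_smul _ hl Q

theorem volume_ne_top (hQ : IsUnitCell e Q) : volume Q ≠ ∞ := hQ.bounded.measure_lt_top.ne

/-- Countably many null cells could not cover space. -/
theorem volume_ne_zero (hQ : IsUnitCell e Q) : volume Q ≠ 0 := by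
  intro h0
  have h1 : volume (⋃ i, cell e Q 1 i) = 0 :=
    measure_iUnion_null fun i => by rw [volume_cell one_pos, h0, mul_zero]
  rw [hQ.iUnion_cell one_pos] at h1
  exact (NeZero.ne (volume : Measure E3)) (Measure.measure_univ_eq_zero.1 h1)

theorem volume_cell_ne_zero (hQ : IsUnitCell e Q) {l : ℝ} (hl : 0 < l) (i : Idx) :
    volume (cell e Q l i) ≠ 0 := by
  rw [volume_cell hl]
  exact mul_ne_zero (by simpa using (by positivity : 0 < l ^ 3)) hQ.volume_ne_zero

theorem volume_cell_ne_top (hQ : IsUnitCell e Q) {l : ℝ} (hl : 0 < l) (i : Idx) :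
    volume (cell e Q l i) ≠ ∞ := by
  rw [volume_cell hl]
  exact ENNReal.mul_ne_top ENNReal.ofReal_ne_top hQ.volume_ne_top

theorem exists_norm_le (hQ : IsUnitCell e Q) : ∃ D > 0, ∀ y ∈ Q, ‖y‖ ≤ D := by
  obtain ⟨D, hD⟩ := hQ.bounded.exists_norm_le
  exact ⟨max D 1, by positivity, fun y hy => (hD y hy).trans (le_max_left _ _)⟩

theorem norm_sub_corner_le {D : ℝ} (hD : ∀ y ∈ Q, ‖y‖ ≤ D) {l : ℝ} (hl : 0 < l) {i : Idx}
    {x : E3} (hx : x ∈ cell e Q l i) : ‖x - corner e l i‖ ≤ D * l := by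
  obtain ⟨y, hy, rfl⟩ := hx
  rw [add_sub_cancel_left, norm_smul, Real.norm_eq_abs, abs_of_pos hl, mul_comm]
  gcongr
  exact hD y hy

theorem dist_le_of_mem_cell {D : ℝ} (hD : ∀ y ∈ Q, ‖y‖ ≤ D) {l : ℝ} (hl : 0 < l) {i : Idx}
    {x x' : E3} (hx : x ∈ cell e Q l i) (hx' : x' ∈ cell e Q l i) : dist x x' ≤ 2 * D * l := by
  have h1 := norm_sub_corner_le hD hl hx
  have h2 := norm_sub_corner_le hD hl hx'
  rw [← dist_eq_norm] at h1 h2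
  linarith [dist_triangle_right x x' (corner e l i)]

/-- The cells in question are disjoint, have equal positive volume and lie in one ball. -/
theorem finite_setOf_cell_inter_nonempty (hQ : IsUnitCell e Q) {l : ℝ} (hl : 0 < l) {X : Set E3}
    (hX : Bornology.IsBounded X) : {i | (cell e Q l i ∩ X).Nonempty}.Finite := by
  obtain ⟨D, hD0, hD⟩ := hQ.exists_norm_le
  obtain ⟨R, hR⟩ := hX.exists_norm_le
  set Y := Metric.closedBall (0 : E3) (R + 2 * D * l)
  have hfin := Measure.finite_const_le_meas_of_disjoint_iUnion (volume.restrict Y)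
    (ε := ENNReal.ofReal (l ^ 3) * volume Q)
    (pos_iff_ne_zero.2 (by rw [← volume_cell (e := e) hl 0]; exact hQ.volume_cell_ne_zero hl 0))
    (hQ.measurableSet_cell hl) (hQ.pairwise_disjoint_cell hl)
    (measure_lt_top_of_subset (subset_univ _) (by
      rw [Measure.restrict_apply_univ]; exact measure_closedBall_lt_top.ne)).ne
  refine hfin.subset fun i ⟨x, hx, hxX⟩ => ?_
  have hsub : cell e Q l i ⊆ Y := fun x' hx' => by
    rw [mem_closedBall_zero_iff]
    have := dist_le_of_mem_cell hD hl hx hx'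
    rw [dist_eq_norm] at this
    linarith [norm_le_norm_add_norm_sub x x', hR x hxX]
  change _ ≤ volume.restrict Y (cell e Q l i)
  rw [Measure.restrict_eq_self _ hsub, volume_cell hl]

theorem map_restrict_eq_smul_restrict_cell {l : ℝ} (hl : 0 < l) (i : Idx) :
    (volume.restrict Q).map (fun y => corner e l i + l • y) =
      ENNReal.ofReal ((l ^ 3)⁻¹) • volume.restrict (cell e Q l i) := by
  have hemb := measurableEmbedding_add_smul (corner e l i) hl
  ext A hA
  rw [Measure.map_apply hemb.measurable hA, Measure.smul_apply, Measure.restrict_apply hA,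
    Measure.restrict_apply (hemb.measurable hA), smul_eq_mul]
  have h1 : A ∩ cell e Q l i = (fun y => corner e l i + l • y) ''
      ((fun y => corner e l i + l • y) ⁻¹' A ∩ Q) := by rw [image_preimage_inter]; rfl
  rw [h1, volume_image_add_smul _ hl, ← mul_assoc, ← ENNReal.ofReal_mul (by positivity),
    inv_mul_cancel₀ (by positivity), ENNReal.ofReal_one, one_mul]

theorem setLIntegral_cell {l : ℝ} (hl : 0 < l) (i : Idx) (f : E3 → ℝ≥0∞) :
    ∫⁻ x in cell e Q l i, f x = ENNReal.ofReal (l ^ 3) * ∫⁻ y in Q, f (corner e l i + l • y) := by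
  rw [← (measurableEmbedding_add_smul (corner e l i) hl).lintegral_map,
    map_restrict_eq_smul_restrict_cell hl, lintegral_smul_measure, smul_eq_mul, ← mul_assoc,
    ← ENNReal.ofReal_mul (by positivity), mul_inv_cancel₀ (by positivity), ENNReal.ofReal_one,
    one_mul]

theorem setIntegral_cell {F : Type*} [NormedAddCommGroup F] [NormedSpace ℝ F]
    {l : ℝ} (hl : 0 < l) (i : Idx) (f : E3 → F) :
    ∫ x in cell e Q l i, f x = l ^ 3 • ∫ y in Q, f (corner e l i + l • y) := by
  rw [← (measurableEmbedding_add_smul (corner e l i) hl).integral_map,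
    map_restrict_eq_smul_restrict_cell hl, integral_smul_measure,
    ENNReal.toReal_ofReal (by positivity), smul_smul, mul_inv_cancel₀ (by positivity), one_smul]

theorem setAverage_cell (hQ : IsUnitCell e Q) {F : Type*} [NormedAddCommGroup F] [NormedSpace ℝ F]
    {l : ℝ} (hl : 0 < l) (i : Idx) (f : E3 → F) :
    ⨍ x in cell e Q l i, f x = ⨍ y in Q, f (corner e l i + l • y) := by
  have hv : volume.real Q ≠ 0 :=
    ENNReal.toReal_ne_zero.2 ⟨hQ.volume_ne_zero, hQ.volume_ne_top⟩
  rw [setAverage_eq, setAverage_eq, setIntegral_cell hl, smul_smul]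
  congr 1
  rw [measureReal_def, volume_cell hl, ENNReal.toReal_mul, ENNReal.toReal_ofReal (by positivity),
    ← measureReal_def]
  field_simp

theorem measurableSet_region (hQ : IsUnitCell e Q) {l : ℝ} (hl : 0 < l) (A : Set Idx) :
    MeasurableSet (region e Q l A) :=
  MeasurableSet.biUnion (to_countable A) fun i _ => hQ.measurableSet_cell hl i

theorem mem_region_iff (hQ : IsUnitCell e Q) {l : ℝ} (hl : 0 < l) {A : Set Idx} {x : E3} :
    x ∈ region e Q l A ↔ hQ.index (l⁻¹ • x) ∈ A := by
  simp only [region, mem_iUnion, exists_prop, hQ.mem_cell_iff_index hl, exists_eq_right']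

theorem volume_region (hQ : IsUnitCell e Q) {l : ℝ} (hl : 0 < l) (A : Set Idx) :
    volume (region e Q l A) = ∑' i : A, volume (cell e Q l i) :=
  measure_biUnion (to_countable A) ((hQ.pairwise_disjoint_cell hl).set_pairwise A)
    fun i _ => hQ.measurableSet_cell hl i

theorem setLIntegral_region (hQ : IsUnitCell e Q) {l : ℝ} (hl : 0 < l) (A : Set Idx)
    (f : E3 → ℝ≥0∞) :
    ∫⁻ x in region e Q l A, f x = ∑' i : A, ∫⁻ x in cell e Q l i, f x :=
  lintegral_biUnion (to_countable A) (fun i _ => hQ.measurableSet_cell hl i)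
    ((hQ.pairwise_disjoint_cell hl).set_pairwise A) f

theorem measurable_index (hQ : IsUnitCell e Q) : Measurable hQ.index := by
  refine measurable_to_countable' fun i => ?_
  have : hQ.index ⁻¹' {i} = cell e Q 1 i := by
    ext x
    rw [hQ.mem_cell_iff_index one_pos, inv_one, one_smul]; rfl
  rw [this]
  exact hQ.measurableSet_cell one_pos i

/-- The point with periodic coordinate `y` in the cell that contains `x`. -/
noncomputable def unfold (hQ : IsUnitCell e Q) (l : ℝ) (z : E3 × E3) : E3 :=
  corner e l (hQ.index (l⁻¹ • z.1)) + l • z.2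

theorem measurable_unfold (hQ : IsUnitCell e Q) (l : ℝ) : Measurable (hQ.unfold l) := by
  have h1 : Measurable fun i : Idx => corner e l i := measurable_of_countable _
  exact (h1.comp (hQ.measurable_index.comp (measurable_fst.const_smul l⁻¹))).add
    (measurable_snd.const_smul l)

theorem unfold_mem_cell (hQ : IsUnitCell e Q) (l : ℝ) (x : E3) {y : E3} (hy : y ∈ Q) :
    hQ.unfold l (x, y) ∈ cell e Q l (hQ.index (l⁻¹ • x)) := ⟨y, hy, rfl⟩

theorem index_unfold (hQ : IsUnitCell e Q) {l : ℝ} (hl : 0 < l) (x : E3) {y : E3} (hy : y ∈ Q) :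
    hQ.index (l⁻¹ • hQ.unfold l (x, y)) = hQ.index (l⁻¹ • x) :=
  (hQ.mem_cell_iff_index hl).1 (hQ.unfold_mem_cell l x hy)

theorem dist_unfold_le (hQ : IsUnitCell e Q) {D : ℝ} (hD : ∀ y ∈ Q, ‖y‖ ≤ D) {l : ℝ} (hl : 0 < l)
    (x : E3) {y : E3} (hy : y ∈ Q) : dist (hQ.unfold l (x, y)) x ≤ 2 * D * l :=
  dist_le_of_mem_cell hD hl (hQ.unfold_mem_cell l x hy) (hQ.mem_cell_index hl x)

/-- The normalised volume on the unit cell. -/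
noncomputable def cellMeasure (Q : Set E3) : Measure E3 := (volume Q)⁻¹ • volume.restrict Q

theorem isProbabilityMeasure_cellMeasure (hQ : IsUnitCell e Q) :
    IsProbabilityMeasure (cellMeasure Q) := by
  refine ⟨?_⟩
  rw [cellMeasure, Measure.smul_apply, Measure.restrict_apply_univ, smul_eq_mul,
    ENNReal.inv_mul_cancel hQ.volume_ne_zero hQ.volume_ne_top]

theorem integral_cellMeasure {F : Type*} [NormedAddCommGroup F] [NormedSpace ℝ F] (f : E3 → F) :
    ∫ y, f y ∂(cellMeasure Q) = ⨍ y in Q, f y := by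
  rw [cellMeasure, average, Measure.restrict_apply_univ]

theorem ae_cellMeasure (hQ : IsUnitCell e Q) : ∀ᵐ y ∂(cellMeasure Q), y ∈ Q := by
  rw [cellMeasure]
  exact Measure.ae_smul_measure (ae_restrict_mem hQ.measurable) _

/-- While `x` runs through one cell, the unfolded point depends on `y` alone and is uniformly
distributed over that cell; the total mass of `x` supplies the volume of the cell. -/
theorem measurePreserving_unfold (hQ : IsUnitCell e Q) {l : ℝ} (hl : 0 < l) :
    MeasurePreserving (hQ.unfold l) ((volume : Measure E3).prod (cellMeasure Q)) volume := by
  have := hQ.isProbabilityMeasure_cellMeasure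
  refine ⟨hQ.measurable_unfold l, ?_⟩
  ext A hA
  rw [Measure.map_apply (hQ.measurable_unfold l) hA,
    Measure.prod_apply (hQ.measurable_unfold l hA)]
  have h1 : ∀ i, ∫⁻ x in cell e Q l i, cellMeasure Q (Prod.mk x ⁻¹' (hQ.unfold l ⁻¹' A)) =
      volume (A ∩ cell e Q l i) := by
    intro i
    have h2 : ∀ x ∈ cell e Q l i, cellMeasure Q (Prod.mk x ⁻¹' (hQ.unfold l ⁻¹' A)) =
        (volume Q)⁻¹ * volume ((fun y => corner e l i + l • y) ⁻¹' A ∩ Q) := by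
      intro x hx
      have h3 : Prod.mk x ⁻¹' (hQ.unfold l ⁻¹' A) = (fun y => corner e l i + l • y) ⁻¹' A := by
        ext y
        simp only [mem_preimage, unfold, (hQ.mem_cell_iff_index hl).1 hx]
      rw [h3, cellMeasure, Measure.smul_apply, Measure.restrict_apply
        ((measurableEmbedding_add_smul _ hl).measurable hA), smul_eq_mul]
    rw [setLIntegral_congr_fun (hQ.measurableSet_cell hl i) h2, setLIntegral_const,
      volume_cell hl]
    have h4 : A ∩ cell e Q l i = (fun y => corner e l i + l • y) ''
      ((fun y => corner e l i + l • y) ⁻¹' A ∩ Q) := by rw [image_preimage_inter]; rfl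
    rw [h4, volume_image_add_smul _ hl]
    calc _ = ENNReal.ofReal (l ^ 3) * volume ((fun y => corner e l i + l • y) ⁻¹' A ∩ Q) *
          ((volume Q)⁻¹ * volume Q) := by ring
      _ = _ := by rw [ENNReal.inv_mul_cancel hQ.volume_ne_zero hQ.volume_ne_top, mul_one]
  calc _ = ∫⁻ x in ⋃ i, cell e Q l i, cellMeasure Q (Prod.mk x ⁻¹' (hQ.unfold l ⁻¹' A)) := by
        rw [hQ.iUnion_cell hl, Measure.restrict_univ]
    _ = ∑' i, volume (A ∩ cell e Q l i) := by
        rw [lintegral_iUnion (hQ.measurableSet_cell hl) (hQ.pairwise_disjoint_cell hl)]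
        exact tsum_congr h1
    _ = volume A := by
        rw [← measure_iUnion (fun i j hij => ((hQ.pairwise_disjoint_cell hl hij).mono
          inter_subset_right inter_subset_right)) (fun i => hA.inter (hQ.measurableSet_cell hl i)),
          ← inter_iUnion, hQ.iUnion_cell hl, inter_univ]

end IsUnitCell

/-! ### Mean bounds for the charges -/

/-- The charges are bounded in quadratic mean and in mean on every union of cells. -/
def HasRegionBound (e : Module.Basis (Fin 3) ℝ E3) (Q : Set E3) (ρ : ℝ → E3 → ℝ) (M : ℝ≥0) : Prop :=
  ∀ l ∈ Ioc (0 : ℝ) 1, ∀ A : Set Idx,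
    ∫⁻ x in region e Q l A, ‖ρ l x‖ₑ ^ 2 ≤ M * volume (region e Q l A) ∧
    ∫⁻ x in region e Q l A, ‖ρ l x‖ₑ ≤ M * volume (region e Q l A)

/-- The bound in each cell scales like the volume of the cell, hence adds up over unions. The bound
in mean follows from `a ≤ a² + 1`, which accounts for the extra `1` in the constant. -/
theorem IsCellwiseL2Bounded.exists_hasRegionBound {e : Module.Basis (Fin 3) ℝ E3} {Q : Set E3}
    (hQ : IsUnitCell e Q) {ρ : ℝ → E3 → ℝ} (h : IsCellwiseL2Bounded e Q ρ) :
    ∃ M : ℝ≥0, HasRegionBound e Q ρ M := by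
  obtain ⟨C, hC⟩ := h
  obtain ⟨q, hq⟩ : ∃ q : ℝ≥0, (q : ℝ≥0∞) = volume Q := ⟨_, ENNReal.coe_toNNReal hQ.volume_ne_top⟩
  have hq0 : q ≠ 0 := fun h0 => hQ.volume_ne_zero (by rw [← hq, h0, ENNReal.coe_zero])
  have hcell : ∀ l ∈ Ioc (0 : ℝ) 1, ∀ i, ∫⁻ x in cell e Q l i, ‖ρ l x‖ₑ ^ 2 ≤
      (C ^ 2 / q : ℝ≥0) * volume (cell e Q l i) := by
    intro l hl i
    have h1 := hC l hl i
    have h2 : ∫⁻ y in Q, ‖ρ l (corner e l i + l • y)‖ₑ ^ 2 ≤ (C : ℝ≥0∞) ^ 2 := by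
      have h3 := eLpNorm_nnreal_pow_eq_lintegral (p := 2) (μ := volume.restrict Q)
        (f := fun y => ρ l (corner e l i + l • y)) two_ne_zero
      have h4 : ∫⁻ y in Q, ‖ρ l (corner e l i + l • y)‖ₑ ^ 2 =
          eLpNorm (fun y => ρ l (corner e l i + l • y)) 2 (volume.restrict Q) ^ 2 := by
        simpa using h3.symm
      rw [h4]
      gcongr
    rw [IsUnitCell.setLIntegral_cell hl.1, IsUnitCell.volume_cell hl.1, ENNReal.coe_div hq0, hq,
      ENNReal.coe_pow]
    calc _ ≤ ENNReal.ofReal (l ^ 3) * (C : ℝ≥0∞) ^ 2 := by gcongr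
      _ = (C : ℝ≥0∞) ^ 2 * ENNReal.ofReal (l ^ 3) * ((volume Q)⁻¹ * volume Q) := by
        rw [ENNReal.inv_mul_cancel hQ.volume_ne_zero hQ.volume_ne_top, mul_one, mul_comm]
      _ = _ := by rw [div_eq_mul_inv]; ring
  have hreg : ∀ l ∈ Ioc (0 : ℝ) 1, ∀ A : Set Idx, ∫⁻ x in region e Q l A, ‖ρ l x‖ₑ ^ 2 ≤
      (C ^ 2 / q : ℝ≥0) * volume (region e Q l A) := by
    intro l hl A
    rw [hQ.setLIntegral_region hl.1, hQ.volume_region hl.1, ← ENNReal.tsum_mul_left]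
    exact ENNReal.tsum_le_tsum fun i => hcell l hl i
  refine ⟨C ^ 2 / q + 1, fun l hl A => ⟨?_, ?_⟩⟩
  · refine (hreg l hl A).trans ?_
    gcongr
    exact le_self_add
  · have h1 : ∀ a : ℝ≥0∞, a ≤ a ^ 2 + 1 := by
      intro a
      rcases le_total a 1 with ha | ha
      · exact ha.trans le_add_self
      · exact (le_self_pow₀ ha two_ne_zero).trans le_self_add
    calc _ ≤ ∫⁻ x in region e Q l A, (‖ρ l x‖ₑ ^ 2 + 1) := lintegral_mono fun x => h1 _
      _ = (∫⁻ x in region e Q l A, ‖ρ l x‖ₑ ^ 2) + volume (region e Q l A) := by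
        rw [lintegral_add_right _ measurable_const, setLIntegral_one]
      _ ≤ _ := by
        rw [ENNReal.coe_add, ENNReal.coe_one, add_mul, one_mul]
        gcongr
        exact hreg l hl A

/-! ### Translations and weak gradients -/

/-- Translations act continuously on `L²`. Applied to the electric field, this is the source of the
small factor in the bulk error. -/
theorem exists_forall_eLpNorm_translate_sub_le {F : Type*} [NormedAddCommGroup F]
    {G : E3 → F} (hG : MemLp G 2 volume) {ε : ℝ≥0∞} (hε : ε ≠ 0) :
    ∃ δ > (0 : ℝ), ∀ v : E3, ‖v‖ < δ → eLpNorm (fun x => G (x + v) - G x) 2 volume ≤ ε := by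
  have : Fact ((1 : ℝ≥0∞) ≤ 2) := ⟨by norm_num⟩
  let g : E3 → C(E3, E3) := fun v => ⟨fun x => x + v, by fun_prop⟩
  have hg : Continuous g := ContinuousMap.continuous_of_continuous_uncurry _ (by
    change Continuous fun p : E3 × E3 => p.2 + p.1
    fun_prop)
  have hmp : ∀ v, MeasurePreserving (g v) (volume : Measure E3) volume := fun v =>
    measurePreserving_add_right volume v
  have hcont : Continuous fun v => Lp.compMeasurePreserving (g v) (hmp v) (hG.toLp G) :=
    continuous_const.compMeasurePreservingLp hg hmp (by norm_num)
  have h0 : Lp.compMeasurePreserving (g 0) (hmp 0) (hG.toLp G) = hG.toLp G := by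
    rw [Lp.toLp_compMeasurePreserving]
    congr 1
    ext x; simp [g]
  have hev := hcont.tendsto 0
  rw [h0, EMetric.tendsto_nhds] at hev
  have h1 := hev ε (pos_iff_ne_zero.2 hε)
  obtain ⟨δ, hδ, h2⟩ := Metric.eventually_nhds_iff.1 h1
  refine ⟨δ, hδ, fun v hv => ?_⟩
  have h3 := h2 (y := v) (by simpa using hv)
  rw [Lp.toLp_compMeasurePreserving, Lp.edist_toLp_toLp] at h3
  exact h3.le

theorem lintegral_mul_le_eLpNorm {α : Type*} [MeasurableSpace α] (μ : Measure α) {f g : α → ℝ≥0∞}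
    (hf : AEMeasurable f μ) (hg : AEMeasurable g μ) :
    ∫⁻ x, f x * g x ∂μ ≤ (∫⁻ x, f x ^ 2 ∂μ) ^ (1 / 2 : ℝ) * (∫⁻ x, g x ^ 2 ∂μ) ^ (1 / 2 : ℝ) := by
  have := ENNReal.lintegral_mul_le_Lp_mul_Lq μ Real.HolderConjugate.two_two hf hg
  simpa using this

theorem eLpNorm_two_eq {α F : Type*} [MeasurableSpace α] [NormedAddCommGroup F] (μ : Measure α)
    (f : α → F) : eLpNorm f 2 μ = (∫⁻ x, ‖f x‖ₑ ^ 2 ∂μ) ^ (1 / 2 : ℝ) := by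
  rw [eLpNorm_eq_lintegral_rpow_enorm_toReal two_ne_zero ENNReal.ofNat_ne_top]
  simp

section

variable {Ω : Set E3} {φ : E3 → ℝ} {G : E3 → E3}

theorem add_smul_mem_of_norm_lt_infDist {w x : E3} (hx : ‖w‖ < Metric.infDist x Ωᶜ) {t : ℝ}
    (ht : t ∈ Icc (0 : ℝ) 1) : x + t • w ∈ Ω := by
  by_contra hcon
  have h1 := Metric.infDist_le_dist_of_mem (x := x) (s := Ωᶜ) hcon
  rw [dist_eq_norm, sub_add_cancel_left, norm_neg, norm_smul, Real.norm_eq_abs,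
    abs_of_nonneg ht.1] at h1
  nlinarith [norm_nonneg w, ht.2]

/-- Justifies exchanging integration along the segments with integration against `η`. -/
theorem integrable_smul_translate {w : E3} (hGm : StronglyMeasurable G) (hG : MemLp G 2 volume)
    {η : E3 → ℝ} (hη : Continuous η) (hηc : HasCompactSupport η) :
    Integrable (fun z : E3 × ℝ => η z.1 * inner ℝ (G (z.1 + z.2 • w)) w)
      ((volume : Measure E3).prod (volume.restrict (Ioc (0 : ℝ) 1))) := by
  have hm : StronglyMeasurable fun z : E3 × ℝ => η z.1 * inner ℝ (G (z.1 + z.2 • w)) w := by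
    have h1 : StronglyMeasurable fun z : E3 × ℝ => G (z.1 + z.2 • w) :=
      hGm.comp_measurable (by fun_prop)
    exact (hη.comp continuous_fst).stronglyMeasurable.mul (h1.inner stronglyMeasurable_const)
  refine ⟨hm.aestronglyMeasurable, ?_⟩
  rw [HasFiniteIntegral, lintegral_prod_symm _ hm.enorm.aemeasurable]
  have hηL : MemLp η 2 volume := hη.memLp_of_hasCompactSupport hηc
  have hb : ∀ t : ℝ, ∫⁻ x, ‖η x * inner ℝ (G (x + t • w)) w‖ₑ ≤
      ‖w‖ₑ * (eLpNorm η 2 volume * eLpNorm G 2 volume) := by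
    intro t
    calc _ ≤ ∫⁻ x, ‖w‖ₑ * (‖η x‖ₑ * ‖G (x + t • w)‖ₑ) := by
          refine lintegral_mono fun x => ?_
          rw [enorm_mul]
          have : ‖(inner ℝ (G (x + t • w)) w : ℝ)‖ₑ ≤ ‖G (x + t • w)‖ₑ * ‖w‖ₑ := by
            simp only [← ofReal_norm, ← ENNReal.ofReal_mul (norm_nonneg _)]
            exact ENNReal.ofReal_le_ofReal (norm_inner_le_norm _ _)
          calc _ ≤ ‖η x‖ₑ * (‖G (x + t • w)‖ₑ * ‖w‖ₑ) := by gcongr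
            _ = _ := by ring
      _ = ‖w‖ₑ * ∫⁻ x, ‖η x‖ₑ * ‖G (x + t • w)‖ₑ := lintegral_const_mul' _ _ enorm_ne_top
      _ ≤ _ := by
          gcongr
          refine (lintegral_mul_le_eLpNorm _ hη.enorm.aemeasurable
            (hGm.comp_measurable (by fun_prop : Measurable fun x : E3 => x + t • w)).enorm.aemeasurable
            ).trans ?_
          rw [eLpNorm_two_eq, eLpNorm_two_eq]
          refine le_of_eq ?_
          congr 2
          exact lintegral_add_right_eq_self (fun x => ‖G x‖ₑ ^ 2) (t • w)
  calc _ ≤ ∫⁻ t in Ioc (0 : ℝ) 1, ‖w‖ₑ * (eLpNorm η 2 volume * eLpNorm G 2 volume) :=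
        lintegral_mono fun t => hb t
    _ = ‖w‖ₑ * (eLpNorm η 2 volume * eLpNorm G 2 volume) := by simp
    _ < ∞ := ENNReal.mul_lt_top enorm_lt_top
        (ENNReal.mul_lt_top hηL.eLpNorm_lt_top hG.eLpNorm_lt_top)

/-- The translation is moved from `φ` to the test function, whose increment is the integral of its
derivative along the segment. Every shifted test function is admissible for the weak gradient
because the segments issuing from the support stay in `Ω`; shifting back yields the claim. -/
theorem integral_mul_translate_sub {w : E3} (hφ : Continuous φ)
    (hGm : StronglyMeasurable G) (hG : MemLp G 2 volume) (hφG : IsWeakGradient Ω φ G)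
    {η : E3 → ℝ} (hη : ContDiff ℝ (⊤ : ℕ∞) η) (hηc : HasCompactSupport η)
    (hηΩ : ∀ x ∈ tsupport η, ∀ t ∈ Icc (0 : ℝ) 1, x + t • w ∈ Ω) :
    ∫ x, η x * (φ (x + w) - φ x) =
      ∫ x, η x * ∫ t in Ioc (0 : ℝ) 1, inner ℝ (G (x + t • w)) w := by
  have hη0 : Continuous η := hη.continuous
  have hdη : Continuous (fderiv ℝ η) := hη.continuous_fderiv (by simp)
  have hηd : Differentiable ℝ η := hη.differentiable (by simp)
  have hshift : ∀ v : E3, HasCompactSupport fun x => η (x - v) := fun v =>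
    hηc.comp_homeomorph (Homeomorph.subRight v)
  have h1 : ∫ x, η x * (φ (x + w) - φ x) = ∫ x, φ x * (η (x - w) - η x) := by
    have i1 : Integrable fun x => η x * φ (x + w) :=
      (by fun_prop : Continuous _).integrable_of_hasCompactSupport hηc.mul_right
    have i2 : Integrable fun x => η x * φ x :=
      (by fun_prop : Continuous _).integrable_of_hasCompactSupport hηc.mul_right
    have i3 : Integrable fun x => φ x * η (x - w) :=
      (by fun_prop : Continuous _).integrable_of_hasCompactSupport (hshift w).mul_left
    have i4 : Integrable fun x => φ x * η x := by simpa only [mul_comm] using i2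
    simp only [mul_sub]
    rw [integral_sub i1 i2, integral_sub i3 i4]
    congr 1
    · rw [← integral_sub_right_eq_self (fun x => η x * φ (x + w)) w]
      simp only [sub_add_cancel, mul_comm]
    · simp only [mul_comm]
  have h2 : ∀ x, η (x - w) - η x = - ∫ t in Ioc (0 : ℝ) 1, fderiv ℝ η (x - t • w) w := by
    intro x
    rw [← intervalIntegral.integral_of_le zero_le_one]
    have hder : ∀ t ∈ uIcc (0 : ℝ) 1, HasDerivAt (fun t : ℝ => η (x - t • w))
        (-(fderiv ℝ η (x - t • w) w)) t := by
      intro t _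
      have h3 : HasDerivAt (fun t : ℝ => x - t • w) (-w) t := by
        simpa using ((hasDerivAt_id t).smul_const w).const_sub x
      have := (hηd (x - t • w)).hasFDerivAt.comp_hasDerivAt t h3
      rwa [map_neg] at this
    have hcont : Continuous fun t : ℝ => -(fderiv ℝ η (x - t • w) w) := by fun_prop
    have := intervalIntegral.integral_eq_sub_of_hasDerivAt hder (hcont.intervalIntegrable 0 1)
    rw [intervalIntegral.integral_neg, one_smul, zero_smul, sub_zero] at this
    exact this.symm
  have hint : Integrable (fun z : E3 × ℝ => φ z.1 * fderiv ℝ η (z.1 - z.2 • w) w)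
      ((volume : Measure E3).prod (volume.restrict (Ioc (0 : ℝ) 1))) := by
    have hK : IsCompact ((fun z : E3 × ℝ => z.1 + z.2 • w) '' (tsupport η ×ˢ Icc (0 : ℝ) 1)) :=
      (hηc.isCompact.prod isCompact_Icc).image (by fun_prop)
    set K := (fun z : E3 × ℝ => z.1 + z.2 • w) '' (tsupport η ×ˢ Icc (0 : ℝ) 1) with hKdef
    have hcont : Continuous fun z : E3 × ℝ => φ z.1 * fderiv ℝ η (z.1 - z.2 • w) w := by fun_prop
    have h5 : IntegrableOn (fun z : E3 × ℝ => φ z.1 * fderiv ℝ η (z.1 - z.2 • w) w)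
        (K ×ˢ Icc (0 : ℝ) 1) ((volume : Measure E3).prod volume) :=
      hcont.continuousOn.integrableOn_compact (hK.prod isCompact_Icc)
    have h6 : IntegrableOn (fun z : E3 × ℝ => φ z.1 * fderiv ℝ η (z.1 - z.2 • w) w)
        (univ ×ˢ Ioc (0 : ℝ) 1) ((volume : Measure E3).prod volume) := by
      refine h5.of_forall_sdiff_eq_zero (MeasurableSet.univ.prod measurableSet_Ioc) ?_
      rintro ⟨x, t⟩ ⟨⟨-, ht⟩, hn⟩
      have : x - t • w ∉ tsupport η := fun hc => hn ⟨⟨(x - t • w, t), ⟨hc, Ioc_subset_Icc_self ht⟩,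
        by simp⟩, Ioc_subset_Icc_self ht⟩
      have h7 : fderiv ℝ η (x - t • w) = 0 := by
        by_contra h8
        exact this (support_fderiv_subset ℝ h8)
      simp [h7]
    rwa [IntegrableOn, ← Measure.prod_restrict, Measure.restrict_univ] at h6
  have h4 : ∀ t ∈ Ioc (0 : ℝ) 1, ∫ x, φ x * fderiv ℝ η (x - t • w) w =
      - ∫ x, η x * inner ℝ (G (x + t • w)) w := by
    intro t ht
    have hsupp : tsupport (fun x => η (x - t • w)) ⊆ Ω := by
      intro x hx
      have h5 : x - t • w ∈ tsupport η := by
        have := tsupport_comp_eq_preimage η (Homeomorph.subRight (t • w))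
        have hx' : x ∈ tsupport (η ∘ Homeomorph.subRight (t • w)) := hx
        rw [this] at hx'
        exact hx'
      simpa using hηΩ _ h5 t (Ioc_subset_Icc_self ht)
    have h5 := hφG (fun x => η (x - t • w)) (hη.comp (contDiff_id.sub contDiff_const))
      (hshift _) hsupp w
    have h6 : ∀ x, fderiv ℝ (fun x => η (x - t • w)) x = fderiv ℝ η (x - t • w) := fun x => by
      rw [fderiv_comp_sub]
    simp only [h6] at h5
    rw [setIntegral_eq_integral_of_forall_compl_eq_zero, setIntegral_eq_integral_of_forall_compl_eq_zero]
      at h5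
    · rw [h5, ← integral_add_right_eq_self (fun x => η (x - t • w) * inner ℝ (G x) w) (t • w)]
      simp
    · intro x hx
      rw [image_eq_zero_of_notMem_tsupport (fun hc => hx (hsupp hc)), zero_mul]
    · intro x hx
      have : fderiv ℝ η (x - t • w) = 0 := by
        rw [← h6]
        by_contra h8
        exact hx (hsupp (support_fderiv_subset ℝ h8))
      simp [this]
  rw [h1]
  simp only [h2, mul_neg, integral_neg]
  calc - ∫ x, φ x * ∫ t in Ioc (0 : ℝ) 1, fderiv ℝ η (x - t • w) w
      = - ∫ x, ∫ t in Ioc (0 : ℝ) 1, φ x * fderiv ℝ η (x - t • w) w := by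
        simp only [integral_const_mul]
    _ = - ∫ t in Ioc (0 : ℝ) 1, ∫ x, φ x * fderiv ℝ η (x - t • w) w := by
        rw [integral_integral_swap hint]
    _ = ∫ t in Ioc (0 : ℝ) 1, ∫ x, η x * inner ℝ (G (x + t • w)) w := by
        rw [setIntegral_congr_fun measurableSet_Ioc h4, integral_neg, neg_neg]
    _ = ∫ x, ∫ t in Ioc (0 : ℝ) 1, η x * inner ℝ (G (x + t • w)) w := by
        rw [← integral_integral_swap (integrable_smul_translate hGm hG hη0 hηc)]
    _ = _ := by simp only [integral_const_mul]

/-- A continuous function with a square integrable weak gradient is almost everywhere recovered by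
integration of the weak gradient along segments. -/
theorem ae_translate_sub_eq (hφ : Continuous φ) (hGm : StronglyMeasurable G)
    (hG : MemLp G 2 volume) (hφG : IsWeakGradient Ω φ G) (w : E3) :
    ∀ᵐ x, ‖w‖ < Metric.infDist x Ωᶜ →
      φ (x + w) - φ x = ∫ t in Ioc (0 : ℝ) 1, inner ℝ (G (x + t • w)) w := by
  set U : Set E3 := {x | ‖w‖ < Metric.infDist x Ωᶜ} with hU
  have hUo : IsOpen U := isOpen_lt continuous_const (Metric.continuous_infDist_pt _)
  have hloc : ∀ η : E3 → ℝ, Continuous η → HasCompactSupport η → Integrable fun x =>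
      η x * ∫ t in Ioc (0 : ℝ) 1, inner ℝ (G (x + t • w)) w := by
    intro η hη hηc
    have := (integrable_smul_translate (w := w) hGm hG hη hηc).integral_prod_left
    simpa only [integral_const_mul] using this
  have hlocint : LocallyIntegrable fun x => ∫ t in Ioc (0 : ℝ) 1, (inner ℝ (G (x + t • w)) w : ℝ) := by
    rw [locallyIntegrable_iff]
    intro K hK
    obtain ⟨η, hη1, -, hη2, -⟩ := exists_continuous_one_zero_of_isCompact hK isClosed_empty
      (disjoint_empty K)
    have := (hloc η η.continuous hη2).integrableOn (s := K)
    refine this.congr_fun (fun x hx => ?_) hK.measurableSet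
    have h1 : η x = 1 := hη1 hx
    simp only [h1, one_mul]
  have key := hUo.ae_eq_zero_of_integral_contDiff_smul_eq_zero (μ := volume)
    (f := fun x => (φ (x + w) - φ x) - ∫ t in Ioc (0 : ℝ) 1, (inner ℝ (G (x + t • w)) w : ℝ))
    (((by fun_prop : Continuous fun x => φ (x + w) - φ x).locallyIntegrable.sub
      hlocint).locallyIntegrableOn _) (fun η hη hηc hηU => by
        have h1 := integral_mul_translate_sub hφ hGm hG hφG hη hηc
          (fun x hx t ht => add_smul_mem_of_norm_lt_infDist (hηU hx) ht)
        simp only [smul_eq_mul, mul_sub (η _) (φ _ - φ _)]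
        rw [integral_sub _ (hloc η hη.continuous hηc), h1, sub_self]
        exact (by have := hη.continuous; fun_prop :
          Continuous fun x => η x * (φ (x + w) - φ x)).integrable_of_hasCompactSupport hηc.mul_right)
  filter_upwards [key] with x hx hxU
  exact sub_eq_zero.1 (hx hxU)

end

/-! ### Neutral charges against the oscillation of the potential -/

/-- Integrability of `f` is not required: if it fails, the right-hand side is infinite. -/
theorem enorm_sub_integral_le {α F : Type*} [MeasurableSpace α] [NormedAddCommGroup F]
    [NormedSpace ℝ F] [CompleteSpace F] (ν : Measure α) [IsProbabilityMeasure ν] (c : F) {f : α → F}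
    (hf : AEStronglyMeasurable f ν) : ‖c - ∫ x, f x ∂ν‖ₑ ≤ ∫⁻ x, ‖c - f x‖ₑ ∂ν := by
  by_cases hi : Integrable f ν
  · have h1 : c - ∫ x, f x ∂ν = ∫ x, (c - f x) ∂ν := by
      rw [integral_sub (integrable_const c) hi]; simp
    rw [h1]
    exact enorm_integral_le_lintegral_enorm _
  · have h2 : ¬ Integrable (fun x => c - f x) ν := fun h => hi
      (((integrable_const (μ := ν) c).sub h).congr (ae_of_all _ fun x => sub_sub_cancel c (f x)))
    have h3 : ∫⁻ x, ‖c - f x‖ₑ ∂ν = ∞ := by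
      by_contra h4
      exact h2 ⟨aestronglyMeasurable_const.sub hf, lt_top_iff_ne_top.2 h4⟩
    rw [h3]; exact le_top

theorem enorm_inner_le {V : Type*} [NormedAddCommGroup V] [InnerProductSpace ℝ V] (x y : V) :
    ‖(inner ℝ x y : ℝ)‖ₑ ≤ ‖x‖ₑ * ‖y‖ₑ := by
  simp only [← ofReal_norm, ← ENNReal.ofReal_mul (norm_nonneg _)]
  exact ENNReal.ofReal_le_ofReal (norm_inner_le_norm _ _)

/-- A neutral charge only sees the oscillation of the potential around an affine function. -/
theorem enorm_integral_sub_inner_le_of_neutral {V : Set E3} (hV : MeasurableSet V)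
    (hVb : Bornology.IsBounded V) {v : ℝ≥0∞} (hv : v ≤ volume V) (hv0 : v ≠ 0)
    {κ : ℝ} (hκ : ∀ x ∈ V, ∀ y ∈ V, dist x y ≤ κ)
    {q φ : E3 → ℝ} {H : E3 → E3} (hq : IntegrableOn q V) (hq0 : ∫ x in V, q x = 0)
    (hφ : Continuous φ) (hH : IntegrableOn H V) :
    ‖(∫ x in V, q x * φ x) - inner ℝ (⨍ y in V, H y) (∫ x in V, q x • x)‖ₑ ≤
      ∫⁻ x in V, ‖q x‖ₑ * (v⁻¹ * ∫⁻ w in Metric.closedBall 0 κ,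
        ‖φ x - φ (x + w) + inner ℝ (H (x + w)) w‖ₑ) := by
  have hVt : volume V ≠ ∞ := hVb.measure_lt_top.ne
  have hV0 : volume V ≠ 0 := (pos_of_ne_zero hv0 |>.trans_le hv).ne'
  have hfin : IsFiniteMeasure (volume.restrict V) := ⟨by
    rw [Measure.restrict_apply_univ]; exact hVb.measure_lt_top⟩
  obtain ⟨R, hR⟩ := hVb.exists_norm_le
  obtain ⟨Cφ, hCφ⟩ : ∃ C, ∀ x ∈ V, ‖φ x‖ ≤ C := by
    have hc : IsCompact (closure V) :=
      Metric.isCompact_of_isClosed_isBounded isClosed_closure hVb.closure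
    obtain ⟨C, hC⟩ := hc.exists_bound_of_continuousOn hφ.continuousOn
    exact ⟨C, fun x hx => hC x (subset_closure hx)⟩
  have iφ : IntegrableOn φ V := Measure.integrableOn_of_bounded hVt
    hφ.aestronglyMeasurable (ae_restrict_of_forall_mem hV hCφ)
  have iqφ : IntegrableOn (fun x => q x * φ x) V := by
    refine Integrable.mul_bdd (c := Cφ) hq hφ.aestronglyMeasurable ?_
    exact ae_restrict_of_forall_mem hV hCφ
  have iqx : IntegrableOn (fun x => q x • x) V := by
    refine Integrable.mono' (g := fun x => ‖q x‖ * R) (hq.norm.mul_const _)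
      (hq.aestronglyMeasurable.smul continuous_id.aestronglyMeasurable) ?_
    refine ae_restrict_of_forall_mem hV fun x hx => ?_
    rw [norm_smul]
    gcongr
    exact hR x hx
  have iHy : ∀ x : E3, IntegrableOn (fun y => (inner ℝ (H y) (x - y) : ℝ)) V := by
    intro x
    refine Integrable.mono' (g := fun y => ‖H y‖ * (‖x‖ + R)) (hH.norm.mul_const _) ?_ ?_
    · exact hH.aestronglyMeasurable.inner (by fun_prop : Continuous fun y : E3 => x - y).aestronglyMeasurable
    · refine ae_restrict_of_forall_mem hV fun y hy => (norm_inner_le_norm _ _).trans ?_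
      gcongr
      exact (norm_sub_le _ _).trans (by gcongr; exact hR y hy)
  have iHy0 : IntegrableOn (fun y => (inner ℝ (H y) y : ℝ)) V := by
    simpa using (iHy 0).neg
  set A := ⨍ y in V, H y with hA
  -- Up to a constant, `e` is `φ` minus the linear function with gradient `A`. As an average over
  -- `y`, it involves only increments of `φ`, which are accessible through the weak gradient.
  set e : E3 → ℝ := fun x => ⨍ y in V, (φ x - φ y - inner ℝ (H y) (x - y)) with he
  have hvr : volume.real V ≠ 0 := ENNReal.toReal_ne_zero.2 ⟨hV0, hVt⟩
  have hee : ∀ x, e x = φ x - inner ℝ A x +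
      ((⨍ y in V, (inner ℝ (H y) y : ℝ)) - ⨍ y in V, φ y) := by
    intro x
    have h1 : ∫ y in V, (φ x - φ y - inner ℝ (H y) (x - y)) =
        volume.real V • φ x - (∫ y in V, φ y) - (inner ℝ (∫ y in V, H y) x
          - ∫ y in V, (inner ℝ (H y) y : ℝ)) := by
      have i2 : IntegrableOn (fun y => φ x - φ y) V := (integrable_const _).sub iφ
      rw [integral_sub i2 (iHy x), integral_sub (integrable_const _) iφ, setIntegral_const]
      congr 1
      simp only [inner_sub_right]
      rw [integral_sub _ iHy0]
      · rw [real_inner_comm, ← integral_inner hH]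
        simp only [real_inner_comm x]
      · simpa only [real_inner_comm x] using hH.const_inner x
    simp only [he, hA, setAverage_eq, h1, real_inner_smul_left, smul_eq_mul]
    field_simp
    ring
  -- Neutrality annihilates the constant, so `q` has the same integral against `e` as against `φ`
  -- minus that linear function.
  have hint : ∫ x in V, q x * e x = (∫ x in V, q x * φ x) - inner ℝ A (∫ x in V, q x • x) := by
    simp only [hee, mul_add, mul_sub]
    have i1 : IntegrableOn (fun x => q x * (inner ℝ A x : ℝ)) V := by
      have := iqx.const_inner (𝕜 := ℝ) A
      simp only [inner_smul_right] at this
      exact this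
    rw [integral_add, integral_sub iqφ i1, integral_sub, integral_mul_const, integral_mul_const,
      hq0, zero_mul, zero_mul, sub_zero, add_zero, ← integral_inner iqx]
    · simp only [inner_smul_right]
    · exact hq.mul_const _
    · exact hq.mul_const _
    · exact iqφ.sub i1
    · exact (hq.mul_const _).sub (hq.mul_const _)
  rw [← hint]
  refine (enorm_integral_le_lintegral_enorm _).trans (setLIntegral_mono' hV fun x hx => ?_)
  rw [enorm_mul]
  gcongr
  have h2 : ‖e x‖ₑ ≤ (volume V)⁻¹ * ∫⁻ y in V, ‖φ x - φ y - inner ℝ (H y) (x - y)‖ₑ := by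
    simp only [he, average, Measure.restrict_apply_univ]
    refine (enorm_integral_le_lintegral_enorm _).trans ?_
    rw [lintegral_smul_measure, smul_eq_mul]
  refine h2.trans ?_
  -- The shape of `V` is forgotten: its volume is replaced by the lower bound `v`, and `V - x` by a
  -- ball of radius `κ`.
  gcongr ?_ * ?_
  · exact ENNReal.inv_le_inv.2 hv
  have hemb : MeasurableEmbedding (fun w : E3 => x + w) := (Homeomorph.addLeft x).measurableEmbedding
  have h3 : ∫⁻ y in V, ‖φ x - φ y - inner ℝ (H y) (x - y)‖ₑ =
      ∫⁻ w in (fun w => x + w) ⁻¹' V, ‖φ x - φ (x + w) + inner ℝ (H (x + w)) w‖ₑ := by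
    rw [← (measurePreserving_add_left volume x).setLIntegral_comp_preimage_emb hemb]
    simp only [sub_add_cancel_left, inner_neg_right, sub_neg_eq_add]
  rw [h3]
  refine lintegral_mono_set fun w hw => ?_
  have := hκ _ hw _ hx
  rwa [dist_eq_norm, add_sub_cancel_left, ← mem_closedBall_zero_iff] at this

section

variable {Ω : Set E3} {φ : E3 → ℝ} {G H : E3 → E3}

/-- For fixed `w` the affine error is the integral over `t` of `⟪H (x + w) - G (x + t w), w⟫`;
Cauchy–Schwarz in `x` is applied for each `t`. Taking `H = G` gives the dipole approximation and `H
= 0` a crude bound. -/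
theorem lintegral_translate_le (hφ : Continuous φ) (hGm : StronglyMeasurable G)
    (hG : MemLp G 2 volume) (hHm : StronglyMeasurable H) (hφG : IsWeakGradient Ω φ G) {w : E3}
    {X : Set E3} (hX : MeasurableSet X) (hXw : ∀ x ∈ X, ‖w‖ < Metric.infDist x Ωᶜ) {q : E3 → ℝ}
    (hq : Measurable q) {Γ : ℝ≥0∞}
    (hΓ : ∀ t ∈ Ioc (0 : ℝ) 1, eLpNorm (fun x => H (x + w) - G (x + t • w)) 2 volume ≤ Γ) :
    ∫⁻ x in X, ‖q x‖ₑ * ‖φ x - φ (x + w) + inner ℝ (H (x + w)) w‖ₑ ≤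
      ‖w‖ₑ * ((∫⁻ x in X, ‖q x‖ₑ ^ 2) ^ (1 / 2 : ℝ) * Γ) := by
  have hprob : IsProbabilityMeasure ((volume : Measure ℝ).restrict (Ioc (0 : ℝ) 1)) :=
    ⟨by simp⟩
  have hGt : StronglyMeasurable fun z : E3 × ℝ => G (z.1 + z.2 • w) :=
    hGm.comp_measurable (by fun_prop)
  have hHt : StronglyMeasurable fun z : E3 × ℝ => H (z.1 + w) :=
    hHm.comp_measurable (by fun_prop)
  have hpt : ∀ᵐ x ∂(volume.restrict X), ‖φ x - φ (x + w) + inner ℝ (H (x + w)) w‖ₑ ≤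
      ∫⁻ t in Ioc (0 : ℝ) 1, ‖H (x + w) - G (x + t • w)‖ₑ * ‖w‖ₑ := by
    filter_upwards [ae_restrict_of_ae (ae_translate_sub_eq hφ hGm hG hφG w), ae_restrict_mem hX]
      with x hx hxX
    have h1 : φ x - φ (x + w) + inner ℝ (H (x + w)) w =
        inner ℝ (H (x + w)) w - ∫ t in Ioc (0 : ℝ) 1, (inner ℝ (G (x + t • w)) w : ℝ) := by
      rw [← hx (hXw x hxX)]; ring
    rw [h1]
    have h2 : StronglyMeasurable fun t : ℝ => G (x + t • w) := hGm.comp_measurable (by fun_prop)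
    refine (enorm_sub_integral_le _ _
      (h2.inner stronglyMeasurable_const).aestronglyMeasurable).trans (lintegral_mono fun t => ?_)
    rw [← inner_sub_left]
    exact enorm_inner_le _ _
  have hmeas : Measurable fun z : E3 × ℝ =>
      ‖q z.1‖ₑ * (‖H (z.1 + w) - G (z.1 + z.2 • w)‖ₑ * ‖w‖ₑ) :=
    (hq.comp measurable_fst).enorm.mul ((hHt.sub hGt).enorm.mul_const _)
  calc ∫⁻ x in X, ‖q x‖ₑ * ‖φ x - φ (x + w) + inner ℝ (H (x + w)) w‖ₑ
      ≤ ∫⁻ x in X, ∫⁻ t in Ioc (0 : ℝ) 1, ‖q x‖ₑ * (‖H (x + w) - G (x + t • w)‖ₑ * ‖w‖ₑ) := by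
        refine lintegral_mono_ae ?_
        filter_upwards [hpt] with x hx
        rw [lintegral_const_mul' _ _ enorm_ne_top]
        gcongr
    _ = ∫⁻ t in Ioc (0 : ℝ) 1, ∫⁻ x in X, ‖q x‖ₑ * (‖H (x + w) - G (x + t • w)‖ₑ * ‖w‖ₑ) :=
        lintegral_lintegral_swap hmeas.aemeasurable
    _ ≤ ∫⁻ t in Ioc (0 : ℝ) 1, ‖w‖ₑ * ((∫⁻ x in X, ‖q x‖ₑ ^ 2) ^ (1 / 2 : ℝ) * Γ) := by
        refine setLIntegral_mono' measurableSet_Ioc fun t ht => ?_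
        have h1 : StronglyMeasurable fun x : E3 => H (x + w) - G (x + t • w) :=
          (hHm.comp_measurable (by fun_prop)).sub (hGm.comp_measurable (by fun_prop))
        calc _ = ∫⁻ x in X, ‖w‖ₑ * (‖q x‖ₑ * ‖H (x + w) - G (x + t • w)‖ₑ) := by
              refine lintegral_congr fun x => by ring
          _ = ‖w‖ₑ * ∫⁻ x in X, ‖q x‖ₑ * ‖H (x + w) - G (x + t • w)‖ₑ :=
              lintegral_const_mul' _ _ enorm_ne_top
          _ ≤ _ := by
              gcongr
              refine (lintegral_mul_le_eLpNorm _ hq.enorm.aemeasurable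
                h1.enorm.aemeasurable).trans ?_
              gcongr
              rw [← eLpNorm_two_eq]
              exact (eLpNorm_mono_measure _ Measure.restrict_le_self).trans (hΓ t ht)
    _ = _ := by simp

/-- Tonelli puts the displacement `w` outermost, so that the bound for fixed `w` applies. The factor
`κ` gained from `‖w‖` will pay for the division by `l`. -/
theorem lintegral_oscillation_le (hφ : Continuous φ) (hGm : StronglyMeasurable G)
    (hG : MemLp G 2 volume) (hHm : StronglyMeasurable H) (hφG : IsWeakGradient Ω φ G) {κ : ℝ}
    {X : Set E3} (hX : MeasurableSet X) (hXκ : ∀ x ∈ X, κ < Metric.infDist x Ωᶜ) {q : E3 → ℝ}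
    (hq : Measurable q) {Γ : ℝ≥0∞} (hΓ : ∀ w : E3, ‖w‖ ≤ κ →
      ∀ t ∈ Ioc (0 : ℝ) 1, eLpNorm (fun x => H (x + w) - G (x + t • w)) 2 volume ≤ Γ) {v : ℝ≥0∞}
      (hv0 : v ≠ 0) :
    ∫⁻ x in X, ‖q x‖ₑ * (v⁻¹ * ∫⁻ w in Metric.closedBall (0 : E3) κ,
        ‖φ x - φ (x + w) + inner ℝ (H (x + w)) w‖ₑ) ≤
      v⁻¹ * volume (Metric.closedBall (0 : E3) κ) * ENNReal.ofReal κ *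
        ((∫⁻ x in X, ‖q x‖ₑ ^ 2) ^ (1 / 2 : ℝ) * Γ) := by
  have hv : v⁻¹ ≠ ∞ := ENNReal.inv_ne_top.2 hv0
  have hHt : StronglyMeasurable fun z : E3 × E3 => H (z.1 + z.2) :=
    hHm.comp_measurable (by fun_prop)
  have hmeas : Measurable fun z : E3 × E3 =>
      ‖q z.1‖ₑ * ‖φ z.1 - φ (z.1 + z.2) + inner ℝ (H (z.1 + z.2)) z.2‖ₑ := by
    refine (hq.comp measurable_fst).enorm.mul ?_
    have h1 : StronglyMeasurable fun z : E3 × E3 => φ z.1 - φ (z.1 + z.2) :=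
      (by fun_prop : Continuous fun z : E3 × E3 => φ z.1 - φ (z.1 + z.2)).stronglyMeasurable
    exact (h1.add (hHt.inner measurable_snd.stronglyMeasurable)).enorm
  calc _ = v⁻¹ * ∫⁻ x in X, ∫⁻ w in Metric.closedBall (0 : E3) κ,
          ‖q x‖ₑ * ‖φ x - φ (x + w) + inner ℝ (H (x + w)) w‖ₑ := by
        rw [← lintegral_const_mul' _ _ hv]
        refine lintegral_congr fun x => ?_
        rw [lintegral_const_mul' _ _ enorm_ne_top]
        ring
    _ = v⁻¹ * ∫⁻ w in Metric.closedBall (0 : E3) κ, ∫⁻ x in X,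
          ‖q x‖ₑ * ‖φ x - φ (x + w) + inner ℝ (H (x + w)) w‖ₑ := by
        rw [lintegral_lintegral_swap hmeas.aemeasurable]
    _ ≤ v⁻¹ * ∫⁻ _ in Metric.closedBall (0 : E3) κ,
          ENNReal.ofReal κ * ((∫⁻ x in X, ‖q x‖ₑ ^ 2) ^ (1 / 2 : ℝ) * Γ) := by
        gcongr v⁻¹ * ?_
        refine setLIntegral_mono' Metric.isClosed_closedBall.measurableSet fun w hw => ?_
        rw [mem_closedBall_zero_iff] at hw
        refine (lintegral_translate_le hφ hGm hG hHm hφG hX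
          (fun x hx => hw.trans_lt (hXκ x hx)) hq (hΓ w hw)).trans ?_
        gcongr
        rw [← ofReal_norm]
        exact ENNReal.ofReal_le_ofReal hw
    _ = _ := by
        rw [setLIntegral_const]; ring

end

/-! ### Auxiliary limits and integrals over boundary tubes -/

theorem exists_forall_mem_abs_sub_le {V : Type*} [NormedAddCommGroup V] [ProperSpace V]
    {φ : V → ℝ} (hφ : Continuous φ) {X : Set V}
    (hX : Bornology.IsBounded X) {ε : ℝ} (hε : 0 < ε) :
    ∃ δ > 0, ∀ x ∈ X, ∀ y, dist x y < δ → |φ x - φ y| ≤ ε := by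
  obtain ⟨R, hR⟩ := hX.exists_norm_le
  have huc := (isCompact_closedBall (0 : V) (R + 1)).uniformContinuousOn_of_continuous
    hφ.continuousOn
  obtain ⟨δ, hδ, h⟩ := Metric.uniformContinuousOn_iff_le.1 huc ε hε
  refine ⟨min δ 1, by positivity, fun x hx y hxy => ?_⟩
  have h1 := hR x hx
  have h2 : dist x y < 1 := hxy.trans_le (min_le_right _ _)
  rw [dist_eq_norm] at h2
  refine h x (by rw [mem_closedBall_zero_iff]; linarith) y ?_ (hxy.le.trans (min_le_left _ _))
  rw [mem_closedBall_zero_iff]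
  linarith [norm_le_norm_add_norm_sub x y]

/-- The common shape of the error estimates below: `ε` times a fixed constant, plus a term that
vanishes. -/
theorem tendsto_zero_of_forall_eventually_le {α : Type*} {F : Filter α} {f z : α → ℝ} {A : ℝ}
    (hz : Tendsto z F (𝓝 0)) (h : ∀ ε > 0, ∀ᶠ a in F, |f a| ≤ ε * A + z a) :
    Tendsto f F (𝓝 0) := by
  rw [Metric.tendsto_nhds]
  intro ε hε
  have hA : 0 < |A| + 1 := by positivity
  filter_upwards [h (ε / 2 / (|A| + 1)) (by positivity),
    hz.eventually (gt_mem_nhds (by linarith : (0 : ℝ) < ε / 2))] with a h1 h2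
  rw [Real.dist_eq, sub_zero]
  have h3 : ε / 2 / (|A| + 1) * A ≤ ε / 2 := by
    rw [div_mul_eq_mul_div, div_le_iff₀ hA]
    have := le_abs_self A
    nlinarith
  linarith

theorem eventually_Ioc_nhdsGT_zero : ∀ᶠ l in 𝓝[>] (0 : ℝ), l ∈ Ioc (0 : ℝ) 1 :=
  Ioc_mem_nhdsGT one_pos

theorem eventually_mul_lt_nhdsGT_zero (A : ℝ) {δ : ℝ} (hδ : 0 < δ) :
    ∀ᶠ l in 𝓝[>] (0 : ℝ), A * l < δ := by
  have : Tendsto (fun l : ℝ => A * l) (𝓝[>] 0) (𝓝 (A * 0)) :=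
    (tendsto_id.const_mul A).mono_left nhdsWithin_le_nhds
  rw [mul_zero] at this
  exact this.eventually (gt_mem_nhds hδ)

namespace HasLipschitzNormal

variable {Ω : Set E3} {n : E3 → E3} {L : ℝ}

theorem ae_mem_frontier (Ω : Set E3) : ∀ᵐ s ∂(surfaceMeasure Ω), s ∈ frontier Ω :=
  ae_restrict_mem isClosed_frontier.measurableSet

theorem exists_forall_frontier_abs_le (h : HasLipschitzNormal Ω n L) {φ : E3 → ℝ}
    (hφ : Continuous φ) : ∃ C, 0 ≤ C ∧ ∀ x ∈ closure Ω, |φ x| ≤ C := by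
  have hc : IsCompact (closure Ω) :=
    Metric.isCompact_of_isClosed_isBounded isClosed_closure h.bounded.closure
  obtain ⟨C, hC⟩ := hc.exists_bound_of_continuousOn hφ.continuousOn
  exact ⟨max C 0, le_max_right _ _, fun x hx => (hC x hx).trans (le_max_left _ _)⟩

theorem integrable_continuous (h : HasLipschitzNormal Ω n L) {φ : E3 → ℝ} (hφ : Continuous φ) :
    Integrable φ (surfaceMeasure Ω) := by
  have := h.isFiniteMeasure
  obtain ⟨C, -, hC⟩ := h.exists_forall_frontier_abs_le hφ
  refine Integrable.of_bound hφ.aestronglyMeasurable C ?_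
  filter_upwards [ae_mem_frontier Ω] with s hs using hC s (frontier_subset_closure hs)

theorem mem_boundaryTube (h : HasLipschitzNormal Ω n L) {a : ℝ} {x : E3}
    (h1 : x ∈ Ω → Metric.infDist x Ωᶜ ≤ a) (h2 : x ∉ Ω → Metric.infDist x Ω ≤ a) :
    x ∈ boundaryTube Ω a := by
  by_cases hx : x ∈ Ω
  · obtain ⟨s, hs, hxs⟩ := h.interior x hx
    refine (Metric.infDist_le_dist_of_mem hs).trans (le_trans (le_of_eq ?_) (h1 hx))
    conv_lhs => rw [hxs]
    rw [dist_eq_norm, sub_sub_cancel_left, norm_neg, norm_smul, h.norm_eq_one s hs, mul_one,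
      Real.norm_eq_abs, abs_of_nonneg Metric.infDist_nonneg]
  · obtain ⟨s, hs, hxs⟩ := h.exterior x hx
    refine (Metric.infDist_le_dist_of_mem hs).trans (le_trans (le_of_eq ?_) (h2 hx))
    conv_lhs => rw [hxs]
    rw [dist_eq_norm, add_sub_cancel_left, norm_smul, h.norm_eq_one s hs, mul_one,
      Real.norm_eq_abs, abs_of_nonneg Metric.infDist_nonneg]

theorem exists_lintegral_boundaryTube_le (h : HasLipschitzNormal Ω n L) :
    ∃ K : ℝ≥0, ∀ a ∈ Icc (0 : ℝ) 1, ∀ f : E3 → ℝ≥0∞, Measurable f →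
      ∫⁻ x in boundaryTube Ω a, f x ≤
        K * ∫⁻ t in Icc (-a) a, ∫⁻ s, f (normalMap n (s, t)) ∂(surfaceMeasure Ω) := by
  have := h.isFiniteMeasure
  obtain ⟨K, hK⟩ := h.tube_comparison zero_le_one
  refine ⟨K, fun a ha f hf => ?_⟩
  have hD : MeasurableSet (frontier Ω ×ˢ Icc (-a) a) :=
    isClosed_frontier.measurableSet.prod measurableSet_Icc
  have h1 := hK hD (prod_mono_right (Icc_subset_Icc (by linarith [ha.2]) ha.2))
    (h.boundaryTube_subset a)
  refine (lintegral_mono' h1 le_rfl).trans ?_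
  rw [lintegral_smul_measure, smul_eq_mul, lintegral_map hf h.measurable_normalMap]
  gcongr
  calc _ ≤ ∫⁻ z in univ ×ˢ Icc (-a) a, f (normalMap n z) ∂((surfaceMeasure Ω).prod volume) :=
        lintegral_mono_set (prod_mono_left (subset_univ _))
    _ = _ := by
        rw [← Measure.prod_restrict, Measure.restrict_univ,
          lintegral_prod_symm (fun z => f (normalMap n z))
            (hf.comp h.measurable_normalMap).aemeasurable]

theorem exists_volume_boundaryTube_le (h : HasLipschitzNormal Ω n L) :
    ∃ K : ℝ≥0, ∀ a ∈ Icc (0 : ℝ) 1, volume (boundaryTube Ω a) ≤ K * ENNReal.ofReal a := by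
  have := h.isFiniteMeasure
  obtain ⟨K, hK⟩ := h.exists_lintegral_boundaryTube_le
  refine ⟨K * 2 * ((surfaceMeasure Ω) univ).toNNReal, fun a ha => ?_⟩
  have h1 := hK a ha (fun _ => 1) measurable_const
  rw [setLIntegral_one, lintegral_one, setLIntegral_const, Real.volume_Icc] at h1
  refine h1.trans (le_of_eq ?_)
  rw [ENNReal.coe_mul, ENNReal.coe_mul, ENNReal.coe_toNNReal (measure_ne_top _ _)]
  have : ENNReal.ofReal (a - -a) = 2 * ENNReal.ofReal a := by
    rw [sub_neg_eq_add, ← two_mul, ENNReal.ofReal_mul zero_le_two]; simp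
  rw [this, ENNReal.coe_ofNat]
  ring

end HasLipschitzNormal

/-! ### Charges on bounded sets and cells near the boundary -/

/-- The cells that meet `X`. -/
def meetingCells (e : Module.Basis (Fin 3) ℝ E3) (Q : Set E3) (l : ℝ) (X : Set E3) : Set Idx :=
  {i | (cell e Q l i ∩ X).Nonempty}

theorem region_mono {e : Module.Basis (Fin 3) ℝ E3} {Q : Set E3} {l : ℝ} {A B : Set Idx}
    (h : A ⊆ B) : region e Q l A ⊆ region e Q l B := biUnion_subset_biUnion_left h

theorem cell_subset_region {e : Module.Basis (Fin 3) ℝ E3} {Q : Set E3} {l : ℝ} {A : Set Idx}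
    {i : Idx} (h : i ∈ A) : cell e Q l i ⊆ region e Q l A := subset_biUnion_of_mem h

theorem region_singleton {e : Module.Basis (Fin 3) ℝ E3} {Q : Set E3} {l : ℝ} (i : Idx) :
    region e Q l {i} = cell e Q l i := by simp [region]

theorem region_union {e : Module.Basis (Fin 3) ℝ E3} {Q : Set E3} {l : ℝ} (A B : Set Idx) :
    region e Q l (A ∪ B) = region e Q l A ∪ region e Q l B := biUnion_union _ _ _

theorem region_sUnion {e : Module.Basis (Fin 3) ℝ E3} {Q : Set E3} {l : ℝ} (𝒰 : Set (Set Idx)) :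
    region e Q l (⋃₀ 𝒰) = ⋃ U ∈ 𝒰, region e Q l U := by
  ext x; simp only [region, mem_iUnion, mem_sUnion, exists_prop]
  constructor
  · rintro ⟨i, ⟨U, hU, hi⟩, hx⟩; exact ⟨U, hU, i, hi, hx⟩
  · rintro ⟨U, hU, i, hi, hx⟩; exact ⟨i, ⟨U, hU, hi⟩, hx⟩

theorem region_fullCells_subset {e : Module.Basis (Fin 3) ℝ E3} {Q Ω : Set E3} {l : ℝ} :
    region e Q l (fullCells e Q Ω l) ⊆ Ω := iUnion₂_subset fun _ hi => hi

namespace IsUnitCell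

variable {e : Module.Basis (Fin 3) ℝ E3} {Q : Set E3}

theorem disjoint_region (hQ : IsUnitCell e Q) {l : ℝ} (hl : 0 < l) {A B : Set Idx}
    (h : Disjoint A B) : Disjoint (region e Q l A) (region e Q l B) :=
  disjoint_left.2 fun _ hA hB =>
    disjoint_left.1 h ((hQ.mem_region_iff hl).1 hA) ((hQ.mem_region_iff hl).1 hB)

theorem cell_nonempty (hQ : IsUnitCell e Q) {l : ℝ} (hl : 0 < l) (i : Idx) :
    (cell e Q l i).Nonempty := nonempty_of_measure_ne_zero (hQ.volume_cell_ne_zero hl i)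

theorem subset_region_meetingCells (hQ : IsUnitCell e Q) {l : ℝ} (hl : 0 < l) (X : Set E3) :
    X ⊆ region e Q l (meetingCells e Q l X) := fun x hx =>
  (hQ.mem_region_iff hl).2 ⟨x, hQ.mem_cell_index hl x, hx⟩

theorem exists_dist_le_of_mem_region_meetingCells (hQ : IsUnitCell e Q) {D : ℝ}
    (hD : ∀ y ∈ Q, ‖y‖ ≤ D) {l : ℝ} (hl : 0 < l) {X : Set E3} {x : E3}
    (hx : x ∈ region e Q l (meetingCells e Q l X)) : ∃ y ∈ X, dist x y ≤ 2 * D * l := by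
  obtain ⟨y, hy, hyX⟩ := (hQ.mem_region_iff hl).1 hx
  exact ⟨y, hyX, dist_le_of_mem_cell hD hl (hQ.mem_cell_index hl x) hy⟩

theorem isBounded_region_meetingCells (hQ : IsUnitCell e Q) {l : ℝ} (hl : 0 < l) {X : Set E3}
    (hX : Bornology.IsBounded X) : Bornology.IsBounded (region e Q l (meetingCells e Q l X)) := by
  obtain ⟨D, -, hD⟩ := hQ.exists_norm_le
  obtain ⟨R, hR⟩ := hX.exists_norm_le
  refine (Metric.isBounded_closedBall (x := (0 : E3)) (r := R + 2 * D * l)).subset fun x hx => ?_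
  obtain ⟨y, hy, hxy⟩ := hQ.exists_dist_le_of_mem_region_meetingCells hD hl hx
  rw [mem_closedBall_zero_iff]
  rw [dist_eq_norm] at hxy
  linarith [norm_le_norm_add_norm_sub y x, norm_sub_rev x y, hR y hy]

theorem region_meetingCells_subset_boundaryTube (hQ : IsUnitCell e Q) {Ω : Set E3} {D : ℝ}
    (hD : ∀ y ∈ Q, ‖y‖ ≤ D) {l : ℝ} (hl : 0 < l) {a : ℝ} {X : Set E3} (hX : X ⊆ boundaryTube Ω a) :
    region e Q l (meetingCells e Q l X) ⊆ boundaryTube Ω (a + 2 * D * l) := by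
  intro x hx
  obtain ⟨y, hy, hxy⟩ := hQ.exists_dist_le_of_mem_region_meetingCells hD hl hx
  have h1 : Metric.infDist y (frontier Ω) ≤ a := hX hy
  have h2 : Metric.infDist x (frontier Ω) ≤ Metric.infDist y (frontier Ω) + dist x y :=
    Metric.infDist_le_infDist_add_dist
  exact h2.trans (add_le_add h1 hxy)

theorem finite_fullCells (hQ : IsUnitCell e Q) {Ω : Set E3} (hΩ : Bornology.IsBounded Ω) {l : ℝ}
    (hl : 0 < l) : (fullCells e Q Ω l).Finite :=
  (hQ.finite_setOf_cell_inter_nonempty hl hΩ).subset fun i hi => by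
    obtain ⟨x, hx⟩ := hQ.cell_nonempty hl i
    exact ⟨x, hx, hi hx⟩

theorem finite_partialCells (hQ : IsUnitCell e Q) {Ω : Set E3} (hΩ : Bornology.IsBounded Ω) {l : ℝ}
    (hl : 0 < l) : (partialCells e Q Ω l).Finite :=
  (hQ.finite_setOf_cell_inter_nonempty hl hΩ).subset fun _ hi => hi.1

theorem diff_region_fullCells (hQ : IsUnitCell e Q) {Ω : Set E3} {l : ℝ} (hl : 0 < l) :
    Ω \ region e Q l (fullCells e Q Ω l) = ⋃ i ∈ partialCells e Q Ω l, cell e Q l i ∩ Ω := by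
  ext x
  simp only [Set.mem_sdiff, hQ.mem_region_iff hl, mem_iUnion, exists_prop, mem_inter_iff,
    hQ.mem_cell_iff_index hl]
  constructor
  · rintro ⟨hx, hf⟩
    exact ⟨_, ⟨⟨x, hQ.mem_cell_index hl x, hx⟩, hf⟩, rfl, hx⟩
  · rintro ⟨i, hi, rfl, hx⟩
    exact ⟨hx, hi.2⟩

theorem cell_subset_boundaryTube {Ω : Set E3} {n : E3 → E3} {L : ℝ}
    (h : HasLipschitzNormal Ω n L) {D : ℝ} (hD : ∀ y ∈ Q, ‖y‖ ≤ D) {l : ℝ} (hl : 0 < l) {i : Idx}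
    (hi : i ∈ partialCells e Q Ω l) : cell e Q l i ⊆ boundaryTube Ω (2 * D * l) := by
  obtain ⟨⟨x, hx, hxΩ⟩, hn⟩ := hi
  obtain ⟨y, hy, hyΩ⟩ := not_subset.1 hn
  intro z hz
  exact h.mem_boundaryTube
    (fun _ => (Metric.infDist_le_dist_of_mem hyΩ).trans (dist_le_of_mem_cell hD hl hz hy))
    (fun _ => (Metric.infDist_le_dist_of_mem hxΩ).trans (dist_le_of_mem_cell hD hl hz hx))

end IsUnitCell

namespace HasRegionBound

variable {e : Module.Basis (Fin 3) ℝ E3} {Q : Set E3} {ρ : ℝ → E3 → ℝ} {M : ℝ≥0}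

theorem integrableOn (hM : HasRegionBound e Q ρ M) (hQ : IsUnitCell e Q) {l : ℝ}
    (hl : l ∈ Ioc (0 : ℝ) 1) (hm : Measurable (ρ l)) {X : Set E3} (hX : Bornology.IsBounded X) :
    IntegrableOn (ρ l) X := by
  refine IntegrableOn.mono_set ⟨hm.aestronglyMeasurable, ?_⟩
    (hQ.subset_region_meetingCells hl.1 X)
  exact (hM l hl _).2.trans_lt (ENNReal.mul_lt_top ENNReal.coe_lt_top
    (hQ.isBounded_region_meetingCells hl.1 hX).measure_lt_top)

theorem integrableOn_mul (hM : HasRegionBound e Q ρ M) (hQ : IsUnitCell e Q) {l : ℝ}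
    (hl : l ∈ Ioc (0 : ℝ) 1) (hm : Measurable (ρ l)) {X : Set E3} (hX : Bornology.IsBounded X)
    {φ : E3 → ℝ} (hφ : Continuous φ) : IntegrableOn (fun x => ρ l x * φ x) X := by
  have hc : IsCompact (closure X) :=
    Metric.isCompact_of_isClosed_isBounded isClosed_closure hX.closure
  obtain ⟨C, hC⟩ := hc.exists_bound_of_continuousOn hφ.continuousOn
  refine IntegrableOn.mono_set ?_ (subset_closure (s := X))
  exact Integrable.mul_bdd (c := C) (hM.integrableOn hQ hl hm hX.closure)
    hφ.aestronglyMeasurable (ae_restrict_of_forall_mem isClosed_closure.measurableSet hC)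

/-- The charge in a cell is at most of the order of its volume. -/
theorem lintegral_cell_le (hM : HasRegionBound e Q ρ M) {l : ℝ}
    (hl : l ∈ Ioc (0 : ℝ) 1) (i : Idx) :
    ∫⁻ x in cell e Q l i, ‖ρ l x‖ₑ ≤ M * volume (cell e Q l i) := by
  have := (hM l hl {i}).2
  rwa [region_singleton] at this

theorem abs_integral_mul_le (hM : HasRegionBound e Q ρ M) (hQ : IsUnitCell e Q) {l : ℝ}
    (hl : l ∈ Ioc (0 : ℝ) 1) {i : Idx} {X : Set E3} (hX : MeasurableSet X)
    (hXi : X ⊆ cell e Q l i) {f : E3 → ℝ} {c : ℝ} (hc : 0 ≤ c) (hf : ∀ x ∈ X, |f x| ≤ c) :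
    |∫ x in X, ρ l x * f x| ≤ c * (M * volume.real Q * l ^ 3) := by
  have h1 : ‖∫ x in X, ρ l x * f x‖ₑ ≤ ENNReal.ofReal (c * (M * volume.real Q * l ^ 3)) := by
    calc _ ≤ ∫⁻ x in X, ‖ρ l x * f x‖ₑ := enorm_integral_le_lintegral_enorm _
      _ ≤ ∫⁻ x in X, ENNReal.ofReal c * ‖ρ l x‖ₑ := by
          refine setLIntegral_mono' hX fun x hx => ?_
          rw [enorm_mul, mul_comm]
          gcongr
          rw [← ofReal_norm]
          exact ENNReal.ofReal_le_ofReal (hf x hx)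
      _ = ENNReal.ofReal c * ∫⁻ x in X, ‖ρ l x‖ₑ :=
          lintegral_const_mul' _ _ ENNReal.ofReal_ne_top
      _ ≤ ENNReal.ofReal c * (M * volume (cell e Q l i)) := by
          gcongr
          exact (lintegral_mono_set hXi).trans (hM.lintegral_cell_le hl i)
      _ = _ := by
          have hl0 := hl.1
          rw [IsUnitCell.volume_cell hl.1, ENNReal.ofReal_mul hc, ENNReal.ofReal_mul (by positivity),
            ENNReal.ofReal_mul (by positivity), ofReal_measureReal hQ.volume_ne_top,
            ENNReal.ofReal_coe_nnreal]
          ring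
  rw [← Real.norm_eq_abs, ← toReal_enorm]
  have hl0 := hl.1
  exact ENNReal.toReal_le_of_le_ofReal (by positivity) h1

end HasRegionBound

/-! ### Partial cells and the inner surface charge -/

section

variable {e : Module.Basis (Fin 3) ℝ E3} {Q Ω : Set E3} {ρ : ℝ → E3 → ℝ} {M : ℝ≥0}
  {n : E3 → E3} {L : ℝ}

theorem innerSurfaceCharge_eq (hQ : IsUnitCell e Q) {l : ℝ} (hl : 0 < l) (s : E3) :
    innerSurfaceCharge e Q Ω ρ l s =
      (∫ x in cell e Q l (hQ.index (l⁻¹ • s)) ∩ Ω, ρ l x / l) /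
        cellArea e Q Ω l (hQ.index (l⁻¹ • s)) := by
  rw [innerSurfaceCharge, finsum_eq_single _ (hQ.index (l⁻¹ • s))]
  · rw [indicator_of_mem (hQ.mem_cell_index hl s)]
  · intro i hi
    rw [indicator_of_notMem]
    rw [hQ.mem_cell_iff_index hl]
    exact hi.symm

/-- The density is constant on each cell. A cell meeting `∂Ω` is not contained in the open set `Ω`;
if it is not partial either, it misses `Ω` and the integral defining its density is over the empty
set. -/
theorem integral_mul_innerSurfaceCharge (hQ : IsUnitCell e Q) (h : HasLipschitzNormal Ω n L)
    {l : ℝ} (hl : 0 < l) {ψ : E3 → ℝ} (hψ : Continuous ψ) :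
    ∫ s, ψ s * innerSurfaceCharge e Q Ω ρ l s ∂(surfaceMeasure Ω) =
      ∑ i ∈ (hQ.finite_partialCells h.bounded hl).toFinset,
        (∫ x in cell e Q l i ∩ Ω, ρ l x / l) / cellArea e Q Ω l i *
          ∫ s in cell e Q l i, ψ s ∂(surfaceMeasure Ω) := by
  classical
  set P := (hQ.finite_partialCells h.bounded hl).toFinset with hP
  have hB := hQ.finite_setOf_cell_inter_nonempty hl h.isCompact_frontier.isBounded
  set T := P ∪ hB.toFinset with hT
  set c : Idx → ℝ := fun i => (∫ x in cell e Q l i ∩ Ω, ρ l x / l) / cellArea e Q Ω l i with hc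
  have hψi := h.integrable_continuous hψ
  have hcell : ∀ i, EqOn (fun s => ψ s * innerSurfaceCharge e Q Ω ρ l s) (fun s => ψ s * c i)
      (cell e Q l i) := by
    intro i s hs
    simp only [innerSurfaceCharge_eq hQ hl, (hQ.mem_cell_iff_index hl).1 hs, hc]
  have hmem : ∀ᵐ s ∂(surfaceMeasure Ω), s ∈ ⋃ i ∈ T, cell e Q l i := by
    filter_upwards [HasLipschitzNormal.ae_mem_frontier Ω] with s hs
    refine mem_biUnion (x := hQ.index (l⁻¹ • s)) ?_ (hQ.mem_cell_index hl s)
    rw [Finset.mem_coe, hT, Finset.mem_union, hB.mem_toFinset]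
    exact Or.inr ⟨s, hQ.mem_cell_index hl s, hs⟩
  have hsum : ∫ s, ψ s * innerSurfaceCharge e Q Ω ρ l s ∂(surfaceMeasure Ω) =
      ∑ i ∈ T, c i * ∫ s in cell e Q l i, ψ s ∂(surfaceMeasure Ω) := by
    conv_lhs => rw [← Measure.restrict_eq_self_of_ae_mem hmem]
    rw [integral_biUnion_finset T (fun i _ => hQ.measurableSet_cell hl i)
      ((hQ.pairwise_disjoint_cell hl).set_pairwise _)]
    · refine Finset.sum_congr rfl fun i _ => ?_
      rw [setIntegral_congr_fun (hQ.measurableSet_cell hl i) (hcell i), integral_mul_const, mul_comm]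
    · intro i _
      refine IntegrableOn.congr_fun ?_ (hcell i).symm (hQ.measurableSet_cell hl i)
      exact (hψi.mul_const _).integrableOn
  rw [hsum]
  symm
  refine Finset.sum_subset Finset.subset_union_left fun i hiT hiP => ?_
  rw [hT, Finset.mem_union, hB.mem_toFinset] at hiT
  obtain ⟨s, hs, hsf⟩ := hiT.resolve_left hiP
  rw [hP, Set.Finite.mem_toFinset] at hiP
  have h1 : ¬ cell e Q l i ⊆ Ω := fun hsub => disjoint_left.1 h.disjoint_frontier (hsub hs) hsf
  have h2 : cell e Q l i ∩ Ω = ∅ := by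
    by_contra hne
    exact hiP ⟨nonempty_iff_ne_empty.2 hne, h1⟩
  simp [h2]

/-- The charge of the part of a cell that lies in `Ω`, compared with the contribution of the cell to
the inner surface charge. -/
theorem abs_charge_sub_innerSurfaceCharge_le (hQ : IsUnitCell e Q) (h : HasLipschitzNormal Ω n L)
    (hM : HasRegionBound e Q ρ M) {l : ℝ} (hl : l ∈ Ioc (0 : ℝ) 1) (hm : Measurable (ρ l))
    {φ : E3 → ℝ} (hφ : Continuous φ) {i : Idx} {c ω : ℝ} (hω : 0 ≤ ω)
    (hc : ∀ x ∈ cell e Q l i, |φ x - c| ≤ ω) (hA : cellArea e Q Ω l i ≠ 0) :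
    |(∫ x in cell e Q l i ∩ Ω, ρ l x * φ x) / l -
      (∫ x in cell e Q l i ∩ Ω, ρ l x / l) / cellArea e Q Ω l i *
          ∫ s in cell e Q l i, φ s ∂(surfaceMeasure Ω)| ≤
      2 * ω * (M * volume.real Q * l ^ 2) := by
  have hl0 := hl.1
  have hfin := h.isFiniteMeasure
  have hcm := hQ.measurableSet_cell hl0 i
  have hXm : MeasurableSet (cell e Q l i ∩ Ω) := hcm.inter (IsOpen.measurableSet h.isOpen)
  have hXb : Bornology.IsBounded (cell e Q l i ∩ Ω) := h.bounded.subset inter_subset_right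
  have iρ := hM.integrableOn hQ hl hm hXb
  have iρφ := hM.integrableOn_mul hQ hl hm hXb hφ
  set q := ∫ x in cell e Q l i ∩ Ω, ρ l x with hq
  set A := cellArea e Q Ω l i with hAdef
  have hA0 : 0 < A := lt_of_le_of_ne measureReal_nonneg (Ne.symm hA)
  have e1 : ∫ x in cell e Q l i ∩ Ω, ρ l x * φ x =
      q * c + ∫ x in cell e Q l i ∩ Ω, ρ l x * (φ x - c) := by
    simp only [mul_sub]
    rw [integral_sub iρφ (iρ.mul_const c), integral_mul_const, ← hq]; ring
  have e2 : ∫ s in cell e Q l i, φ s ∂(surfaceMeasure Ω) =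
      c * A + ∫ s in cell e Q l i, (φ s - c) ∂(surfaceMeasure Ω) := by
    rw [integral_sub (h.integrable_continuous hφ).integrableOn (integrable_const c),
      setIntegral_const, smul_eq_mul, hAdef, cellArea]; ring
  have b1 : |∫ x in cell e Q l i ∩ Ω, ρ l x * (φ x - c)| ≤ ω * (M * volume.real Q * l ^ 3) :=
    hM.abs_integral_mul_le hQ hl hXm inter_subset_left hω fun x hx => hc x hx.1
  have b2 : |q| ≤ 1 * (M * volume.real Q * l ^ 3) := by
    have := hM.abs_integral_mul_le hQ hl hXm inter_subset_left (f := fun _ => 1) zero_le_one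
      (fun x _ => by simp)
    simpa only [mul_one] using this
  have b3 : |∫ s in cell e Q l i, (φ s - c) ∂(surfaceMeasure Ω)| ≤ ω * A := by
    have := norm_setIntegral_le_of_norm_le_const (μ := surfaceMeasure Ω) (f := fun s => φ s - c)
      (measure_lt_top (surfaceMeasure Ω) (cell e Q l i)) hc
    rwa [Real.norm_eq_abs] at this
  have e3 : ∫ x in cell e Q l i ∩ Ω, ρ l x / l = q / l := integral_div _ _
  rw [e1, e2, e3]
  set X := ∫ x in cell e Q l i ∩ Ω, ρ l x * (φ x - c)
  set Y := ∫ s in cell e Q l i, (φ s - c) ∂(surfaceMeasure Ω)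
  -- The frozen value `c` contributes `q c / l` to both terms and cancels; only the oscillations
  -- about `c` remain.
  have e4 : (q * c + X) / l - q / l / A * (c * A + Y) = X / l - q / l * (Y / A) := by
    field_simp; ring
  rw [e4]
  have b4 : |X / l| ≤ ω * (M * volume.real Q * l ^ 2) := by
    rw [abs_div, abs_of_pos hl0, div_le_iff₀ hl0]
    calc _ ≤ _ := b1
      _ = _ := by ring
  have b5 : |q / l| ≤ M * volume.real Q * l ^ 2 := by
    rw [abs_div, abs_of_pos hl0, div_le_iff₀ hl0]
    calc _ ≤ _ := b2
      _ = _ := by ring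
  have b6 : |Y / A| ≤ ω := by
    rw [abs_div, abs_of_pos hA0, div_le_iff₀ hA0]; exact b3
  calc _ ≤ |X / l| + |q / l * (Y / A)| := abs_sub _ _
    _ ≤ ω * (M * volume.real Q * l ^ 2) + M * volume.real Q * l ^ 2 * ω := by
        rw [abs_mul]; gcongr
    _ = _ := by ring

/-- A partial cell carries charge `O(l³)`, so freezing `φ` in it costs `O(ε l²)` after division by
`l`, and there are `O(l⁻²)` such cells. A cell without boundary area contributes its whole energy,
`O(l²)`, but there are only `o(l⁻²)` of these. -/
theorem tendsto_partialCells_sub_innerSurfaceCharge (hQ : IsUnitCell e Q)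
    (h : HasLipschitzNormal Ω n L) (hM : HasRegionBound e Q ρ M)
    (hmeas : ∀ l ∈ Ioc (0 : ℝ) 1, Measurable (ρ l)) (hgood : IsGoodBoundary e Q Ω)
    (harea : FewAreaFreePartialCells e Q Ω) {φ : E3 → ℝ} (hφ : Continuous φ) :
    Tendsto (fun l => (∫ x in Ω \ region e Q l (fullCells e Q Ω l), ρ l x * φ x) / l -
      ∫ s, φ s * innerSurfaceCharge e Q Ω ρ l s ∂(surfaceMeasure Ω)) (𝓝[>] 0) (𝓝 0) := by
  classical
  obtain ⟨C, hC⟩ := hgood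
  obtain ⟨D, hD0, hD⟩ := hQ.exists_norm_le
  obtain ⟨Cφ, hCφ0, hCφ⟩ := h.exists_forall_frontier_abs_le hφ
  set m : ℝ := M * volume.real Q with hmdef
  have hm0 : 0 ≤ m := by positivity
  set S := (surfaceMeasure Ω).real univ
  set Z : ℝ → ℝ := fun l => Cφ * m *
    (l ^ 2 * ({i ∈ partialCells e Q Ω l | cellArea e Q Ω l i = 0}.ncard : ℝ)) with hZ
  have hZ0 : Tendsto Z (𝓝[>] 0) (𝓝 0) := by
    have := harea.const_mul (Cφ * m); rwa [mul_zero] at this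
  refine tendsto_zero_of_forall_eventually_le (A := 2 * m * (C * S)) hZ0 fun ε hε => ?_
  obtain ⟨δ, hδ, hosc⟩ := exists_forall_mem_abs_sub_le hφ h.bounded hε
  filter_upwards [eventually_Ioc_nhdsGT_zero, eventually_mul_lt_nhdsGT_zero (2 * D) hδ] with l hl hlδ
  have hl0 := hl.1
  have hfin := hQ.finite_partialCells (Ω := Ω) h.bounded hl0
  set P := hfin.toFinset with hP
  have hcm := hQ.measurableSet_cell hl0
  have e1 : ∫ x in Ω \ region e Q l (fullCells e Q Ω l), ρ l x * φ x =
      ∑ i ∈ P, ∫ x in cell e Q l i ∩ Ω, ρ l x * φ x := by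
    rw [hQ.diff_region_fullCells hl0]
    have : ⋃ i ∈ partialCells e Q Ω l, cell e Q l i ∩ Ω = ⋃ i ∈ P, cell e Q l i ∩ Ω := by
      simp [hP]
    rw [this, integral_biUnion_finset P
      (fun i _ => (hcm i).inter (IsOpen.measurableSet h.isOpen))]
    · intro i _ j _ hij
      exact (hQ.pairwise_disjoint_cell hl0 hij).mono inter_subset_left inter_subset_left
    · exact fun i _ => hM.integrableOn_mul hQ hl (hmeas l hl)
        (h.bounded.subset inter_subset_right) hφ
  rw [e1, integral_mul_innerSurfaceCharge hQ h hl0 hφ, ← hP, Finset.sum_div,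
    ← Finset.sum_sub_distrib]
  have hbound : ∀ i ∈ P, |(∫ x in cell e Q l i ∩ Ω, ρ l x * φ x) / l -
      (∫ x in cell e Q l i ∩ Ω, ρ l x / l) / cellArea e Q Ω l i *
          ∫ s in cell e Q l i, φ s ∂(surfaceMeasure Ω)| ≤
      2 * ε * (m * l ^ 2) + if cellArea e Q Ω l i = 0 then Cφ * (m * l ^ 2) else 0 := by
    intro i hi
    split_ifs with hA
    · rw [hA, div_zero, zero_mul, sub_zero, abs_div, abs_of_pos hl0, div_le_iff₀ hl0]
      have := hM.abs_integral_mul_le hQ hl ((hcm i).inter (IsOpen.measurableSet h.isOpen))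
        inter_subset_left hCφ0 (f := φ) fun x hx => hCφ x (subset_closure hx.2)
      refine this.trans ?_
      have h2 : 0 ≤ 2 * ε * (m * l ^ 2) := by positivity
      nlinarith
    · rw [add_zero]
      obtain ⟨⟨x₀, hx₀, hx₀Ω⟩, -⟩ := hfin.mem_toFinset.1 hi
      refine abs_charge_sub_innerSurfaceCharge_le hQ h hM hl (hmeas l hl) hφ (c := φ x₀) hε.le
        (fun x hx => ?_) hA
      rw [abs_sub_comm]
      exact hosc x₀ hx₀Ω x ((IsUnitCell.dist_le_of_mem_cell hD hl0 hx₀ hx).trans_lt hlδ)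
  calc _ ≤ ∑ i ∈ P, (2 * ε * (m * l ^ 2) +
        if cellArea e Q Ω l i = 0 then Cφ * (m * l ^ 2) else 0) :=
        (Finset.abs_sum_le_sum_abs _ _).trans (Finset.sum_le_sum hbound)
    _ = P.card * (2 * ε * (m * l ^ 2)) +
        (P.filter fun i => cellArea e Q Ω l i = 0).card * (Cφ * (m * l ^ 2)) := by
        rw [Finset.sum_add_distrib, Finset.sum_const, nsmul_eq_mul, ← Finset.sum_filter,
          Finset.sum_const, nsmul_eq_mul]
    _ ≤ ε * (2 * m * (C * S)) + Z l := by
        have h1 : (P.card : ℝ) ≤ C * S / l ^ 2 := by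
          have := hC l hl
          rwa [Set.ncard_eq_toFinset_card _ hfin] at this
        have h2 : ((P.filter fun i => cellArea e Q Ω l i = 0).card : ℝ) =
            ({i ∈ partialCells e Q Ω l | cellArea e Q Ω l i = 0}.ncard : ℝ) := by
          have : {i ∈ partialCells e Q Ω l | cellArea e Q Ω l i = 0} =
              ((P.filter fun i => cellArea e Q Ω l i = 0 : Finset Idx) : Set Idx) := by
            ext i; simp [hP]
          rw [this, Set.ncard_coe_finset]
        rw [h2]
        have h3 : (P.card : ℝ) * l ^ 2 ≤ C * S := by rwa [← le_div_iff₀ (by positivity)]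
        have h4 : (P.card : ℝ) * (2 * ε * (m * l ^ 2)) ≤ ε * (2 * m * (C * S)) := by
          calc _ = (2 * ε * m) * ((P.card : ℝ) * l ^ 2) := by ring
            _ ≤ (2 * ε * m) * (C * S) := by gcongr
            _ = _ := by ring
        have h5 : Z l = ({i ∈ partialCells e Q Ω l | cellArea e Q Ω l i = 0}.ncard : ℝ) *
            (Cφ * (m * l ^ 2)) := by rw [hZ]; ring
        linarith

end

/-! ### Full cells: neutral clusters, bulk and transition region -/

section

variable {e : Module.Basis (Fin 3) ℝ E3} {Q Ω : Set E3} {ρ : ℝ → E3 → ℝ} {M : ℝ≥0}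
  {n : E3 → E3} {L : ℝ}

theorem integral_region_union (hQ : IsUnitCell e Q) {l : ℝ} (hl : 0 < l) {A B : Set Idx}
    (hAB : Disjoint A B) {f : E3 → ℝ} (hf : IntegrableOn f (region e Q l (A ∪ B))) :
    ∫ x in region e Q l (A ∪ B), f x =
      (∫ x in region e Q l A, f x) + ∫ x in region e Q l B, f x := by
  rw [region_union] at hf ⊢
  exact setIntegral_union (hQ.disjoint_region hl hAB) (hQ.measurableSet_region hl B)
    hf.left_of_union hf.right_of_union

/-- Estimates on the clusters of a finite disjoint family add up. -/
theorem enorm_integral_region_sUnion_le (hQ : IsUnitCell e Q) {l : ℝ} (hl : 0 < l)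
    {𝒰 : Set (Set Idx)} (hfin : 𝒰.Finite) (hd : 𝒰.PairwiseDisjoint id) {f : E3 → ℝ}
    {g : E3 → ℝ≥0∞} (hf : IntegrableOn f (region e Q l (⋃₀ 𝒰)))
    (h : ∀ U ∈ 𝒰, ‖∫ x in region e Q l U, f x‖ₑ ≤ ∫⁻ x in region e Q l U, g x) :
    ‖∫ x in region e Q l (⋃₀ 𝒰), f x‖ₑ ≤ ∫⁻ x in region e Q l (⋃₀ 𝒰), g x := by
  have hU : region e Q l (⋃₀ 𝒰) = ⋃ U ∈ hfin.toFinset, region e Q l U := by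
    rw [region_sUnion]; simp
  have hdisj : (hfin.toFinset : Set (Set Idx)).PairwiseDisjoint (fun U => region e Q l U) := by
    rw [Set.Finite.coe_toFinset]
    exact fun U hU V hV hUV => hQ.disjoint_region hl (hd hU hV hUV)
  rw [hU, integral_biUnion_finset _ (fun U _ => hQ.measurableSet_region hl U) hdisj,
    lintegral_biUnion_finset hdisj fun U _ => hQ.measurableSet_region hl U]
  · refine (enorm_sum_le _ _).trans (Finset.sum_le_sum fun U hU => ?_)
    exact h U (hfin.mem_toFinset.1 hU)
  · intro U hU
    exact hf.mono_set (region_mono (subset_sUnion_of_mem (hfin.mem_toFinset.1 hU)))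

theorem finite_of_subset_powerset_fullCells (hQ : IsUnitCell e Q) (h : HasLipschitzNormal Ω n L)
    {l : ℝ} (hl : 0 < l) {𝒰 : Set (Set Idx)} (hU : ∀ U ∈ 𝒰, U ⊆ fullCells e Q Ω l) : 𝒰.Finite :=
  (hQ.finite_fullCells h.bounded hl).finite_subsets.subset hU

theorem region_subset_of_subset_fullCells {l : ℝ} {A : Set Idx} (hA : A ⊆ fullCells e Q Ω l) :
    region e Q l A ⊆ Ω := (region_mono hA).trans region_fullCells_subset

/-- Neutral clusters contribute to the scaled energy at most the oscillation of the potential on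
them, times the scaled volume. -/
theorem tendsto_neutral_clusters_zero (hQ : IsUnitCell e Q) (h : HasLipschitzNormal Ω n L)
    (hM : HasRegionBound e Q ρ M) (hmeas : ∀ l ∈ Ioc (0 : ℝ) 1, Measurable (ρ l))
    {φ : E3 → ℝ} (hφ : Continuous φ) {𝒰 : ℝ → Set (Set Idx)}
    (hd : ∀ l ∈ Ioc (0 : ℝ) 1, (𝒰 l).PairwiseDisjoint id)
    (hfull : ∀ l ∈ Ioc (0 : ℝ) 1, ∀ U ∈ 𝒰 l, U ⊆ fullCells e Q Ω l)
    (hneut : ∀ l ∈ Ioc (0 : ℝ) 1, ∀ U ∈ 𝒰 l, regionCharge e Q ρ l U = 0)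
    (hdiam : ∀ δ > 0, ∀ᶠ l in 𝓝[>] (0 : ℝ), ∀ U ∈ 𝒰 l, ∀ x ∈ region e Q l U,
      ∀ y ∈ region e Q l U, dist x y < δ)
    {C : ℝ} (hvol : ∀ᶠ l in 𝓝[>] (0 : ℝ),
      volume (region e Q l (⋃₀ 𝒰 l)) ≤ ENNReal.ofReal (C * l)) :
    Tendsto (fun l => (∫ x in region e Q l (⋃₀ 𝒰 l), ρ l x * φ x) / l) (𝓝[>] 0) (𝓝 0) := by
  refine tendsto_zero_of_forall_eventually_le (A := M * max C 0) (z := fun _ => 0)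
    tendsto_const_nhds fun ε hε => ?_
  obtain ⟨δ, hδ, hosc⟩ := exists_forall_mem_abs_sub_le hφ h.bounded hε
  filter_upwards [eventually_Ioc_nhdsGT_zero, hdiam δ hδ, hvol] with l hl hdl hvl
  have hl0 := hl.1
  have hΩ : region e Q l (⋃₀ 𝒰 l) ⊆ Ω :=
    region_subset_of_subset_fullCells (sUnion_subset (hfull l hl))
  have iρφ : ∀ {X : Set E3}, X ⊆ Ω → IntegrableOn (fun x => ρ l x * φ x) X := fun hX =>
    hM.integrableOn_mul hQ hl (hmeas l hl) (h.bounded.subset hX) hφ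
  have key := enorm_integral_region_sUnion_le hQ hl0
    (finite_of_subset_powerset_fullCells hQ h hl0 (hfull l hl)) (hd l hl) (iρφ hΩ)
    (g := fun x => ENNReal.ofReal ε * ‖ρ l x‖ₑ) (fun U hU => by
      have hUΩ := region_subset_of_subset_fullCells (hfull l hl U hU)
      rcases (region e Q l U).eq_empty_or_nonempty with h0 | ⟨x₀, hx₀⟩
      · simp [h0]
      have hiρ := hM.integrableOn hQ hl (hmeas l hl) (h.bounded.subset hUΩ)
      have e1 : ∫ x in region e Q l U, ρ l x * φ x =
          ∫ x in region e Q l U, ρ l x * (φ x - φ x₀) := by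
        simp only [mul_sub]
        have hn : ∫ x in region e Q l U, ρ l x = 0 := hneut l hl U hU
        rw [integral_sub (iρφ hUΩ) (hiρ.mul_const _), integral_mul_const, hn, zero_mul, sub_zero]
      rw [e1]
      refine (enorm_integral_le_lintegral_enorm _).trans
        (setLIntegral_mono' (hQ.measurableSet_region hl0 U) fun x hx => ?_)
      rw [enorm_mul, mul_comm]
      gcongr
      rw [← ofReal_norm, Real.norm_eq_abs]
      exact ENNReal.ofReal_le_ofReal (hosc x (hUΩ hx) x₀ (hdl U hU x hx x₀ hx₀)))
  rw [lintegral_const_mul' _ _ ENNReal.ofReal_ne_top] at key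
  have key2 : ‖∫ x in region e Q l (⋃₀ 𝒰 l), ρ l x * φ x‖ₑ ≤
      ENNReal.ofReal (ε * (M * (max C 0 * l))) := by
    refine key.trans ?_
    rw [ENNReal.ofReal_mul hε.le, ENNReal.ofReal_mul (NNReal.coe_nonneg M), ENNReal.ofReal_coe_nnreal]
    gcongr
    refine (hM l hl _).2.trans ?_
    gcongr
    refine hvl.trans (ENNReal.ofReal_le_ofReal ?_)
    gcongr
    exact le_max_left _ _
  have key3 := ENNReal.toReal_le_of_le_ofReal (by positivity) key2
  rw [toReal_enorm, Real.norm_eq_abs] at key3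
  rw [abs_div, abs_of_pos hl0, div_le_iff₀ hl0, add_zero]
  linarith

/-- Neutral clusters of microscopic size near the boundary do not contribute to the scaled energy. -/
theorem tendsto_shallow_clusters_zero (hQ : IsUnitCell e Q) (h : HasLipschitzNormal Ω n L)
    (hM : HasRegionBound e Q ρ M) (hmeas : ∀ l ∈ Ioc (0 : ℝ) 1, Measurable (ρ l))
    {φ : E3 → ℝ} (hφ : Continuous φ) {𝒰 : ℝ → Set (Set Idx)}
    (hd : ∀ l ∈ Ioc (0 : ℝ) 1, (𝒰 l).PairwiseDisjoint id)
    (hfull : ∀ l ∈ Ioc (0 : ℝ) 1, ∀ U ∈ 𝒰 l, U ⊆ fullCells e Q Ω l)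
    (hneut : ∀ l ∈ Ioc (0 : ℝ) 1, ∀ U ∈ 𝒰 l, regionCharge e Q ρ l U = 0)
    {κ : ℝ} (hκ : 0 ≤ κ) (hdiam : ∀ l ∈ Ioc (0 : ℝ) 1, ∀ U ∈ 𝒰 l, ∀ x ∈ region e Q l U,
      ∀ y ∈ region e Q l U, dist x y ≤ κ * l)
    (hnear : ∀ l ∈ Ioc (0 : ℝ) 1, ∀ U ∈ 𝒰 l, ∃ x ∈ region e Q l U, Metric.infDist x Ωᶜ ≤ κ * l) :
    Tendsto (fun l => (∫ x in region e Q l (⋃₀ 𝒰 l), ρ l x * φ x) / l) (𝓝[>] 0) (𝓝 0) := by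
  obtain ⟨K, hK⟩ := h.exists_volume_boundaryTube_le
  refine tendsto_neutral_clusters_zero hQ h hM hmeas hφ hd hfull hneut (fun δ hδ => ?_)
    (C := K * (2 * κ)) ?_
  · filter_upwards [eventually_Ioc_nhdsGT_zero, eventually_mul_lt_nhdsGT_zero κ hδ]
      with l hl hlδ U hU x hx y hy using (hdiam l hl U hU x hx y hy).trans_lt hlδ
  · filter_upwards [eventually_Ioc_nhdsGT_zero, eventually_mul_lt_nhdsGT_zero (2 * κ) one_pos]
      with l hl hl1
    have hl0 := hl.1
    -- Distance `κ l` of one point from the exterior plus diameter `κ l`: the clusters fill part of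
    -- a tube whose volume is `O(l)`, so uniform continuity of `φ` is enough.
    have hsub : region e Q l (⋃₀ 𝒰 l) ⊆ boundaryTube Ω (2 * κ * l) := by
      rw [region_sUnion]
      refine iUnion₂_subset fun U hU x hx => ?_
      obtain ⟨y, hy, hyd⟩ := hnear l hl U hU
      refine h.mem_boundaryTube (fun _ => ?_) (fun hx' => absurd
        (region_subset_of_subset_fullCells (hfull l hl U hU) hx) hx')
      have h1 : Metric.infDist x Ωᶜ ≤ Metric.infDist y Ωᶜ + dist x y :=
        Metric.infDist_le_infDist_add_dist
      linarith [hdiam l hl U hU x hx y hy]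
    refine (measure_mono hsub).trans ((hK _ ⟨by positivity, hl1.le⟩).trans (le_of_eq ?_))
    rw [mul_assoc (K : ℝ), ENNReal.ofReal_mul (NNReal.coe_nonneg K), ENNReal.ofReal_coe_nnreal]

theorem cellPolarization_eq_of_mem (hQ : IsUnitCell e Q) {l : ℝ} (hl : 0 < l) {i : Idx}
    (hi : i ∈ fullCells e Q Ω l) {x : E3} (hx : x ∈ cell e Q l i) :
    cellPolarization e Q Ω ρ l x = ⨍ z in cell e Q l i, ρ l z • (l⁻¹ • (z - corner e l i)) := by
  rw [cellPolarization, finsum_eq_single _ i]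
  · simp [hi, hx]
  · intro j hj
    have : x ∉ cell e Q l j := by
      rw [hQ.mem_cell_iff_index hl] at hx ⊢
      rw [hx]; exact hj.symm
    simp [this]

theorem cellPolarization_eq_zero {l : ℝ} {x : E3}
    (hx : x ∉ region e Q l (fullCells e Q Ω l)) : cellPolarization e Q Ω ρ l x = 0 := by
  rw [cellPolarization]
  refine finsum_mem_eq_zero_of_forall_eq_zero fun i hi => ?_
  exact indicator_of_notMem (fun hxi => hx (cell_subset_region hi hxi)) _

theorem measurable_cellPolarization (hQ : IsUnitCell e Q) {l : ℝ} (hl : 0 < l) :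
    Measurable (cellPolarization e Q Ω ρ l) := by
  classical
  have h1 : cellPolarization e Q Ω ρ l = (fun i : Idx => if i ∈ fullCells e Q Ω l then
      ⨍ z in cell e Q l i, ρ l z • (l⁻¹ • (z - corner e l i)) else 0) ∘
        (fun x => hQ.index (l⁻¹ • x)) := by
    ext1 x
    simp only [Function.comp]
    split_ifs with hx
    · exact cellPolarization_eq_of_mem hQ hl hx (hQ.mem_cell_index hl x)
    · exact cellPolarization_eq_zero (by rwa [hQ.mem_region_iff hl])
  rw [h1]
  exact (measurable_of_countable _).comp (hQ.measurable_index.comp (measurable_const_smul _))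

/-- In scaled coordinates positions are bounded by `D` and the mean charge density by `M`. The
uniform bound lets sets of vanishing volume be discarded. -/
theorem norm_cellPolarization_le (hQ : IsUnitCell e Q) (hM : HasRegionBound e Q ρ M) {D : ℝ}
    (hD : ∀ y ∈ Q, ‖y‖ ≤ D) (hD0 : 0 ≤ D) {l : ℝ} (hl : l ∈ Ioc (0 : ℝ) 1) (x : E3) :
    ‖cellPolarization e Q Ω ρ l x‖ ≤ D * M := by
  have hl0 := hl.1
  by_cases hx : x ∈ region e Q l (fullCells e Q Ω l)
  · set i := hQ.index (l⁻¹ • x)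
    rw [cellPolarization_eq_of_mem hQ hl0 ((hQ.mem_region_iff hl0).1 hx) (hQ.mem_cell_index hl0 x)]
    have hc0 := hQ.volume_cell_ne_zero hl0 i
    have hct := hQ.volume_cell_ne_top hl0 i
    have h1 : ‖⨍ z in cell e Q l i, ρ l z • (l⁻¹ • (z - corner e l i))‖ₑ ≤
        ENNReal.ofReal (D * M) := by
      rw [average, Measure.restrict_apply_univ]
      refine (enorm_integral_le_lintegral_enorm _).trans ?_
      rw [lintegral_smul_measure, smul_eq_mul]
      calc _ ≤ (volume (cell e Q l i))⁻¹ * ∫⁻ z in cell e Q l i, ENNReal.ofReal D * ‖ρ l z‖ₑ := by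
            gcongr (volume (cell e Q l i))⁻¹ * ?_
            refine setLIntegral_mono' (hQ.measurableSet_cell hl0 i) fun z hz => ?_
            rw [enorm_smul, mul_comm]
            gcongr
            rw [← ofReal_norm]
            refine ENNReal.ofReal_le_ofReal ?_
            rw [norm_smul, norm_inv, Real.norm_eq_abs, abs_of_pos hl0, inv_mul_le_iff₀ hl0, mul_comm]
            exact IsUnitCell.norm_sub_corner_le hD hl0 hz
        _ ≤ (volume (cell e Q l i))⁻¹ * (ENNReal.ofReal D * (M * volume (cell e Q l i))) := by
            rw [lintegral_const_mul' _ _ ENNReal.ofReal_ne_top]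
            gcongr
            exact hM.lintegral_cell_le hl i
        _ = ENNReal.ofReal (D * M) * ((volume (cell e Q l i))⁻¹ * volume (cell e Q l i)) := by
            rw [ENNReal.ofReal_mul hD0, ENNReal.ofReal_coe_nnreal]; ring
        _ = _ := by rw [ENNReal.inv_mul_cancel hc0 hct, mul_one]
    rw [← toReal_enorm]
    exact ENNReal.toReal_le_of_le_ofReal (by positivity) h1
  · rw [cellPolarization_eq_zero hx, norm_zero]; positivity

theorem volume_closedBall_mul (κ : ℝ) {l : ℝ} (hl : 0 < l) :
    volume (Metric.closedBall (0 : E3) (κ * l)) =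
      ENNReal.ofReal (l ^ 3) * volume (Metric.closedBall (0 : E3) κ) := by
  have h1 : Metric.closedBall (0 : E3) (κ * l) = (fun y => (0 : E3) + l • y) ''
      Metric.closedBall 0 κ := by
    simp only [zero_add]
    rw [image_smul, smul_closedBall' hl.ne', smul_zero, Real.norm_eq_abs, abs_of_pos hl, mul_comm]
  rw [h1, volume_image_add_smul _ hl]

/-- Ball and cell both scale like `l³`; the surviving factor `l` is the length of the displacement.
-/
theorem scaled_oscillation_constant {κ l : ℝ} (hκ : 0 ≤ κ) (hl : 0 < l) :
    (ENNReal.ofReal (l ^ 3) * volume Q)⁻¹ * volume (Metric.closedBall (0 : E3) (κ * l)) *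
      ENNReal.ofReal (κ * l) =
    (volume Q)⁻¹ * volume (Metric.closedBall (0 : E3) κ) * ENNReal.ofReal κ * ENNReal.ofReal l := by
  have h0 : ENNReal.ofReal (l ^ 3) ≠ 0 := by simpa using (by positivity : 0 < l ^ 3)
  rw [volume_closedBall_mul κ hl, ENNReal.mul_inv (Or.inl h0) (Or.inl ENNReal.ofReal_ne_top),
    ENNReal.ofReal_mul hκ]
  calc _ = ((ENNReal.ofReal (l ^ 3))⁻¹ * ENNReal.ofReal (l ^ 3)) * ((volume Q)⁻¹ *
        volume (Metric.closedBall (0 : E3) κ) * ENNReal.ofReal κ * ENNReal.ofReal l) := by ring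
    _ = _ := by rw [ENNReal.inv_mul_cancel h0 ENNReal.ofReal_ne_top, one_mul]

end

section

variable {e : Module.Basis (Fin 3) ℝ E3} {Q Ω : Set E3} {ρ : ℝ → E3 → ℝ} {M : ℝ≥0}
  {n : E3 → E3} {L : ℝ} {φ : E3 → ℝ} {G H : E3 → E3}

theorem IsUnitCell.isBounded_cell (hQ : IsUnitCell e Q) {l : ℝ} (hl : 0 < l) (i : Idx) :
    Bornology.IsBounded (cell e Q l i) := by
  obtain ⟨D, -, hD⟩ := hQ.exists_norm_le
  exact (Metric.isBounded_closedBall (x := corner e l i) (r := D * l)).subset fun x hx =>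
    mem_closedBall_iff_norm.2 (IsUnitCell.norm_sub_corner_le hD hl hx)

theorem integral_region_sUnion_split (hQ : IsUnitCell e Q) {l : ℝ} (hl : 0 < l)
    {𝒰 : Set (Set Idx)} (hd : 𝒰.PairwiseDisjoint id) (P : Set Idx → Prop) {f : E3 → ℝ}
    (hf : IntegrableOn f (region e Q l (⋃₀ 𝒰))) :
    ∫ x in region e Q l (⋃₀ 𝒰), f x = (∫ x in region e Q l (⋃₀ {U ∈ 𝒰 | P U}), f x) +
      ∫ x in region e Q l (⋃₀ {U ∈ 𝒰 | ¬ P U}), f x := by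
  have h1 : 𝒰 = {U ∈ 𝒰 | P U} ∪ {U ∈ 𝒰 | ¬ P U} := by
    ext U; by_cases h : P U <;> simp [h]
  have h2 : ⋃₀ 𝒰 = ⋃₀ {U ∈ 𝒰 | P U} ∪ ⋃₀ {U ∈ 𝒰 | ¬ P U} := by
    rw [← sUnion_union, ← h1]
  rw [h2] at hf ⊢
  refine integral_region_union hQ hl ?_ hf
  refine disjoint_sUnion_left.2 fun U hU => disjoint_sUnion_right.2 fun V hV => ?_
  exact hd hU.1 hV.1 (fun hUV => hV.2 (hUV ▸ hU.2))

/-- The microscopic oscillation of the potential on neutral clusters away from the boundary. -/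
theorem abs_integral_deep_clusters_le (hQ : IsUnitCell e Q) (h : HasLipschitzNormal Ω n L)
    (hM : HasRegionBound e Q ρ M) (hmeas : ∀ l ∈ Ioc (0 : ℝ) 1, Measurable (ρ l))
    (hφ : Continuous φ) (hGm : StronglyMeasurable G)
    (hG : MemLp G 2 volume) (hφG : IsWeakGradient Ω φ G) (hHm : StronglyMeasurable H)
    (hH : MemLp H 2 volume)
    {l : ℝ} (hl : l ∈ Ioc (0 : ℝ) 1) {𝒰 : Set (Set Idx)} (hd : 𝒰.PairwiseDisjoint id)
    (hfull : ∀ U ∈ 𝒰, U ⊆ fullCells e Q Ω l) (hneut : ∀ U ∈ 𝒰, regionCharge e Q ρ l U = 0)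
    {κ : ℝ} (hκ : 0 ≤ κ) (hdiam : ∀ U ∈ 𝒰, ∀ x ∈ region e Q l U, ∀ y ∈ region e Q l U,
      dist x y ≤ κ * l)
    (hdeep : ∀ U ∈ 𝒰, ∀ x ∈ region e Q l U, κ * l < Metric.infDist x Ωᶜ) {f : E3 → ℝ}
    (hf : IntegrableOn f (region e Q l (⋃₀ 𝒰)))
    (hfU : ∀ U ∈ 𝒰, U.Nonempty → ∫ x in region e Q l U, f x =
      (∫ x in region e Q l U, ρ l x * φ x) -
        inner ℝ (⨍ y in region e Q l U, H y) (∫ x in region e Q l U, ρ l x • x))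
    {Γ : ℝ≥0∞} (hΓ : ∀ w : E3, ‖w‖ ≤ κ * l → ∀ t ∈ Ioc (0 : ℝ) 1,
      eLpNorm (fun x => H (x + w) - G (x + t • w)) 2 volume ≤ Γ) {ε : ℝ} {A : ℝ≥0} (hε : 0 ≤ ε)
    (hA : (∫⁻ x in region e Q l (⋃₀ 𝒰), ‖ρ l x‖ₑ ^ 2) ^ (1 / 2 : ℝ) * Γ ≤ ENNReal.ofReal ε * A) :
    |∫ x in region e Q l (⋃₀ 𝒰), f x| ≤
      ε * (((volume Q)⁻¹ * volume (Metric.closedBall (0 : E3) κ) * ENNReal.ofReal κ).toReal * A)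
        * l := by
  have hl0 := hl.1
  -- The volume of one cell: a nonempty cluster contains at least one, so this bounds its volume
  -- from below.
  set v : ℝ≥0∞ := ENNReal.ofReal (l ^ 3) * volume Q with hv
  have hv0 : v ≠ 0 := mul_ne_zero (by simpa using (by positivity : 0 < l ^ 3)) hQ.volume_ne_zero
  have hX := hQ.measurableSet_region hl0 (⋃₀ 𝒰)
  have key := enorm_integral_region_sUnion_le hQ hl0
    (finite_of_subset_powerset_fullCells hQ h hl0 hfull) hd hf
    (g := fun x => ‖ρ l x‖ₑ * (v⁻¹ * ∫⁻ w in Metric.closedBall 0 (κ * l),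
        ‖φ x - φ (x + w) + inner ℝ (H (x + w)) w‖ₑ)) (fun U hU => by
      rcases U.eq_empty_or_nonempty with rfl | ⟨i, hi⟩
      · simp [region]
      rw [hfU U hU ⟨i, hi⟩]
      have hUΩ := region_subset_of_subset_fullCells (hfull U hU)
      have hb := h.bounded.subset hUΩ
      refine enorm_integral_sub_inner_le_of_neutral (hQ.measurableSet_region hl0 U)
        hb ?_ hv0 (hdiam U hU)
        (hM.integrableOn hQ hl (hmeas l hl) hb) (hneut U hU) hφ ?_
      · rw [hv, ← IsUnitCell.volume_cell (e := e) hl0 i]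
        exact measure_mono (cell_subset_region hi)
      · have : IsFiniteMeasure (volume.restrict (region e Q l U)) :=
          ⟨by rw [Measure.restrict_apply_univ]; exact hb.measure_lt_top⟩
        exact (hH.restrict _).integrable one_le_two)
  have key2 := key.trans (lintegral_oscillation_le hφ hGm hG hHm hφG hX (fun x hx => by
    rw [region_sUnion] at hx
    obtain ⟨U, hU, hx⟩ := mem_iUnion₂.1 hx
    exact hdeep U hU x hx) (hmeas l hl) hΓ hv0)
  rw [hv, scaled_oscillation_constant hκ hl0] at key2
  have hK : (volume Q)⁻¹ * volume (Metric.closedBall (0 : E3) κ) * ENNReal.ofReal κ ≠ ∞ :=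
    ENNReal.mul_ne_top (ENNReal.mul_ne_top (ENNReal.inv_ne_top.2 hQ.volume_ne_zero)
      measure_closedBall_lt_top.ne) ENNReal.ofReal_ne_top
  rw [← ENNReal.ofReal_toReal hK] at key2
  have key3 := key2.trans (mul_le_mul_right hA _)
  rw [← ENNReal.ofReal_coe_nnreal, ← ENNReal.ofReal_mul ENNReal.toReal_nonneg,
    ← ENNReal.ofReal_mul hε, ← ENNReal.ofReal_mul (by positivity)] at key3
  have key4 := ENNReal.toReal_le_of_le_ofReal (by positivity) key3
  rw [toReal_enorm, Real.norm_eq_abs] at key4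
  linarith

/-- The bulk cells: the neutral full cells. -/
def bulkCells (e : Module.Basis (Fin 3) ℝ E3) (Q Ω : Set E3) (ρ : ℝ → E3 → ℝ) (l : ℝ) : Set Idx :=
  fullCells e Q Ω l \ transitionCells e Q Ω ρ l

theorem regionCharge_singleton_of_mem_bulkCells {l : ℝ} {i : Idx} (hi : i ∈ bulkCells e Q Ω ρ l) :
    regionCharge e Q ρ l {i} = 0 := by
  rw [regionCharge, region_singleton]
  by_contra h
  exact hi.2 ⟨hi.1, h⟩

/-- The energy of a uniform field in a bulk cell is the energy of its dipole. -/
theorem integral_cell_inner_cellPolarization (hQ : IsUnitCell e Q) (hM : HasRegionBound e Q ρ M)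
    (hmeas : ∀ l ∈ Ioc (0 : ℝ) 1, Measurable (ρ l)) (hG : MemLp G 2 volume) {l : ℝ}
    (hl : l ∈ Ioc (0 : ℝ) 1) {i : Idx} (hi : i ∈ bulkCells e Q Ω ρ l) :
    l * ∫ x in cell e Q l i, inner ℝ (G x) (cellPolarization e Q Ω ρ l x) =
      inner ℝ (⨍ y in cell e Q l i, G y) (∫ x in cell e Q l i, ρ l x • x) := by
  have hl0 := hl.1
  have hb : Bornology.IsBounded (cell e Q l i) := hQ.isBounded_cell hl0 i
  have hfin : IsFiniteMeasure (volume.restrict (cell e Q l i)) :=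
    ⟨by rw [Measure.restrict_apply_univ]; exact hb.measure_lt_top⟩
  have hGi : IntegrableOn G (cell e Q l i) := (hG.restrict _).integrable one_le_two
  have hρ : IntegrableOn (ρ l) (cell e Q l i) := hM.integrableOn hQ hl (hmeas l hl) hb
  have hρx : IntegrableOn (fun x => ρ l x • x) (cell e Q l i) := by
    obtain ⟨R, hR⟩ := hb.exists_norm_le
    exact Integrable.smul_bdd hρ R continuous_id.aestronglyMeasurable
      (ae_restrict_of_forall_mem (hQ.measurableSet_cell hl0 i) hR)
  have h1 : ∫ x in cell e Q l i, inner ℝ (G x) (cellPolarization e Q Ω ρ l x) =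
      inner ℝ (∫ x in cell e Q l i, G x)
        (⨍ z in cell e Q l i, ρ l z • (l⁻¹ • (z - corner e l i))) := by
    rw [real_inner_comm, ← integral_inner hGi]
    refine setIntegral_congr_fun (hQ.measurableSet_cell hl0 i) fun x hx => ?_
    beta_reduce
    rw [cellPolarization_eq_of_mem hQ hl0 hi.1 hx, real_inner_comm]
  have hn : ∫ x in cell e Q l i, ρ l x = 0 := by
    have := regionCharge_singleton_of_mem_bulkCells hi
    rwa [regionCharge, region_singleton] at this
  have h2 : ∫ z in cell e Q l i, ρ l z • (l⁻¹ • (z - corner e l i)) =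
      -- By neutrality the dipole moment does not depend on the corner.
      l⁻¹ • ∫ z in cell e Q l i, ρ l z • z := by
    have : ∀ z, ρ l z • (l⁻¹ • (z - corner e l i)) =
        l⁻¹ • (ρ l z • z - ρ l z • corner e l i) := fun z => by
      rw [smul_comm, smul_sub]
    simp only [this]
    rw [integral_smul, integral_sub hρx (hρ.smul_const _), integral_smul_const, hn, zero_smul,
      sub_zero]
  rw [h1, setAverage_eq, setAverage_eq, h2]
  simp only [real_inner_smul_left, real_inner_smul_right]
  field_simp

end

section

variable {e : Module.Basis (Fin 3) ℝ E3} {Q Ω : Set E3} {ρ : ℝ → E3 → ℝ} {M : ℝ≥0}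
  {n : E3 → E3} {L : ℝ} {φ : E3 → ℝ} {G H : E3 → E3}

/-- Neutral clusters of microscopic size and vanishing volume do not contribute to the scaled
energy. -/
theorem tendsto_microscopic_clusters_zero (hQ : IsUnitCell e Q) (h : HasLipschitzNormal Ω n L)
    (hM : HasRegionBound e Q ρ M) (hmeas : ∀ l ∈ Ioc (0 : ℝ) 1, Measurable (ρ l))
    (hφ : Continuous φ) (hGm : StronglyMeasurable G)
    (hG : MemLp G 2 volume) (hφG : IsWeakGradient Ω φ G) {𝒰 : ℝ → Set (Set Idx)}
    (hd : ∀ l ∈ Ioc (0 : ℝ) 1, (𝒰 l).PairwiseDisjoint id)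
    (hfull : ∀ l ∈ Ioc (0 : ℝ) 1, ∀ U ∈ 𝒰 l, U ⊆ fullCells e Q Ω l)
    (hneut : ∀ l ∈ Ioc (0 : ℝ) 1, ∀ U ∈ 𝒰 l, regionCharge e Q ρ l U = 0)
    {κ : ℝ} (hκ : 0 ≤ κ) (hdiam : ∀ l ∈ Ioc (0 : ℝ) 1, ∀ U ∈ 𝒰 l, ∀ x ∈ region e Q l U,
      ∀ y ∈ region e Q l U, dist x y ≤ κ * l)
    (hvol : Tendsto (fun l => volume (region e Q l (⋃₀ 𝒰 l))) (𝓝[>] 0) (𝓝 0)) :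
    Tendsto (fun l => (∫ x in region e Q l (⋃₀ 𝒰 l), ρ l x * φ x) / l) (𝓝[>] 0) (𝓝 0) := by
  -- Displacements up to `κ l` have to stay in `Ω`, so clusters coming closer than this to the
  -- exterior are treated separately by uniform continuity.
  set P : ℝ → Set Idx → Prop := fun l U => ∀ x ∈ region e Q l U, κ * l < Metric.infDist x Ωᶜ
  have iρφ : ∀ {l}, l ∈ Ioc (0 : ℝ) 1 → IntegrableOn (fun x => ρ l x * φ x)
      (region e Q l (⋃₀ 𝒰 l)) := fun hl =>
    hM.integrableOn_mul hQ hl (hmeas _ hl) (h.bounded.subset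
      (region_subset_of_subset_fullCells (sUnion_subset (hfull _ hl)))) hφ
  have hshallow := tendsto_shallow_clusters_zero hQ h hM hmeas hφ
    (𝒰 := fun l => {U ∈ 𝒰 l | ¬ P l U}) (fun l hl => (hd l hl).subset (sep_subset _ _))
    (fun l hl U hU => hfull l hl U hU.1) (fun l hl U hU => hneut l hl U hU.1) hκ
    (fun l hl U hU => hdiam l hl U hU.1) (fun l hl U hU => by
      have := hU.2
      simp only [P] at this
      push Not at this
      exact this)
  have hdeep : Tendsto (fun l => (∫ x in region e Q l (⋃₀ {U ∈ 𝒰 l | P l U}), ρ l x * φ x) / l)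
      (𝓝[>] 0) (𝓝 0) := by
    set K := ((volume Q)⁻¹ * volume (Metric.closedBall (0 : E3) κ) * ENNReal.ofReal κ).toReal
    refine tendsto_zero_of_forall_eventually_le (A := K * (eLpNorm G 2 volume).toNNReal)
      (z := fun _ => 0) tendsto_const_nhds fun ε hε => ?_
    -- The threshold is `ε²` because the volume enters through the `L²` norm of the charge.
    have hε2 : ∀ᶠ l in 𝓝[>] (0 : ℝ), M * volume (region e Q l (⋃₀ 𝒰 l)) <
        ENNReal.ofReal (ε ^ 2) := by
      have h1 := ENNReal.Tendsto.const_mul (a := (M : ℝ≥0∞)) hvol (Or.inr ENNReal.coe_ne_top)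
      rw [mul_zero] at h1
      exact h1.eventually (gt_mem_nhds (by simpa using (by positivity : 0 < ε ^ 2)))
    filter_upwards [eventually_Ioc_nhdsGT_zero, hε2] with l hl hl2
    have hsub : ⋃₀ {U ∈ 𝒰 l | P l U} ⊆ ⋃₀ 𝒰 l := sUnion_subset_sUnion (sep_subset _ _)
    -- With `H = 0` no affine part is subtracted: `G` contributes its full norm, and the smallness
    -- comes from the charge.
    have h1 := abs_integral_deep_clusters_le hQ h hM hmeas hφ hGm hG hφG (H := 0)
      stronglyMeasurable_zero MemLp.zero hl (𝒰 := {U ∈ 𝒰 l | P l U})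
      ((hd l hl).subset (sep_subset _ _)) (fun U hU => hfull l hl U hU.1)
      (fun U hU => hneut l hl U hU.1) hκ (fun U hU => hdiam l hl U hU.1) (fun U hU => hU.2)
      ((iρφ hl).mono_set (region_mono hsub)) (fun U _ _ => by simp) (Γ := eLpNorm G 2 volume)
      (fun w _ t _ => by
        have h2 : (fun x => (0 : E3 → E3) (x + w) - G (x + t • w)) =
            -(G ∘ fun x => x + t • w) := by ext1 x; simp
        rw [h2, eLpNorm_neg]
        exact (eLpNorm_comp_measurePreserving hGm.aestronglyMeasurable
          (measurePreserving_add_right volume _)).le)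
      (A := (eLpNorm G 2 volume).toNNReal) hε.le (by
        rw [ENNReal.coe_toNNReal hG.2.ne]
        gcongr
        calc _ ≤ (ENNReal.ofReal (ε ^ 2)) ^ (1 / 2 : ℝ) := by
              gcongr
              refine ((hM l hl _).1.trans ?_).trans hl2.le
              gcongr
              exact region_mono hsub
          _ = _ := by
              rw [ENNReal.ofReal_rpow_of_nonneg (by positivity) (by norm_num), ← Real.sqrt_eq_rpow,
                Real.sqrt_sq hε.le])
    rw [abs_div, abs_of_pos hl.1, div_le_iff₀ hl.1, add_zero]
    exact h1
  have := hdeep.add hshallow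
  rw [add_zero] at this
  refine this.congr' ?_
  filter_upwards [eventually_Ioc_nhdsGT_zero] with l hl
  rw [integral_region_sUnion_split hQ hl.1 (hd l hl) (P l) (iρφ hl), add_div]

/-- The bulk cells which are farther than `κ l` from the exterior of `Ω`. -/
def deepBulkCells (e : Module.Basis (Fin 3) ℝ E3) (Q Ω : Set E3) (ρ : ℝ → E3 → ℝ) (κ l : ℝ) :
    Set Idx :=
  {i ∈ bulkCells e Q Ω ρ l | ∀ x ∈ cell e Q l i, κ * l < Metric.infDist x Ωᶜ}

theorem sUnion_image_singleton {α : Type*} (A : Set α) : ⋃₀ ((fun i => ({i} : Set α)) '' A) = A := by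
  ext; simp

theorem pairwiseDisjoint_image_singleton {α : Type*} (A : Set α) :
    ((fun i => ({i} : Set α)) '' A).PairwiseDisjoint id := by
  rintro _ ⟨i, -, rfl⟩ _ ⟨j, -, rfl⟩ hij
  exact disjoint_singleton.2 fun h => hij (by rw [h])

theorem deepBulkCells_subset {κ l : ℝ} : deepBulkCells e Q Ω ρ κ l ⊆ fullCells e Q Ω l :=
  fun _ hi => hi.1.1

theorem integrableOn_inner_cellPolarization (hQ : IsUnitCell e Q) (h : HasLipschitzNormal Ω n L)
    (hM : HasRegionBound e Q ρ M) (hG : MemLp G 2 (volume.restrict Ω)) {l : ℝ}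
    (hl : l ∈ Ioc (0 : ℝ) 1) :
    IntegrableOn (fun x => (inner ℝ (G x) (cellPolarization e Q Ω ρ l x) : ℝ)) Ω := by
  obtain ⟨D, hD0, hD⟩ := hQ.exists_norm_le
  have hfin : IsFiniteMeasure (volume.restrict Ω) :=
    ⟨by rw [Measure.restrict_apply_univ]; exact h.bounded.measure_lt_top⟩
  refine Integrable.mono' (g := fun x => ‖G x‖ * (D * M))
    ((hG.integrable one_le_two).norm.mul_const _)
    (hG.1.inner (measurable_cellPolarization hQ hl.1).aestronglyMeasurable)
    (ae_of_all _ fun x => (norm_inner_le_norm _ _).trans ?_)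
  gcongr
  exact norm_cellPolarization_le hQ hM hD hD0.le hl x

/-- Single cells serve as clusters and `H = G`. The charge is bounded in `L²`, and the smallness
comes from the modulus of continuity of `G` under translations of length at most `κ l`. The
condition `2 D ≤ κ` makes `κ l` exceed the diameter of a cell. -/
theorem tendsto_deepBulkCells (hQ : IsUnitCell e Q) (h : HasLipschitzNormal Ω n L)
    (hM : HasRegionBound e Q ρ M) (hmeas : ∀ l ∈ Ioc (0 : ℝ) 1, Measurable (ρ l))
    (hφ : Continuous φ) (hGm : StronglyMeasurable G)
    (hG : MemLp G 2 volume) (hφG : IsWeakGradient Ω φ G) {κ : ℝ} (hκ : 0 ≤ κ) {D : ℝ}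
    (hD : ∀ y ∈ Q, ‖y‖ ≤ D) (hDκ : 2 * D ≤ κ) :
    Tendsto (fun l => (∫ x in region e Q l (deepBulkCells e Q Ω ρ κ l), ρ l x * φ x) / l -
      ∫ x in region e Q l (deepBulkCells e Q Ω ρ κ l),
        inner ℝ (G x) (cellPolarization e Q Ω ρ l x)) (𝓝[>] 0) (𝓝 0) := by
  set K := ((volume Q)⁻¹ * volume (Metric.closedBall (0 : E3) κ) * ENNReal.ofReal κ).toReal
  have hVt : (M * volume Ω) ^ (1 / 2 : ℝ) ≠ ∞ := ENNReal.rpow_ne_top_of_nonneg (by norm_num)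
    (ENNReal.mul_ne_top ENNReal.coe_ne_top h.bounded.measure_lt_top.ne)
  refine tendsto_zero_of_forall_eventually_le (A := K * ((M * volume Ω) ^ (1 / 2 : ℝ)).toNNReal)
    (z := fun _ => 0) tendsto_const_nhds fun ε hε => ?_
  obtain ⟨δ, hδ, hosc⟩ := exists_forall_eLpNorm_translate_sub_le hG (ε := ENNReal.ofReal ε)
    (by simpa using hε)
  filter_upwards [eventually_Ioc_nhdsGT_zero, eventually_mul_lt_nhdsGT_zero κ hδ] with l hl hlδ
  have hl0 := hl.1
  set A := deepBulkCells e Q Ω ρ κ l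
  have hAΩ : region e Q l A ⊆ Ω := region_subset_of_subset_fullCells deepBulkCells_subset
  have i1 : IntegrableOn (fun x => ρ l x * φ x) (region e Q l A) :=
    hM.integrableOn_mul hQ hl (hmeas l hl) (h.bounded.subset hAΩ) hφ
  have i2 : IntegrableOn (fun x => (inner ℝ (G x) (cellPolarization e Q Ω ρ l x) : ℝ))
      (region e Q l A) :=
    (integrableOn_inner_cellPolarization hQ h hM (hG.restrict Ω) hl).mono_set hAΩ
  have key := abs_integral_deep_clusters_le hQ h hM hmeas hφ hGm hG hφG hGm hG hl
    (𝒰 := (fun i => {i}) '' A) (pairwiseDisjoint_image_singleton A)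
    (by rintro _ ⟨i, hi, rfl⟩; exact singleton_subset_iff.2 hi.1.1)
    (by rintro _ ⟨i, hi, rfl⟩; exact regionCharge_singleton_of_mem_bulkCells hi.1) hκ
    (by
      rintro _ ⟨i, hi, rfl⟩ x hx y hy
      rw [region_singleton] at hx hy
      exact (IsUnitCell.dist_le_of_mem_cell hD hl0 hx hy).trans
        (mul_le_mul_of_nonneg_right hDκ hl0.le))
    (by
      rintro _ ⟨i, hi, rfl⟩ x hx
      rw [region_singleton] at hx
      exact hi.2 x hx)
    (f := fun x => ρ l x * φ x - l * inner ℝ (G x) (cellPolarization e Q Ω ρ l x))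
    (by rw [sUnion_image_singleton]; exact i1.sub (i2.const_mul l))
    (by
      rintro _ ⟨i, hi, rfl⟩ -
      have hs : cell e Q l i ⊆ region e Q l A := cell_subset_region hi
      rw [region_singleton, integral_sub (i1.mono_set hs) ((i2.mono_set hs).const_mul l),
        integral_const_mul, integral_cell_inner_cellPolarization hQ hM hmeas hG hl hi.1])
    (Γ := ENNReal.ofReal ε) (fun w hw t ht => by
      -- After a translation by `t w` this is an increment of `G` over `(1 - t) w`, which is no
      -- longer than `w`.
      have h2 : (fun x => G (x + w) - G (x + t • w)) =
          (fun x => G (x + (1 - t) • w) - G x) ∘ fun x => x + t • w := by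
        ext1 x
        simp only [Function.comp]
        congr 2
        rw [add_assoc, ← add_smul]; simp
      rw [h2, eLpNorm_comp_measurePreserving _ (measurePreserving_add_right volume _)]
      · refine hosc _ (lt_of_le_of_lt ?_ hlδ)
        rw [norm_smul, Real.norm_eq_abs, abs_of_nonneg (by linarith [ht.2])]
        refine (mul_le_of_le_one_left (norm_nonneg w) (by linarith [ht.1])).trans hw
      · exact ((hGm.comp_measurable (measurable_id.add_const _)).sub hGm).aestronglyMeasurable)
    (A := ((M * volume Ω) ^ (1 / 2 : ℝ)).toNNReal) hε.le (by
      rw [ENNReal.coe_toNNReal hVt, mul_comm, sUnion_image_singleton]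
      gcongr
      refine (hM l hl _).1.trans ?_
      gcongr)
  rw [sUnion_image_singleton, integral_sub i1 (i2.const_mul l), integral_const_mul] at key
  rw [add_zero, div_sub' hl0.ne', abs_div, abs_of_pos hl0, div_le_iff₀ hl0]
  exact key

/-- The width `2 κ l` is the depth `κ l` plus one cell diameter, which is at most `κ l`. -/
theorem diff_deepBulkCells_subset (hQ : IsUnitCell e Q) (h : HasLipschitzNormal Ω n L) {κ : ℝ}
    (hκ : 0 ≤ κ) {D : ℝ} (hD : ∀ y ∈ Q, ‖y‖ ≤ D) (hDκ : 2 * D ≤ κ) {l : ℝ} (hl : 0 < l) :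
    Ω \ region e Q l (deepBulkCells e Q Ω ρ κ l) ⊆
      boundaryTube Ω (2 * κ * l) ∪ region e Q l (transitionCells e Q Ω ρ l) := by
  rintro x ⟨hx, hxA⟩
  set i := hQ.index (l⁻¹ • x)
  have hxi : x ∈ cell e Q l i := hQ.mem_cell_index hl x
  have hDl : 2 * D * l ≤ κ * l := by gcongr
  by_cases hf : i ∈ fullCells e Q Ω l
  · by_cases ht : i ∈ transitionCells e Q Ω ρ l
    · exact Or.inr (cell_subset_region ht hxi)
    · have hnd : ¬ ∀ x ∈ cell e Q l i, κ * l < Metric.infDist x Ωᶜ := fun hall =>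
        hxA (cell_subset_region (⟨⟨hf, ht⟩, hall⟩ : i ∈ deepBulkCells e Q Ω ρ κ l) hxi)
      push Not at hnd
      obtain ⟨y, hy, hyd⟩ := hnd
      refine Or.inl (h.mem_boundaryTube (fun _ => ?_) (fun hx' => absurd hx hx'))
      have h1 : Metric.infDist x Ωᶜ ≤ Metric.infDist y Ωᶜ + dist x y :=
        Metric.infDist_le_infDist_add_dist
      linarith [IsUnitCell.dist_le_of_mem_cell hD hl hxi hy]
  · have := IsUnitCell.cell_subset_boundaryTube h hD hl (⟨⟨x, hxi, hx⟩, hf⟩ : i ∈ partialCells e Q Ω l) hxi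
    refine Or.inl (le_trans (show Metric.infDist x (frontier Ω) ≤ _ from this) ?_)
    nlinarith

end

section

variable {e : Module.Basis (Fin 3) ℝ E3} {Q Ω : Set E3} {ρ : ℝ → E3 → ℝ} {M : ℝ≥0}
  {n : E3 → E3} {L : ℝ} {φ : E3 → ℝ} {G : E3 → E3}

theorem HasLipschitzNormal.tendsto_volume_boundaryTube (h : HasLipschitzNormal Ω n L) {κ : ℝ}
    (hκ : 0 ≤ κ) : Tendsto (fun l => volume (boundaryTube Ω (κ * l))) (𝓝[>] 0) (𝓝 0) := by
  obtain ⟨K, hK⟩ := h.exists_volume_boundaryTube_le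
  have h1 : Tendsto (fun l : ℝ => (K : ℝ≥0∞) * ENNReal.ofReal (κ * l)) (𝓝[>] 0) (𝓝 0) := by
    have h2 : Tendsto (fun l : ℝ => ENNReal.ofReal (κ * l)) (𝓝[>] 0) (𝓝 0) := by
      have : Tendsto (fun l : ℝ => κ * l) (𝓝[>] 0) (𝓝 (κ * 0)) :=
        (tendsto_id.const_mul κ).mono_left nhdsWithin_le_nhds
      simpa using ENNReal.tendsto_ofReal this
    simpa using ENNReal.Tendsto.const_mul (a := (K : ℝ≥0∞)) h2 (Or.inr ENNReal.coe_ne_top)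
  refine tendsto_of_tendsto_of_tendsto_of_le_of_le' tendsto_const_nhds h1
    (Eventually.of_forall fun _ => zero_le) ?_
  filter_upwards [eventually_Ioc_nhdsGT_zero, eventually_mul_lt_nhdsGT_zero κ one_pos] with l hl hl1
  exact hK _ ⟨mul_nonneg hκ hl.1.le, hl1.le⟩

theorem tendsto_volume_transition {N S : ℝ → Set (Set Idx)} {R : ℝ → Set Idx}
    (h : HasLipschitzNormal Ω n L) (htrans : IsTransitionDecomposition e Q Ω ρ N S R) :
    Tendsto (fun l => volume (region e Q l (transitionCells e Q Ω ρ l))) (𝓝[>] 0) (𝓝 0) := by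
  have h1 := ENNReal.tendsto_ofReal htrans.volume_tendsto_zero
  rw [ENNReal.ofReal_zero] at h1
  refine h1.congr fun l => ?_
  rw [measureReal_def, ENNReal.ofReal_toReal]
  exact (h.bounded.subset
    (region_subset_of_subset_fullCells fun i hi => hi.1)).measure_lt_top.ne

theorem tendsto_volume_diff_deepBulkCells {N S : ℝ → Set (Set Idx)} {R : ℝ → Set Idx}
    (hQ : IsUnitCell e Q) (h : HasLipschitzNormal Ω n L)
    (htrans : IsTransitionDecomposition e Q Ω ρ N S R) {κ : ℝ} (hκ : 0 ≤ κ) {D : ℝ}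
    (hD : ∀ y ∈ Q, ‖y‖ ≤ D) (hDκ : 2 * D ≤ κ) :
    Tendsto (fun l => volume (Ω \ region e Q l (deepBulkCells e Q Ω ρ κ l))) (𝓝[>] 0) (𝓝 0) := by
  have h1 := (h.tendsto_volume_boundaryTube (κ := 2 * κ) (by positivity)).add
    (tendsto_volume_transition h htrans)
  rw [add_zero] at h1
  refine tendsto_of_tendsto_of_tendsto_of_le_of_le' tendsto_const_nhds h1
    (Eventually.of_forall fun _ => zero_le) ?_
  filter_upwards [self_mem_nhdsWithin] with l hl
  exact (measure_mono (diff_deepBulkCells_subset hQ h hκ hD hDκ hl)).trans (measure_union_le _ _)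

/-- Absolute continuity of the integral of `‖G‖` over the bounded set `Ω`. -/
theorem HasLipschitzNormal.tendsto_setIntegral_inner_zero (h : HasLipschitzNormal Ω n L)
    (hG : MemLp G 2 (volume.restrict Ω)) {Y : ℝ → Set E3}
    (hYm : ∀ l ∈ Ioc (0 : ℝ) 1, MeasurableSet (Y l)) (hY : ∀ l, Y l ⊆ Ω)
    (hvol : Tendsto (fun l => volume (Y l)) (𝓝[>] 0) (𝓝 0)) {v : ℝ → E3 → E3} {B : ℝ}
    (hB : ∀ l ∈ Ioc (0 : ℝ) 1, ∀ x, ‖v l x‖ ≤ B) :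
    Tendsto (fun l => ∫ x in Y l, (inner ℝ (G x) (v l x) : ℝ)) (𝓝[>] 0) (𝓝 0) := by
  have hfin : IsFiniteMeasure (volume.restrict Ω) :=
    ⟨by rw [Measure.restrict_apply_univ]; exact h.bounded.measure_lt_top⟩
  have hGi : ∫⁻ x in Ω, ‖G x‖ₑ ≠ ∞ := (hG.integrable one_le_two).2.ne
  have h1 := tendsto_setLIntegral_zero hGi (l := 𝓝[>] (0 : ℝ)) (s := Y) (by
    refine hvol.congr fun l => ?_
    simp only [Function.comp]
    rw [Measure.restrict_eq_self _ (hY l)])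
  have h2 := ENNReal.Tendsto.const_mul (a := ENNReal.ofReal B) h1 (Or.inr ENNReal.ofReal_ne_top)
  rw [mul_zero] at h2
  rw [tendsto_zero_iff_enorm_tendsto_zero]
  refine tendsto_of_tendsto_of_tendsto_of_le_of_le' tendsto_const_nhds h2
    (Eventually.of_forall fun _ => zero_le) ?_
  filter_upwards [eventually_Ioc_nhdsGT_zero] with l hl
  refine (enorm_integral_le_lintegral_enorm _).trans ?_
  rw [← lintegral_const_mul' _ _ ENNReal.ofReal_ne_top, Measure.restrict_restrict (hYm l hl),
    inter_eq_left.2 (hY l)]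
  refine lintegral_mono fun x => ?_
  refine (enorm_inner_le _ _).trans ?_
  rw [mul_comm]
  gcongr
  rw [← ofReal_norm]
  exact ENNReal.ofReal_le_ofReal (hB l hl x)

/-- The energy of the charge in the full cells is that of the cell dipoles. -/
theorem tendsto_fullCells_energy {N S : ℝ → Set (Set Idx)} {R : ℝ → Set Idx}
    (hQ : IsUnitCell e Q) (h : HasLipschitzNormal Ω n L) (hM : HasRegionBound e Q ρ M)
    (hmeas : ∀ l ∈ Ioc (0 : ℝ) 1, Measurable (ρ l))
    (htrans : IsTransitionDecomposition e Q Ω ρ N S R)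
    (hφ : Continuous φ) (hGm : StronglyMeasurable G)
    (hG : MemLp G 2 volume) (hφG : IsWeakGradient Ω φ G) :
    Tendsto (fun l => (∫ x in region e Q l (fullCells e Q Ω l), ρ l x * φ x) / l -
      ∫ x in Ω, inner ℝ (G x) (cellPolarization e Q Ω ρ l x)) (𝓝[>] 0) (𝓝 0) := by
  obtain ⟨D, hD0, hD⟩ := hQ.exists_norm_le
  obtain ⟨κN, hκN⟩ := htrans.nondegenerate
  -- One constant for the diameters of both the microscopic clusters and the cells.
  set κ := max κN (2 * D)
  have hκ : 0 ≤ κ := le_trans (by positivity) (le_max_right _ _)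
  have hsubT : ∀ l ∈ Ioc (0 : ℝ) 1, ⋃₀ (N l ∪ S l) ∪ R l ⊆ fullCells e Q Ω l := fun l hl => by
    rw [htrans.union_eq l hl]; exact fun i hi => hi.1
  have hsubU : ∀ l ∈ Ioc (0 : ℝ) 1, ∀ U ∈ N l ∪ S l, U ⊆ fullCells e Q Ω l := fun l hl U hU =>
    ((subset_sUnion_of_mem hU).trans subset_union_left).trans (hsubT l hl)
  have hbdd : ∀ l {A : Set Idx}, A ⊆ fullCells e Q Ω l →
      Bornology.IsBounded (region e Q l A) := fun l A hA =>
    h.bounded.subset (region_subset_of_subset_fullCells hA)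
  have iρφ : ∀ {l}, l ∈ Ioc (0 : ℝ) 1 → ∀ {A : Set Idx}, A ⊆ fullCells e Q Ω l →
      IntegrableOn (fun x => ρ l x * φ x) (region e Q l A) := fun hl _ hA =>
    hM.integrableOn_mul hQ hl (hmeas _ hl) (hbdd _ hA) hφ
  -- microscopic clusters
  have hN := tendsto_microscopic_clusters_zero hQ h hM hmeas hφ hGm hG hφG (𝒰 := N)
    (fun l hl => (htrans.pairwise_disjoint l hl).subset subset_union_left)
    (fun l hl U hU => hsubU l hl U (Or.inl hU)) (fun l hl U hU => htrans.neutral l hl U (Or.inl hU))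
    hκ (fun l hl U hU x hx y hy => by
      refine (Metric.dist_le_diam_of_mem (hbdd l (hsubU l hl U (Or.inl hU))) hx hy).trans
        ((hκN l hl U hU).trans ?_)
      exact mul_le_mul_of_nonneg_right (le_max_left _ _) hl.1.le)
    (by
      refine tendsto_of_tendsto_of_tendsto_of_le_of_le' tendsto_const_nhds
        (tendsto_volume_transition h htrans) (Eventually.of_forall fun _ => zero_le) ?_
      filter_upwards [eventually_Ioc_nhdsGT_zero] with l hl
      refine measure_mono (region_mono ?_)
      rw [← htrans.union_eq l hl]
      exact (sUnion_subset_sUnion subset_union_left).trans subset_union_left)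
  -- mesoscopic clusters
  obtain ⟨CS, hCS⟩ := htrans.surface_volume
  -- A cluster may belong to both families; those already counted in `N l` are left out.
  have hS := tendsto_neutral_clusters_zero hQ h hM hmeas hφ (𝒰 := fun l => S l \ N l)
    (fun l hl => (htrans.pairwise_disjoint l hl).subset (sdiff_subset.trans subset_union_right))
    (fun l hl U hU => hsubU l hl U (Or.inr hU.1))
    (fun l hl U hU => htrans.neutral l hl U (Or.inr hU.1))
    (fun δ hδ => by
      filter_upwards [eventually_Ioc_nhdsGT_zero, htrans.surface_diam (δ / 2) (by positivity)]
        with l hl h1 U hU x hx y hy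
      have := Metric.dist_le_diam_of_mem (hbdd l (hsubU l hl U (Or.inr hU.1))) hx hy
      linarith [h1 U hU.1])
    (C := CS) (by
      filter_upwards [eventually_Ioc_nhdsGT_zero] with l hl
      have hSf : ⋃₀ S l ⊆ fullCells e Q Ω l := sUnion_subset fun U hU => hsubU l hl U (Or.inr hU)
      refine (measure_mono (region_mono (sUnion_subset_sUnion sdiff_subset))).trans ?_
      have hSt : volume (region e Q l (⋃₀ S l)) ≠ ∞ := (hbdd l hSf).measure_lt_top.ne
      rw [← ENNReal.ofReal_toReal hSt]
      exact ENNReal.ofReal_le_ofReal (hCS l hl))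
  -- the remainder
  obtain ⟨Cφ, hCφ0, hCφ⟩ := h.exists_forall_frontier_abs_le hφ
  have hR : Tendsto (fun l => (∫ x in region e Q l (R l), ρ l x * φ x) / l) (𝓝[>] 0) (𝓝 0) := by
    have h1 := htrans.remainder_volume.const_mul (Cφ * M)
    rw [mul_zero] at h1
    refine squeeze_zero_norm' ?_ h1
    filter_upwards [eventually_Ioc_nhdsGT_zero] with l hl
    have hRf : R l ⊆ fullCells e Q Ω l := subset_union_right.trans (hsubT l hl)
    have hRt : volume (region e Q l (R l)) ≠ ∞ := (hbdd l hRf).measure_lt_top.ne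
    have h2 : ‖∫ x in region e Q l (R l), ρ l x * φ x‖ₑ ≤
        ENNReal.ofReal (Cφ * (M * volume.real (region e Q l (R l)))) := by
      calc _ ≤ ∫⁻ x in region e Q l (R l), ENNReal.ofReal Cφ * ‖ρ l x‖ₑ := by
            refine (enorm_integral_le_lintegral_enorm _).trans
              (setLIntegral_mono' (hQ.measurableSet_region hl.1 _) fun x hx => ?_)
            rw [enorm_mul, mul_comm]
            gcongr
            rw [← ofReal_norm]
            exact ENNReal.ofReal_le_ofReal
              (hCφ x (subset_closure (region_subset_of_subset_fullCells hRf hx)))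
        _ ≤ ENNReal.ofReal Cφ * (M * volume (region e Q l (R l))) := by
            rw [lintegral_const_mul' _ _ ENNReal.ofReal_ne_top]
            gcongr
            exact (hM l hl _).2
        _ = _ := by
            rw [ENNReal.ofReal_mul hCφ0, ENNReal.ofReal_mul (NNReal.coe_nonneg M),
              ENNReal.ofReal_coe_nnreal, measureReal_def, ENNReal.ofReal_toReal hRt]
    have h3 := ENNReal.toReal_le_of_le_ofReal (by positivity) h2
    rw [toReal_enorm] at h3
    rw [norm_div, Real.norm_of_nonneg hl.1.le, ← mul_div_assoc, mul_assoc]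
    gcongr
    exact hl.1.le
  -- the bulk
  have hB := tendsto_deepBulkCells hQ h hM hmeas hφ hGm hG hφG hκ hD (le_max_right _ _)
  have hP := h.tendsto_setIntegral_inner_zero (hG.restrict Ω)
    (Y := fun l => Ω \ region e Q l (deepBulkCells e Q Ω ρ κ l))
    (fun l hl => (IsOpen.measurableSet h.isOpen).diff (hQ.measurableSet_region hl.1 _))
    (fun l => sdiff_subset) (tendsto_volume_diff_deepBulkCells hQ h htrans hκ hD (le_max_right _ _))
    (fun l hl => norm_cellPolarization_le (Ω := Ω) hQ hM hD hD0.le hl)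
  have hBs := tendsto_shallow_clusters_zero hQ h hM hmeas hφ
    (𝒰 := fun l => (fun i => {i}) '' (bulkCells e Q Ω ρ l \ deepBulkCells e Q Ω ρ κ l))
    (fun l hl => pairwiseDisjoint_image_singleton _)
    (by rintro l hl _ ⟨i, hi, rfl⟩; exact singleton_subset_iff.2 hi.1.1)
    (by rintro l hl _ ⟨i, hi, rfl⟩; exact regionCharge_singleton_of_mem_bulkCells hi.1) hκ
    (by
      rintro l hl _ ⟨i, hi, rfl⟩ x hx y hy
      rw [region_singleton] at hx hy
      exact (IsUnitCell.dist_le_of_mem_cell hD hl.1 hx hy).trans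
        (mul_le_mul_of_nonneg_right (le_max_right _ _) hl.1.le))
    (by
      rintro l hl _ ⟨i, hi, rfl⟩
      have := hi.2
      rw [region_singleton]
      by_contra! hcon
      exact this ⟨hi.1, hcon⟩)
  have hsum := ((((hN.add hS).add hR).add hB).add hBs).sub hP
  simp only [add_zero, sub_zero] at hsum
  refine hsum.congr' ?_
  filter_upwards [eventually_Ioc_nhdsGT_zero] with l hl
  have hl0 := hl.1
  set A := deepBulkCells e Q Ω ρ κ l
  set B := bulkCells e Q Ω ρ l
  have hAf : A ⊆ fullCells e Q Ω l := deepBulkCells_subset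
  have hAB : A ⊆ B := fun i hi => hi.1
  have e1 : fullCells e Q Ω l = ((⋃₀ N l ∪ ⋃₀ (S l \ N l)) ∪ R l) ∪ (A ∪ (B \ A)) := by
    rw [union_sdiff_cancel hAB, ← sUnion_union, union_sdiff_self, htrans.union_eq l hl]
    exact (union_sdiff_cancel fun i hi => hi.1).symm
  have hf := iρφ hl (subset_refl _)
  have d1 : Disjoint ((⋃₀ N l ∪ ⋃₀ (S l \ N l)) ∪ R l) (A ∪ (B \ A)) := by
    rw [union_sdiff_cancel hAB, ← sUnion_union, union_sdiff_self, htrans.union_eq l hl]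
    exact disjoint_sdiff_right
  have d2 : Disjoint (⋃₀ N l ∪ ⋃₀ (S l \ N l)) (R l) := by
    rw [← sUnion_union, union_sdiff_self]; exact htrans.disjoint_remainder l hl
  have d3 : Disjoint (⋃₀ N l) (⋃₀ (S l \ N l)) := by
    refine disjoint_sUnion_left.2 fun U hU => disjoint_sUnion_right.2 fun V hV => ?_
    exact htrans.pairwise_disjoint l hl (Or.inl hU) (Or.inr hV.1) (fun hUV => hV.2 (hUV ▸ hU))
  have e2 : ∫ x in region e Q l (fullCells e Q Ω l), ρ l x * φ x =
      (((∫ x in region e Q l (⋃₀ N l), ρ l x * φ x) +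
        ∫ x in region e Q l (⋃₀ (S l \ N l)), ρ l x * φ x) +
        ∫ x in region e Q l (R l), ρ l x * φ x) + ((∫ x in region e Q l A, ρ l x * φ x) +
        ∫ x in region e Q l (B \ A), ρ l x * φ x) := by
    rw [e1] at hf ⊢
    have hf1 := hf.mono_set (region_mono subset_union_left)
    rw [integral_region_union hQ hl0 d1 hf, integral_region_union hQ hl0 d2 hf1,
      integral_region_union hQ hl0 d3 (hf1.mono_set (region_mono subset_union_left)),
      integral_region_union hQ hl0 disjoint_sdiff_right
        (hf.mono_set (region_mono subset_union_right))]
  have e3 : ∫ x in Ω, (inner ℝ (G x) (cellPolarization e Q Ω ρ l x) : ℝ) =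
      (∫ x in region e Q l A, inner ℝ (G x) (cellPolarization e Q Ω ρ l x)) +
        ∫ x in Ω \ region e Q l A, inner ℝ (G x) (cellPolarization e Q Ω ρ l x) := by
    have hi := integrableOn_inner_cellPolarization (ρ := ρ) hQ h hM (hG.restrict Ω) hl
    rw [← setIntegral_union disjoint_sdiff_right
      ((IsOpen.measurableSet h.isOpen).diff (hQ.measurableSet_region hl0 A))
      (hi.mono_set (region_subset_of_subset_fullCells hAf)) (hi.mono_set sdiff_subset),
      union_sdiff_cancel (region_subset_of_subset_fullCells hAf)]
  rw [e2, e3, sUnion_image_singleton]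
  ring

end

/-! ### The energy inside and outside the domain -/

/-- For nonnegative functions, `∫ dν - ∫ dμ ≤ ε ∫ dμ`, while `∫ dμ - ∫ dν ≤ ε ∫ dν ≤ ε (1 + ε) ∫
dμ`. The general case follows by positive and negative parts. -/
theorem abs_integral_sub_integral_le_of_le_smul {α : Type*} [MeasurableSpace α] {μ ν : Measure α}
    {ε : ℝ} (hε : 0 ≤ ε) (h1 : μ ≤ ENNReal.ofReal (1 + ε) • ν) (h2 : ν ≤ ENNReal.ofReal (1 + ε) • μ)
    {f : α → ℝ} (hf : Integrable f μ) :
    |∫ x, f x ∂μ - ∫ x, f x ∂ν| ≤ ε * (1 + ε) * ∫ x, |f x| ∂μ := by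
  have hfν : Integrable f ν := (hf.smul_measure ENNReal.ofReal_ne_top).mono_measure h2
  have key : ∀ g : α → ℝ, (∀ x, 0 ≤ g x) → Integrable g μ → Integrable g ν →
      |∫ x, g x ∂μ - ∫ x, g x ∂ν| ≤ ε * (1 + ε) * ∫ x, g x ∂μ := by
    intro g hg0 hgμ hgν
    have a1 := integral_mono_measure h1 (ae_of_all _ hg0) (hgν.smul_measure ENNReal.ofReal_ne_top)
    have a2 := integral_mono_measure h2 (ae_of_all _ hg0) (hgμ.smul_measure ENNReal.ofReal_ne_top)
    rw [integral_smul_measure, ENNReal.toReal_ofReal (by positivity), smul_eq_mul] at a1 a2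
    have a3 : 0 ≤ ∫ x, g x ∂μ := integral_nonneg hg0
    have a4 : 0 ≤ ε * ε * ∫ x, g x ∂μ := by positivity
    rw [abs_le]
    constructor
    · nlinarith
    · have := mul_le_mul_of_nonneg_left a2 hε
      nlinarith
  have e1 : ∀ x, f x = max (f x) 0 - max (-f x) 0 := fun x => (max_zero_sub_eq_self _).symm
  have e2 : ∀ x, |f x| = max (f x) 0 + max (-f x) 0 := fun x => by
    rcases le_total 0 (f x) with h | h
    · rw [abs_of_nonneg h, max_eq_left h, max_eq_right (by linarith), add_zero]
    · rw [abs_of_nonpos h, max_eq_right h, max_eq_left (by linarith), zero_add]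
  have k1 := key (fun x => max (f x) 0) (fun x => le_max_right _ _) hf.pos_part hfν.pos_part
  have k2 := key (fun x => max (-f x) 0) (fun x => le_max_right _ _) hf.neg_part hfν.neg_part
  have i1 : ∫ x, f x ∂μ = ∫ x, max (f x) 0 ∂μ - ∫ x, max (-f x) 0 ∂μ := by
    rw [← integral_sub hf.pos_part hf.neg_part]; exact integral_congr_ae (ae_of_all _ e1)
  have i2 : ∫ x, f x ∂ν = ∫ x, max (f x) 0 ∂ν - ∫ x, max (-f x) 0 ∂ν := by
    rw [← integral_sub hfν.pos_part hfν.neg_part]; exact integral_congr_ae (ae_of_all _ e1)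
  have i3 : ∫ x, |f x| ∂μ = ∫ x, max (f x) 0 ∂μ + ∫ x, max (-f x) 0 ∂μ := by
    rw [← integral_add hf.pos_part hf.neg_part]; exact integral_congr_ae (ae_of_all _ e2)
  rw [i1, i2, i3, mul_add]
  refine le_trans (le_of_eq ?_) ((abs_sub _ _).trans (add_le_add k1 k2))
  ring_nf

section

variable {e : Module.Basis (Fin 3) ℝ E3} {Q Ω : Set E3} {ρ : ℝ → E3 → ℝ} {M : ℝ≥0}
  {n : E3 → E3} {L : ℝ} {φ : E3 → ℝ} {G : E3 → E3}

theorem IsWeakGradient.congr_ae {G' : E3 → E3} (hφG : IsWeakGradient Ω φ G)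
    (hG : G =ᵐ[volume.restrict Ω] G') : IsWeakGradient Ω φ G' := fun η h1 h2 h3 v => by
  rw [hφG η h1 h2 h3 v]
  congr 1
  refine integral_congr_ae ?_
  filter_upwards [hG] with x hx
  rw [hx]

/-- The energy of the charge in `Ω` is that of the inner surface charge and the cell dipoles. -/
theorem tendsto_inside_energy {N S : ℝ → Set (Set Idx)} {R : ℝ → Set Idx}
    (hQ : IsUnitCell e Q) (h : HasLipschitzNormal Ω n L) (hM : HasRegionBound e Q ρ M)
    (hmeas : ∀ l ∈ Ioc (0 : ℝ) 1, Measurable (ρ l)) (hgood : IsGoodBoundary e Q Ω)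
    (harea : FewAreaFreePartialCells e Q Ω)
    (htrans : IsTransitionDecomposition e Q Ω ρ N S R)
    (hφ : Continuous φ) (hG : MemLp G 2 (volume.restrict Ω)) (hφG : IsWeakGradient Ω φ G) :
    Tendsto (fun l => (∫ x in Ω, ρ l x * φ x) / l -
      ((∫ s, φ s * innerSurfaceCharge e Q Ω ρ l s ∂(surfaceMeasure Ω)) +
      ∫ x in Ω, inner ℝ (G x) (cellPolarization e Q Ω ρ l x))) (𝓝[>] 0) (𝓝 0) := by
  have hΩm := IsOpen.measurableSet h.isOpen
  -- A strongly measurable representative, extended by zero, so that translations act on it in the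
  -- whole space.
  set G' : E3 → E3 := Ω.indicator (hG.aestronglyMeasurable.mk G)
  have hGG' : G =ᵐ[volume.restrict Ω] G' := by
    filter_upwards [hG.aestronglyMeasurable.ae_eq_mk, ae_restrict_mem hΩm] with x hx hxΩ
    exact hx.trans (indicator_of_mem hxΩ _).symm
  have hG'm : StronglyMeasurable G' := hG.aestronglyMeasurable.stronglyMeasurable_mk.indicator hΩm
  have hG' : MemLp G' 2 volume :=
    (memLp_indicator_iff_restrict hΩm).2 (hG.ae_eq hG.aestronglyMeasurable.ae_eq_mk)
  have h1 := (tendsto_partialCells_sub_innerSurfaceCharge hQ h hM hmeas hgood harea hφ).add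
    (tendsto_fullCells_energy hQ h hM hmeas htrans hφ hG'm hG' (hφG.congr_ae hGG'))
  rw [add_zero] at h1
  refine h1.congr' ?_
  filter_upwards [eventually_Ioc_nhdsGT_zero] with l hl
  have hi := hM.integrableOn_mul hQ hl (hmeas l hl) h.bounded hφ
  have e1 : ∫ x in Ω, ρ l x * φ x = (∫ x in region e Q l (fullCells e Q Ω l), ρ l x * φ x) +
      ∫ x in Ω \ region e Q l (fullCells e Q Ω l), ρ l x * φ x := by
    rw [← setIntegral_union disjoint_sdiff_right (hΩm.diff (hQ.measurableSet_region hl.1 _))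
      (hi.mono_set region_fullCells_subset) (hi.mono_set sdiff_subset),
      union_sdiff_cancel region_fullCells_subset]
  have e2 : ∫ x in Ω, (inner ℝ (G x) (cellPolarization e Q Ω ρ l x) : ℝ) =
      ∫ x in Ω, inner ℝ (G' x) (cellPolarization e Q Ω ρ l x) := by
    refine integral_congr_ae ?_
    filter_upwards [hGG'] with x hx
    rw [hx]
  rw [e1, e2]
  ring

theorem HasLipschitzNormal.volume_frontier (h : HasLipschitzNormal Ω n L) :
    volume (frontier Ω) = 0 := by
  obtain ⟨K, hK⟩ := h.exists_volume_boundaryTube_le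
  have h1 := hK 0 ⟨le_rfl, zero_le_one⟩
  rw [ENNReal.ofReal_zero, mul_zero, nonpos_iff_eq_zero] at h1
  exact measure_mono_null (fun x hx => (Metric.infDist_zero_of_mem hx).le) h1

theorem HasLipschitzNormal.outerLayer_subset_boundaryTube (h : HasLipschitzNormal Ω n L) (τ : ℝ) :
    outerLayer Ω τ ⊆ boundaryTube Ω τ := fun x hx => by
  refine h.mem_boundaryTube (fun hxΩ => ?_) (fun _ => hx.2.le)
  have : 0 < Metric.infDist x Ω := hx.1
  rw [Metric.infDist_zero_of_mem hxΩ] at this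
  exact absurd this (lt_irrefl _)

/-- The charge near the boundary at microscopic scale is a surface quantity. -/
theorem exists_forall_lintegral_outerLayer_le (hQ : IsUnitCell e Q) (h : HasLipschitzNormal Ω n L)
    (hM : HasRegionBound e Q ρ M) :
    ∃ C : ℝ≥0, ∀ᶠ l : ℝ in 𝓝[>] 0, ∀ τ : ℝ≥0, l * (τ : ℝ) ≤ 1 / 2 →
      ∫⁻ x in outerLayer Ω (l * (τ : ℝ)), ‖ρ l x‖ₑ ^ 2 ≤ C * (τ + 1) * ENNReal.ofReal l ∧
      ∫⁻ x in outerLayer Ω (l * (τ : ℝ)), ‖ρ l x‖ₑ ≤ C * (τ + 1) * ENNReal.ofReal l := by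
  obtain ⟨D, hD0, hD⟩ := hQ.exists_norm_le
  obtain ⟨K, hK⟩ := h.exists_volume_boundaryTube_le
  refine ⟨M * (K * (max 1 (2 * D)).toNNReal), ?_⟩
  filter_upwards [eventually_Ioc_nhdsGT_zero, eventually_mul_lt_nhdsGT_zero (2 * D) one_half_pos]
    with l hl hl1 τ hτ
  have hl0 := hl.1
  have hsub := hQ.subset_region_meetingCells hl.1 (outerLayer Ω (l * τ))
  have hv : volume (region e Q l (meetingCells e Q l (outerLayer Ω (l * τ)))) ≤
      K * ((max 1 (2 * D)).toNNReal * (τ + 1) * ENNReal.ofReal l) := by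
    refine (measure_mono (hQ.region_meetingCells_subset_boundaryTube hD hl.1
      (h.outerLayer_subset_boundaryTube _))).trans ?_
    refine (hK _ ⟨by positivity, by linarith⟩).trans ?_
    gcongr
    have e1 : l * τ + 2 * D * l ≤ max 1 (2 * D) * (τ + 1) * l := by
      have h1 : (τ : ℝ) ≤ max 1 (2 * D) * τ := le_mul_of_one_le_left τ.2 (le_max_left _ _)
      have h2 : 2 * D ≤ max 1 (2 * D) := le_max_right _ _
      calc l * τ + 2 * D * l = (τ + 2 * D) * l := by ring
        _ ≤ (max 1 (2 * D) * τ + max 1 (2 * D)) * l := by gcongr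
        _ = _ := by ring
    refine (ENNReal.ofReal_le_ofReal e1).trans (le_of_eq ?_)
    rw [ENNReal.ofReal_mul (by positivity), ENNReal.ofReal_mul (by positivity),
      ENNReal.ofReal_add τ.coe_nonneg zero_le_one, ENNReal.ofReal_coe_nnreal, ENNReal.ofReal_one]
    rfl
  have hl2 := hM l hl (meetingCells e Q l (outerLayer Ω (l * τ)))
  constructor
  · refine (lintegral_mono_set hsub).trans (hl2.1.trans ?_)
    refine (mul_le_mul_right hv _).trans (le_of_eq ?_)
    push_cast; ring
  · refine (lintegral_mono_set hsub).trans (hl2.2.trans ?_)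
    refine (mul_le_mul_right hv _).trans (le_of_eq ?_)
    push_cast; ring

theorem mul_outerSurfaceCharge {l h : ℝ} (hl : 0 < l) (hh : 0 ≤ h) (s : E3) :
    l * outerSurfaceCharge n ρ l h s = ∫ t in Ioo 0 (l * h), ρ l (normalMap n (s, t)) := by
  have h1 := intervalIntegral.integral_comp_mul_left (a := 0) (b := h)
    (fun t => ρ l (s + t • n s)) hl.ne'
  rw [mul_zero, intervalIntegral.integral_of_le hh,
    intervalIntegral.integral_of_le (by positivity : 0 ≤ l * h), smul_eq_mul] at h1
  rw [outerSurfaceCharge, h1, mul_inv_cancel_left₀ hl.ne', integral_Ioc_eq_integral_Ioo]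
  rfl

/-- The energy of the charge in a microscopic layer outside `Ω`. -/
theorem tendsto_outerLayer_energy (hQ : IsUnitCell e Q) (h : HasLipschitzNormal Ω n L)
    (hM : HasRegionBound e Q ρ M) (hmeas : ∀ l ∈ Ioc (0 : ℝ) 1, Measurable (ρ l))
    (hφ : Continuous φ) {τ : ℝ} (hτ : 0 < τ) :
    Tendsto (fun l => (∫ x in outerLayer Ω (l * τ), ρ l x * φ x) / l -
      ∫ s, φ s * outerSurfaceCharge n ρ l τ s ∂(surfaceMeasure Ω)) (𝓝[>] 0) (𝓝 0) := by
  have := h.isFiniteMeasure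
  obtain ⟨C, hC⟩ : ∃ C : ℝ≥0, ∀ᶠ l in 𝓝[>] (0 : ℝ),
      ∫⁻ x in outerLayer Ω (l * τ), ‖ρ l x‖ₑ ≤ C * ENNReal.ofReal l := by
    obtain ⟨C, hC⟩ := exists_forall_lintegral_outerLayer_le hQ h hM
    refine ⟨C * (τ.toNNReal + 1), ?_⟩
    filter_upwards [hC, eventually_mul_lt_nhdsGT_zero τ one_half_pos] with l h1 h2
    have h3 := (h1 τ.toNNReal (by rw [Real.coe_toNNReal _ hτ.le, mul_comm]; exact h2.le)).2
    rw [Real.coe_toNNReal _ hτ.le] at h3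
    exact_mod_cast h3
  obtain ⟨Cφ, hCφ0, hCφ⟩ := h.exists_forall_frontier_abs_le hφ
  have hb : Bornology.IsBounded (frontier Ω) := h.bounded.closure.subset frontier_subset_closure
  refine tendsto_zero_of_forall_eventually_le (A := 2 * (Cφ + 1) * C + 2 * C) (z := fun _ => 0)
    tendsto_const_nhds fun ε' hε' => ?_
  -- Keeps the factor `1 + ε` below `2`, so that the error is linear in `ε`.
  set ε := min ε' 1
  have hε : 0 < ε := by positivity
  have hε1 : ε ≤ 1 := min_le_right _ _
  obtain ⟨δ, hδ, hosc⟩ := exists_forall_mem_abs_sub_le hφ hb hε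
  obtain ⟨τ₀, hτ₀, hLτ, hcomp⟩ := h.layer_comparison hε
  filter_upwards [eventually_Ioc_nhdsGT_zero, eventually_mul_lt_nhdsGT_zero τ hτ₀,
    eventually_mul_lt_nhdsGT_zero τ hδ, hC] with l hl hlτ hlδ hCl
  have hl0 := hl.1
  rw [mul_comm] at hlτ hlδ
  obtain ⟨c1, c2⟩ := hcomp (l * τ) hlτ.le
  set μ := surfaceMeasure Ω
  set Dm := (μ.prod volume).restrict (frontier Ω ×ˢ Ioo 0 (l * τ)) with hDm
  have hmm := h.measurable_normalMap
  have hDs : MeasurableSet (frontier Ω ×ˢ Ioo 0 (l * τ)) :=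
    isClosed_frontier.measurableSet.prod measurableSet_Ioo
  -- every point of the layer is close to its foot point
  have hpt : ∀ z ∈ frontier Ω ×ˢ Ioo 0 (l * τ), |φ (normalMap n z) - φ z.1| ≤ ε := by
    rintro ⟨s, t⟩ ⟨hs, ht⟩
    rw [abs_sub_comm]
    refine hosc s hs _ ?_
    rw [dist_eq_norm, normalMap, sub_add_cancel_left, norm_neg, norm_smul, h.norm_eq_one s hs,
      mul_one, Real.norm_eq_abs, abs_of_pos ht.1]
    exact ht.2.trans hlδ
  have hφb : ∀ x ∈ outerLayer Ω (l * τ), |φ x| ≤ Cφ + 1 := by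
    intro x hx
    have hL := h.pos
    rw [← h.image_normalMap_layer (by nlinarith)] at hx
    obtain ⟨z, hz, rfl⟩ := hx
    have h1 := abs_le.1 (hpt z hz)
    have h2 := abs_le.1 (hCφ z.1 (frontier_subset_closure hz.1))
    rw [abs_le]
    constructor <;> linarith
  have hOm := measurableSet_outerLayer Ω (l * τ)
  have iρ : IntegrableOn (ρ l) (outerLayer Ω (l * τ)) :=
    ⟨(hmeas l hl).aestronglyMeasurable, hCl.trans_lt
      (ENNReal.mul_lt_top ENNReal.coe_lt_top ENNReal.ofReal_lt_top)⟩
  have Iρ : ∫ x in outerLayer Ω (l * τ), |ρ l x| ≤ C * l := by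
    have h1 := integral_norm_eq_lintegral_enorm iρ.1
    simp only [Real.norm_eq_abs] at h1
    rw [h1]
    refine ENNReal.toReal_le_of_le_ofReal (by positivity) ?_
    rw [ENNReal.ofReal_mul (NNReal.coe_nonneg C), ENNReal.ofReal_coe_nnreal]
    exact hCl
  have iρφ : IntegrableOn (fun x => ρ l x * φ x) (outerLayer Ω (l * τ)) :=
    Integrable.mul_bdd (c := Cφ + 1) iρ hφ.aestronglyMeasurable
      (ae_restrict_of_forall_mem hOm hφb)
  have Iρφ : ∫ x in outerLayer Ω (l * τ), |ρ l x * φ x| ≤ (Cφ + 1) * (C * l) := by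
    calc _ ≤ ∫ x in outerLayer Ω (l * τ), (Cφ + 1) * |ρ l x| := by
          refine setIntegral_mono_on iρφ.abs (iρ.abs.const_mul _) hOm fun x hx => ?_
          rw [abs_mul, mul_comm]
          gcongr
          exact hφb x hx
      _ ≤ _ := by rw [integral_const_mul]; gcongr
  -- flattening
  have k1 := abs_integral_sub_integral_le_of_le_smul hε.le c1 c2 iρφ
  rw [integral_map (f := fun x => ρ l x * φ x) hmm.aemeasurable
    ((hmeas l hl).mul hφ.measurable).aestronglyMeasurable] at k1
  have iρD : Integrable (fun z => ρ l (normalMap n z)) Dm :=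
    (((iρ.smul_measure ENNReal.ofReal_ne_top).mono_measure c2).comp_measurable hmm)
  have iρφD : Integrable (fun z => ρ l (normalMap n z) * φ (normalMap n z)) Dm :=
    (((iρφ.smul_measure ENNReal.ofReal_ne_top).mono_measure c2).comp_measurable hmm)
  have iρsD : Integrable (fun z => ρ l (normalMap n z) * φ z.1) Dm :=
    Integrable.mul_bdd (c := Cφ) iρD (hφ.comp continuous_fst).aestronglyMeasurable
      (ae_restrict_of_forall_mem hDs fun z hz => hCφ _ (frontier_subset_closure hz.1))
  have IρD : ∫ z, |ρ l (normalMap n z)| ∂Dm ≤ 2 * (C * l) := by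
    have h1 := integral_mono_measure c2 (f := fun x => |ρ l x|) (ae_of_all _ fun x => abs_nonneg _)
      (iρ.abs.smul_measure ENNReal.ofReal_ne_top)
    rw [integral_map (f := fun x => |ρ l x|) hmm.aemeasurable (hmeas l hl).norm.aestronglyMeasurable,
      integral_smul_measure, ENNReal.toReal_ofReal (by positivity), smul_eq_mul] at h1
    refine h1.trans ?_
    gcongr
    linarith
  have k2 : |(∫ z, ρ l (normalMap n z) * φ (normalMap n z) ∂Dm) -
      ∫ z, ρ l (normalMap n z) * φ z.1 ∂Dm| ≤ ε * (2 * (C * l)) := by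
    rw [← integral_sub iρφD iρsD]
    refine (abs_integral_le_integral_abs).trans ?_
    calc _ ≤ ∫ z, ε * |ρ l (normalMap n z)| ∂Dm := by
          refine integral_mono_ae (iρφD.sub iρsD).abs (iρD.abs.const_mul _)
            (ae_restrict_of_forall_mem hDs fun z hz => ?_)
          beta_reduce
          rw [← mul_sub, abs_mul, mul_comm]
          gcongr
          exact hpt z hz
      _ ≤ _ := by rw [integral_const_mul]; gcongr
  have k3 : ∫ z, ρ l (normalMap n z) * φ z.1 ∂Dm =
      l * ∫ s, φ s * outerSurfaceCharge n ρ l τ s ∂μ := by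
    have hμ : μ.restrict (frontier Ω) = μ := by
      simp only [μ, surfaceMeasure]
      rw [Measure.restrict_restrict isClosed_frontier.measurableSet, inter_self]
    rw [hDm, ← Measure.prod_restrict, hμ] at iρsD ⊢
    rw [integral_prod _ iρsD, ← integral_const_mul]
    refine integral_congr_ae (ae_of_all _ fun s => ?_)
    change ∫ t in Ioo 0 (l * τ), ρ l (normalMap n (s, t)) * φ s = _
    rw [integral_mul_const, ← mul_outerSurfaceCharge hl0 hτ.le]
    ring
  rw [k3] at k2
  have k4 : |(∫ x in outerLayer Ω (l * τ), ρ l x * φ x) -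
      l * ∫ s, φ s * outerSurfaceCharge n ρ l τ s ∂μ| ≤
      ε * (1 + ε) * ((Cφ + 1) * (C * l)) + ε * (2 * (C * l)) := by
    refine (abs_sub_le _ _ _).trans (add_le_add (k1.trans ?_) k2)
    gcongr
  rw [add_zero, div_sub' hl0.ne', abs_div, abs_of_pos hl0, div_le_iff₀ hl0]
  refine k4.trans ?_
  have hε2 : ε ≤ ε' := min_le_left _ _
  calc ε * (1 + ε) * ((Cφ + 1) * (C * l)) + ε * (2 * (C * l))
      ≤ ε * (1 + 1) * ((Cφ + 1) * (C * l)) + ε * (2 * (C * l)) := by gcongr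
    _ = ε * ((2 * (Cφ + 1) * C + 2 * C) * l) := by ring
    _ ≤ ε' * ((2 * (Cφ + 1) * C + 2 * C) * l) := by gcongr
    _ = _ := by ring

end

section

variable {e : Module.Basis (Fin 3) ℝ E3} {Q Ω : Set E3} {ρ : ℝ → E3 → ℝ} {M : ℝ≥0}
  {n : E3 → E3} {L : ℝ} {φ : E3 → ℝ} {G : E3 → E3}

/-- A concentrated charge is small, at microscopic scale, beyond a thick microscopic layer. -/
theorem exists_lintegral_concentrated_le (h : HasLipschitzNormal Ω n L)
    (hmeas : ∀ l ∈ Ioc (0 : ℝ) 1, Measurable (ρ l)) {d : ℝ} {g : ℝ → ℝ}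
    (hg : ∀ l ∈ Ioc (0 : ℝ) 1, ∀ s ∈ frontier Ω, ∀ t > d,
      Metric.infDist (s + (l * t) • n s) Ω = l * t → |ρ l (s + (l * t) • n s)| ≤ g t)
    {T : ℝ} (hT : 0 ≤ T) :
    ∃ K : ℝ≥0, ∀ l ∈ Ioc (0 : ℝ) 1, ∀ τ > max d 0,
      ∫⁻ x in {x | l * τ ≤ Metric.infDist x Ω ∧ Metric.infDist x Ω ≤ T}, ‖ρ l x‖ₑ ≤
        K * (ENNReal.ofReal l * ∫⁻ t in Ici τ, ‖g t‖ₑ) := by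
  have := h.isFiniteMeasure
  obtain ⟨K, hK⟩ := h.tube_comparison hT
  refine ⟨K * ((surfaceMeasure Ω) univ).toNNReal, fun l hl τ hτ => ?_⟩
  have hl0 := hl.1
  have hτ0 : 0 < τ := (le_max_right _ _).trans_lt hτ
  have hτd : d < τ := (le_max_left _ _).trans_lt hτ
  have hmm := h.measurable_normalMap
  -- At thickness `T` the normals may cross. Only pairs whose height is the true distance to `Ω` are
  -- kept: they suffice to cover the set, and the concentration bound applies to them.
  set D : Set (E3 × ℝ) := (frontier Ω ×ˢ Icc (l * τ) T) ∩
    {z | Metric.infDist (normalMap n z) Ω = z.2}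
  have hD : MeasurableSet D :=
    (isClosed_frontier.measurableSet.prod measurableSet_Icc).inter (measurableSet_eq_fun
      ((Metric.continuous_infDist_pt Ω).measurable.comp hmm) measurable_snd)
  have hsub : {x | l * τ ≤ Metric.infDist x Ω ∧ Metric.infDist x Ω ≤ T} ⊆ normalMap n '' D := by
    rintro x ⟨h1, h2⟩
    have hx : x ∉ Ω := fun hx => by
      rw [Metric.infDist_zero_of_mem hx] at h1
      have := mul_pos hl0 hτ0
      linarith
    obtain ⟨s, hs, hxs⟩ := h.exterior x hx
    refine ⟨(s, Metric.infDist x Ω), ⟨⟨hs, h1, h2⟩, ?_⟩, hxs.symm⟩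
    change Metric.infDist (s + Metric.infDist x Ω • n s) Ω = Metric.infDist x Ω
    rw [← hxs]
  have h1 := hK hD (fun z hz => ⟨hz.1.1, by
    have := mul_pos hl0 hτ0
    have h3 := hz.1.2.1
    exact (show -T ≤ z.2 by linarith), hz.1.2.2⟩) hsub
  refine (lintegral_mono' h1 le_rfl).trans ?_
  rw [lintegral_smul_measure, lintegral_map (hmeas l hl).enorm hmm, smul_eq_mul, ENNReal.coe_mul,
    mul_assoc, ENNReal.coe_toNNReal (measure_ne_top _ _)]
  gcongr
  calc ∫⁻ z in D, ‖ρ l (normalMap n z)‖ₑ ∂((surfaceMeasure Ω).prod volume)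
      ≤ ∫⁻ z in D, (Ici (l * τ)).indicator (fun t => ‖g (l⁻¹ * t)‖ₑ) z.2
          ∂((surfaceMeasure Ω).prod volume) := by
        refine setLIntegral_mono' hD fun z hz => ?_
        rw [indicator_of_mem (show z.2 ∈ Ici (l * τ) from hz.1.2.1)]
        have e1 : l * (l⁻¹ * z.2) = z.2 := mul_inv_cancel_left₀ hl0.ne' _
        have h2 := hg l hl z.1 hz.1.1 (l⁻¹ * z.2) (hτd.trans_le (by
          rw [le_inv_mul_iff₀ hl0]; exact hz.1.2.1))
        rw [e1] at h2
        have h3 := h2 hz.2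
        rw [← ofReal_norm, ← ofReal_norm]
        exact ENNReal.ofReal_le_ofReal (h3.trans (le_abs_self _))
    _ ≤ ∫⁻ z, (Ici (l * τ)).indicator (fun t => ‖g (l⁻¹ * t)‖ₑ) z.2
          ∂((surfaceMeasure Ω).prod volume) := setLIntegral_le_lintegral _ _
    -- As an inequality, Tonelli's theorem needs no measurability of `g`.
    _ ≤ ∫⁻ s, ∫⁻ t, (Ici (l * τ)).indicator (fun t => ‖g (l⁻¹ * t)‖ₑ) t ∂volume
          ∂(surfaceMeasure Ω) := lintegral_prod_le _
    _ = (surfaceMeasure Ω) univ * (ENNReal.ofReal l * ∫⁻ t in Ici τ, ‖g t‖ₑ) := by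
        rw [lintegral_const, mul_comm]
        congr 1
        have h4 : ∀ t, (Ici (l * τ)).indicator (fun t => ‖g (l⁻¹ * t)‖ₑ) t =
            (Ici τ).indicator (fun t => ‖g t‖ₑ) (l⁻¹ * t) := fun t => by
          simp only [indicator, mem_Ici, le_inv_mul_iff₀ hl0]
        simp only [h4]
        rw [← lintegral_indicator measurableSet_Ici]
        have hemb := (Homeomorph.mulLeft₀ l⁻¹ (inv_ne_zero hl0.ne')).measurableEmbedding
        have h5 := hemb.lintegral_map (μ := volume) ((Ici τ).indicator fun t => ‖g t‖ₑ)
        simp only [Homeomorph.coe_mulLeft₀] at h5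
        rw [← h5, Real.map_volume_mul_left (inv_ne_zero hl0.ne'), lintegral_smul_measure, inv_inv,
          abs_of_pos hl0, smul_eq_mul]

/-- Far from the boundary, at microscopic scale, there is little charge. -/
theorem exists_integral_outside_le (h : HasLipschitzNormal Ω n L)
    (hmeas : ∀ l ∈ Ioc (0 : ℝ) 1, Measurable (ρ l))
    (hL1 : ∀ l ∈ Ioc (0 : ℝ) 1, IntegrableOn (ρ l) Ωᶜ) (hconc : IsOneConcentrated Ω n ρ)
    (htight : IsTightOutside Ω ρ) {ε : ℝ} (hε : 0 < ε) :
    ∀ᶠ τ in atTop, ∀ l ∈ Ioc (0 : ℝ) 1,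
      ∫ x in {x | l * τ ≤ Metric.infDist x Ω}, |ρ l x| ≤ ε * l := by
  obtain ⟨d, hd, g, hgi, hg⟩ := hconc
  obtain ⟨R, hR⟩ := htight (ε / 2) (by positivity)
  obtain ⟨x₀, hx₀⟩ := h.nonempty
  -- Points of norm at most `R` are no farther than this from `x₀ ∈ Ω`; points beyond are left to
  -- tightness.
  set T := |R| + ‖x₀‖
  obtain ⟨K, hK⟩ := exists_lintegral_concentrated_le h hmeas hg (by positivity : 0 ≤ T)
  have h0 : Tendsto (fun τ : ℝ => (K : ℝ≥0∞) * ∫⁻ t in Ici τ, ‖g t‖ₑ) atTop (𝓝 0) := by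
    have h1 : Tendsto (fun τ : ℝ => volume.withDensity (fun t => ‖g t‖ₑ) (Ici τ)) atTop (𝓝 0) := by
      have : IsFiniteMeasure (volume.withDensity (fun t => ‖g t‖ₑ)) :=
        isFiniteMeasure_withDensity hgi.2.ne
      have h3 := tendsto_measure_iInter_atTop (μ := volume.withDensity fun t => ‖g t‖ₑ)
        (s := fun τ : ℝ => Ici τ) (fun _ => measurableSet_Ici.nullMeasurableSet) antitone_Ici
        ⟨0, measure_ne_top _ _⟩
      have h4 : ⋂ τ : ℝ, Ici τ = ∅ := eq_empty_of_forall_notMem fun x hx => by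
        have h5 : x + 1 ≤ x := mem_iInter.1 hx (x + 1)
        linarith
      rwa [h4, measure_empty] at h3
    have h2 := ENNReal.Tendsto.const_mul (a := (K : ℝ≥0∞)) h1 (Or.inr ENNReal.coe_ne_top)
    rw [mul_zero] at h2
    refine h2.congr fun τ => ?_
    rw [withDensity_apply _ measurableSet_Ici]
  filter_upwards [h0.eventually (gt_mem_nhds (by simpa using hε : 0 < ENNReal.ofReal (ε / 2))),
    eventually_gt_atTop (max d 0)] with τ hτ hτd l hl
  have hl0 := hl.1
  have hτ0 : 0 < τ := (le_max_right _ _).trans_lt hτd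
  have hinf : Measurable fun x => Metric.infDist x Ω := (Metric.continuous_infDist_pt Ω).measurable
  set X := {x | l * τ ≤ Metric.infDist x Ω ∧ Metric.infDist x Ω ≤ T}
  have hXm : MeasurableSet X :=
    (measurableSet_le measurable_const hinf).inter (measurableSet_le hinf measurable_const)
  have hΩm := IsOpen.measurableSet h.isOpen
  have hout : {x | l * τ ≤ Metric.infDist x Ω} ⊆ Ωᶜ := fun x hx hxΩ => by
    have h1 : l * τ ≤ Metric.infDist x Ω := hx
    rw [Metric.infDist_zero_of_mem hxΩ] at h1
    have := mul_pos hl0 hτ0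
    linarith
  have hsub : {x | l * τ ≤ Metric.infDist x Ω} ⊆ X ∪ Ωᶜ \ Metric.closedBall 0 R := fun x hx => by
    by_cases hxR : x ∈ Metric.closedBall 0 R
    · refine Or.inl ⟨hx, (Metric.infDist_le_dist_of_mem hx₀).trans ?_⟩
      rw [mem_closedBall_zero_iff] at hxR
      rw [dist_eq_norm]
      exact (norm_sub_le _ _).trans (add_le_add (hxR.trans (le_abs_self _)) le_rfl)
    · exact Or.inr ⟨hout hx, hxR⟩
  have hXΩ : X ⊆ Ωᶜ := fun x hx => hout hx.1
  have i1 : IntegrableOn (fun x => |ρ l x|) Ωᶜ := (hL1 l hl).abs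
  have b1 : ∫ x in X, |ρ l x| ≤ ε / 2 * l := by
    have e1 := integral_norm_eq_lintegral_enorm ((hL1 l hl).mono_set hXΩ).1
    simp only [Real.norm_eq_abs] at e1
    rw [e1]
    refine ENNReal.toReal_le_of_le_ofReal (by positivity) ?_
    refine (hK l hl τ hτd).trans ?_
    rw [ENNReal.ofReal_mul (by positivity), mul_left_comm, mul_comm]
    gcongr
  have b2 : ∫ x in Ωᶜ \ Metric.closedBall 0 R, |ρ l x| ≤ ε / 2 * l := by
    have := hR l hl
    rwa [integral_div, div_le_iff₀ hl0] at this
  calc _ ≤ ∫ x in X ∪ Ωᶜ \ Metric.closedBall 0 R, |ρ l x| :=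
        setIntegral_mono_set (i1.mono_set (union_subset hXΩ sdiff_subset))
          (ae_of_all _ fun x => abs_nonneg _) (LE.le.eventuallyLE hsub)
    _ ≤ (∫ x in X, |ρ l x|) + ∫ x in Ωᶜ \ Metric.closedBall 0 R, |ρ l x| := by
        rw [← union_sdiff_self, setIntegral_union disjoint_sdiff_right
          ((hΩm.compl.diff measurableSet_closedBall).diff hXm) (i1.mono_set hXΩ)
          (i1.mono_set (sdiff_subset.trans sdiff_subset))]
        refine add_le_add le_rfl (setIntegral_mono_set (i1.mono_set sdiff_subset)
          (ae_of_all _ fun x => abs_nonneg _) (LE.le.eventuallyLE sdiff_subset))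
    _ ≤ ε * l := by linarith

theorem integrable_mul_potential (hQ : IsUnitCell e Q) (h : HasLipschitzNormal Ω n L)
    (hM : HasRegionBound e Q ρ M) (hmeas : ∀ l ∈ Ioc (0 : ℝ) 1, Measurable (ρ l))
    (hL1 : ∀ l ∈ Ioc (0 : ℝ) 1, IntegrableOn (ρ l) Ωᶜ) (hφ : Continuous φ) {Cφ : ℝ}
    (hCφ : ∀ x ∈ Ωᶜ, |φ x| ≤ Cφ) {l : ℝ} (hl : l ∈ Ioc (0 : ℝ) 1) :
    Integrable (fun x => ρ l x * φ x) := by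
  have hΩm := IsOpen.measurableSet h.isOpen
  rw [← integrableOn_univ, ← union_compl_self Ω]
  refine (hM.integrableOn_mul hQ hl (hmeas l hl) h.bounded hφ).union ?_
  exact Integrable.mul_bdd (c := Cφ) (hL1 l hl) hφ.aestronglyMeasurable
    (ae_restrict_of_forall_mem hΩm.compl hCφ)

/-- The energy of the charge outside `Ω` is that of the outer surface charge. -/
theorem tendsto_outside_energy (hQ : IsUnitCell e Q) (h : HasLipschitzNormal Ω n L)
    (hM : HasRegionBound e Q ρ M) (hmeas : ∀ l ∈ Ioc (0 : ℝ) 1, Measurable (ρ l))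
    (hL1 : ∀ l ∈ Ioc (0 : ℝ) 1, IntegrableOn (ρ l) Ωᶜ) (hconc : IsOneConcentrated Ω n ρ)
    (htight : IsTightOutside Ω ρ) (hφ : Continuous φ) {Cφ : ℝ} (hCφ : ∀ x ∈ Ωᶜ, |φ x| ≤ Cφ)
    {F : Filter ℝ} (hF : F ≤ 𝓝[>] 0) {σh : ℝ → E3 → ℝ} {σo : E3 → ℝ}
    (hσh : ∀ h > (0 : ℝ), TendstoOnBoundary Ω F (fun l => outerSurfaceCharge n ρ l h) (σh h))
    (hσo : TendstoOnBoundary Ω atTop σh σo) :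
    Tendsto (fun l => (∫ x in Ωᶜ, ρ l x * φ x) / l) F
      (𝓝 (∫ s, φ s * σo s ∂(surfaceMeasure Ω))) := by
  rw [← tendsto_sub_nhds_zero_iff]
  -- Three errors `ε`, for flattening the layer, for `l → 0` at fixed height and for the height
  -- tending to infinity, and `|Cφ| ε` for the tail.
  refine tendsto_zero_of_forall_eventually_le (A := |Cφ| + 3) (z := fun _ => 0)
    tendsto_const_nhds fun ε hε => ?_
  have hnear : ∀ {a b : ℝ}, b ∈ Metric.ball a ε → |b - a| ≤ ε := fun hb =>
    (by simpa [Real.dist_eq] using hb : |_| < ε).le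
  -- The height is fixed before `l`; this is possible because the tail estimate is uniform in `l`.
  obtain ⟨τ, hτ1, hτ2, hτ0⟩ := ((exists_integral_outside_le h hmeas hL1 hconc htight hε).and
    (((hσo.2 φ hφ).eventually (Metric.ball_mem_nhds _ hε)).and (eventually_gt_atTop 0))).exists
  filter_upwards [hF eventually_Ioc_nhdsGT_zero,
    ((hσh τ hτ0).2 φ hφ).eventually (Metric.ball_mem_nhds _ hε),
    hF ((tendsto_outerLayer_energy hQ h hM hmeas hφ hτ0).eventually (Metric.ball_mem_nhds _ hε))]
    with l hl h1 h2
  have hl0 := hl.1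
  have hΩm := IsOpen.measurableSet h.isOpen
  have iφ := integrable_mul_potential hQ h hM hmeas hL1 hφ hCφ hl
  set X := {x | l * τ ≤ Metric.infDist x Ω}
  have hXm : MeasurableSet X :=
    measurableSet_le measurable_const (Metric.continuous_infDist_pt Ω).measurable
  have hXΩ : X ⊆ Ωᶜ := fun x hx hxΩ => by
    have h1 : l * τ ≤ Metric.infDist x Ω := hx
    rw [Metric.infDist_zero_of_mem hxΩ] at h1
    have := mul_pos hl0 hτ0
    linarith
  have hdisj : Disjoint (outerLayer Ω (l * τ)) X := disjoint_left.2 fun x hx hxX =>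
    (not_lt.2 (show l * τ ≤ Metric.infDist x Ω from hxX)) hx.2
  have hsplit : ∫ x in Ωᶜ, ρ l x * φ x = (∫ x in outerLayer Ω (l * τ), ρ l x * φ x) +
      ∫ x in X, ρ l x * φ x := by
    rw [← setIntegral_union hdisj hXm
      iφ.integrableOn iφ.integrableOn]
    refine (setIntegral_congr_set ?_).symm
    refine ((LE.le.eventuallyLE ?_).antisymm ?_)
    · refine union_subset (fun x hx hxΩ => ?_) hXΩ
      have : 0 < Metric.infDist x Ω := hx.1
      rw [Metric.infDist_zero_of_mem hxΩ] at this
      exact lt_irrefl _ this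
    · have hnull : ∀ᵐ x, x ∉ frontier Ω := measure_eq_zero_iff_ae_notMem.1 h.volume_frontier
      filter_upwards [hnull] with x hx hxΩ
      have hpos : 0 < Metric.infDist x Ω := h.infDist_pos_iff_notMem_closure.2 fun hc =>
        hx ⟨hc, by rw [IsOpen.interior_eq h.isOpen]; exact hxΩ⟩
      rcases lt_or_ge (Metric.infDist x Ω) (l * τ) with h3 | h3
      · exact Or.inl ⟨hpos, h3⟩
      · exact Or.inr h3
  have htail : |∫ x in X, ρ l x * φ x| ≤ |Cφ| * (ε * l) := by
    calc _ ≤ ∫ x in X, |ρ l x * φ x| := abs_integral_le_integral_abs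
      _ ≤ ∫ x in X, |Cφ| * |ρ l x| := by
          refine setIntegral_mono_on iφ.abs.integrableOn
            (((hL1 l hl).mono_set hXΩ).abs.const_mul _) hXm fun x hx => ?_
          rw [abs_mul, mul_comm]
          exact mul_le_mul_of_nonneg_right ((hCφ x (hXΩ hx)).trans (le_abs_self _)) (abs_nonneg _)
      _ ≤ _ := by rw [integral_const_mul]; gcongr; exact hτ1 l hl
  have h1' := hnear h1
  have h2' := hnear h2
  have h3' := hnear hτ2
  rw [sub_zero] at h2'
  have h4' : |(∫ x in X, ρ l x * φ x) / l| ≤ |Cφ| * ε := by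
    rw [abs_div, abs_of_pos hl0, div_le_iff₀ hl0]; linarith
  rw [hsplit, add_div]
  rw [abs_le] at h1' h2' h3' h4' ⊢
  constructor <;> linarith

end

/-! ### Weak convergence in `L²` -/

section WeakConvergence

variable {α : Type*} [MeasurableSpace α] {μ : Measure α}

theorem integral_mul_eq_inner_toLp {f g : α → ℝ} (hf : MemLp f 2 μ) (hg : MemLp g 2 μ) :
    ∫ x, f x * g x ∂μ = inner ℝ (hf.toLp f) (hg.toLp g) := by
  rw [L2.inner_def]
  refine integral_congr_ae ?_
  filter_upwards [hf.coeFn_toLp, hg.coeFn_toLp] with x h1 h2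
  rw [h1, h2, real_inner_eq_re_inner ℝ, RCLike.inner_apply]
  simp [mul_comm]

theorem norm_toLp_le {f : α → ℝ} (hf : MemLp f 2 μ) {C : ℝ≥0} (hC : eLpNorm f 2 μ ≤ C) :
    ‖hf.toLp f‖ ≤ C := by
  rw [Lp.norm_toLp]
  exact ENNReal.toReal_le_of_le_ofReal C.2 (by simpa using hC)

/-- Bounded families in `L²` converge weakly as soon as they converge against test functions
without common orthogonal vectors. -/
theorem tendsto_integral_mul_of_forall_orthogonal {ι : Type*} {F : Filter ι} {u : ι → α → ℝ}
    {C : ℝ≥0} (hu : ∀ᶠ i in F, MemLp (u i) 2 μ ∧ eLpNorm (u i) 2 μ ≤ C) {u₀ : α → ℝ}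
    (hu₀ : MemLp u₀ 2 μ) {S : Set (α → ℝ)} (hS : ∀ v ∈ S, MemLp v 2 μ)
    (hlim : ∀ v ∈ S, Tendsto (fun i => ∫ x, u i x * v x ∂μ) F (𝓝 (∫ x, u₀ x * v x ∂μ)))
    (horth : ∀ w, MemLp w 2 μ → (∀ v ∈ S, ∫ x, w x * v x ∂μ = 0) → w =ᵐ[μ] 0) {v : α → ℝ}
    (hv : MemLp v 2 μ) :
    Tendsto (fun i => ∫ x, u i x * v x ∂μ) F (𝓝 (∫ x, u₀ x * v x ∂μ)) := by
  classical
  set U : ι → Lp ℝ 2 μ := fun i => if h : MemLp (u i) 2 μ then h.toLp (u i) else 0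
  have hUC : ∀ᶠ i in F, ‖U i‖ ≤ C := by
    filter_upwards [hu] with i hi
    simp only [U, dif_pos hi.1]
    exact norm_toLp_le hi.1 hi.2
  have hUv : ∀ w (hw : MemLp w 2 μ), (fun i => ∫ x, u i x * w x ∂μ) =ᶠ[F]
      fun i => inner ℝ (U i) (hw.toLp w) := by
    intro w hw
    filter_upwards [hu] with i hi
    simp only [U, dif_pos hi.1]
    exact integral_mul_eq_inner_toLp hi.1 hw
  set K : Submodule ℝ (Lp ℝ 2 μ) := Submodule.span ℝ {w | ∃ v ∈ S, ∃ hv : MemLp v 2 μ, w = hv.toLp v}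
  have hK : K.topologicalClosure = ⊤ := by
    -- In a Hilbert space, a subspace with trivial orthogonal complement is dense.
    rw [Submodule.topologicalClosure_eq_top_iff, Submodule.eq_bot_iff]
    intro w hw
    have h1 : (w : α → ℝ) =ᵐ[μ] 0 := by
      refine horth w (Lp.memLp w) fun v hv => ?_
      rw [integral_mul_eq_inner_toLp (Lp.memLp w) (hS v hv), Lp.toLp_coeFn, real_inner_comm]
      exact (Submodule.mem_orthogonal _ _).1 hw _ (Submodule.subset_span ⟨v, hv, hS v hv, rfl⟩)
    exact (Lp.eq_zero_iff_ae_eq_zero).2 h1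
  have hKlim : ∀ w ∈ K, Tendsto (fun i => inner ℝ (U i) w) F (𝓝 (inner ℝ (hu₀.toLp u₀) w)) := by
    intro w hw
    induction hw using Submodule.span_induction with
    | mem w hw =>
      obtain ⟨v, hv, hvm, rfl⟩ := hw
      have h1 := (hlim v hv).congr' (hUv v hvm)
      rwa [integral_mul_eq_inner_toLp hu₀ hvm] at h1
    | zero => simpa only [inner_zero_right] using tendsto_const_nhds
    | add a b _ _ ha hb =>
      simp only [inner_add_right]
      exact ha.add hb
    | smul c a _ ha =>
      simp only [real_inner_smul_right]
      exact ha.const_mul c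
  rw [tendsto_congr' (hUv v hv), integral_mul_eq_inner_toLp hu₀ hv, Metric.tendsto_nhds]
  intro ε hε
  set B := (C : ℝ) + ‖hu₀.toLp u₀‖ + 1
  have hB : 0 < B := by positivity
  have hvK : hv.toLp v ∈ closure (K : Set (Lp ℝ 2 μ)) := by
    rw [← Submodule.topologicalClosure_coe, hK]; trivial
  obtain ⟨w, hw, hvw⟩ := Metric.mem_closure_iff.1 hvK (ε / 2 / B) (by positivity)
  filter_upwards [hUC, (hKlim w hw).eventually (Metric.ball_mem_nhds _ (half_pos hε))] with i h1 h2
  have h2 : |inner ℝ (U i) w - inner ℝ (hu₀.toLp u₀) w| < ε / 2 := h2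
  rw [Real.dist_eq]
  have e1 : inner ℝ (U i) (hv.toLp v) - inner ℝ (hu₀.toLp u₀) (hv.toLp v) =
      inner ℝ (U i - hu₀.toLp u₀) (hv.toLp v - w) +
        (inner ℝ (U i) w - inner ℝ (hu₀.toLp u₀) w) := by
    simp only [inner_sub_left, inner_sub_right]; ring
  have h3 : |inner ℝ (U i - hu₀.toLp u₀) (hv.toLp v - w)| ≤ B * (ε / 2 / B) := by
    refine (abs_real_inner_le_norm _ _).trans (mul_le_mul ?_ ?_ (norm_nonneg _) hB.le)
    · exact (norm_sub_le _ _).trans (by linarith)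
    · rw [← dist_eq_norm]; exact hvw.le
  rw [mul_div_cancel₀ _ hB.ne'] at h3
  rw [e1]
  exact (abs_add_le _ _).trans_lt (by linarith)

/-- Bounded sequences in `L²` have weakly convergent subsequences. -/
theorem exists_subseq_tendsto_integral_mul [IsSeparable μ] {u : ℕ → α → ℝ} {C : ℝ≥0}
    (hu : ∀ᶠ k in atTop, MemLp (u k) 2 μ ∧ eLpNorm (u k) 2 μ ≤ C) :
    ∃ m : ℕ → ℕ, StrictMono m ∧ ∃ w : α → ℝ, MemLp w 2 μ ∧ ∀ v, MemLp v 2 μ →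
      Tendsto (fun k => ∫ x, u (m k) x * v x ∂μ) atTop (𝓝 (∫ x, w x * v x ∂μ)) := by
  classical
  have : Fact ((2 : ℝ≥0∞) ≠ ∞) := ⟨by norm_num⟩
  set U : ℕ → Lp ℝ 2 μ := fun k =>
    if h : MemLp (u k) 2 μ ∧ eLpNorm (u k) 2 μ ≤ C then h.1.toLp (u k) else 0
  have hUC : ∀ k, ‖U k‖ ≤ C := by
    intro k
    by_cases h : MemLp (u k) 2 μ ∧ eLpNorm (u k) 2 μ ≤ C
    · simp only [U, dif_pos h]; exact norm_toLp_le h.1 h.2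
    · simp only [U, dif_neg h, norm_zero]; exact C.2
  -- The Riesz isomorphism turns bounded vectors into bounded functionals, for which sequential
  -- Banach–Alaoglu holds because the space is separable.
  set T : ℕ → WeakDual ℝ (Lp ℝ 2 μ) := fun k =>
    StrongDual.toWeakDual (InnerProductSpace.toDual ℝ _ (U k))
  obtain ⟨Λ, -, m, hm, hlim⟩ := WeakDual.isSeqCompact_closedBall ℝ (Lp ℝ 2 μ) 0 (C : ℝ)
    (x := T) (fun k => by
      simp only [T, mem_preimage, mem_closedBall_zero_iff]
      exact ((InnerProductSpace.toDual ℝ (Lp ℝ 2 μ)).norm_map (U k)).trans_le (hUC k))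
  set w : Lp ℝ 2 μ := (InnerProductSpace.toDual ℝ _).symm (WeakDual.toStrongDual Λ)
  refine ⟨m, hm, w, Lp.memLp w, fun v hv => ?_⟩
  have h1 := (WeakDual.eval_continuous (hv.toLp v)).tendsto Λ |>.comp hlim
  have h2 : Λ (hv.toLp v) = ∫ x, (w : α → ℝ) x * v x ∂μ := by
    rw [integral_mul_eq_inner_toLp (Lp.memLp w) hv, Lp.toLp_coeFn,
      InnerProductSpace.toDual_symm_apply]
    rfl
  rw [h2] at h1
  refine h1.congr' ?_
  filter_upwards [hm.tendsto_atTop.eventually hu] with k hk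
  rw [integral_mul_eq_inner_toLp hk.1 hv]
  simp only [Function.comp, T, U, dif_pos hk]
  exact InnerProductSpace.toDual_apply_apply ..

end WeakConvergence

/-! ### Unfolding and two-scale test functions -/

section

variable {e : Module.Basis (Fin 3) ℝ E3} {Q Ω : Set E3} {ρ : ℝ → E3 → ℝ} {M : ℝ≥0}
  {n : E3 → E3} {L : ℝ}

theorem IsUnitCell.ae_prod_cellMeasure (hQ : IsUnitCell e Q) (μ : Measure E3) [SFinite μ] :
    ∀ᵐ z ∂(μ.prod (IsUnitCell.cellMeasure Q)), z.2 ∈ Q :=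
  Measure.quasiMeasurePreserving_snd.ae hQ.ae_cellMeasure

/-- A point and its unfolded image share a cell, so the preimage of a union of cells is that union
times everything, up to the null set where `y ∉ Q`. -/
theorem IsUnitCell.measurePreserving_unfold_region (hQ : IsUnitCell e Q) {l : ℝ} (hl : 0 < l)
    (A : Set Idx) : MeasurePreserving (hQ.unfold l)
      ((volume.restrict (region e Q l A)).prod (IsUnitCell.cellMeasure Q))
      (volume.restrict (region e Q l A)) := by
  have := hQ.isProbabilityMeasure_cellMeasure
  have h1 := (hQ.measurePreserving_unfold hl).restrict_preimage (hQ.measurableSet_region hl A)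
  have h2 : ((volume : Measure E3).prod (IsUnitCell.cellMeasure Q)).restrict
      (hQ.unfold l ⁻¹' region e Q l A) =
      (volume.restrict (region e Q l A)).prod (IsUnitCell.cellMeasure Q) := by
    nth_rewrite 2 [← Measure.restrict_univ (μ := cellMeasure Q)]
    rw [Measure.prod_restrict]
    refine Measure.restrict_congr_set ?_
    filter_upwards [hQ.ae_prod_cellMeasure volume] with z hz
    refine propext ?_
    change hQ.unfold l z ∈ region e Q l A ↔ z ∈ region e Q l A ×ˢ univ
    rw [mem_prod, hQ.mem_region_iff hl, hQ.mem_region_iff hl]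
    simp [hQ.index_unfold hl z.1 hz]
  rwa [h2] at h1

/-- All cells that meet a bounded set stay in a fixed ball. -/
theorem IsUnitCell.exists_region_meetingCells_subset (hQ : IsUnitCell e Q) {X : Set E3}
    (hX : Bornology.IsBounded X) :
    ∃ R : ℝ, ∀ l ∈ Ioc (0 : ℝ) 1, region e Q l (meetingCells e Q l X) ⊆ Metric.closedBall 0 R := by
  obtain ⟨D, hD0, hD⟩ := hQ.exists_norm_le
  obtain ⟨R, hR⟩ := hX.exists_norm_le
  refine ⟨R + 2 * D, fun l hl x hx => ?_⟩
  obtain ⟨y, hy, hxy⟩ := hQ.exists_dist_le_of_mem_region_meetingCells hD hl.1 hx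
  rw [mem_closedBall_zero_iff]
  rw [dist_eq_norm] at hxy
  have : 2 * D * l ≤ 2 * D := mul_le_of_le_one_right (by positivity) hl.2
  linarith [norm_le_norm_add_norm_sub y x, norm_sub_rev x y, hR y hy]

/-- `Ω` is enlarged to the union of the cells that meet it, where unfolding preserves volume; these
cells stay in a ball independent of `l`. -/
theorem exists_memLp_unfold (hQ : IsUnitCell e Q) (hM : HasRegionBound e Q ρ M)
    (hmeas : ∀ l ∈ Ioc (0 : ℝ) 1, Measurable (ρ l)) (hΩ : Bornology.IsBounded Ω) :
    ∃ C : ℝ≥0, ∀ l ∈ Ioc (0 : ℝ) 1,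
      MemLp (fun z => ρ l (hQ.unfold l z)) 2 ((volume.restrict Ω).prod (IsUnitCell.cellMeasure Q)) ∧
      eLpNorm (fun z => ρ l (hQ.unfold l z)) 2 ((volume.restrict Ω).prod (IsUnitCell.cellMeasure Q)) ≤ C := by
  have := hQ.isProbabilityMeasure_cellMeasure
  obtain ⟨R, hR⟩ := hQ.exists_region_meetingCells_subset hΩ
  have hfin : ((M : ℝ≥0∞) * volume (Metric.closedBall (0 : E3) R)) ^ (1 / 2 : ℝ) ≠ ∞ :=
    ENNReal.rpow_ne_top_of_nonneg (by norm_num)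
      (ENNReal.mul_ne_top ENNReal.coe_ne_top measure_closedBall_lt_top.ne)
  refine ⟨(((M : ℝ≥0∞) * volume (Metric.closedBall (0 : E3) R)) ^ (1 / 2 : ℝ)).toNNReal,
    fun l hl => ?_⟩
  have hb : eLpNorm (fun z => ρ l (hQ.unfold l z)) 2 ((volume.restrict Ω).prod (IsUnitCell.cellMeasure Q)) ≤
      ((M : ℝ≥0∞) * volume (Metric.closedBall (0 : E3) R)) ^ (1 / 2 : ℝ) := by
    rw [eLpNorm_two_eq]
    gcongr
    set A := meetingCells e Q l Ω
    calc _ ≤ ∫⁻ z, ‖ρ l (hQ.unfold l z)‖ₑ ^ 2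
          ∂((volume.restrict (region e Q l A)).prod (IsUnitCell.cellMeasure Q)) := by
          refine lintegral_mono' (Measure.prod_mono (Measure.restrict_mono_set _ ?_) le_rfl) le_rfl
          exact hQ.subset_region_meetingCells hl.1 Ω
      _ = ∫⁻ x in region e Q l A, ‖ρ l x‖ₑ ^ 2 :=
          (hQ.measurePreserving_unfold_region hl.1 A).lintegral_comp
            ((hmeas l hl).enorm.pow_const 2)
      _ ≤ _ := (hM l hl A).1.trans (by gcongr; exact hR l hl)
  refine ⟨⟨((hmeas l hl).comp (hQ.measurable_unfold l)).aestronglyMeasurable,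
    hb.trans_lt (lt_top_iff_ne_top.2 hfin)⟩, ?_⟩
  rwa [ENNReal.coe_toNNReal hfin]

theorem inv_smul_unfold (hQ : IsUnitCell e Q) {l : ℝ} (hl : 0 < l) (z : E3 × E3) :
    l⁻¹ • hQ.unfold l z = z.2 + latticePoint e (hQ.index (l⁻¹ • z.1)) := by
  rw [IsUnitCell.unfold, corner, smul_add, smul_smul, smul_smul, inv_mul_cancel₀ hl.ne', one_smul,
    one_smul, add_comm]

/-- Testing at two scales is testing the unfolded function. -/
theorem tendsto_twoScale_sub_unfold (hQ : IsUnitCell e Q) (hM : HasRegionBound e Q ρ M)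
    (hmeas : ∀ l ∈ Ioc (0 : ℝ) 1, Measurable (ρ l)) (hΩ : Bornology.IsBounded Ω)
    (hΩm : MeasurableSet Ω) {ψ : E3 × E3 → ℝ} (hψ : Continuous ψ)
    (hψ0 : ∀ x ∉ Ω, ∀ y, ψ (x, y) = 0)
    (hper : ∀ x y i, ψ (x, y + latticePoint e i) = ψ (x, y)) :
    Tendsto (fun l : ℝ => (∫ x in Ω, ρ l x * ψ (x, l⁻¹ • x)) -
      ∫ z, ρ l (hQ.unfold l z) * ψ z ∂((volume.restrict Ω).prod (IsUnitCell.cellMeasure Q))) (𝓝[>] 0)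
      (𝓝 0) := by
  have := hQ.isProbabilityMeasure_cellMeasure
  obtain ⟨D, hD0, hD⟩ := hQ.exists_norm_le
  obtain ⟨R, hR⟩ := hQ.exists_region_meetingCells_subset hΩ
  have hXb : Bornology.IsBounded (Metric.closedBall (0 : E3) R ×ˢ Q) :=
    Metric.isBounded_closedBall.prod hQ.bounded
  obtain ⟨Cψ, hCψ⟩ : ∃ C, ∀ z ∈ Metric.closedBall (0 : E3) R ×ˢ Q, ‖ψ z‖ ≤ C := by
    obtain ⟨C, hC⟩ := (Metric.isCompact_of_isClosed_isBounded isClosed_closure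
      hXb.closure).exists_bound_of_continuousOn hψ.continuousOn
    exact ⟨C, fun z hz => hC z (subset_closure hz)⟩
  set V := (M : ℝ≥0∞) * volume (Metric.closedBall (0 : E3) R)
  have hV : V ≠ ∞ := ENNReal.mul_ne_top ENNReal.coe_ne_top measure_closedBall_lt_top.ne
  refine tendsto_zero_of_forall_eventually_le (A := V.toReal) (z := fun _ => 0) tendsto_const_nhds
    fun ε hε => ?_
  obtain ⟨δ, hδ, hosc⟩ := exists_forall_mem_abs_sub_le hψ hXb hε
  filter_upwards [eventually_Ioc_nhdsGT_zero, eventually_mul_lt_nhdsGT_zero (2 * D) hδ]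
    with l hl hlδ
  have hl0 := hl.1
  set A := meetingCells e Q l Ω
  set RA := region e Q l A
  have hRAm : MeasurableSet RA := hQ.measurableSet_region hl0 A
  have hΩR : Ω ⊆ RA := hQ.subset_region_meetingCells hl0 Ω
  set ν' := (volume.restrict RA).prod (IsUnitCell.cellMeasure Q)
  have hmp : MeasurePreserving (hQ.unfold l) ν' (volume.restrict RA) :=
    hQ.measurePreserving_unfold_region hl0 A
  have hT := (hmeas l hl).comp (hQ.measurable_unfold l)
  have iT : Integrable (fun z => ρ l (hQ.unfold l z)) ν' :=
    hmp.integrable_comp_of_integrable (hM.integrableOn hQ hl (hmeas l hl)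
      (Metric.isBounded_closedBall.subset (hR l hl)))
  have hae : ∀ᵐ z ∂ν', z.1 ∈ RA ∧ z.2 ∈ Q := by
    filter_upwards [hQ.ae_prod_cellMeasure (volume.restrict RA),
      Measure.quasiMeasurePreserving_fst.ae (ae_restrict_mem hRAm)] with z h1 h2 using ⟨h2, h1⟩
  have iTψ : Integrable (fun z => ρ l (hQ.unfold l z) * ψ z) ν' := by
    refine Integrable.mul_bdd (c := Cψ) iT hψ.aestronglyMeasurable ?_
    filter_upwards [hae] with z hz using hCψ z ⟨hR l hl hz.1, hz.2⟩
  have e1 : ∫ x in Ω, ρ l x * ψ (x, l⁻¹ • x) =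
      ∫ z, ρ l (hQ.unfold l z) * ψ (hQ.unfold l z, l⁻¹ • hQ.unfold l z) ∂ν' := by
    rw [← setIntegral_eq_of_subset_of_forall_sdiff_eq_zero hRAm hΩR
      (f := fun x => ρ l x * ψ (x, l⁻¹ • x)) fun x hx => by rw [hψ0 x hx.2, mul_zero]]
    have hm : Measurable fun x => ρ l x * ψ (x, l⁻¹ • x) :=
      (hmeas l hl).mul (hψ.comp (by fun_prop : Continuous fun x : E3 => (x, l⁻¹ • x))).measurable
    rw [← hmp.map_eq, integral_map hmp.measurable.aemeasurable hm.aestronglyMeasurable]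
  have e2 : ∫ z, ρ l (hQ.unfold l z) * ψ z ∂((volume.restrict Ω).prod (IsUnitCell.cellMeasure Q)) =
      ∫ z, ρ l (hQ.unfold l z) * ψ z ∂ν' := by
    have h1 : (volume.restrict Ω).prod (IsUnitCell.cellMeasure Q) = ν'.restrict (Ω ×ˢ univ) := by
      rw [← Measure.prod_restrict, Measure.restrict_restrict hΩm, inter_eq_left.2 hΩR,
        Measure.restrict_univ]
    rw [h1]
    refine setIntegral_eq_integral_of_forall_compl_eq_zero fun z hz => ?_
    rw [show z = (z.1, z.2) from rfl, hψ0 z.1 (fun h => hz ⟨h, trivial⟩), mul_zero]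
  have i1 : Integrable
      (fun z => ρ l (hQ.unfold l z) * ψ (hQ.unfold l z, l⁻¹ • hQ.unfold l z)) ν' :=
    hmp.integrable_comp_of_integrable (g := fun x => ρ l x * ψ (x, l⁻¹ • x))
      (hM.integrableOn_mul hQ hl (hmeas l hl)
      (Metric.isBounded_closedBall.subset (hR l hl)) (hψ.comp (by fun_prop)))
  rw [e1, e2, ← integral_sub i1 iTψ, add_zero]
  refine abs_integral_le_integral_abs.trans ?_
  calc _ ≤ ∫ z, ε * |ρ l (hQ.unfold l z)| ∂ν' := by
        refine integral_mono_ae (i1.sub iTψ).abs (iT.abs.const_mul ε) ?_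
        filter_upwards [hae] with z hz
        -- By periodicity the second argument may be replaced exactly by `y`; unfolding only moves
        -- the first one, by at most `2 D l`.
        rw [← mul_sub, abs_mul, mul_comm, inv_smul_unfold hQ hl0, hper]
        refine mul_le_mul_of_nonneg_right ?_ (abs_nonneg _)
        rw [abs_sub_comm]
        refine hosc z ⟨hR l hl hz.1, hz.2⟩ _ ?_
        rw [Prod.dist_eq, dist_self, max_eq_left dist_nonneg, dist_comm]
        exact (hQ.dist_unfold_le hD hl0 z.1 hz.2).trans_lt hlδ
    _ ≤ ε * V.toReal := by
        rw [integral_const_mul]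
        gcongr
        have h1 := integral_norm_eq_lintegral_enorm iT.1
        simp only [Real.norm_eq_abs] at h1
        rw [h1]
        refine ENNReal.toReal_mono hV ?_
        rw [hmp.lintegral_comp (hmeas l hl).enorm]
        exact (hM l hl A).2.trans (mul_le_mul_right (measure_mono (hR l hl)) _)

end

section

variable {e : Module.Basis (Fin 3) ℝ E3} {Q Ω : Set E3}

theorem latticePoint_add (i j : Idx) :
    latticePoint e (i + j) = latticePoint e i + latticePoint e j := by
  simp [latticePoint, add_smul, Finset.sum_add_distrib]

theorem IsUnitCell.finite_norm_latticePoint_le (hQ : IsUnitCell e Q) (r : ℝ) :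
    {i : Idx | ‖latticePoint e i‖ ≤ r}.Finite := by
  obtain ⟨D, hD0, hD⟩ := hQ.exists_norm_le
  refine (hQ.finite_setOf_cell_inter_nonempty one_pos
    (Metric.isBounded_closedBall (x := (0 : E3)) (r := r + D))).subset fun i hi => ?_
  obtain ⟨x, hx⟩ := hQ.cell_nonempty one_pos i
  refine ⟨x, hx, ?_⟩
  have h1 := IsUnitCell.norm_sub_corner_le hD one_pos hx
  rw [corner, one_smul] at h1
  have hi : ‖latticePoint e i‖ ≤ r := hi
  rw [mem_closedBall_zero_iff]
  linarith [norm_le_norm_add_norm_sub (latticePoint e i) x, norm_sub_rev x (latticePoint e i)]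

/-- The test functions for two-scale convergence. -/
def twoScaleTests (e : Module.Basis (Fin 3) ℝ E3) (Ω : Set E3) : Set (E3 × E3 → ℝ) :=
  {ψ | ContDiff ℝ (⊤ : ℕ∞) ψ ∧ (∃ K ⊆ Ω, IsCompact K ∧ ∀ x ∉ K, ∀ y, ψ (x, y) = 0) ∧
    ∀ x y i, ψ (x, y + latticePoint e i) = ψ (x, y)}

/-- The periodization of a function in its second variable. -/
noncomputable def periodize (e : Module.Basis (Fin 3) ℝ E3) (η : E3 × E3 → ℝ) (z : E3 × E3) : ℝ :=
  ∑ᶠ i : Idx, η (z.1, z.2 + latticePoint e i)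

/-- Compact support makes the sum locally finite, hence smooth, and a lattice shift merely relabels
its terms. -/
theorem periodize_mem_twoScaleTests (hQ : IsUnitCell e Q) {η : E3 × E3 → ℝ}
    (hη : ContDiff ℝ (⊤ : ℕ∞) η) (hηc : HasCompactSupport η) (hηΩ : tsupport η ⊆ Ω ×ˢ univ) :
    periodize e η ∈ twoScaleTests e Ω := by
  obtain ⟨R, hR⟩ := hηc.isCompact.isBounded.exists_norm_le
  refine ⟨?_, ⟨Prod.fst '' tsupport η, ?_, hηc.isCompact.image continuous_fst, ?_⟩, ?_⟩
  · rw [← contMDiff_iff_contDiff]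
    refine contMDiff_finsum (fun i => contMDiff_iff_contDiff.2 (hη.comp (by fun_prop))) ?_
    intro z₀
    refine ⟨Metric.ball z₀ 1, Metric.ball_mem_nhds _ one_pos,
      (hQ.finite_norm_latticePoint_le (R + (‖z₀‖ + 1))).subset ?_⟩
    rintro i ⟨z, hz, hzb⟩
    have h1 := hR _ (subset_tsupport η hz)
    have h2 : ‖z.2 + latticePoint e i‖ ≤ R := (norm_snd_le (z.1, z.2 + latticePoint e i)).trans h1
    have h3 : ‖z.2‖ ≤ ‖z₀‖ + 1 := by
      have h4 : ‖z - z₀‖ < 1 := by rwa [← mem_ball_iff_norm]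
      linarith [norm_snd_le z, norm_le_norm_add_norm_sub' z z₀]
    have h4 : latticePoint e i = (z.2 + latticePoint e i) - z.2 := by abel
    change ‖latticePoint e i‖ ≤ _
    rw [h4]
    exact (norm_sub_le _ _).trans (add_le_add h2 h3)
  · rintro _ ⟨z, hz, rfl⟩
    exact (hηΩ hz).1
  · intro x hx y
    rw [periodize, ← finsum_zero (α := Idx)]
    refine finsum_congr fun i => ?_
    by_contra hne
    exact hx ⟨_, subset_tsupport η hne, rfl⟩
  · intro x y i
    rw [periodize, periodize]
    refine (finsum_congr fun j => ?_).trans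
      (finsum_comp_equiv (Equiv.addLeft i) (f := fun j => η (x, y + latticePoint e j)))
    simp only [Equiv.coe_addLeft]
    rw [latticePoint_add, add_assoc]

theorem map_prod_restrict_cell (μ : Measure E3) [SFinite μ] (i : Idx) :
    (μ.prod (volume.restrict Q)).map (fun z => (z.1, latticePoint e i + z.2)) =
      μ.prod (volume.restrict (cell e Q 1 i)) := by
  have h1 := IsUnitCell.map_restrict_eq_smul_restrict_cell (e := e) (Q := Q) one_pos i
  simp only [corner, one_smul, one_pow, inv_one, ENNReal.ofReal_one] at h1
  rw [← h1]
  conv_rhs => rw [← Measure.map_id (μ := μ)]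
  rw [Measure.map_prod_map _ _ measurable_id (by fun_prop)]
  rfl

/-- Two-scale test functions have no common orthogonal function in `L²(Ω × Q)`. -/
theorem ae_eq_zero_of_forall_twoScaleTests (hQ : IsUnitCell e Q) (hΩo : IsOpen Ω)
    (hΩ : Bornology.IsBounded Ω) {w : E3 × E3 → ℝ}
    (hw : MemLp w 2 ((volume.restrict Ω).prod (volume.restrict Q)))
    (h0 : ∀ ψ ∈ twoScaleTests e Ω,
      ∫ z, w z * ψ z ∂((volume.restrict Ω).prod (volume.restrict Q)) = 0) :
    w =ᵐ[(volume.restrict Ω).prod (volume.restrict Q)] 0 := by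
  classical
  set ν := (volume.restrict Ω).prod (volume.restrict Q)
  have hΩm := hΩo.measurableSet
  have hfin : IsFiniteMeasure (volume.restrict Ω) :=
    ⟨by rw [Measure.restrict_apply_univ]; exact hΩ.measure_lt_top⟩
  have hfinQ : IsFiniteMeasure (volume.restrict Q) :=
    ⟨by rw [Measure.restrict_apply_univ]; exact hQ.bounded.measure_lt_top⟩
  -- a measurable version, extended periodically
  set w' := hw.aestronglyMeasurable.mk w
  have hw'm : Measurable w' := hw.aestronglyMeasurable.stronglyMeasurable_mk.measurable
  have hww' : w =ᵐ[ν] w' := hw.aestronglyMeasurable.ae_eq_mk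
  have hw' : Integrable w' ν := (hw.integrable one_le_two).congr hww'
  have hlat : Measurable fun i : Idx => latticePoint e i := measurable_of_countable _
  set W : E3 × E3 → ℝ := fun z => w' (z.1, z.2 - latticePoint e (hQ.index z.2))
  have hWm : Measurable W := hw'm.comp (measurable_fst.prodMk
    (measurable_snd.sub (hlat.comp (hQ.measurable_index.comp measurable_snd))))
  have hidx : ∀ i : Idx, ∀ y ∈ Q, hQ.index (latticePoint e i + y) = i := fun i y hy => by
    have h1 : latticePoint e i + y ∈ cell e Q 1 i := ⟨y, hy, by simp [corner]⟩
    rw [hQ.mem_cell_iff_index one_pos] at h1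
    simpa using h1
  have hWcell : ∀ i : Idx, ∀ z : E3 × E3, z.2 ∈ Q → W (z.1, latticePoint e i + z.2) = w' z :=
    fun i z hz => by simp only [W]; rw [hidx i z.2 hz, add_sub_cancel_left]
  have hQae : ∀ᵐ z ∂ν, z.2 ∈ Q :=
    Measure.quasiMeasurePreserving_snd.ae (ae_restrict_mem hQ.measurable)
  have hmap : ∀ i, ν.map (fun z => (z.1, latticePoint e i + z.2)) =
      ((volume : Measure E3).prod (volume : Measure E3)).restrict (Ω ×ˢ cell e Q 1 i) := fun i => by
    rw [map_prod_restrict_cell, Measure.prod_restrict]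
  have hmeasmap : ∀ i : Idx, Measurable fun z : E3 × E3 => (z.1, latticePoint e i + z.2) :=
    fun i => by fun_prop
  have hWint : ∀ i, IntegrableOn W (Ω ×ˢ cell e Q 1 i)
      ((volume : Measure E3).prod (volume : Measure E3)) := fun i => by
    rw [IntegrableOn, ← hmap, integrable_map_measure hWm.aestronglyMeasurable
      (hmeasmap i).aemeasurable]
    refine hw'.congr ?_
    filter_upwards [hQae] with z hz using (hWcell i z hz).symm
  have hloc : LocallyIntegrableOn W (Ω ×ˢ univ)
      ((volume : Measure E3).prod (volume : Measure E3)) := by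
    rintro ⟨x, z⟩ ⟨hx, -⟩
    refine ⟨Ω ×ˢ Metric.ball z 1, ?_, ?_⟩
    · refine mem_nhdsWithin_of_mem_nhds ((hΩo.prod Metric.isOpen_ball).mem_nhds ⟨hx, ?_⟩)
      exact Metric.mem_ball_self one_pos
    · have hfinI := hQ.finite_setOf_cell_inter_nonempty one_pos
        (Metric.isBounded_ball (x := z) (r := 1))
      refine IntegrableOn.mono_set ((integrableOn_finset_iUnion (s := hfinI.toFinset)
        (t := fun i => Ω ×ˢ cell e Q 1 i)).2 fun i _ => hWint i) ?_
      rintro ⟨x', z'⟩ ⟨hx', hz'⟩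
      refine mem_biUnion (x := hQ.index ((1 : ℝ)⁻¹ • z')) ?_ ⟨hx', hQ.mem_cell_index one_pos z'⟩
      exact hfinI.mem_toFinset.2 ⟨z', hQ.mem_cell_index one_pos z', hz'⟩
  -- Integrating `η` against the periodic extension `W` cell by cell, and shifting each cell back to
  -- `Q`, gives the pairing of `w` with the periodization of `η`, which vanishes. The fundamental
  -- lemma of the calculus of variations then applies on `Ω × ℝ³`, with no care for the boundary of
  -- `Q`.
  have hzero : ∀ᵐ z ∂((volume : Measure E3).prod (volume : Measure E3)),
      z ∈ Ω ×ˢ (univ : Set E3) → W z = 0 := by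
    refine (hΩo.prod isOpen_univ).ae_eq_zero_of_integral_contDiff_smul_eq_zero hloc
      fun η hη hηc hηΩ => ?_
    obtain ⟨R, hR⟩ := hηc.isCompact.isBounded.exists_norm_le
    have hfinI := hQ.finite_setOf_cell_inter_nonempty one_pos
      (Metric.isBounded_closedBall (x := (0 : E3)) (r := R))
    set I := hfinI.toFinset
    have hηI : ∀ i ∉ I, ∀ x, ∀ z ∈ cell e Q 1 i, η (x, z) = 0 := by
      intro i hi x z hz
      by_contra hne
      refine hi (hfinI.mem_toFinset.2 ⟨z, hz, ?_⟩)
      rw [mem_closedBall_zero_iff]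
      exact (norm_snd_le (x, z)).trans (hR _ (subset_tsupport η hne))
    obtain ⟨Cη, hCη⟩ := hη.continuous.bounded_above_of_compact_support hηc
    have hiη : ∀ i, IntegrableOn (fun z => η z • W z) (Ω ×ˢ cell e Q 1 i)
        ((volume : Measure E3).prod (volume : Measure E3)) := fun i =>
      Integrable.bdd_mul (c := Cη) (hWint i) hη.continuous.aestronglyMeasurable (ae_of_all _ hCη)
    have hcell : ∀ i, ∫ z in Ω ×ˢ cell e Q 1 i, η z • W z ∂(volume.prod volume) =
        ∫ z, w' z * η (z.1, z.2 + latticePoint e i) ∂ν := fun i => by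
      rw [← hmap, integral_map (f := fun z => η z • W z) (hmeasmap i).aemeasurable
        (hη.continuous.measurable.smul hWm).aestronglyMeasurable]
      refine integral_congr_ae ?_
      filter_upwards [hQae] with z hz
      rw [hWcell i z hz, smul_eq_mul, mul_comm, add_comm (latticePoint e i)]
    have hwi : ∀ i, Integrable (fun z => w' z * η (z.1, z.2 + latticePoint e i)) ν := fun i =>
      Integrable.mul_bdd (c := Cη) hw' (hη.continuous.comp (by fun_prop)).aestronglyMeasurable
        (ae_of_all _ fun z => hCη _)
    have e1 : ∫ z, η z • W z ∂((volume : Measure E3).prod (volume : Measure E3)) =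
        ∫ z in ⋃ i ∈ I, Ω ×ˢ cell e Q 1 i, η z • W z ∂(volume.prod volume) := by
      refine (setIntegral_eq_integral_of_forall_compl_eq_zero fun z hz => ?_).symm
      rw [smul_eq_mul]
      refine mul_eq_zero_of_left ?_ _
      by_contra hne
      have hzΩ : z.1 ∈ Ω := (hηΩ (subset_tsupport η hne)).1
      refine hz (mem_biUnion (x := hQ.index ((1 : ℝ)⁻¹ • z.2)) ?_
        ⟨hzΩ, hQ.mem_cell_index one_pos z.2⟩)
      by_contra hi
      exact hne (hηI _ hi z.1 z.2 (hQ.mem_cell_index one_pos z.2))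
    have e2 : ∫ z, w' z * periodize e η z ∂ν = 0 := by
      rw [← h0 _ (periodize_mem_twoScaleTests hQ hη hηc hηΩ)]
      refine integral_congr_ae ?_
      filter_upwards [hww'] with z hz
      rw [hz]
    rw [e1, integral_biUnion_finset _
      (fun i _ => hΩm.prod (hQ.measurableSet_cell one_pos i)) ?_ fun i _ => hiη i]
    · simp only [hcell]
      rw [← integral_finsetSum _ fun i _ => hwi i, ← e2]
      refine integral_congr_ae ?_
      filter_upwards [hQae] with z hz
      rw [← Finset.mul_sum, periodize, finsum_eq_sum_of_support_subset]
      intro i hi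
      by_contra hiI
      refine hi (hηI i hiI z.1 _ ⟨z.2, hz, ?_⟩)
      simp [corner, add_comm]
    · intro i _ j _ hij
      exact (hQ.pairwise_disjoint_cell one_pos hij).set_prod_right _ _
  have hz2 : ∀ᵐ z ∂ν, W z = 0 := by
    have h1 : ν = ((volume : Measure E3).prod (volume : Measure E3)).restrict (Ω ×ˢ Q) :=
      Measure.prod_restrict _ _
    rw [h1]
    filter_upwards [ae_restrict_of_ae hzero, ae_restrict_mem (hΩm.prod hQ.measurable)] with z hz hzm
      using hz ⟨hzm.1, trivial⟩
  filter_upwards [hww', hz2, hQae] with z h1 h2 h3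
  have h4 : hQ.index z.2 = 0 := by
    have := hidx 0 z.2 h3
    simpa [latticePoint] using this
  simp only [W, h4] at h2
  rw [h1, Pi.zero_apply, ← h2]
  simp [latticePoint]

end

/-! ### The two-scale limit and the polarization -/

section

variable {e : Module.Basis (Fin 3) ℝ E3} {Q Ω : Set E3} {ρ : ℝ → E3 → ℝ} {M : ℝ≥0}
  {n : E3 → E3} {L : ℝ}

/-- The measure on `Ω × Q` that is normalised on the unit cell. -/
noncomputable def twoScaleMeasure (Ω Q : Set E3) : Measure (E3 × E3) :=
  (volume.restrict Ω).prod (IsUnitCell.cellMeasure Q)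

theorem twoScaleMeasure_eq (hQ : IsUnitCell e Q) :
    twoScaleMeasure Ω Q = (volume Q)⁻¹ • (volume.restrict Ω).prod (volume.restrict Q) := by
  have hfinQ : IsFiniteMeasure (volume.restrict Q) :=
    ⟨by rw [Measure.restrict_apply_univ]; exact hQ.bounded.measure_lt_top⟩
  rw [twoScaleMeasure, IsUnitCell.cellMeasure, Measure.prod_smul_right]

theorem prod_eq_smul_twoScaleMeasure (hQ : IsUnitCell e Q) :
    (volume.restrict Ω).prod (volume.restrict Q) = volume Q • twoScaleMeasure Ω Q := by
  rw [twoScaleMeasure_eq hQ, smul_smul, ENNReal.mul_inv_cancel hQ.volume_ne_zero hQ.volume_ne_top,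
    one_smul]

theorem isFiniteMeasure_twoScaleMeasure (hQ : IsUnitCell e Q) (hΩ : Bornology.IsBounded Ω) :
    IsFiniteMeasure (twoScaleMeasure Ω Q) := by
  have := hQ.isProbabilityMeasure_cellMeasure
  have hfin : IsFiniteMeasure (volume.restrict Ω) :=
    ⟨by rw [Measure.restrict_apply_univ]; exact hΩ.measure_lt_top⟩
  rw [twoScaleMeasure]; infer_instance

theorem memLp_twoScaleMeasure_iff (hQ : IsUnitCell e Q) {w : E3 × E3 → ℝ} :
    MemLp w 2 (twoScaleMeasure Ω Q) ↔ MemLp w 2 (volume.restrict (Ω ×ˢ Q)) := by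
  have h1 : (volume : Measure (E3 × E3)).restrict (Ω ×ˢ Q) =
      (volume.restrict Ω).prod (volume.restrict Q) := (Measure.prod_restrict _ _).symm
  constructor
  · intro h
    rw [h1, prod_eq_smul_twoScaleMeasure hQ]
    exact h.smul_measure hQ.volume_ne_top
  · intro h
    rw [h1] at h
    rw [twoScaleMeasure_eq hQ]
    exact h.smul_measure (ENNReal.inv_ne_top.2 hQ.volume_ne_zero)

theorem memLp_of_mem_twoScaleTests (hQ : IsUnitCell e Q) (hΩ : Bornology.IsBounded Ω)
    (hΩm : MeasurableSet Ω) {ψ : E3 × E3 → ℝ} (hψ : ψ ∈ twoScaleTests e Ω) :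
    MemLp ψ 2 (twoScaleMeasure Ω Q) := by
  have := isFiniteMeasure_twoScaleMeasure hQ hΩ
  have hc := hψ.1.continuous
  obtain ⟨C, hC⟩ := (Metric.isCompact_of_isClosed_isBounded isClosed_closure
    (hΩ.prod hQ.bounded).closure).exists_bound_of_continuousOn hc.continuousOn
  refine MemLp.of_bound hc.aestronglyMeasurable C ?_
  have := hQ.isProbabilityMeasure_cellMeasure
  filter_upwards [hQ.ae_prod_cellMeasure (volume.restrict Ω),
    Measure.quasiMeasurePreserving_fst.ae (ae_restrict_mem hΩm)] with z h1 h2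
    using hC z (subset_closure ⟨h2, h1⟩)

theorem setIntegral_setAverage_eq (hQ : IsUnitCell e Q) {ρ₀ : E3 → E3 → ℝ}
    (hρ₀ : MemLp (Function.uncurry ρ₀) 2 (twoScaleMeasure Ω Q)) {ψ : E3 × E3 → ℝ}
    (hψ : MemLp ψ 2 (twoScaleMeasure Ω Q)) :
    ∫ x in Ω, ⨍ y in Q, ρ₀ x y * ψ (x, y) =
      ∫ z, Function.uncurry ρ₀ z * ψ z ∂(twoScaleMeasure Ω Q) := by
  have := hQ.isProbabilityMeasure_cellMeasure
  simp only [← IsUnitCell.integral_cellMeasure]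
  exact (integral_prod _ (hρ₀.integrable_mul hψ)).symm

/-- The two-scale limit is the weak limit of the unfolded functions. -/
theorem IsTwoScaleLimit.tendsto_integral_unfold (hQ : IsUnitCell e Q)
    (hM : HasRegionBound e Q ρ M) (hmeas : ∀ l ∈ Ioc (0 : ℝ) 1, Measurable (ρ l))
    (hΩ : Bornology.IsBounded Ω) (hΩo : IsOpen Ω) {F : Filter ℝ} (hF : F ≤ 𝓝[>] 0)
    {ρ₀ : E3 → E3 → ℝ} (hρ₀ : IsTwoScaleLimit e Q Ω ρ F ρ₀) {u : E3 × E3 → ℝ}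
    (hu : MemLp u 2 (twoScaleMeasure Ω Q)) :
    Tendsto (fun l => ∫ z, ρ l (hQ.unfold l z) * u z ∂(twoScaleMeasure Ω Q)) F
      (𝓝 (∫ z, Function.uncurry ρ₀ z * u z ∂(twoScaleMeasure Ω Q))) := by
  obtain ⟨C, hC⟩ := exists_memLp_unfold hQ hM hmeas hΩ
  have hρ₀L := (memLp_twoScaleMeasure_iff hQ).2 hρ₀.memLp
  -- Uniform boundedness and totality of the smooth periodic tests extend the convergence to every
  -- `L²` test.
  refine tendsto_integral_mul_of_forall_orthogonal (C := C) (S := twoScaleTests e Ω) ?_ hρ₀L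
    (fun ψ hψ => memLp_of_mem_twoScaleTests hQ hΩ hΩo.measurableSet hψ) (fun ψ hψ => ?_)
    (fun w hw h0 => ?_) hu
  · exact (eventually_Ioc_nhdsGT_zero.filter_mono hF).mono hC
  · obtain ⟨h1, ⟨K, hK, hKc, hK0⟩, h3⟩ := hψ
    have h4 := (tendsto_twoScale_sub_unfold hQ hM hmeas hΩ hΩo.measurableSet h1.continuous
      (fun x hx => hK0 x fun hxK => hx (hK hxK)) h3).mono_left hF
    have h5 := (hρ₀.tendsto ψ h1 ⟨K, hK, hKc, hK0⟩ h3).sub h4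
    rw [sub_zero, setIntegral_setAverage_eq hQ hρ₀L
      (memLp_of_mem_twoScaleTests hQ hΩ hΩo.measurableSet ⟨h1, ⟨K, hK, hKc, hK0⟩, h3⟩)] at h5
    refine h5.congr fun l => ?_
    rw [sub_sub_cancel]; rfl
  · rw [twoScaleMeasure_eq hQ]
    refine Measure.ae_smul_measure (ae_eq_zero_of_forall_twoScaleTests hQ hΩo hΩ ?_
      fun ψ hψ => ?_) _
    · have := (memLp_twoScaleMeasure_iff hQ).1 hw
      rwa [show (volume : Measure (E3 × E3)).restrict (Ω ×ˢ Q) =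
        (volume.restrict Ω).prod (volume.restrict Q) from (Measure.prod_restrict _ _).symm] at this
    · rw [prod_eq_smul_twoScaleMeasure hQ, integral_smul_measure, h0 ψ hψ, smul_zero]

theorem isTwoScaleLimit_of_tendsto_integral_unfold (hQ : IsUnitCell e Q)
    (hM : HasRegionBound e Q ρ M) (hmeas : ∀ l ∈ Ioc (0 : ℝ) 1, Measurable (ρ l))
    (hΩ : Bornology.IsBounded Ω) (hΩo : IsOpen Ω) {F : Filter ℝ} (hF : F ≤ 𝓝[>] 0)
    {w : E3 × E3 → ℝ} (hw : MemLp w 2 (twoScaleMeasure Ω Q))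
    (h : ∀ u, MemLp u 2 (twoScaleMeasure Ω Q) →
      Tendsto (fun l => ∫ z, ρ l (hQ.unfold l z) * u z ∂(twoScaleMeasure Ω Q)) F
        (𝓝 (∫ z, w z * u z ∂(twoScaleMeasure Ω Q)))) :
    IsTwoScaleLimit e Q Ω ρ F (Function.curry w) where
  memLp := (memLp_twoScaleMeasure_iff hQ).1 (by rwa [Function.uncurry_curry])
  tendsto ψ h1 h2 h3 := by
    have hψ := memLp_of_mem_twoScaleTests hQ hΩ hΩo.measurableSet ⟨h1, h2, h3⟩
    obtain ⟨K, hK, hKc, hK0⟩ := h2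
    have h4 := (tendsto_twoScale_sub_unfold hQ hM hmeas hΩ hΩo.measurableSet h1.continuous
      (fun x hx => hK0 x fun hxK => hx (hK hxK)) h3).mono_left hF
    have h5 := h4.add (h ψ hψ)
    rw [zero_add] at h5
    rw [setIntegral_setAverage_eq hQ (by rwa [Function.uncurry_curry]) hψ, Function.uncurry_curry]
    refine h5.congr fun l => ?_
    exact sub_add_cancel _ _

/-- The dipole test `⟪ψ(x), y⟫` is in general neither smooth nor periodic; square integrability is
all that the weak convergence of the unfolded charges asks. -/
theorem memLp_inner_snd (hQ : IsUnitCell e Q) {ψ : E3 → E3} (hψ : MemLp ψ 2 (volume.restrict Ω)) :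
    MemLp (fun z : E3 × E3 => (inner ℝ (ψ z.1) z.2 : ℝ)) 2 (twoScaleMeasure Ω Q) := by
  have := hQ.isProbabilityMeasure_cellMeasure
  obtain ⟨D, hD0, hD⟩ := hQ.exists_norm_le
  have h1 : MemLp (fun z : E3 × E3 => ψ z.1) 2 (twoScaleMeasure Ω Q) := hψ.comp_fst _
  refine MemLp.of_le_mul (c := D) h1 (h1.aestronglyMeasurable.inner
    continuous_snd.aestronglyMeasurable) ?_
  filter_upwards [hQ.ae_prod_cellMeasure (volume.restrict Ω)] with z hz
  rw [mul_comm]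
  exact (norm_inner_le_norm _ _).trans (mul_le_mul_of_nonneg_left (hD _ hz) (norm_nonneg _))

/-- Pairing with `⟪ψ(x), y⟫` is pairing the dipole moment with `ψ`. -/
theorem integral_mul_inner_snd (hQ : IsUnitCell e Q) {τ : E3 × E3 → ℝ}
    (hτ : MemLp τ 2 (twoScaleMeasure Ω Q)) (hΩ : Bornology.IsBounded Ω) {ψ : E3 → E3}
    (hψ : MemLp ψ 2 (volume.restrict Ω)) :
    ∫ z, τ z * (inner ℝ (ψ z.1) z.2 : ℝ) ∂(twoScaleMeasure Ω Q) =
      ∫ x in Ω, inner ℝ (ψ x) (⨍ y in Q, τ (x, y) • y) := by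
  have := hQ.isProbabilityMeasure_cellMeasure
  have := isFiniteMeasure_twoScaleMeasure (Ω := Ω) hQ hΩ
  obtain ⟨D, hD0, hD⟩ := hQ.exists_norm_le
  have hi := hτ.integrable_mul (memLp_inner_snd hQ hψ)
  refine (integral_prod _ hi).trans ?_
  have hτi : Integrable τ ((volume.restrict Ω).prod (IsUnitCell.cellMeasure Q)) :=
    hτ.integrable one_le_two
  have hi2 : Integrable (fun z : E3 × E3 => τ z • z.2)
      ((volume.restrict Ω).prod (IsUnitCell.cellMeasure Q)) := by
    refine Integrable.smul_bdd hτi D continuous_snd.aestronglyMeasurable ?_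
    filter_upwards [hQ.ae_prod_cellMeasure (volume.restrict Ω)] with z hz using hD _ hz
  refine integral_congr_ae ?_
  filter_upwards [hi2.prod_right_ae] with x hx
  rw [← IsUnitCell.integral_cellMeasure, ← integral_inner hx]
  refine integral_congr_ae (ae_of_all _ fun y => ?_)
  simp only [Pi.mul_apply, inner_smul_right]

/-- Cauchy–Schwarz for the normalised measure on the cell, where `‖y‖ ≤ D`, followed by integration
over `Ω`. -/
theorem memLp_polarization (hQ : IsUnitCell e Q) {ρ₀ : E3 → E3 → ℝ}
    (hρ₀ : MemLp (Function.uncurry ρ₀) 2 (twoScaleMeasure Ω Q)) :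
    MemLp (polarization Q ρ₀) 2 (volume.restrict Ω) := by
  have := hQ.isProbabilityMeasure_cellMeasure
  obtain ⟨D, hD0, hD⟩ := hQ.exists_norm_le
  have hp : polarization Q ρ₀ = fun x => ∫ y, ρ₀ x y • y ∂(IsUnitCell.cellMeasure Q) := by
    ext1 x; rw [polarization, IsUnitCell.integral_cellMeasure]
  have hm : AEStronglyMeasurable (fun z : E3 × E3 => Function.uncurry ρ₀ z • z.2)
      ((volume.restrict Ω).prod (IsUnitCell.cellMeasure Q)) :=
    hρ₀.aestronglyMeasurable.smul continuous_snd.aestronglyMeasurable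
  refine ⟨by rw [hp]; exact hm.integral_prod_right', ?_⟩
  have hρ₀m : AEStronglyMeasurable (Function.uncurry ρ₀)
      ((volume.restrict Ω).prod (IsUnitCell.cellMeasure Q)) := hρ₀.aestronglyMeasurable
  have hb : ∀ᵐ x ∂(volume.restrict Ω), ‖polarization Q ρ₀ x‖ₑ ^ 2 ≤
      ENNReal.ofReal D ^ 2 * ∫⁻ y, ‖ρ₀ x y‖ₑ ^ 2 ∂(IsUnitCell.cellMeasure Q) := by
    filter_upwards [hρ₀m.prodMk_left] with x hx
    rw [hp]
    have h1 : ‖∫ y, ρ₀ x y • y ∂(IsUnitCell.cellMeasure Q)‖ₑ ≤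
        ENNReal.ofReal D * ∫⁻ y, ‖ρ₀ x y‖ₑ ∂(IsUnitCell.cellMeasure Q) := by
      rw [← lintegral_const_mul' _ _ ENNReal.ofReal_ne_top]
      refine (enorm_integral_le_lintegral_enorm _).trans (lintegral_mono_ae ?_)
      filter_upwards [hQ.ae_cellMeasure] with y hy
      rw [enorm_smul, mul_comm]
      gcongr
      rw [← ofReal_norm]
      exact ENNReal.ofReal_le_ofReal (hD y hy)
    have h2 := lintegral_mul_le_eLpNorm (IsUnitCell.cellMeasure Q) (f := fun y => ‖ρ₀ x y‖ₑ)
      (g := fun _ => 1) hx.enorm aemeasurable_const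
    simp only [mul_one, one_pow, lintegral_one, measure_univ, ENNReal.one_rpow] at h2
    refine (pow_le_pow_left' (h1.trans (mul_le_mul_right h2 _)) 2).trans (le_of_eq ?_)
    rw [mul_pow, ← ENNReal.rpow_natCast (_ ^ _), ← ENNReal.rpow_mul]
    norm_num
  rw [eLpNorm_two_eq]
  refine ENNReal.rpow_lt_top_of_nonneg (by norm_num) (ne_of_lt ?_)
  refine (lintegral_mono_ae hb).trans_lt ?_
  rw [lintegral_const_mul' _ _ (by simp)]
  refine ENNReal.mul_lt_top (by simp) ?_
  have h3 : ∫⁻ z, ‖Function.uncurry ρ₀ z‖ₑ ^ 2 ∂(twoScaleMeasure Ω Q) < ∞ := by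
    have h4 := hρ₀.2
    rw [eLpNorm_two_eq] at h4
    exact (ENNReal.rpow_lt_top_iff_of_pos (by norm_num)).1 h4
  refine lt_of_le_of_lt (le_of_eq ?_) h3
  exact (lintegral_prod _ (hρ₀m.enorm.pow_const 2)).symm

/-- The polarization of the two-scale limit is the weak limit of the cell polarizations. -/
theorem tendsto_inner_cellPolarization (hQ : IsUnitCell e Q) (h : HasLipschitzNormal Ω n L)
    (hM : HasRegionBound e Q ρ M) (hmeas : ∀ l ∈ Ioc (0 : ℝ) 1, Measurable (ρ l))
    {F : Filter ℝ} (hF : F ≤ 𝓝[>] 0)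
    {ρ₀ : E3 → E3 → ℝ} (hρ₀ : IsTwoScaleLimit e Q Ω ρ F ρ₀) {ψ : E3 → E3}
    (hψ : MemLp ψ 2 (volume.restrict Ω)) :
    Tendsto (fun l => ∫ x in Ω, (inner ℝ (ψ x) (cellPolarization e Q Ω ρ l x) : ℝ)) F
      (𝓝 (∫ x in Ω, inner ℝ (ψ x) (polarization Q ρ₀ x))) := by
  obtain ⟨D, hD0, hD⟩ := hQ.exists_norm_le
  obtain ⟨C, hC⟩ := exists_memLp_unfold hQ hM hmeas h.bounded
  have hΩm := IsOpen.measurableSet h.isOpen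
  have hρ₀L := (memLp_twoScaleMeasure_iff hQ).2 hρ₀.memLp
  have h1 := hρ₀.tendsto_integral_unfold hQ hM hmeas h.bounded h.isOpen hF (memLp_inner_snd hQ hψ)
  rw [integral_mul_inner_snd hQ hρ₀L h.bounded hψ] at h1
  -- Unfolding produces the dipoles of all cells, that is, the cell polarization with `univ` as
  -- domain, for which every cell is full. The difference lives on the partial cells, whose volume
  -- vanishes.
  have h2 := (h.tendsto_setIntegral_inner_zero hψ
    (Y := fun l => Ω \ region e Q l (fullCells e Q Ω l))
    (fun l hl => hΩm.diff (hQ.measurableSet_region hl.1 _)) (fun l => sdiff_subset) (by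
      refine tendsto_of_tendsto_of_tendsto_of_le_of_le' tendsto_const_nhds
        (h.tendsto_volume_boundaryTube (κ := 2 * D) (by positivity))
        (Eventually.of_forall fun _ => zero_le) ?_
      filter_upwards [self_mem_nhdsWithin] with l hl
      rw [hQ.diff_region_fullCells hl]
      exact measure_mono (iUnion₂_subset fun i hi =>
        inter_subset_left.trans (IsUnitCell.cell_subset_boundaryTube h hD hl hi)))
    (fun l hl => norm_cellPolarization_le (Ω := univ) hQ hM hD hD0.le hl)).mono_left hF
  have h3 := h1.sub h2
  rw [sub_zero] at h3
  refine h3.congr' ?_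
  filter_upwards [hF eventually_Ioc_nhdsGT_zero] with l hl
  have hl0 := hl.1
  have e1 : ∀ x, ⨍ y in Q, ρ l (hQ.unfold l (x, y)) • y = cellPolarization e Q univ ρ l x := by
    intro x
    rw [cellPolarization_eq_of_mem hQ hl0 (subset_univ _) (hQ.mem_cell_index hl0 x),
      hQ.setAverage_cell hl0]
    congr 1
    ext1 y
    rw [add_sub_cancel_left, inv_smul_smul₀ hl0.ne']
    rfl
  have hi := integrableOn_inner_cellPolarization (ρ := ρ) (Ω := Ω) hQ h hM hψ hl
  set RF := region e Q l (fullCells e Q Ω l)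
  have hRΩ : RF ⊆ Ω := region_fullCells_subset
  have hRm : MeasurableSet RF := hQ.measurableSet_region hl0 _
  have hfin : IsFiniteMeasure (volume.restrict Ω) :=
    ⟨by rw [Measure.restrict_apply_univ]; exact h.bounded.measure_lt_top⟩
  have hi' : IntegrableOn (fun x => (inner ℝ (ψ x) (cellPolarization e Q univ ρ l x) : ℝ)) Ω := by
    refine Integrable.mono' (g := fun x => ‖ψ x‖ * (D * M))
      ((hψ.integrable one_le_two).norm.mul_const _)
      (hψ.1.inner (measurable_cellPolarization hQ hl0).aestronglyMeasurable)
      (ae_of_all _ fun x => (norm_inner_le_norm _ _).trans ?_)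
    gcongr
    exact norm_cellPolarization_le hQ hM hD hD0.le hl x
  rw [integral_mul_inner_snd hQ (hC l hl).1 h.bounded hψ]
  simp only [e1]
  have e2 : ∀ f : E3 → ℝ, IntegrableOn f Ω →
      ∫ x in Ω, f x = (∫ x in RF, f x) + ∫ x in Ω \ RF, f x := fun f hf => by
    rw [← setIntegral_union disjoint_sdiff_right (hΩm.diff hRm) (hf.mono_set hRΩ)
      (hf.mono_set sdiff_subset), union_sdiff_cancel hRΩ]
  rw [e2 _ hi', e2 _ hi, add_sub_cancel_right]
  have e3 : ∫ x in Ω \ RF, (inner ℝ (ψ x) (cellPolarization e Q Ω ρ l x) : ℝ) = 0 := by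
    refine setIntegral_eq_zero_of_forall_eq_zero fun x hx => ?_
    rw [cellPolarization_eq_zero hx.2, inner_zero_right]
  rw [e3, add_zero]
  refine setIntegral_congr_fun hRm fun x hx => ?_
  have hx' := (hQ.mem_region_iff hl0).1 hx
  rw [cellPolarization_eq_of_mem hQ hl0 hx' (hQ.mem_cell_index hl0 x),
    cellPolarization_eq_of_mem hQ hl0 (subset_univ _) (hQ.mem_cell_index hl0 x)]

end

/-! ### Compactness of the inner surface charges -/

theorem map_prod_mul_left {α : Type*} [MeasurableSpace α] (μ : Measure α) [SFinite μ] {l : ℝ}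
    (hl : 0 < l) {T : Set ℝ} (hT : MeasurableSet T) :
    (μ.prod (volume.restrict ((fun t => l * t) ⁻¹' T))).map (fun z => (z.1, l * z.2)) =
      ENNReal.ofReal l⁻¹ • μ.prod (volume.restrict T) := by
  have hm : Measurable fun t : ℝ => l * t := measurable_const_mul l
  have h1 : (volume.restrict ((fun t => l * t) ⁻¹' T)).map (fun t => l * t) =
      ENNReal.ofReal l⁻¹ • volume.restrict T := by
    rw [← Measure.restrict_map hm hT, Real.map_volume_mul_left hl.ne', Measure.restrict_smul,
      abs_of_pos (inv_pos.2 hl)]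
  have h2 := Measure.map_prod_map μ (volume.restrict ((fun t => l * t) ⁻¹' T))
    (f := id) (g := fun t => l * t) measurable_id hm
  rw [Measure.map_id, h1, Measure.prod_smul_right] at h2
  exact h2.symm

section

variable {e : Module.Basis (Fin 3) ℝ E3} {Q Ω : Set E3} {ρ : ℝ → E3 → ℝ} {M : ℝ≥0}
  {n : E3 → E3} {L : ℝ}

theorem TendstoOnBoundary.mono {α : Type} {F F' : Filter α} (hF : F' ≤ F) {τ' : α → E3 → ℝ}
    {τ : E3 → ℝ} (h : TendstoOnBoundary Ω F τ' τ) : TendstoOnBoundary Ω F' τ' τ :=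
  ⟨h.1, fun ψ hψ => (h.2 ψ hψ).mono_left hF⟩

theorem IsTwoScaleLimit.mono {F F' : Filter ℝ} (hF : F' ≤ F) {ρ₀ : E3 → E3 → ℝ}
    (h : IsTwoScaleLimit e Q Ω ρ F ρ₀) : IsTwoScaleLimit e Q Ω ρ F' ρ₀ :=
  ⟨h.memLp, fun ψ h1 h2 h3 => (h.tendsto ψ h1 h2 h3).mono_left hF⟩

theorem map_le_nhdsGT_zero {l : ℕ → ℝ} (hl : ∀ k, l k ∈ Ioc (0 : ℝ) 1)
    (hl0 : Tendsto l atTop (𝓝 0)) : map l atTop ≤ 𝓝[>] (0 : ℝ) :=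
  tendsto_nhdsWithin_iff.2 ⟨hl0, Eventually.of_forall fun k => (hl k).1⟩

theorem exists_subseq_isTwoScaleLimit (hQ : IsUnitCell e Q) (hM : HasRegionBound e Q ρ M)
    (hmeas : ∀ l ∈ Ioc (0 : ℝ) 1, Measurable (ρ l)) (hΩ : Bornology.IsBounded Ω) (hΩo : IsOpen Ω)
    {l : ℕ → ℝ} (hl : ∀ k, l k ∈ Ioc (0 : ℝ) 1) (hl0 : Tendsto l atTop (𝓝 0)) :
    ∃ m : ℕ → ℕ, StrictMono m ∧ ∃ ρ₀, IsTwoScaleLimit e Q Ω ρ (map (l ∘ m) atTop) ρ₀ := by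
  have := isFiniteMeasure_twoScaleMeasure (Ω := Ω) hQ hΩ
  obtain ⟨C, hC⟩ := exists_memLp_unfold hQ hM hmeas hΩ
  obtain ⟨m, hm, w, hw, hlim⟩ := exists_subseq_tendsto_integral_mul
    (μ := twoScaleMeasure Ω Q) (u := fun k z => ρ (l k) (hQ.unfold (l k) z)) (C := C)
    (Eventually.of_forall fun k => hC _ (hl k))
  refine ⟨m, hm, _, isTwoScaleLimit_of_tendsto_integral_unfold hQ hM hmeas hΩ hΩo
    (map_le_nhdsGT_zero (fun k => hl (m k)) (hl0.comp hm.tendsto_atTop)) hw fun u hu => ?_⟩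
  exact tendsto_map'_iff.2 (hlim u hu)

/-- Volume near the boundary in normal coordinates, with a bounded density. -/
theorem HasLipschitzNormal.exists_density (h : HasLipschitzNormal Ω n L) {T : ℝ} (hT : 0 ≤ T) :
    ∃ K : ℝ≥0, ∀ {D : Set (E3 × ℝ)}, MeasurableSet D → D ⊆ frontier Ω ×ˢ Icc (-T) T →
      ∀ {X : Set E3}, X ⊆ normalMap n '' D → ∃ b : E3 → ℝ≥0, Measurable b ∧ (∀ x, b x ≤ K) ∧
        volume.restrict X = ((((surfaceMeasure Ω).prod volume).restrict D).map
          (normalMap n)).withDensity (fun x => (b x : ℝ≥0∞)) := by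
  have := h.isFiniteMeasure
  obtain ⟨K, hK⟩ := h.tube_comparison hT
  refine ⟨K, fun {D} hD hDs {X} hX => ?_⟩
  set P := (((surfaceMeasure Ω).prod volume).restrict D).map (normalMap n)
  have hfin : IsFiniteMeasure (((surfaceMeasure Ω).prod volume).restrict D) := by
    refine ⟨?_⟩
    rw [Measure.restrict_apply_univ]
    refine (measure_mono hDs).trans_lt ?_
    rw [Measure.prod_prod, Real.volume_Icc]
    exact ENNReal.mul_lt_top (measure_lt_top _ _) ENNReal.ofReal_lt_top
  have hle : volume.restrict X ≤ (K : ℝ≥0∞) • P := hK hD hDs hX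
  set ν := (K : ℝ≥0∞) • P
  have hνfin : IsFiniteMeasure ν := Measure.smul_finite _ ENNReal.coe_ne_top
  have hXfin : IsFiniteMeasure (volume.restrict X) := isFiniteMeasure_of_le ν hle
  have h1 := Measure.rnDeriv_le_one_of_le hle
  have h2 : ν.withDensity ((volume.restrict X).rnDeriv ν) = volume.restrict X :=
    Measure.withDensity_rnDeriv_eq _ _ (Measure.absolutelyContinuous_of_le hle)
  -- Truncating the Radon–Nikodym density at `1` makes its bound hold everywhere and not only almost
  -- everywhere.
  refine ⟨fun x => K * (min ((volume.restrict X).rnDeriv ν x) 1).toNNReal, ?_, fun x => ?_, ?_⟩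
  · exact ((Measure.measurable_rnDeriv _ _).min measurable_const).ennreal_toNNReal.const_mul _
  · refine mul_le_of_le_one_right' ?_
    rw [← ENNReal.coe_le_coe, ENNReal.coe_toNNReal (by simp)]
    simp
  · have h3 : (fun x => ((K * (min ((volume.restrict X).rnDeriv ν x) 1).toNNReal : ℝ≥0) : ℝ≥0∞)) =
        (K : ℝ≥0∞) • fun x => min ((volume.restrict X).rnDeriv ν x) 1 := by
      ext1 x
      simp [ENNReal.coe_toNNReal]
    rw [h3, withDensity_smul _ ((Measure.measurable_rnDeriv _ _).min measurable_const),
      ← withDensity_smul_measure]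
    rw [← h2]
    refine withDensity_congr_ae ?_
    rw [h2]
    filter_upwards [h1] with x hx
    exact (min_eq_left hx).symm

end

theorem integral_abs_le_of_eLpNorm_two_le {α : Type*} [MeasurableSpace α] {μ : Measure α}
    [IsFiniteMeasure μ] {f : α → ℝ} (hf : MemLp f 2 μ) {C : ℝ≥0} (hC : eLpNorm f 2 μ ≤ C) :
    ∫ x, |f x| ∂μ ≤ (C * μ univ ^ (1 / 2 : ℝ)).toReal := by
  have h1 := eLpNorm_le_eLpNorm_mul_rpow_measure_univ (μ := μ) (p := 1) (q := 2) one_le_two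
    hf.aestronglyMeasurable
  have h2 : ∫ x, |f x| ∂μ = (eLpNorm f 1 μ).toReal := by
    have := integral_norm_eq_lintegral_enorm hf.aestronglyMeasurable
    rw [eLpNorm_one_eq_lintegral_enorm, ← this]
    rfl
  rw [h2]
  refine ENNReal.toReal_mono (ENNReal.mul_ne_top ENNReal.coe_ne_top
    (ENNReal.rpow_ne_top_of_nonneg (by norm_num) (measure_ne_top _ _))) (h1.trans ?_)
  refine mul_le_mul' hC (le_of_eq ?_)
  norm_num

section

variable {e : Module.Basis (Fin 3) ℝ E3} {Q Ω : Set E3} {ρ : ℝ → E3 → ℝ} {M : ℝ≥0}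
  {n : E3 → E3} {L : ℝ}

theorem HasLipschitzNormal.prod_restrict_frontier (h : HasLipschitzNormal Ω n L) (T : Set ℝ) :
    ((surfaceMeasure Ω).prod volume).restrict (frontier Ω ×ˢ T) =
      (surfaceMeasure Ω).prod (volume.restrict T) := by
  have := h.isFiniteMeasure
  rw [← Measure.prod_restrict]
  congr 1
  rw [surfaceMeasure, Measure.restrict_restrict isClosed_frontier.measurableSet, inter_self]

/-- The charge of the partial cells in scaled normal coordinates. -/
theorem exists_boundary_profile (hQ : IsUnitCell e Q) (h : HasLipschitzNormal Ω n L)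
    (hM : HasRegionBound e Q ρ M) (hmeas : ∀ l ∈ Ioc (0 : ℝ) 1, Measurable (ρ l)) :
    ∃ (a : ℝ) (C : ℝ≥0), ∀ᶠ l : ℝ in 𝓝[>] 0, ∃ f : E3 × ℝ → ℝ,
      MemLp f 2 ((surfaceMeasure Ω).prod (volume.restrict (Icc (-a) a))) ∧
      eLpNorm f 2 ((surfaceMeasure Ω).prod (volume.restrict (Icc (-a) a))) ≤ C ∧
      ∀ ψ : E3 → ℝ, Continuous ψ →
        (∫ x in Ω \ region e Q l (fullCells e Q Ω l), ρ l x * ψ x) / l =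
          ∫ z, f z * ψ (normalMap n (z.1, l * z.2))
            ∂((surfaceMeasure Ω).prod (volume.restrict (Icc (-a) a))) := by
  have := h.isFiniteMeasure
  obtain ⟨D, hD0, hD⟩ := hQ.exists_norm_le
  obtain ⟨K, hK⟩ := h.exists_density zero_le_one
  obtain ⟨K', hK'⟩ := h.exists_volume_boundaryTube_le
  set a := 2 * D with ha
  set ν := (surfaceMeasure Ω).prod (volume.restrict (Icc (-a) a)) with hν
  -- The cells meeting the partial region lie in a tube of width `a l + 2 D l = 2 a l`; together
  -- with `b² ≤ K b` for the density `b`, this gives the constant.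
  refine ⟨a, NNReal.sqrt (K * (M * (K' * (2 * a).toNNReal))), ?_⟩
  filter_upwards [eventually_Ioc_nhdsGT_zero, eventually_mul_lt_nhdsGT_zero (2 * a) one_pos]
    with l hl hl1
  have hl0 := hl.1
  have ha0 : 0 < a := by positivity
  set X := Ω \ region e Q l (fullCells e Q Ω l) with hX
  have hXt : X ⊆ boundaryTube Ω (a * l) := by
    rw [hX, hQ.diff_region_fullCells hl0]
    exact iUnion₂_subset fun i hi =>
      inter_subset_left.trans (IsUnitCell.cell_subset_boundaryTube h hD hl0 hi)
  set T := Icc (-(a * l)) (a * l) with hT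
  have hpre : (fun t => l * t) ⁻¹' T = Icc (-a) a := by
    ext t
    simp only [hT, Set.mem_preimage, Set.mem_Icc]
    rw [← mul_comm l, ← mul_neg, mul_le_mul_iff_right₀ hl0, mul_le_mul_iff_right₀ hl0]
  obtain ⟨b, hbm, hbK, hb⟩ := hK (D := frontier Ω ×ˢ T)
    (isClosed_frontier.measurableSet.prod measurableSet_Icc)
    (prod_mono_right (Icc_subset_Icc (by nlinarith) (by nlinarith)))
    (hXt.trans (h.boundaryTube_subset _))
  set Φ : E3 × ℝ → E3 := fun z => normalMap n (z.1, l * z.2) with hΦ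
  have hsc : Measurable fun z : E3 × ℝ => (z.1, l * z.2) := by fun_prop
  have hΦm : Measurable Φ := h.measurable_normalMap.comp hsc
  have hmap : (((surfaceMeasure Ω).prod volume).restrict (frontier Ω ×ˢ T)).map (normalMap n) =
      ENNReal.ofReal l • ν.map Φ := by
    have h1 := map_prod_mul_left (surfaceMeasure Ω) hl0 (T := T) measurableSet_Icc
    rw [hpre, ← hν] at h1
    have h2 : ν.map Φ = ENNReal.ofReal l⁻¹ •
        ((surfaceMeasure Ω).prod (volume.restrict T)).map (normalMap n) := by
      rw [← Measure.map_smul, ← h1, Measure.map_map h.measurable_normalMap hsc]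
      rfl
    rw [h.prod_restrict_frontier, h2, smul_smul, ← ENNReal.ofReal_mul hl0.le,
      mul_inv_cancel₀ hl0.ne', ENNReal.ofReal_one, one_smul]
  rw [hmap] at hb
  have hρm := hmeas l hl
  -- The density is absorbed in the profile, so that the energy identity is exact and no Jacobian
  -- has to converge.
  set f : E3 × ℝ → ℝ := fun z => b (Φ z) * ρ l (Φ z) with hf
  have hfm : Measurable f :=
    (hbm.coe_nnreal_real.comp hΦm).mul (hρm.comp hΦm)
  have hbound : eLpNorm f 2 ν ≤ NNReal.sqrt (K * (M * (K' * (2 * a).toNNReal))) := by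
    have h1 : ENNReal.ofReal l * ∫⁻ z, b (Φ z) * ‖ρ l (Φ z)‖ₑ ^ 2 ∂ν =
        ∫⁻ x in X, ‖ρ l x‖ₑ ^ 2 := by
      rw [hb, lintegral_withDensity_eq_lintegral_mul _ hbm.coe_nnreal_ennreal
        (hρm.enorm.pow_const 2), lintegral_smul_measure, smul_eq_mul, lintegral_map
        (hbm.coe_nnreal_ennreal.mul (hρm.enorm.pow_const 2)) hΦm]
      rfl
    have h2 : ∫⁻ x in X, ‖ρ l x‖ₑ ^ 2 ≤
        ENNReal.ofReal l * (M * (K' * (2 * a).toNNReal)) := by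
      refine (lintegral_mono_set (hQ.subset_region_meetingCells hl0 X)).trans
        ((hM l hl _).1.trans ?_)
      have h3 := (measure_mono (hQ.region_meetingCells_subset_boundaryTube hD hl0 hXt)).trans
        (hK' _ ⟨by positivity, by linarith⟩)
      refine (mul_le_mul_right h3 _).trans (le_of_eq ?_)
      rw [show a * l + 2 * D * l = l * (2 * a) by rw [ha]; ring, ENNReal.ofReal_mul hl0.le]
      simp only [ENNReal.ofReal]
      ring
    rw [← h1, ENNReal.mul_le_mul_iff_right (ENNReal.ofReal_pos.2 hl0).ne'
      ENNReal.ofReal_ne_top] at h2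
    have h3 : ∫⁻ z, ‖f z‖ₑ ^ 2 ∂ν ≤ K * (M * (K' * (2 * a).toNNReal)) := by
      refine le_trans ?_ (mul_le_mul_right h2 (K : ℝ≥0∞))
      rw [← lintegral_const_mul' _ _ ENNReal.coe_ne_top]
      refine lintegral_mono fun z => ?_
      have h4 : ‖f z‖ₑ = b (Φ z) * ‖ρ l (Φ z)‖ₑ := by
        rw [hf, enorm_mul, NNReal.enorm_eq]
      rw [h4, mul_pow, sq (b (Φ z) : ℝ≥0∞), mul_assoc]
      gcongr
      exact hbK _
    rw [eLpNorm_two_eq, ← ENNReal.rpow_le_rpow_iff (z := 2) two_pos, ← ENNReal.rpow_mul]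
    norm_num
    refine h3.trans (le_of_eq ?_)
    norm_cast
    rw [NNReal.sq_sqrt]
  refine ⟨f, ⟨hfm.aestronglyMeasurable, hbound.trans_lt ENNReal.coe_lt_top⟩, hbound,
    fun ψ hψ => ?_⟩
  rw [div_eq_iff hl0.ne', hb, integral_withDensity_eq_integral_smul hbm, integral_smul_measure,
    integral_map hΦm.aemeasurable ?_, ENNReal.toReal_ofReal hl0.le, smul_eq_mul, mul_comm]
  · congr 1
    refine integral_congr_ae (ae_of_all _ fun z => ?_)
    simp only [hf, NNReal.smul_def, smul_eq_mul]
    ring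
  · simp only [NNReal.smul_def, smul_eq_mul]
    exact (hbm.coe_nnreal_real.mul (hρm.mul hψ.measurable)).aestronglyMeasurable

theorem HasLipschitzNormal.ae_prod_mem_frontier (h : HasLipschitzNormal Ω n L) (ν : Measure ℝ)
    [SFinite ν] : ∀ᵐ z ∂(surfaceMeasure Ω).prod ν, z.1 ∈ frontier Ω := by
  have := h.isFiniteMeasure
  exact Measure.quasiMeasurePreserving_fst.ae (ae_mem_frontier Ω)

/-- Division by possibly tiny cell areas gives no direct bound on the densities. Compactness is used
instead for the profiles of the partial cells in stretched normal coordinates, and the comparison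
with the energy of the partial cells transfers it. The limit charge integrates the limit profile
along the normals. -/
theorem exists_subseq_tendsto_innerSurfaceCharge (hQ : IsUnitCell e Q)
    (h : HasLipschitzNormal Ω n L) (hM : HasRegionBound e Q ρ M)
    (hmeas : ∀ l ∈ Ioc (0 : ℝ) 1, Measurable (ρ l)) (hgood : IsGoodBoundary e Q Ω)
    (harea : FewAreaFreePartialCells e Q Ω) {l : ℕ → ℝ} (hl : ∀ k, l k ∈ Ioc (0 : ℝ) 1)
    (hl0 : Tendsto l atTop (𝓝 0)) :
    ∃ m : ℕ → ℕ, StrictMono m ∧ ∃ σi,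
      TendstoOnBoundary Ω (map (l ∘ m) atTop) (innerSurfaceCharge e Q Ω ρ) σi := by
  have := h.isFiniteMeasure
  obtain ⟨a, C, hC⟩ := exists_boundary_profile hQ h hM hmeas
  set ν := (surfaceMeasure Ω).prod (volume.restrict (Icc (-a) a)) with hν
  have hνs : SFinite ν := inferInstance
  have hlt : Tendsto l atTop (𝓝[>] 0) := map_le_nhdsGT_zero hl hl0
  obtain ⟨u, hu⟩ := (hlt.eventually hC).choice
  obtain ⟨m, hm, w, hw, hlim⟩ := exists_subseq_tendsto_integral_mul (μ := ν) (u := u) (C := C)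
    (hu.mono fun k hk => ⟨hk.1, hk.2.1⟩)
  have hwi : Integrable w ν := hw.integrable one_le_two
  refine ⟨m, hm, fun s => ∫ t in Icc (-a) a, w (s, t), hwi.integral_prod_left, fun ψ hψ => ?_⟩
  rw [tendsto_map'_iff]
  obtain ⟨Cψ, -, hCψ⟩ := h.exists_forall_frontier_abs_le hψ
  have hb : Bornology.IsBounded (frontier Ω) := h.bounded.closure.subset frontier_subset_closure
  have hψν : MemLp (fun z : E3 × ℝ => ψ z.1) 2 ν := by
    refine MemLp.of_bound (hψ.comp continuous_fst).aestronglyMeasurable Cψ ?_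
    filter_upwards [h.ae_prod_mem_frontier (volume.restrict (Icc (-a) a))] with z hz
    exact hCψ _ (frontier_subset_closure hz)
  have hlm : Tendsto (l ∘ m) atTop (𝓝[>] 0) := hlt.comp hm.tendsto_atTop
  have h1 := (tendsto_partialCells_sub_innerSurfaceCharge hQ h hM hmeas hgood harea hψ).comp hlm
  have h2 : Tendsto (fun k => ∫ z, u (m k) z * ψ (normalMap n (z.1, l (m k) * z.2)) ∂ν -
      ∫ z, u (m k) z * ψ z.1 ∂ν) atTop (𝓝 0) := by
    refine tendsto_zero_of_forall_eventually_le
      (A := (C * ν univ ^ (1 / 2 : ℝ)).toReal) (z := fun _ => 0) tendsto_const_nhds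
      fun ε hε => ?_
    obtain ⟨δ, hδ, hosc⟩ := exists_forall_mem_abs_sub_le hψ hb hε
    filter_upwards [hm.tendsto_atTop.eventually hu,
      hlm.eventually (eventually_mul_lt_nhdsGT_zero a hδ)] with k hk hkδ
    have hl0' := (hl (m k)).1
    have hmeasψ : Measurable fun z : E3 × ℝ => ψ (normalMap n (z.1, l (m k) * z.2)) :=
      hψ.measurable.comp (h.measurable_normalMap.comp (by fun_prop))
    have hpt : ∀ᵐ z ∂ν, |ψ (normalMap n (z.1, l (m k) * z.2)) - ψ z.1| ≤ ε := by
      have h3 : ∀ᵐ z ∂ν, z.2 ∈ Icc (-a) a :=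
        Measure.quasiMeasurePreserving_snd.ae (ae_restrict_mem measurableSet_Icc)
      filter_upwards [h3, h.ae_prod_mem_frontier (volume.restrict (Icc (-a) a))] with z hz hzf
      rw [abs_sub_comm]
      refine hosc _ hzf _ (lt_of_le_of_lt ?_ hkδ)
      rw [normalMap, dist_self_add_right, norm_smul, h.norm_eq_one _ hzf, mul_one,
        Real.norm_eq_abs, abs_mul, abs_of_pos hl0', mul_comm, Function.comp_apply]
      exact mul_le_mul_of_nonneg_right (abs_le.2 hz) hl0'.le
    have hui : Integrable (u (m k)) ν := hk.1.integrable one_le_two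
    have i2 : Integrable (fun z => u (m k) z * (ψ (normalMap n (z.1, l (m k) * z.2)) - ψ z.1)) ν :=
      hui.mul_bdd (c := ε) (hmeasψ.sub (hψ.measurable.comp measurable_fst)).aestronglyMeasurable hpt
    have i3 : Integrable (fun z => u (m k) z * ψ z.1) ν := hk.1.integrable_mul hψν
    have i1 : Integrable (fun z => u (m k) z * ψ (normalMap n (z.1, l (m k) * z.2))) ν := by
      refine (i2.add i3).congr (ae_of_all _ fun z => ?_)
      simp only [Pi.add_apply]; ring
    rw [← integral_sub i1 i3, add_zero]
    calc ‖∫ z, (u (m k) z * ψ (normalMap n (z.1, l (m k) * z.2)) - u (m k) z * ψ z.1) ∂ν‖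
        ≤ ∫ z, ε * |u (m k) z| ∂ν := by
          refine norm_integral_le_of_norm_le (hui.abs.const_mul ε) ?_
          filter_upwards [hpt] with z hz
          rw [← mul_sub, norm_mul, mul_comm]
          exact mul_le_mul_of_nonneg_right hz (abs_nonneg _)
      _ ≤ _ := by
          rw [integral_const_mul]
          exact mul_le_mul_of_nonneg_left (integral_abs_le_of_eLpNorm_two_le hk.1 hk.2.1) hε.le
  have h4 := hlim _ hψν
  have h5 : ∫ z, w z * ψ z.1 ∂ν =
      ∫ s, ψ s * (∫ t in Icc (-a) a, w (s, t)) ∂(surfaceMeasure Ω) := by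
    rw [hν, integral_prod (fun z => w z * ψ z.1) (hw.integrable_mul hψν)]
    simp_rw [integral_mul_const, mul_comm]
  rw [h5] at h4
  have h6 := (h4.add h2).sub h1
  rw [add_zero, sub_zero] at h6
  refine h6.congr' ?_
  filter_upwards [hm.tendsto_atTop.eventually hu] with k hk
  simp only [Function.comp_apply]
  rw [hk.2.2 ψ hψ]
  ring

end

/-! ### Compactness of the outer surface charges -/

/-- The mass below height `k` grows at most linearly, and `4⁻ᵏ (k + 1) ≤ 2⁻ᵏ` is summable with sum
`2`. The exponent `⌊t⌋₊ + 1` is a `k` with `t < k`, so the weighted integrand is one term of the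
series. -/
theorem lintegral_inv_two_pow_floor_mul_le {α : Type*} [MeasurableSpace α] {ν : Measure α}
    {t : α → ℝ} (ht : Measurable t) {F : α → ℝ≥0∞} (hF : Measurable F) {C : ℝ≥0∞}
    (h : ∀ k : ℕ, ∫⁻ z in {z | t z < k}, F z ∂ν ≤ C * (k + 1)) :
    ∫⁻ z, ((2⁻¹ : ℝ≥0∞) ^ (⌊t z⌋₊ + 1)) ^ 2 * F z ∂ν ≤ 2 * C := by
  have hs : ∀ k : ℕ, MeasurableSet {z | t z < k} := fun k => measurableSet_lt ht measurable_const
  calc _ ≤ ∫⁻ z, ∑' k : ℕ, {z | t z < k}.indicator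
          (fun z => ((2⁻¹ : ℝ≥0∞) ^ k) ^ 2 * F z) z ∂ν := by
        refine lintegral_mono fun z => ?_
        refine le_trans (le_of_eq ?_) (ENNReal.le_tsum (⌊t z⌋₊ + 1))
        rw [indicator_of_mem]
        show t z < ((⌊t z⌋₊ + 1 : ℕ) : ℝ)
        exact_mod_cast Nat.lt_floor_add_one (t z)
    _ = ∑' k : ℕ, ((2⁻¹ : ℝ≥0∞) ^ k) ^ 2 * ∫⁻ z in {z | t z < k}, F z ∂ν := by
        rw [lintegral_tsum fun k => ((hF.const_mul _).indicator (hs k)).aemeasurable]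
        refine tsum_congr fun k => ?_
        rw [lintegral_indicator (hs k), lintegral_const_mul _ hF]
    _ ≤ ∑' k : ℕ, (2⁻¹ : ℝ≥0∞) ^ k * C := by
        refine ENNReal.tsum_le_tsum fun k => ?_
        have h1 : (2⁻¹ : ℝ≥0∞) ^ k * ((k : ℝ≥0∞) + 1) ≤ 1 := by
          have h2 : ((k : ℝ≥0∞) + 1) ≤ 2 ^ k := by exact_mod_cast Nat.lt_two_pow_self
          calc _ ≤ (2⁻¹ : ℝ≥0∞) ^ k * 2 ^ k := by gcongr
            _ = 1 := by
              rw [← mul_pow, ENNReal.inv_mul_cancel two_ne_zero ENNReal.ofNat_ne_top, one_pow]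
        calc _ ≤ ((2⁻¹ : ℝ≥0∞) ^ k) ^ 2 * (C * (k + 1)) := by gcongr; exact h k
          _ = (2⁻¹ : ℝ≥0∞) ^ k * C * ((2⁻¹ : ℝ≥0∞) ^ k * ((k : ℝ≥0∞) + 1)) := by ring
          _ ≤ (2⁻¹ : ℝ≥0∞) ^ k * C * 1 := by gcongr
          _ = _ := mul_one _
    _ = 2 * C := by
        rw [ENNReal.tsum_mul_right, ENNReal.tsum_geometric, ENNReal.one_sub_inv_two, inv_inv]

section

variable {e : Module.Basis (Fin 3) ℝ E3} {Q Ω : Set E3} {ρ : ℝ → E3 → ℝ} {M : ℝ≥0}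
  {n : E3 → E3} {L : ℝ}

/-- The charge outside `Ω` in scaled normal coordinates, cut off at the distance `τ` and multiplied
by a weight. -/
noncomputable def outerProfile (n : E3 → E3) (ρ : ℝ → E3 → ℝ) (τ l : ℝ) (z : E3 × ℝ) : ℝ :=
  {z : E3 × ℝ | l * z.2 < τ}.indicator
    (fun z => (2⁻¹ : ℝ) ^ (⌊z.2⌋₊ + 1) * ρ l (normalMap n (z.1, l * z.2))) z

theorem measurable_outerProfile (h : HasLipschitzNormal Ω n L) {τ l : ℝ} (hm : Measurable (ρ l)) :
    Measurable (outerProfile n ρ τ l) := by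
  have h1 : Measurable fun z : E3 × ℝ => ρ l (normalMap n (z.1, l * z.2)) :=
    hm.comp (h.measurable_normalMap.comp (by fun_prop))
  have h2 : Measurable fun z : E3 × ℝ => (2⁻¹ : ℝ) ^ (⌊z.2⌋₊ + 1) := by
    have : Measurable fun z : E3 × ℝ => ⌊z.2⌋₊ := Nat.measurable_floor.comp measurable_snd
    exact (measurable_from_top (f := fun k : ℕ => (2⁻¹ : ℝ) ^ (k + 1))).comp this
  exact (h2.mul h1).indicator (measurableSet_lt (by fun_prop) measurable_const)

/-- In stretched coordinates the half-line of heights carries infinite measure, and the quadratic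
charge below a given height is only known to grow linearly. The exponential weight restores a
uniform `L²` bound; the cut-off stays in the layer where normal coordinates are comparable with
volume. -/
theorem exists_eLpNorm_outerProfile_le (hQ : IsUnitCell e Q) (h : HasLipschitzNormal Ω n L)
    (hM : HasRegionBound e Q ρ M) (hmeas : ∀ l ∈ Ioc (0 : ℝ) 1, Measurable (ρ l)) :
    ∃ τ > 0, 2 * L * τ ≤ 1 ∧ ∃ C : ℝ≥0, ∀ᶠ l : ℝ in 𝓝[>] 0,
      MemLp (outerProfile n ρ τ l) 2 ((surfaceMeasure Ω).prod (volume.restrict (Ioi 0))) ∧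
      eLpNorm (outerProfile n ρ τ l) 2 ((surfaceMeasure Ω).prod (volume.restrict (Ioi 0))) ≤ C := by
  have := h.isFiniteMeasure
  have hL := h.pos
  obtain ⟨τ₀, hτ₀, hLτ₀, hcomp⟩ := h.layer_comparison one_pos
  obtain ⟨C, hC⟩ := exists_forall_lintegral_outerLayer_le hQ h hM
  set τ := min τ₀ (1 / 2) with hτdef
  have hτ : 0 < τ := by positivity
  refine ⟨τ, hτ, le_trans (by gcongr; exact min_le_left _ _) hLτ₀, NNReal.sqrt (2 * (2 * C)), ?_⟩
  filter_upwards [eventually_Ioc_nhdsGT_zero, hC] with l hl hCl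
  have hl0 := hl.1
  have hρm := hmeas l hl
  have hum := measurable_outerProfile (τ := τ) h hρm
  set ν := (surfaceMeasure Ω).prod (volume.restrict (Ioi (0 : ℝ))) with hν
  set Φ : E3 × ℝ → E3 := fun z => normalMap n (z.1, l * z.2) with hΦ
  have hsc : Measurable fun z : E3 × ℝ => (z.1, l * z.2) := by fun_prop
  have hΦm : Measurable Φ := h.measurable_normalMap.comp hsc
  set E : Set (E3 × ℝ) := {z | l * z.2 < τ} with hE
  have hEm : MeasurableSet E := measurableSet_lt (by fun_prop) measurable_const
  have hkey : ∀ k : ℕ, ∫⁻ z in {z | z.2 < (k : ℝ)}, E.indicator (fun z => ‖ρ l (Φ z)‖ₑ ^ 2) z ∂ν ≤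
      2 * C * (k + 1) := by
    intro k
    set a : ℝ≥0 := min k (τ / l).toNNReal with ha
    have hτl : 0 ≤ τ / l := by positivity
    have haτ : l * (a : ℝ) ≤ τ := by
      have : (a : ℝ) ≤ τ / l := by
        rw [ha, NNReal.coe_min, Real.coe_toNNReal _ hτl]; exact min_le_right _ _
      calc l * (a : ℝ) ≤ l * (τ / l) := by gcongr
        _ = τ := by field_simp
    have hset : E ∩ {z : E3 × ℝ | z.2 < (k : ℝ)} = univ ×ˢ Iio (a : ℝ) := by
      ext z
      simp only [hE, mem_inter_iff, mem_ofPred_eq, mem_prod, mem_univ, true_and, mem_Iio, ha,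
        NNReal.coe_min, Real.coe_toNNReal _ hτl, lt_min_iff, NNReal.coe_natCast, lt_div_iff₀ hl0]
      rw [and_comm, mul_comm]
    have hres : ν.restrict (univ ×ˢ Iio (a : ℝ)) =
        (surfaceMeasure Ω).prod (volume.restrict (Ioo 0 (a : ℝ))) := by
      rw [hν, ← Measure.prod_restrict, Measure.restrict_univ,
        Measure.restrict_restrict measurableSet_Iio, inter_comm, Ioi_inter_Iio]
    have hpre : (fun t => l * t) ⁻¹' Ioo 0 (l * (a : ℝ)) = Ioo 0 (a : ℝ) := by
      ext t
      simp only [Set.mem_preimage, Set.mem_Ioo, mul_lt_mul_iff_right₀ hl0, mul_pos_iff_of_pos_left hl0]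
    have h1 := map_prod_mul_left (surfaceMeasure Ω) hl0 (T := Ioo 0 (l * (a : ℝ)))
      measurableSet_Ioo
    rw [hpre] at h1
    rw [lintegral_indicator hEm, Measure.restrict_restrict hEm, hset, hres]
    have h2 : ∫⁻ z, ‖ρ l (Φ z)‖ₑ ^ 2 ∂((surfaceMeasure Ω).prod
        (volume.restrict (Ioo 0 (a : ℝ)))) = ENNReal.ofReal l⁻¹ *
        ∫⁻ x, ‖ρ l x‖ₑ ^ 2 ∂((((surfaceMeasure Ω).prod volume).restrict
          (frontier Ω ×ˢ Ioo 0 (l * (a : ℝ)))).map (normalMap n)) := by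
      rw [h.prod_restrict_frontier, ← smul_eq_mul, ← lintegral_smul_measure, ← Measure.map_smul,
        ← h1, Measure.map_map h.measurable_normalMap hsc,
        lintegral_map (hρm.enorm.pow_const 2) (h.measurable_normalMap.comp hsc)]
      rfl
    have h3 := lintegral_mono' (hcomp (l * a) (haτ.trans (min_le_left _ _))).2
      (le_refl fun x => ‖ρ l x‖ₑ ^ 2)
    rw [lintegral_smul_measure, smul_eq_mul] at h3
    rw [h2]
    calc _ ≤ ENNReal.ofReal l⁻¹ * (ENNReal.ofReal (1 + 1) * (C * (a + 1) * ENNReal.ofReal l)) := by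
          refine mul_le_mul_right (h3.trans ?_) _
          exact mul_le_mul_right (hCl a (haτ.trans (min_le_right _ _))).1 _
      _ = (ENNReal.ofReal l⁻¹ * ENNReal.ofReal l) * (2 * C * (a + 1)) := by
          rw [one_add_one_eq_two, ENNReal.ofReal_ofNat]; ring
      _ = 2 * C * (a + 1) := by
          rw [← ENNReal.ofReal_mul (by positivity), inv_mul_cancel₀ hl0.ne', ENNReal.ofReal_one,
            one_mul]
      _ ≤ _ := by
          gcongr
          exact_mod_cast min_le_left _ _
  have hint := lintegral_inv_two_pow_floor_mul_le (ν := ν) measurable_snd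
    (((hρm.comp hΦm).enorm.pow_const 2).indicator hEm) hkey
  have hbound : eLpNorm (outerProfile n ρ τ l) 2 ν ≤ NNReal.sqrt (2 * (2 * C)) := by
    rw [eLpNorm_two_eq, ← ENNReal.rpow_le_rpow_iff (z := 2) two_pos, ← ENNReal.rpow_mul]
    norm_num
    refine (le_trans (lintegral_mono fun z => ?_) hint).trans (le_of_eq ?_)
    · rw [outerProfile]
      by_cases hz : z ∈ E
      · rw [indicator_of_mem hz, indicator_of_mem hz, enorm_mul, mul_pow, enorm_pow]
        have : ‖(2⁻¹ : ℝ)‖ₑ = 2⁻¹ := by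
          rw [Real.enorm_of_nonneg (by norm_num), ENNReal.ofReal_inv_of_pos two_pos,
            ENNReal.ofReal_ofNat]
        rw [this]
        rfl
      · rw [indicator_of_notMem hz, indicator_of_notMem hz]
        simp
    · norm_cast
      rw [NNReal.sq_sqrt]
  exact ⟨⟨hum.aestronglyMeasurable, hbound.trans_lt ENNReal.coe_lt_top⟩, hbound⟩

end

section

variable {e : Module.Basis (Fin 3) ℝ E3} {Q Ω : Set E3} {ρ : ℝ → E3 → ℝ} {M : ℝ≥0}
  {n : E3 → E3} {L : ℝ}

/-- At bounded heights the weight can be undone inside the test function. -/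
theorem HasLipschitzNormal.memLp_indicator_two_pow_floor (h : HasLipschitzNormal Ω n L)
    {g : E3 × ℝ → ℝ} (hg : Measurable g) {B : ℝ}
    (hB : ∀ᵐ z ∂(surfaceMeasure Ω).prod (volume.restrict (Ioi 0)), |g z| ≤ B) (a : ℝ) :
    MemLp ({z : E3 × ℝ | z.2 ≤ a}.indicator fun z => (2 : ℝ) ^ (⌊z.2⌋₊ + 1) * g z) 2
      ((surfaceMeasure Ω).prod (volume.restrict (Ioi 0))) := by
  have := h.isFiniteMeasure
  have hs : MeasurableSet {z : E3 × ℝ | z.2 ≤ a} := measurableSet_le measurable_snd measurable_const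
  have hfin : IsFiniteMeasure (((surfaceMeasure Ω).prod (volume.restrict (Ioi 0))).restrict
      {z : E3 × ℝ | z.2 ≤ a}) := by
    have h1 : {z : E3 × ℝ | z.2 ≤ a} = univ ×ˢ Iic a := by ext z; simp
    rw [h1, ← Measure.prod_restrict, Measure.restrict_univ,
      Measure.restrict_restrict measurableSet_Iic, inter_comm, Ioi_inter_Iic]
    infer_instance
  have hW : Measurable fun z : E3 × ℝ => (2 : ℝ) ^ (⌊z.2⌋₊ + 1) :=
    (measurable_from_top (f := fun k : ℕ => (2 : ℝ) ^ (k + 1))).comp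
      (Nat.measurable_floor.comp measurable_snd)
  rw [memLp_indicator_iff_restrict hs]
  refine MemLp.of_bound (hW.mul hg).aestronglyMeasurable (2 ^ (⌊a⌋₊ + 1) * B) ?_
  filter_upwards [ae_restrict_of_ae hB, ae_restrict_mem hs] with z hz hza
  have hza : z.2 ≤ a := hza
  rw [norm_mul, Real.norm_of_nonneg (by positivity : (0 : ℝ) ≤ 2 ^ (⌊z.2⌋₊ + 1))]
  gcongr
  · exact one_le_two
  · exact hz

/-- Weak limit of the charges outside `Ω` in scaled normal coordinates. -/
theorem exists_subseq_tendsto_outer_profile (hQ : IsUnitCell e Q) (h : HasLipschitzNormal Ω n L)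
    (hM : HasRegionBound e Q ρ M) (hmeas : ∀ l ∈ Ioc (0 : ℝ) 1, Measurable (ρ l)) {l : ℕ → ℝ}
    (hl : ∀ k, l k ∈ Ioc (0 : ℝ) 1) (hl0 : Tendsto l atTop (𝓝 0)) :
    ∃ m : ℕ → ℕ, StrictMono m ∧ ∃ f : E3 × ℝ → ℝ, Measurable f ∧
      ∀ (g : E3 × ℝ → ℝ) (B a : ℝ), Measurable g →
        (∀ᵐ z ∂(surfaceMeasure Ω).prod (volume.restrict (Ioi 0)), |g z| ≤ B) →
        IntegrableOn (fun z => f z * g z) {z | z.2 ≤ a}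
          ((surfaceMeasure Ω).prod (volume.restrict (Ioi 0))) ∧
        (∀ᶠ k in atTop, IntegrableOn
          (fun z => ρ (l (m k)) (normalMap n (z.1, l (m k) * z.2)) * g z) {z | z.2 ≤ a}
          ((surfaceMeasure Ω).prod (volume.restrict (Ioi 0)))) ∧
        Tendsto (fun k => ∫ z in {z | z.2 ≤ a},
            ρ (l (m k)) (normalMap n (z.1, l (m k) * z.2)) * g z
              ∂((surfaceMeasure Ω).prod (volume.restrict (Ioi 0)))) atTop
          (𝓝 (∫ z in {z | z.2 ≤ a}, f z * g z
            ∂((surfaceMeasure Ω).prod (volume.restrict (Ioi 0))))) := by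
  have := h.isFiniteMeasure
  obtain ⟨τ, hτ, -, C, hC⟩ := exists_eLpNorm_outerProfile_le hQ h hM hmeas
  set ν := (surfaceMeasure Ω).prod (volume.restrict (Ioi (0 : ℝ))) with hν
  have hνs : SFinite ν := inferInstance
  have hlt : Tendsto l atTop (𝓝[>] 0) := map_le_nhdsGT_zero hl hl0
  obtain ⟨m, hm, w₀, hw₀, hlim⟩ := exists_subseq_tendsto_integral_mul (μ := ν)
    (u := fun k => outerProfile n ρ τ (l k)) (C := C) (hlt.eventually hC)
  have hlm : Tendsto (fun k => l (m k)) atTop (𝓝[>] 0) := hlt.comp hm.tendsto_atTop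
  obtain ⟨w, hwm, hww⟩ := hw₀.aestronglyMeasurable.aemeasurable
  have hw : MemLp w 2 ν := hw₀.ae_eq hww
  have hW : Measurable fun z : E3 × ℝ => (2 : ℝ) ^ (⌊z.2⌋₊ + 1) :=
    (measurable_from_top (f := fun k : ℕ => (2 : ℝ) ^ (k + 1))).comp
      (Nat.measurable_floor.comp measurable_snd)
  -- The weight is removed from the weak limit by multiplying with its inverse.
  refine ⟨m, hm, fun z => 2 ^ (⌊z.2⌋₊ + 1) * w z, hW.mul hwm, fun g B a hg hB => ?_⟩
  have hs : MeasurableSet {z : E3 × ℝ | z.2 ≤ a} := measurableSet_le measurable_snd measurable_const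
  set v : E3 × ℝ → ℝ := {z : E3 × ℝ | z.2 ≤ a}.indicator fun z => (2 : ℝ) ^ (⌊z.2⌋₊ + 1) * g z
    with hv
  have hvν : MemLp v 2 ν := h.memLp_indicator_two_pow_floor hg hB a
  have e1 : {z : E3 × ℝ | z.2 ≤ a}.indicator (fun z => 2 ^ (⌊z.2⌋₊ + 1) * w z * g z) =
      fun z => w z * v z := by
    ext z
    by_cases hz : z ∈ {z : E3 × ℝ | z.2 ≤ a}
    · rw [hv, indicator_of_mem hz, indicator_of_mem hz]; ring
    · rw [hv, indicator_of_notMem hz, indicator_of_notMem hz, mul_zero]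
  -- Below a fixed height `a` the cut-off is eventually invisible, because `a l < τ`.
  have e2 : ∀ᶠ k in atTop, {z : E3 × ℝ | z.2 ≤ a}.indicator
      (fun z => ρ (l (m k)) (normalMap n (z.1, l (m k) * z.2)) * g z) =
      fun z => outerProfile n ρ τ (l (m k)) z * v z := by
    filter_upwards [hlm.eventually (eventually_mul_lt_nhdsGT_zero a hτ)] with k hk
    ext z
    by_cases hz : z ∈ {z : E3 × ℝ | z.2 ≤ a}
    · have hz2 : z.2 ≤ a := hz
      have hzE : z ∈ {z : E3 × ℝ | l (m k) * z.2 < τ} := by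
        have := mul_le_mul_of_nonneg_left hz2 (hl (m k)).1.le
        exact this.trans_lt (by rwa [mul_comm])
      rw [hv, outerProfile, indicator_of_mem hz, indicator_of_mem hz, indicator_of_mem hzE, inv_pow]
      field_simp
    · rw [hv, indicator_of_notMem hz, indicator_of_notMem hz, mul_zero]
  refine ⟨?_, ?_, ?_⟩
  · rw [← integrable_indicator_iff hs, e1]
    exact hw.integrable_mul hvν
  · filter_upwards [e2, hlm.eventually hC] with k hk hCk
    rw [← integrable_indicator_iff hs, hk]
    exact hCk.1.integrable_mul hvν
  · have h1 := hlim v hvν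
    have h2 : ∫ z, w₀ z * v z ∂ν = ∫ z in {z : E3 × ℝ | z.2 ≤ a},
        2 ^ (⌊z.2⌋₊ + 1) * w z * g z ∂ν := by
      rw [← integral_indicator hs, e1]
      exact integral_congr_ae (hww.mono fun z hz => by simp only [hz])
    rw [h2] at h1
    refine h1.congr' ?_
    filter_upwards [e2] with k hk
    rw [← integral_indicator hs, hk]

theorem aecover_snd_le (ν : Measure (E3 × ℝ)) :
    AECover ν atTop fun a : ℝ => {z : E3 × ℝ | z.2 ≤ a} :=
  ⟨ae_of_all _ fun z => eventually_ge_atTop z.2,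
    fun _ => measurableSet_le measurable_snd measurable_const⟩

/-- One subsequence serves all heights, since the profiles converge against tests supported at any
bounded height. The charge at height `a` integrates the limit profile up to `a`, and integrability
of that profile gives the limit for large heights. -/
theorem exists_subseq_tendsto_outerSurfaceCharge (hQ : IsUnitCell e Q)
    (h : HasLipschitzNormal Ω n L) (hM : HasRegionBound e Q ρ M)
    (hmeas : ∀ l ∈ Ioc (0 : ℝ) 1, Measurable (ρ l)) (hconc : IsOneConcentrated Ω n ρ) {l : ℕ → ℝ}
    (hl : ∀ k, l k ∈ Ioc (0 : ℝ) 1) (hl0 : Tendsto l atTop (𝓝 0)) :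
    ∃ m : ℕ → ℕ, StrictMono m ∧ ∃ (σh : ℝ → E3 → ℝ) (σo : E3 → ℝ),
      (∀ a > (0 : ℝ), TendstoOnBoundary Ω (map (l ∘ m) atTop)
        (fun l => outerSurfaceCharge n ρ l a) (σh a)) ∧ TendstoOnBoundary Ω atTop σh σo := by
  have := h.isFiniteMeasure
  obtain ⟨m, hm, f, hfm, hf⟩ := exists_subseq_tendsto_outer_profile hQ h hM hmeas hl hl0
  set ν := (surfaceMeasure Ω).prod (volume.restrict (Ioi (0 : ℝ))) with hν
  have hνs : SFinite ν := inferInstance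
  have hlm : Tendsto (fun k => l (m k)) atTop (𝓝[>] 0) :=
    Tendsto.comp (map_le_nhdsGT_zero hl hl0) hm.tendsto_atTop
  have hs : ∀ a : ℝ, MeasurableSet {z : E3 × ℝ | z.2 ≤ a} := fun a =>
    measurableSet_le measurable_snd measurable_const
  have hfa : ∀ a : ℝ, IntegrableOn f {z | z.2 ≤ a} ν := fun a => by
    simpa only [mul_one] using (hf (fun _ => 1) 1 a measurable_const (by simp)).1
  have hψb : ∀ ψ : E3 → ℝ, Continuous ψ → ∃ B, ∀ᵐ z ∂ν, |ψ z.1| ≤ B := fun ψ hψ => by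
    obtain ⟨B, -, hB⟩ := h.exists_forall_frontier_abs_le hψ
    exact ⟨B, (h.ae_prod_mem_frontier _).mono fun z hz => hB _ (frontier_subset_closure hz)⟩
  -- integrals over a layer, computed along the normals
  have hlayer : ∀ (F : E3 × ℝ → ℝ) (ψ : E3 → ℝ) (a : ℝ),
      IntegrableOn (fun z => F z * ψ z.1) {z | z.2 ≤ a} ν →
      ∫ z in {z | z.2 ≤ a}, F z * ψ z.1 ∂ν =
        ∫ s, ψ s * (∫ t in Ioc 0 a, F (s, t)) ∂(surfaceMeasure Ω) := by
    intro F ψ a hF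
    have h1 : {z : E3 × ℝ | z.2 ≤ a} = univ ×ˢ Iic a := by ext z; simp
    have h2 : ν.restrict {z | z.2 ≤ a} = (surfaceMeasure Ω).prod (volume.restrict (Ioc 0 a)) := by
      rw [h1, hν, ← Measure.prod_restrict, Measure.restrict_univ,
        Measure.restrict_restrict measurableSet_Iic, inter_comm, Ioi_inter_Iic]
    rw [IntegrableOn, h2] at hF
    rw [h2, integral_prod _ hF]
    simp_rw [integral_mul_const, mul_comm]
  -- the limit profile is integrable, by the concentration near the boundary
  have hfi : Integrable f ν := by
    obtain ⟨d, hd, g, hg, hgb⟩ := hconc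
    have hgν : Integrable (fun z : E3 × ℝ => |g z.2|) ν := hg.restrict.abs.comp_snd _
    -- Testing the weak convergence with the sign of the limit beyond height `d` bounds the integral
    -- of `|f|` there by that of `|g|`.
    set v : E3 × ℝ → ℝ := {z : E3 × ℝ | d < z.2}.indicator fun z => if 0 ≤ f z then 1 else -1
      with hv
    have hdm : MeasurableSet {z : E3 × ℝ | d < z.2} := measurableSet_lt measurable_const measurable_snd
    have hvm : Measurable v := (Measurable.ite (measurableSet_le measurable_const hfm)
      measurable_const measurable_const).indicator hdm
    have hv1 : ∀ z, |v z| ≤ 1 := fun z => by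
      rw [hv, indicator_apply]
      split_ifs <;> simp
    have hfv : ∀ z, |f z| = f z * v z + {z : E3 × ℝ | z.2 ≤ d}.indicator (fun z => |f z|) z := by
      intro z
      by_cases hz : d < z.2
      · have hz' : z ∈ {z : E3 × ℝ | d < z.2} := hz
        have hz'' : z ∉ {z : E3 × ℝ | z.2 ≤ d} := not_le.2 hz
        rw [hv, indicator_of_mem hz', indicator_of_notMem hz'', add_zero]
        split_ifs with h0
        · rw [abs_of_nonneg h0, mul_one]
        · rw [abs_of_neg (not_le.1 h0), mul_neg_one]
      · have hz' : z ∉ {z : E3 × ℝ | d < z.2} := hz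
        have hz'' : z ∈ {z : E3 × ℝ | z.2 ≤ d} := not_lt.1 hz
        rw [hv, indicator_of_notMem hz', indicator_of_mem hz'', mul_zero, zero_add]
    refine (aecover_snd_le ν).integrable_of_integral_norm_bounded
      ((∫ z, |g z.2| ∂ν) + ∫ z in {z | z.2 ≤ d}, |f z| ∂ν) hfa (Eventually.of_forall fun a => ?_)
    obtain ⟨i1, i2, hlim⟩ := hf v 1 a hvm (ae_of_all _ hv1)
    have i3 : Integrable ({z : E3 × ℝ | z.2 ≤ d}.indicator fun z => |f z|) ν :=
      (integrable_indicator_iff (hs d)).2 (hfa d).abs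
    simp only [Real.norm_eq_abs]
    rw [integral_congr_ae (ae_of_all _ hfv), integral_add i1 i3.integrableOn]
    refine add_le_add ?_ ?_
    · refine le_of_tendsto hlim ?_
      filter_upwards [i2, hlm.eventually (eventually_mul_lt_nhdsGT_zero a
        (show 0 < (2 * L)⁻¹ by have := h.pos; positivity))] with k hk hka
      have hl0' := (hl (m k)).1
      refine (integral_mono_ae hk hgν.integrableOn ?_).trans
        (setIntegral_le_integral hgν (ae_of_all _ fun _ => abs_nonneg _))
      filter_upwards [ae_restrict_of_ae (h.ae_prod_mem_frontier (volume.restrict (Ioi 0))),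
        ae_restrict_mem (hs a)] with z hz hza
      have hza : z.2 ≤ a := hza
      by_cases hzd : d < z.2
      · have h1 : Metric.infDist (z.1 + (l (m k) * z.2) • n z.1) Ω = l (m k) * z.2 := by
          refine h.infDist_normalMap hz (mul_nonneg hl0'.le (hd.trans hzd).le) ?_
          have h2 : l (m k) * z.2 ≤ a * l (m k) := by
            rw [mul_comm]; exact mul_le_mul_of_nonneg_right hza hl0'.le
          have hL := h.pos
          have h3 := h2.trans hka.le
          calc 2 * L * (l (m k) * z.2) ≤ 2 * L * (2 * L)⁻¹ := by gcongr
            _ = 1 := mul_inv_cancel₀ (by positivity)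
        calc ρ (l (m k)) (normalMap n (z.1, l (m k) * z.2)) * v z
            ≤ |ρ (l (m k)) (normalMap n (z.1, l (m k) * z.2))| * |v z| := by
              rw [← abs_mul]; exact le_abs_self _
          _ ≤ |ρ (l (m k)) (normalMap n (z.1, l (m k) * z.2))| :=
              mul_le_of_le_one_right (abs_nonneg _) (hv1 z)
          _ ≤ g z.2 := hgb _ (hl (m k)) _ hz _ hzd h1
          _ ≤ |g z.2| := le_abs_self _
      · have hz' : z ∉ {z : E3 × ℝ | d < z.2} := hzd
        rw [hv, indicator_of_notMem hz', mul_zero]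
        exact abs_nonneg _
    · rw [← integral_indicator (hs d)]
      exact setIntegral_le_integral i3
        (ae_of_all _ fun z => indicator_nonneg (fun _ _ => abs_nonneg _) z)
  refine ⟨m, hm, fun a s => ∫ t in Ioc 0 a, f (s, t), fun s => ∫ t in Ioi 0, f (s, t),
    fun a ha => ⟨?_, fun ψ hψ => ?_⟩, hfi.integral_prod_left, fun ψ hψ => ?_⟩
  · refine Integrable.integral_prod_left (f := f) (ν := volume.restrict (Ioc 0 a))
      (hfi.mono_measure ?_)
    exact Measure.prod_mono le_rfl (Measure.restrict_mono Ioc_subset_Ioi_self le_rfl)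
  · obtain ⟨B, hB⟩ := hψb ψ hψ
    obtain ⟨i1, i2, hlim⟩ := hf (fun z => ψ z.1) B a (hψ.measurable.comp measurable_fst) hB
    rw [hlayer f ψ a i1] at hlim
    refine tendsto_map'_iff.2 (hlim.congr' ?_)
    filter_upwards [i2] with k hk
    exact hlayer _ ψ a hk
  · obtain ⟨B, hB⟩ := hψb ψ hψ
    have i1 : Integrable (fun z => f z * ψ z.1) ν :=
      hfi.mul_bdd (c := B) (hψ.comp continuous_fst).aestronglyMeasurable hB
    have h1 := (aecover_snd_le ν).integral_tendsto_of_countably_generated i1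
    have h2 : ∫ z, f z * ψ z.1 ∂ν =
        ∫ s, ψ s * (∫ t in Ioi 0, f (s, t)) ∂(surfaceMeasure Ω) := by
      rw [hν, integral_prod (fun z => f z * ψ z.1) i1]
      simp_rw [integral_mul_const, mul_comm]
    rw [h2] at h1
    exact h1.congr fun a => hlayer f ψ a i1.integrableOn

end

/-! ### Assembly of the theorem -/

theorem mainTheorem2
    (Ω : Set E3) (r : E3 → ℝ) (hΩ : IsC2Domain Ω r)
    (e : Module.Basis (Fin 3) ℝ E3) (Q : Set E3) (hQ : IsUnitCell e Q)
    (hgood : IsGoodBoundary e Q Ω) (harea : FewAreaFreePartialCells e Q Ω)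
    (ρ : ℝ → E3 → ℝ)
    (hmeas : ∀ l ∈ Set.Ioc (0 : ℝ) 1, Measurable (ρ l))
    (hL2 : IsCellwiseL2Bounded e Q ρ)
    (hL1 : ∀ l ∈ Set.Ioc (0 : ℝ) 1, IntegrableOn (ρ l) Ωᶜ)
    (hconc : IsOneConcentrated Ω (outwardNormal r) ρ)
    (htight : IsTightOutside Ω ρ)
    (N S : ℝ → Set (Set Idx)) (R : ℝ → Set Idx)
    (htrans : IsTransitionDecomposition e Q Ω ρ N S R) :
    -- limit objects exist along a subsequence of every sequence of scales
    (∀ l : ℕ → ℝ, (∀ k, l k ∈ Set.Ioc (0 : ℝ) 1) → Tendsto l atTop (𝓝 0) →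
      ∃ m : ℕ → ℕ, StrictMono m ∧ ∃ (ρ₀ : E3 → E3 → ℝ) (σi σo : E3 → ℝ),
        IsHomogenizedLimit e Q Ω (outwardNormal r) ρ (map (l ∘ m) atTop) ρ₀ σi σo) ∧
    -- wherever they exist, they determine the limit of the scaled energy variation
    (∀ (F : Filter ℝ), F ≤ 𝓝[>] (0 : ℝ) →
      ∀ (ρ₀ : E3 → E3 → ℝ) (σi σo : E3 → ℝ),
        IsHomogenizedLimit e Q Ω (outwardNormal r) ρ F ρ₀ σi σo →
        -- the polarization of the two-scale limit is the classical one
        (MemLp (polarization Q ρ₀) 2 (volume.restrict Ω) ∧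
          ∀ ψ : E3 → E3, MemLp ψ 2 (volume.restrict Ω) →
            Tendsto (fun l => ∫ x in Ω, inner ℝ (ψ x) (cellPolarization e Q Ω ρ l x)) F
              (𝓝 (∫ x in Ω, inner ℝ (ψ x) (polarization Q ρ₀ x)))) ∧
        -- the same polarization is conjugate to the electric field in the energy
        ∀ (φ : E3 → ℝ) (G : E3 → E3), IsPotentialVariation Ω φ G →
          (∀ l ∈ Set.Ioc (0 : ℝ) 1, Integrable (fun x => ρ l x * φ x)) ∧
          Integrable (fun s => φ s * (σi s + σo s)) (surfaceMeasure Ω) ∧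
          IntegrableOn (fun x => (inner ℝ (G x) (polarization Q ρ₀ x) : ℝ)) Ω ∧
          Tendsto (fun l => energyVariation (ρ l) φ / l) F
            (𝓝 ((∫ s, φ s * (σi s + σo s) ∂(surfaceMeasure Ω)) +
              ∫ x in Ω, inner ℝ (G x) (polarization Q ρ₀ x)))) := by
  obtain ⟨L, h⟩ := hΩ.exists_hasLipschitzNormal
  obtain ⟨M, hM⟩ := hL2.exists_hasRegionBound hQ
  have hfin := h.isFiniteMeasure
  refine ⟨fun l hl hl0 => ?_, fun F hF ρ₀ σi σo hlim => ⟨⟨?_, fun ψ hψ => ?_⟩, fun φ G hφ => ?_⟩⟩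
  · obtain ⟨m₁, hm₁, ρ₀, hρ₀⟩ :=
      exists_subseq_isTwoScaleLimit hQ hM hmeas h.bounded h.isOpen hl hl0
    obtain ⟨m₂, hm₂, σi, hσi⟩ := exists_subseq_tendsto_innerSurfaceCharge hQ h hM hmeas hgood harea
      (fun k => hl (m₁ k)) (hl0.comp hm₁.tendsto_atTop)
    obtain ⟨m₃, hm₃, σh, σo, hσh, hσo⟩ := exists_subseq_tendsto_outerSurfaceCharge hQ h hM hmeas
      hconc (fun k => hl (m₁ (m₂ k)))
      (hl0.comp (hm₁.tendsto_atTop.comp hm₂.tendsto_atTop))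
    -- Three successive extractions; the earlier limits persist because a further subsequence has a
    -- finer filter.
    exact ⟨m₁ ∘ m₂ ∘ m₃, hm₁.comp (hm₂.comp hm₃), ρ₀, σi, σo,
      hρ₀.mono (map_mono (m := l ∘ m₁) (hm₂.comp hm₃).tendsto_atTop),
      hσi.mono (map_mono (m := l ∘ m₁ ∘ m₂) hm₃.tendsto_atTop), σh, hσh, hσo⟩
  · exact memLp_polarization hQ ((memLp_twoScaleMeasure_iff hQ).2 hlim.twoScale.memLp)
  · exact tendsto_inner_cellPolarization hQ h hM hmeas hF hlim.twoScale hψ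
  · obtain ⟨Cφ, hCφ⟩ := hφ.bounded_outside
    obtain ⟨Bφ, -, hBφ⟩ := h.exists_forall_frontier_abs_le hφ.continuous
    obtain ⟨σh, hσh, hσo⟩ := hlim.outer
    have hbdd : ∀ᵐ s ∂(surfaceMeasure Ω), ‖φ s‖ ≤ Bφ :=
      (HasLipschitzNormal.ae_mem_frontier Ω).mono fun s hs => hBφ s (frontier_subset_closure hs)
    have ii : Integrable (fun s => φ s * σi s) (surfaceMeasure Ω) :=
      hlim.inner.1.bdd_mul hφ.continuous.aestronglyMeasurable hbdd
    have io : Integrable (fun s => φ s * σo s) (surfaceMeasure Ω) :=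
      hσo.1.bdd_mul hφ.continuous.aestronglyMeasurable hbdd
    have hint : ∀ l ∈ Ioc (0 : ℝ) 1, Integrable (fun x => ρ l x * φ x) := fun l hl =>
      integrable_mul_potential hQ h hM hmeas hL1 hφ.continuous hCφ hl
    have hp := memLp_polarization hQ ((memLp_twoScaleMeasure_iff hQ).2 hlim.twoScale.memLp)
    refine ⟨hint, by simp only [mul_add]; exact ii.add io,
      (hφ.memLp_gradient.norm.integrable_mul hp.norm).mono' (hφ.memLp_gradient.1.inner hp.1)
        (ae_of_all _ fun x => norm_inner_le_norm _ _), ?_⟩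
    have h1 := (tendsto_inside_energy hQ h hM hmeas hgood harea htrans hφ.continuous
      hφ.memLp_gradient hφ.weakGradient).mono_left hF
    have h2 := hlim.inner.2 φ hφ.continuous
    have h3 := tendsto_inner_cellPolarization hQ h hM hmeas hF hlim.twoScale hφ.memLp_gradient
    have h4 := tendsto_outside_energy hQ h hM hmeas hL1 hconc htight hφ.continuous hCφ hF hσh hσo
    -- `h1` compares the interior energy with the pairings at scale `l` whose limits are `h2` and
    -- `h3`; in the sum these intermediate terms cancel.
    have h5 := (h1.add (h2.add h3)).add h4
    simp only [mul_add]
    rw [integral_add ii io]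
    convert! h5.congr' ?_ using 2
    · ring
    · filter_upwards [hF eventually_Ioc_nhdsGT_zero] with l hl
      rw [energyVariation, ← integral_add_compl (IsOpen.measurableSet h.isOpen) (hint l hl),
        add_div]
      ring
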